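/- **Definitions.** A *Borel foliation* of dimension $n$ is a standard Borel space $X$ together with a second structure on $X$, that of a Hausdorff topological $n$-manifold (the leaf topology, which need not generate the Borel structure), whose connected components, the *leaves*, are second countable, and which has an *atlas*: countably many prisms whose interiors cover $X$. A *prism* is an isomorphism (Borel, and homeomorphic for the leaf topology) of $\mathbb D^n\times V$, where $\mathbb D^n$ is the closed $n$-disc and $V$ is a standard Borel space with the discrete topology, onto a Borel subset of $X$ that is closed for the leaf topology; its interior is the image of $\operatorname{int}\mathbb D^n\times V$. A *leafwise smooth structure* is an atlas whose changes of plaques are $C^\infty$ on the interiors of the plaques. A *transversal* is a Borel set $T\subset X$ which is closed and discrete for the leaf topology. An *invariant transverse measure* $\mu$ is a countably additive function on transversals with values in $[0,+\infty]$ such that $\mu(S)=\mu(T)$ whenever there is a Borel isomorphism $\gamma:S\to T$ with $\gamma(s)$ in the leaf of $s$ for all $s\in S$. The pair $(X,\mu)$ is a *measured foliation*. A set is *negligible* if all transversals contained in it have measure $0$. A *total part* is a Borel union of leaves whose complement is negligible. $(X,\mu)$ is *ergodic* if every Borel union of leaves is negligible or has negligible complement. *The generic leaf has two ends* if all leaves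 in some total part have exactly two (Freudenthal) ends. Two measured foliations $(Y_0,\nu_0)$, $(Y_1,\nu_1)$ are *isomorphic* if there are total parts $\widehat Y_0\subset Y_0$, $\widehat Y_1\subset Y_1$ and a bijection $\widehat Y_0\to\widehat Y_1$ which is, together with its inverse, Borel and continuous for the leaf topologies, and which carries $\nu_0$ to $\nu_1$. An *écrasement* of $(X,\mu)$ onto a one-dimensional measured foliation $(Y,\nu)$ is a map $\pi$ for which there are total parts $\widehat X\subset X$, $\widehat Y\subset Y$ such that $\pi$ maps $\widehat X$ onto $\widehat Y$, is Borel and continuous for the leaf topologies on $\widehat X$, and such that: the fibres $\pi^{-1}(y)\cap\widehat X$, $y\in\widehat Y$, are compact for the leaf topology and each is contained in one leaf; for every leaf $L\subset\widehat X$, $\pi$ induces a bijection from the ends of $L$ onto the ends of the leaf of $Y$ containing $\pi(L)$, $\pi(z)$ tending to the image of the end $\varepsilon$ when $z\in L$ tends to $\varepsilon$; and $\pi_*\mu=\nu$, that is, $\nu(S)=\mu(T)$ whenever $\pi$ maps a transversal $T\subset\widehat X$ bijectively onto a transversal $S\subset\widehat Y$. **Théorème C.** Let $(X,\mu)$ be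 an ergodic measured foliation whose generic leaf has two ends. 1. If $\pi_0:(X,\mu)\to(Y_0,\nu_0)$ and $\pi_1:(X,\mu)\to(Y_1,\nu_1)$ are two écrasements of $(X,\mu)$, then $(Y_0,\nu_0)$ and $(Y_1,\nu_1)$ are isomorphic; for any leafwise smooth structures on $Y_0$ and $Y_1$, the isomorphism can be chosen to be a $C^\infty$ diffeomorphism along the leaves. 2. Hence the isomorphism type of the target is an invariant of $X$: if $(X',\mu')$ is a measured foliation isomorphic to $(X,\mu)$, and $\pi_0:(X,\mu)\to(Y_0,\nu_0)$ and $\pi_1:(X',\mu')\to(Y_1,\nu_1)$ are écrasements, then the conclusions of 1 hold for $(Y_0,\nu_0)$ and $(Y_1,\nu_1)$. -/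

import Mathlib

open Set TopologicalSpace
open scoped ENNReal

universe u v

namespace MeasuredFoliation

/-! ### Borel foliations

A type `X` carries a Borel structure (`MeasurableSpace X`) and the leaf topology
(`TopologicalSpace X`); these two structures are *not* assumed to generate each other. The leaves
are the connected components of the leaf topology. -/

/-- The closed unit disc of dimension `n`. -/
abbrev Disc (n : ℕ) : Type := Metric.closedBall (0 : EuclideanSpace ℝ (Fin n)) 1

/-- A prism of `X`: an isomorphism, both Borel and topological, of a product
`Disc n × V` (where `V` is a standard Borel space with the discrete topology)
onto a Borel subset of `X` that is closed for the leaf topology. The image of the interior of the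
prism is open for the leaf topology, as invariance of domain requires in an `n`-manifold. -/
structure PrismChart (n : ℕ) (X : Type u) [TopologicalSpace X] [MeasurableSpace X] where
  V : Type u
  [measurableSpaceV : MeasurableSpace V]
  [standardBorelSpaceV : StandardBorelSpace V]
  [topologicalSpaceV : TopologicalSpace V]
  [discreteTopologyV : DiscreteTopology V]
  toFun : Disc n × V → X
  isClosedEmbedding : Topology.IsClosedEmbedding toFun
  measurableEmbedding : MeasurableEmbedding toFun
  isOpen_core : IsOpen (toFun '' {p | ‖(p.1 : EuclideanSpace ℝ (Fin n))‖ < 1})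

/-- The image of the interior of a prism. -/
def PrismChart.core {n : ℕ} {X : Type u} [TopologicalSpace X] [MeasurableSpace X]
    (a : PrismChart n X) : Set X :=
  a.toFun '' {p | ‖(p.1 : EuclideanSpace ℝ (Fin n))‖ < 1}

/-- `X` is a Borel foliation of dimension `n`: a standard Borel space with a leaf topology that
is Hausdorff, whose connected components are second countable, and which is
covered by (the interiors of) countably many prisms of dimension `n`. The last condition makes the
leaf topology an `n`-manifold without boundary. -/
class BorelFoliation (n : ℕ) (X : Type u) [TopologicalSpace X] [MeasurableSpace X] : Prop where
  standardBorelSpace : StandardBorelSpace X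
  t2Space : T2Space X
  secondCountable_leaf : ∀ x : X, SecondCountableTopology (connectedComponent x)
  exists_atlas : ∃ φ : ℕ → PrismChart n X, ∀ x, ∃ i, x ∈ (φ i).core

section Transverse

variable {X : Type u} [TopologicalSpace X]

/-- A union of leaves. -/
def IsSaturated (B : Set X) : Prop := ∀ x ∈ B, connectedComponent x ⊆ B

variable [MeasurableSpace X]

/-- A transversal: a Borel set that is closed and discrete for the leaf topology. -/
structure IsTransversal (T : Set X) : Prop where
  measurableSet : MeasurableSet T
  isClosed : IsClosed T
  discreteTopology : DiscreteTopology T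

/-- Two transversals are equivalent if there is a Borel isomorphism between them that moves each
point inside its leaf. -/
def TransversalEquiv (S T : Set X) : Prop :=
  ∃ γ : S ≃ᵐ T, ∀ s : S, connectedComponent (γ s : X) = connectedComponent (s : X)

end Transverse

/-- An invariant transverse measure: a countably additive function on transversals with values
in `[0, ∞]`, taking the same value on equivalent transversals. (The values on sets that
are not transversals play no role.) -/
structure InvTransverseMeasure (X : Type u) [TopologicalSpace X] [MeasurableSpace X] where
  toFun : Set X → ℝ≥0∞
  empty : toFun ∅ = 0
  iUnion : ∀ T : ℕ → Set X, (∀ i, IsTransversal (T i)) → Pairwise (Function.onFun Disjoint T) →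
    IsTransversal (⋃ i, T i) → toFun (⋃ i, T i) = ∑' i, toFun (T i)
  invariant : ∀ S T : Set X, IsTransversal S → IsTransversal T → TransversalEquiv S T →
    toFun S = toFun T

instance {X : Type u} [TopologicalSpace X] [MeasurableSpace X] :
    CoeFun (InvTransverseMeasure X) (fun _ => Set X → ℝ≥0∞) := ⟨InvTransverseMeasure.toFun⟩

section Measured

variable {X : Type u} [TopologicalSpace X] [MeasurableSpace X]

/-- Every transversal contained in `B` has measure zero. -/
def IsNegligible (μ : InvTransverseMeasure X) (B : Set X) : Prop :=
  ∀ T : Set X, IsTransversal T → T ⊆ B → μ T = 0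

/-- A total part: a Borel union of leaves with negligible complement. -/
structure IsTotal (μ : InvTransverseMeasure X) (A : Set X) : Prop where
  measurableSet : MeasurableSet A
  isSaturated : IsSaturated A
  negligible_compl : IsNegligible μ Aᶜ

/-- Ergodicity: every Borel union of leaves is negligible or has negligible complement. -/
def IsErgodic (μ : InvTransverseMeasure X) : Prop :=
  ∀ B : Set X, MeasurableSet B → IsSaturated B → IsNegligible μ B ∨ IsNegligible μ Bᶜ

end Measured

/-! ### Ends -/

/-- An end of a space `L`: a compatible choice, for every compact `K ⊆ L`, of a connected
component of `L \ K`. -/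
structure TopEnd (L : Type u) [TopologicalSpace L] where
  comp : Compacts L → Set L
  isComponent : ∀ K : Compacts L, ∃ x ∈ (K : Set L)ᶜ, comp K = connectedComponentIn (K : Set L)ᶜ x
  anti : ∀ K K' : Compacts L, K ≤ K' → comp K' ⊆ comp K

/-- The generic leaf has two ends: all the leaves of some total part have exactly two ends. -/
def GenericLeafTwoEnded {X : Type u} [TopologicalSpace X] [MeasurableSpace X]
    (μ : InvTransverseMeasure X) : Prop :=
  ∃ A : Set X, IsTotal μ A ∧ ∀ x ∈ A, Nat.card (TopEnd (connectedComponent x)) = 2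

/-- `π` sends the ends of the leaf of `x` bijectively to the ends of the leaf of `π x`: for some
bijection `e` between ends, `π z` tends to the end `e ε` as `z` tends to `ε` inside the leaf. -/
def MatchesEnds {X : Type u} {Y : Type v} [TopologicalSpace X] [TopologicalSpace Y]
    (π : X → Y) (x : X) : Prop :=
  ∃ e : TopEnd (connectedComponent x) ≃ TopEnd (connectedComponent (π x)),
    ∀ (ε : TopEnd (connectedComponent x)) (K' : Compacts (connectedComponent (π x))),
      ∃ K : Compacts (connectedComponent x),
        π '' ((↑) '' ε.comp K) ⊆ (↑) '' (e ε).comp K'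

/-! ### Collapses and isomorphisms -/

/-- `π` is a collapse (écrasement) of the measured foliation `(X, μ)` onto `(Y, ν)`, the
dimension of `Y` being required separately to be one. As every
morphism of measured foliations, `π` only matters on a total part `A`, which it maps onto a
total part `B`. The equality `π_* μ = ν` is expressed by `measure_eq`: the `ν`-measure
of a transversal is the `μ`-measure of any transversal lifting it bijectively. -/
structure IsCollapseOn {X : Type u} {Y : Type v} [TopologicalSpace X] [MeasurableSpace X]
    [TopologicalSpace Y] [MeasurableSpace Y] (μ : InvTransverseMeasure X)
    (ν : InvTransverseMeasure Y) (π : X → Y) (A : Set X) (B : Set Y) : Prop where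
  isTotal_source : IsTotal μ A
  isTotal_target : IsTotal ν B
  mapsTo : MapsTo π A B
  surjOn : SurjOn π A B
  measurable : Measurable (fun x : A => π x)
  continuousOn : ContinuousOn π A
  isCompact_fibre : ∀ y ∈ B, IsCompact (A ∩ π ⁻¹' {y})
  fibre_in_leaf : ∀ x ∈ A, ∀ x' ∈ A, π x = π x' → connectedComponent x = connectedComponent x'
  matchesEnds : ∀ x ∈ A, MatchesEnds π x
  measure_eq : ∀ (T : Set X) (S : Set Y), IsTransversal T → IsTransversal S →
    T ⊆ A → S ⊆ B → BijOn π T S → ν S = μ T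

/-- `π` is a collapse of `(X, μ)` onto `(Y, ν)`. -/
def IsCollapse {X : Type u} {Y : Type v} [TopologicalSpace X] [MeasurableSpace X]
    [TopologicalSpace Y] [MeasurableSpace Y] (μ : InvTransverseMeasure X)
    (ν : InvTransverseMeasure Y) (π : X → Y) : Prop :=
  ∃ (A : Set X) (B : Set Y), IsCollapseOn μ ν π A B

/-- `e` is an isomorphism of measured foliations: a leafwise homeomorphism between total parts
which is Borel together with its inverse and preserves the transverse measures. -/
structure IsMeasuredIso {X : Type u} {Y : Type v} [TopologicalSpace X] [MeasurableSpace X]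
    [TopologicalSpace Y] [MeasurableSpace Y] (μ : InvTransverseMeasure X)
    (ν : InvTransverseMeasure Y) {A : Set X} {B : Set Y} (e : A ≃ₜ B) : Prop where
  isTotal_source : IsTotal μ A
  isTotal_target : IsTotal ν B
  measurable : Measurable e
  measurable_symm : Measurable e.symm
  measure_eq : ∀ S : Set A, IsTransversal ((↑) '' S : Set X) →
    ν ((↑) '' (e '' S)) = μ ((↑) '' S)

/-- Two measured foliations are isomorphic. -/
def Isomorphic {X : Type u} {Y : Type v} [TopologicalSpace X] [MeasurableSpace X]
    [TopologicalSpace Y] [MeasurableSpace Y] (μ : InvTransverseMeasure X)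
    (ν : InvTransverseMeasure Y) : Prop :=
  ∃ (A : Set X) (B : Set Y) (e : A ≃ₜ B), IsMeasuredIso μ ν e

/-! ### Leafwise smooth structures -/

/-- Read in the interiors of the plaques of the prisms `a` and `b`, the functional relation `R`
between points of `X` and points of `Y` is a `C^∞` function. -/
def SmoothInCharts {n m : ℕ} {X : Type u} {Y : Type v} [TopologicalSpace X] [MeasurableSpace X]
    [TopologicalSpace Y] [MeasurableSpace Y] (a : PrismChart n X) (b : PrismChart m Y)
    (R : X → Y → Prop) : Prop :=
  ∀ (s : a.V) (t : b.V), ∃ g : EuclideanSpace ℝ (Fin n) → EuclideanSpace ℝ (Fin m),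
    ContDiffOn ℝ ((⊤ : ℕ∞) : WithTop ℕ∞) g
      {d | ∃ (p : Disc n) (q : Disc m), ‖(p : EuclideanSpace ℝ (Fin n))‖ < 1 ∧
        ‖(q : EuclideanSpace ℝ (Fin m))‖ < 1 ∧ R (a.toFun (p, s)) (b.toFun (q, t)) ∧ (p : _) = d} ∧
    ∀ (p : Disc n) (q : Disc m), ‖(p : EuclideanSpace ℝ (Fin n))‖ < 1 →
      ‖(q : EuclideanSpace ℝ (Fin m))‖ < 1 → R (a.toFun (p, s)) (b.toFun (q, t)) → g p = q

/-- A leafwise smooth structure: an atlas of prisms whose changes of plaques are smooth. -/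
structure LeafwiseSmoothStructure (n : ℕ) (X : Type u) [TopologicalSpace X]
    [MeasurableSpace X] where
  chart : ℕ → PrismChart n X
  cover : ∀ x, ∃ i, x ∈ (chart i).core
  smooth : ∀ i j, SmoothInCharts (chart i) (chart j) (fun x y => x = y)

/-- Two measured foliations with leafwise smooth structures are isomorphic by an isomorphism that
is a diffeomorphism along the leaves. -/
def DiffIsomorphic {n : ℕ} {X : Type u} {Y : Type v} [TopologicalSpace X] [MeasurableSpace X]
    [TopologicalSpace Y] [MeasurableSpace Y] (μ : InvTransverseMeasure X)
    (𝒜 : LeafwiseSmoothStructure n X) (ν : InvTransverseMeasure Y)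
    (ℬ : LeafwiseSmoothStructure n Y) : Prop :=
  ∃ (A : Set X) (B : Set Y) (e : A ≃ₜ B), IsMeasuredIso μ ν e ∧
    (∀ i j, SmoothInCharts (𝒜.chart i) (ℬ.chart j)
      (fun x y => ∃ hx : x ∈ A, (e ⟨x, hx⟩ : Y) = y)) ∧
    (∀ i j, SmoothInCharts (ℬ.chart j) (𝒜.chart i)
      (fun y x => ∃ hx : x ∈ A, (e ⟨x, hx⟩ : Y) = y))

end MeasuredFoliation

namespace MeasuredFoliation

open Filter Topology MeasureTheory

/-! ### Local isometries of subsets of the line -/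

/-! Restrict both collapses to a common total part `A` consisting of two-ended leaves. Each leaf `L`
of `A` is then sent onto a leaf `ℓ₀` of `Y₀` and a leaf `ℓ₁` of `Y₁`. These leaves have ends, so
they are noncompact and hence lines. Since the fibres lie in leaves, distinct leaves of `A` have
distinct images. Both maps match the ends of `L` with those of a line, so the correspondence `Z =
{(π₀ ξ, π₁ ξ) : ξ ∈ L} ⊆ ℓ₀ × ℓ₁` is coarse: its two coordinates go to infinity together, in
matching directions. A homeomorphism `ℓ₀ → ℓ₁` certainly exists; the whole difficulty is to obtain
one without any choice, so that it is Borel across the leaves, and smooth along them.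

Coordinates on the leaves. Locally finite Borel weights subordinate to an atlas define an arc length
along the leaves (`IsWeightSystem.isLengthAtlas`), hence a parametrization of each line by an open
interval, unique up to sign and translation. The interval may be bounded; `stretch` maps it onto `ℝ`
by a formula that commutes with isometries. Thus every leaf has parametrizations by `ℝ`, unique up
to `t ↦ ±t + τ` (`IsLeafParam.exists_affine`).

A canonical curve. Let `Z ⊆ ℝ × ℝ` have matched ends. On the antidiagonal `x + y = u`, `midCurve`
selects the abscissa halfway between the supremum over `Z` of `min x (u - y)` and the infimum of
`max x (u - y)`. This abscissa and its complement to `u` are nondecreasing in `u`. Averaging against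
a Gaussian makes both strictly increasing, and convolving with a bump function makes them smooth;
the result is `junction`, and `u ↦ (junction u, u - junction u)` is the graph of a diffeomorphism of
`ℝ`. The construction commutes with exchanging the factors and with isometries of the two factors
having the same sign, and two matched parametrizations always differ by isometries of the same sign.
The relation `JunctionRel` is therefore the graph of a well-defined homeomorphism
(`JunctionRel.unique`, `EndsCompatible.exists_homeomorph`).

Borel dependence. `Z` may be replaced by a dense countable subset, given by countably many Borel
maps with dense values in the leaves. All auxiliary data then range over a Borel set projecting onto
`Y₀`, on which the image point is a Borel function; this suffices for the map to be Borel.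
Smoothness holds because the weights of a smooth atlas are smooth along plaques.

Measure. A leafwise proper Borel map with fibres in leaves has a Borel section
(`BorelFoliation.exists_section`), so a transversal of `Y₀` and its image in `Y₁` lift to
transversals of `X`. The homeomorphism induces a Borel isomorphism between these lifts which
preserves the leaves, and the invariance of `μ` gives equal measures. The second assertion follows
by pulling a collapse back along an isomorphism. -/

lemma exists_affine_of_abs_sub {ι : Type*} {s α : ι → ℝ} {k₀ l₀ : ι} (hne : s k₀ ≠ s l₀)
    {p : ι → Prop} (hk : p k₀) (hl : p l₀)
    (h : ∀ k l, p k → p l → |α k - α l| = |s k - s l|) :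
    ∃ σ τ : ℝ, (σ = 1 ∨ σ = -1) ∧ ∀ k, p k → α k = σ * s k + τ := by
  -- The pair `k₀, l₀` decides the sign. For a third point, choosing the opposite sign relative to
  -- both would force `s k₀ = s l₀`.
  rcases abs_eq_abs.1 (h k₀ l₀ hk hl) with h0 | h0
  · refine ⟨1, α k₀ - s k₀, Or.inl rfl, fun k hpk => ?_⟩
    rcases abs_eq_abs.1 (h k k₀ hpk hk) with h1 | h1
    · linarith
    · rcases abs_eq_abs.1 (h k l₀ hpk hl) with h2 | h2
      · linarith
      · exact absurd (by linarith) hne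
  · refine ⟨-1, α k₀ + s k₀, Or.inr rfl, fun k hpk => ?_⟩
    rcases abs_eq_abs.1 (h k k₀ hpk hk) with h1 | h1
    · rcases abs_eq_abs.1 (h k l₀ hpk hl) with h2 | h2
      · exact absurd (by linarith) hne
      · linarith
    · linarith

/-- One sample value near `t` would not determine the sign of an isometry; two distinct ones do.
They are taken on either side of `t`. -/
lemma exists_two_of_subset_closure_range {ι : Type*} {J : Set ℝ} (hJ : IsOpen J) {s : ι → ℝ}
    (hd : J ⊆ closure (range s)) {t δ : ℝ} (ht : t ∈ J) (hδ : 0 < δ) :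
    ∃ k l, s k < s l ∧ |s k - t| < δ ∧ |s l - t| < δ := by
  have key : ∀ x ∈ J, ∀ O : Set ℝ, IsOpen O → x ∈ O → ∃ k, s k ∈ O := by
    intro x hx O hO hxO
    obtain ⟨_, h1, k, rfl⟩ := mem_closure_iff.1 (hd hx) O hO hxO
    exact ⟨k, h1⟩
  obtain ⟨ε, hε, hball⟩ := Metric.isOpen_iff.1 hJ t ht
  set r := min δ ε with hr
  have hr0 : 0 < r := lt_min hδ hε
  have h1 : t - r / 2 ∈ J := hball (by
    rw [Metric.mem_ball, Real.dist_eq, show t - r / 2 - t = -(r / 2) by ring, abs_neg,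
      abs_of_pos (by positivity)]
    linarith [min_le_right δ ε])
  have h2 : t + r / 2 ∈ J := hball (by
    rw [Metric.mem_ball, Real.dist_eq, show t + r / 2 - t = (r / 2) by ring,
      abs_of_pos (by positivity)]
    linarith [min_le_right δ ε])
  obtain ⟨k, hk⟩ := key _ h1 (Ioo (t - r) t) isOpen_Ioo ⟨by linarith, by linarith⟩
  obtain ⟨l, hl⟩ := key _ h2 (Ioo t (t + r)) isOpen_Ioo ⟨by linarith, by linarith⟩
  refine ⟨k, l, hk.2.trans hl.1, ?_, ?_⟩
  · rw [abs_lt]; constructor <;> linarith [hk.1, hk.2, min_le_left δ ε]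
  · rw [abs_lt]; constructor <;> linarith [hl.1, hl.2, min_le_left δ ε]

/-- A local isometry defined on a dense part of an interval is the restriction of an isometry. -/
theorem exists_affine_of_locally_isometric {ι : Type*} {J : Set ℝ} (hJ : IsOpen J)
    (hJc : IsPreconnected J) {s α : ι → ℝ} (hs : ∀ k, s k ∈ J) (hd : J ⊆ closure (range s))
    (h : ∀ t ∈ J, ∃ δ > 0, ∀ k l, |s k - t| < δ → |s l - t| < δ → |α k - α l| = |s k - s l|) :
    ∃ σ τ : ℝ, (σ = 1 ∨ σ = -1) ∧ ∀ k, α k = σ * s k + τ := by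
  have loc : ∀ t ∈ J, ∃ σ τ : ℝ, (σ = 1 ∨ σ = -1) ∧
      ∃ δ > 0, ∀ k, |s k - t| < δ → α k = σ * s k + τ := by
    intro t ht
    obtain ⟨δ, hδ, hiso⟩ := h t ht
    obtain ⟨k, l, hkl, hk, hl⟩ := exists_two_of_subset_closure_range hJ hd ht hδ
    obtain ⟨σ, τ, hσ, hh⟩ := exists_affine_of_abs_sub (p := fun k => |s k - t| < δ) hkl.ne hk hl
      (fun k l hk hl => hiso k l hk hl)
    exact ⟨σ, τ, hσ, δ, hδ, hh⟩
  rcases isEmpty_or_nonempty ι with hι | ⟨⟨i⟩⟩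
  · exact ⟨1, 0, Or.inl rfl, fun k => (hι.false k).elim⟩
  obtain ⟨σ, τ, hσ, hQ⟩ := loc (s i) (hs i)
  refine ⟨σ, τ, hσ, ?_⟩
  set u : Set ℝ := {t | ∃ δ > 0, ∀ k, |s k - t| < δ → α k = σ * s k + τ} with hu
  have huo : IsOpen u := by
    rw [Metric.isOpen_iff]
    rintro t ⟨δ, hδ, hh⟩
    refine ⟨δ / 2, by positivity, fun t' ht' => ⟨δ / 2, by positivity, fun k hk => hh k ?_⟩⟩
    rw [Metric.mem_ball, Real.dist_eq] at ht'
    calc |s k - t| = |(s k - t') + (t' - t)| := by ring_nf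
      _ ≤ |s k - t'| + |t' - t| := abs_add_le _ _
      _ < δ := by linarith
  -- It remains to see that `u` is closed in `J`. At a limit point `t` some affine map `(σ', τ')` is
  -- valid; it agrees with `(σ, τ)` at two distinct sample values close to a point of `u`, hence
  -- everywhere.
  have hsub : J ⊆ u := by
    refine hJc.subset_of_closure_inter_subset huo ⟨s i, hs i, hQ⟩ ?_
    rintro t ⟨htc, htJ⟩
    obtain ⟨σ', τ', -, δ, hδ, hh⟩ := loc t htJ
    obtain ⟨t', ht'u, ht'⟩ := Metric.mem_closure_iff.1 htc (δ / 2) (by positivity)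
    obtain ⟨δ', hδ', hh'⟩ := ht'u
    rw [Real.dist_eq] at ht'
    obtain ⟨ε, hε, hball⟩ := Metric.isOpen_iff.1 hJ t htJ
    -- The bound `ε` keeps `t''` in `J`, where samples are dense; the bound `δ / 2` keeps the
    -- samples near `t''` within `δ` of `t`.
    obtain ⟨t'', ht''u, ht''⟩ := Metric.mem_closure_iff.1 htc (min (δ / 2) ε) (by positivity)
    obtain ⟨δ'', hδ'', hh''⟩ := ht''u
    rw [Real.dist_eq] at ht''
    have ht''J : t'' ∈ J := hball (by
      rw [Metric.mem_ball, Real.dist_eq, abs_sub_comm]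
      exact ht''.trans_le (min_le_right _ _))
    obtain ⟨k, l, hkl, hk, hl⟩ := exists_two_of_subset_closure_range hJ hd ht''J
      (lt_min hδ'' (show 0 < δ / 2 by positivity))
    have near : ∀ m, |s m - t''| < min δ'' (δ / 2) → |s m - t| < δ := by
      intro m hm
      have h1 := hm.trans_le (min_le_right _ _)
      have h2 := ht''.trans_le (min_le_left _ _)
      rw [abs_sub_comm] at h2
      calc |s m - t| = |(s m - t'') + (t'' - t)| := by ring_nf
        _ ≤ |s m - t''| + |t'' - t| := abs_add_le _ _
        _ < δ := by linarith
    have e1 := hh k (near k hk)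
    have e2 := hh l (near l hl)
    have e3 := hh'' k (hk.trans_le (min_le_left _ _))
    have e4 := hh'' l (hl.trans_le (min_le_left _ _))
    have h5 : (σ - σ') * (s l - s k) = 0 := by linear_combination e3 - e1 + e2 - e4
    rcases mul_eq_zero.1 h5 with h6 | h6
    · have h7 : σ' = σ := by linarith
      subst h7
      have h8 : τ' = τ := by linarith
      subst h8
      exact ⟨δ, hδ, hh⟩
    · linarith
  intro k
  obtain ⟨δ, hδ, hh⟩ := hsub (hs k)
  exact hh k (by simpa using hδ)

/-! ### Stretching an open interval to the line -/

open Classical in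
/-- A canonical increasing diffeomorphism of an open interval `J` onto `ℝ`. -/
noncomputable def stretch (J : Set ℝ) (s : ℝ) : ℝ :=
  s + (if BddBelow J then Real.log (s - sInf J) else 0) -
    (if BddAbove J then Real.log (sSup J - s) else 0)

/-- The formula sees `J` only through its bounds, which a dense subset already determines. A
sequence of coordinates can thus be stretched without knowing the interval in which it is dense. -/
lemma stretch_eq_of_dense {D J : Set ℝ} (h1 : D ⊆ J) (h2 : J ⊆ closure D) (hne : D.Nonempty) :
    stretch D = stretch J := by
  have hb : BddBelow D ↔ BddBelow J :=
    ⟨fun h => (bddBelow_closure.2 h).mono h2, fun h => h.mono h1⟩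
  have ha : BddAbove D ↔ BddAbove J :=
    ⟨fun h => (bddAbove_closure.2 h).mono h2, fun h => h.mono h1⟩
  funext s
  unfold stretch
  congr 1
  · congr 1
    by_cases h : BddBelow D
    · rw [if_pos h, if_pos (hb.1 h)]
      congr 2
      refine le_antisymm ?_ (csInf_le_csInf (hb.1 h) hne h1)
      exact le_csInf (hne.mono h1) fun x hx =>
        closure_minimal (fun y hy => csInf_le h hy) isClosed_Ici (h2 hx)
    · rw [if_neg h, if_neg (fun h' => h (hb.2 h'))]
  · by_cases h : BddAbove D
    · rw [if_pos h, if_pos (ha.1 h)]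
      congr 2
      refine le_antisymm (csSup_le_csSup (ha.1 h) hne h1) ?_
      exact csSup_le (hne.mono h1) fun x hx =>
        closure_minimal (fun y hy => le_csSup h hy) isClosed_Iic (h2 hx)
    · rw [if_neg h, if_neg (fun h' => h (ha.2 h'))]

lemma stretch_neg (J : Set ℝ) (s : ℝ) : stretch (-J) (-s) = -stretch J s := by
  unfold stretch
  simp only [Real.sInf_neg, Real.sSup_neg]
  rw [show -s - -sSup J = sSup J - s by ring, show -sInf J - -s = s - sInf J by ring]
  by_cases h1 : BddBelow J <;> by_cases h2 : BddAbove J <;> simp [h1, h2] <;> ring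

lemma stretch_add {J : Set ℝ} (hne : J.Nonempty) (s c : ℝ) :
    stretch ((fun x => x + c) '' J) (s + c) = stretch J s + c := by
  have e : (fun x : ℝ => x + c) = OrderIso.addRight c := rfl
  have hb : BddBelow ((fun x => x + c) '' J) ↔ BddBelow J := by
    rw [e]; exact (OrderIso.addRight c).bddBelow_image
  have ha : BddAbove ((fun x => x + c) '' J) ↔ BddAbove J := by
    rw [e]; exact (OrderIso.addRight c).bddAbove_image
  have h1 : BddBelow J → sInf ((fun x => x + c) '' J) = sInf J + c := fun h => by
    rw [e, ← (OrderIso.addRight c).map_csInf' hne h]; rfl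
  have h2 : BddAbove J → sSup ((fun x => x + c) '' J) = sSup J + c := fun h => by
    rw [e, ← (OrderIso.addRight c).map_csSup' hne h]; rfl
  unfold stretch
  by_cases h3 : BddBelow J <;> by_cases h4 : BddAbove J <;>
    simp only [hb, ha, h3, h4, h1, h2, if_true, if_false, add_sub_add_right_eq_sub] <;> ring

/-- This equivariance is the reason for the particular formula: an isometry between two intervals
becomes the same isometry of the line, so stretched parametrizations remain unique up to isometry.
-/
lemma stretch_affine {J : Set ℝ} (hne : J.Nonempty) {σ : ℝ} (hσ : σ = 1 ∨ σ = -1) (s τ : ℝ) :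
    stretch ((fun x => σ * x + τ) '' J) (σ * s + τ) = σ * stretch J s + τ := by
  rcases hσ with rfl | rfl
  · simpa using stretch_add hne s τ
  · have h := stretch_add (J := -J) (by simpa using hne) (-s) τ
    rw [stretch_neg, ← Set.image_neg_eq_neg, Set.image_image] at h
    simpa using h

section Stretch
variable {J : Set ℝ} (hJ : IsOpen J) (hc : J.OrdConnected)
include hJ

lemma sInf_lt_of_isOpen (hb : BddBelow J) {s : ℝ} (hs : s ∈ J) : sInf J < s := by
  obtain ⟨ε, hε, hball⟩ := Metric.isOpen_iff.1 hJ s hs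
  have : s - ε / 2 ∈ J := hball (by
    rw [Metric.mem_ball, Real.dist_eq, show s - ε / 2 - s = -(ε / 2) by ring, abs_neg,
      abs_of_pos (by positivity)]
    linarith)
  linarith [csInf_le hb this]

lemma lt_sSup_of_isOpen (hb : BddAbove J) {s : ℝ} (hs : s ∈ J) : s < sSup J := by
  obtain ⟨ε, hε, hball⟩ := Metric.isOpen_iff.1 hJ s hs
  have : s + ε / 2 ∈ J := hball (by
    rw [Metric.mem_ball, Real.dist_eq, show s + ε / 2 - s = (ε / 2) by ring,
      abs_of_pos (by positivity)]
    linarith)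
  linarith [le_csSup hb this]

lemma hasDerivAt_stretch {s : ℝ} (hs : s ∈ J) : ∃ d > 0, HasDerivAt (stretch J) d s := by
  have h1 : ∃ d ≥ 0, HasDerivAt
      (fun s => open Classical in if BddBelow J then Real.log (s - sInf J) else 0) d s := by
    by_cases hb : BddBelow J
    · simp only [if_pos hb]
      have := sInf_lt_of_isOpen hJ hb hs
      exact ⟨1 / (s - sInf J), by have : 0 < s - sInf J := by linarith
                                  positivity,
        ((hasDerivAt_id s).sub_const _).log (by simp; linarith)⟩
    · simp only [if_neg hb]
      exact ⟨0, le_rfl, hasDerivAt_const _ _⟩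
  have h2 : ∃ d ≤ 0, HasDerivAt
      (fun s => open Classical in if BddAbove J then Real.log (sSup J - s) else 0) d s := by
    by_cases hb : BddAbove J
    · simp only [if_pos hb]
      have := lt_sSup_of_isOpen hJ hb hs
      refine ⟨-1 / (sSup J - s), ?_, ((hasDerivAt_id s).const_sub _).log (by simp; linarith)⟩
      have : 0 < sSup J - s := by linarith
      rw [neg_div]
      simp only [Left.neg_nonpos_iff]
      positivity
    · simp only [if_neg hb]
      exact ⟨0, le_rfl, hasDerivAt_const _ _⟩
  obtain ⟨d1, hd1, h1⟩ := h1
  obtain ⟨d2, hd2, h2⟩ := h2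
  exact ⟨1 + d1 - d2, by linarith, ((hasDerivAt_id s).add h1).sub h2⟩

lemma contDiffAt_stretch {s : ℝ} (hs : s ∈ J) {n : WithTop ℕ∞} :
    ContDiffAt ℝ n (stretch J) s := by
  unfold stretch
  refine (contDiffAt_id.add ?_).sub ?_
  · by_cases hb : BddBelow J
    · simp only [if_pos hb]
      have := sInf_lt_of_isOpen hJ hb hs
      exact (contDiffAt_id.sub contDiffAt_const).log (by simp; linarith)
    · simp only [if_neg hb]
      exact contDiffAt_const
  · by_cases hb : BddAbove J
    · simp only [if_pos hb]
      have := lt_sSup_of_isOpen hJ hb hs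
      exact (contDiffAt_const.sub contDiffAt_id).log (by simp; linarith)
    · simp only [if_neg hb]
      exact contDiffAt_const

lemma continuousOn_stretch : ContinuousOn (stretch J) J := fun _ hs =>
  (contDiffAt_stretch hJ hs (n := 0)).continuousAt.continuousWithinAt

include hc

lemma strictMonoOn_stretch : StrictMonoOn (stretch J) J := by
  refine strictMonoOn_of_deriv_pos hc.convex (continuousOn_stretch hJ) fun s hs => ?_
  obtain ⟨d, hd, h⟩ := hasDerivAt_stretch hJ (interior_subset hs)
  rwa [h.deriv]

/-- To the right of `s₀` the lower logarithm stays above its value `c` at `s₀`. If `J` is bounded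
above, the term `-log (sSup J - s)` blows up at the endpoint; otherwise `s` itself is unbounded. -/
lemma exists_le_stretch (hne : J.Nonempty) (N : ℝ) : ∃ s ∈ J, N ≤ stretch J s := by
  obtain ⟨s₀, hs₀⟩ := hne
  set c : ℝ := open Classical in if BddBelow J then Real.log (s₀ - sInf J) else 0 with hcdef
  have hlow : ∀ s ≥ s₀, c ≤ (open Classical in
      if BddBelow J then Real.log (s - sInf J) else 0) := by
    intro s hs
    rw [hcdef]
    by_cases hb : BddBelow J
    · simp only [if_pos hb]
      have := sInf_lt_of_isOpen hJ hb hs₀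
      exact Real.log_le_log (by linarith) (by linarith)
    · simp only [if_neg hb, le_refl]
  by_cases hb : BddAbove J
  · have hlt := lt_sSup_of_isOpen hJ hb hs₀
    -- The exponential is chosen so that `-log ε ≥ N - s₀ - c`; the other bound keeps the point to
    -- the right of `s₀`.
    set ε := min (sSup J - s₀) (Real.exp (s₀ + c - N)) with hε
    have hε0 : 0 < ε := lt_min (by linarith) (Real.exp_pos _)
    have h1 : s₀ ≤ sSup J - ε := by linarith [min_le_left (sSup J - s₀) (Real.exp (s₀ + c - N))]
    obtain ⟨b, hbJ, hbs⟩ := exists_lt_of_lt_csSup ⟨s₀, hs₀⟩ (show sSup J - ε < sSup J by linarith)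
    refine ⟨sSup J - ε, hc.out hs₀ hbJ ⟨h1, hbs.le⟩, ?_⟩
    unfold stretch
    rw [if_pos hb]
    have h2 := hlow _ h1
    have h3 : Real.log (sSup J - (sSup J - ε)) ≤ s₀ + c - N := by
      rw [sub_sub_cancel]
      calc Real.log ε ≤ Real.log (Real.exp (s₀ + c - N)) :=
            Real.log_le_log hε0 (min_le_right _ _)
        _ = _ := Real.log_exp _
    linarith
  · obtain ⟨b, hbJ, hbs⟩ := not_bddAbove_iff.1 hb (max s₀ (N - c))
    refine ⟨b, hbJ, ?_⟩
    unfold stretch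
    rw [if_neg hb]
    have h2 := hlow b (le_max_left _ _ |>.trans hbs.le)
    linarith [le_max_right s₀ (N - c)]

/-- Values below `y` come from values above `-y` on the reflected interval; the intermediate value
theorem does the rest. -/
lemma surjOn_stretch (hne : J.Nonempty) : SurjOn (stretch J) J univ := by
  intro y _
  obtain ⟨s, hs, h1⟩ := exists_le_stretch hJ hc hne y
  have hn : (-J).OrdConnected := by
    refine ⟨fun x hx z hz w hw => ?_⟩
    exact hc.out hz hx ⟨neg_le_neg hw.2, neg_le_neg hw.1⟩
  obtain ⟨s', hs', h2⟩ := exists_le_stretch hJ.neg hn (by simpa using hne) (-y)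
  have h3 : stretch J (-s') ≤ y := by
    have := stretch_neg J (-s')
    rw [neg_neg] at this
    linarith
  have := (hc.isPreconnected).intermediate_value (show -s' ∈ J from hs') hs
    (continuousOn_stretch hJ)
  exact this ⟨h3, h1⟩

end Stretch

/-! ### Smoothing monotone functions -/

/-- A symmetric bump function on the line, of integral one. -/
noncomputable def mollifier : ℝ → ℝ := (⟨1 / 2, 1, by norm_num, by norm_num⟩ :
  ContDiffBump (0 : ℝ)).normed volume

lemma mollifier_nonneg (r : ℝ) : 0 ≤ mollifier r := ContDiffBump.nonneg_normed _ _
lemma mollifier_neg (r : ℝ) : mollifier (-r) = mollifier r := ContDiffBump.normed_neg _ _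
lemma continuous_mollifier : Continuous mollifier := ContDiffBump.continuous_normed _
lemma integral_mollifier : ∫ r, mollifier r = 1 := ContDiffBump.integral_normed _
lemma hasCompactSupport_mollifier : HasCompactSupport mollifier :=
  ContDiffBump.hasCompactSupport_normed _
lemma contDiff_mollifier : ContDiff ℝ ((⊤ : ℕ∞) : WithTop ℕ∞) mollifier :=
  ContDiffBump.contDiff_normed _
lemma mollifier_eq_zero {r : ℝ} (h : 1 < |r|) : mollifier r = 0 := by
  by_contra hne
  have h1 : r ∈ Function.support mollifier := hne
  rw [mollifier, ContDiffBump.support_normed_eq] at h1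
  rw [Metric.mem_ball, Real.dist_eq, sub_zero] at h1
  exact absurd h1 (by simp; exact h.le)

/-- The standard Gaussian law. -/
noncomputable abbrev gauss : Measure ℝ := ProbabilityTheory.gaussianReal 0 1

lemma integrable_id_gauss : Integrable (fun s : ℝ => s) gauss := by
  have := ProbabilityTheory.memLp_id_gaussianReal (μ := 0) (v := 1) 1
  exact (memLp_one_iff_integrable.1 this)

lemma integral_id_gauss : ∫ s, s ∂gauss = 0 := ProbabilityTheory.integral_id_gaussianReal

lemma integral_comp_neg_gauss (f : ℝ → ℝ) : ∫ s, f (-s) ∂gauss = ∫ s, f s ∂gauss := by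
  have h := ProbabilityTheory.gaussianReal_map_neg (μ := 0) (v := 1)
  rw [neg_zero] at h
  rw [gauss]
  conv_rhs => rw [← h]
  exact ((Homeomorph.neg ℝ).measurableEmbedding.integral_map f).symm

/-- The average of `P` against the Gaussian law. -/
noncomputable def gaussAvg (P : ℝ → ℝ) (u : ℝ) : ℝ := ∫ s, P (u - s) ∂gauss

/-- A canonical smoothing of functions of at most linear growth. -/
noncomputable def smoothing (P : ℝ → ℝ) (u : ℝ) : ℝ := ∫ r, mollifier r * gaussAvg P (u - r)

/-- Monotone functions of slope at most one. -/
structure SlopeLeOne (P : ℝ → ℝ) : Prop where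
  mono : ∀ u v, u ≤ v → P u ≤ P v
  lip : ∀ u v, u ≤ v → P v ≤ P u + (v - u)

namespace SlopeLeOne
variable {P : ℝ → ℝ} (hP : SlopeLeOne P)
include hP

lemma abs_sub_le (u v : ℝ) : |P u - P v| ≤ |u - v| := by
  rcases le_total u v with h | h
  · have h1 := hP.mono _ _ h
    have h2 := hP.lip _ _ h
    rw [abs_of_nonpos (by linarith), abs_of_nonpos (by linarith)]; linarith
  · have h1 := hP.mono _ _ h
    have h2 := hP.lip _ _ h
    rw [abs_of_nonneg (by linarith), abs_of_nonneg (by linarith)]; linarith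

lemma continuous : Continuous P := by
  refine LipschitzWith.continuous (K := 1) (LipschitzWith.of_dist_le_mul fun u v => ?_)
  simpa [Real.dist_eq] using hP.abs_sub_le u v

lemma integrable (u : ℝ) : Integrable (fun s => P (u - s)) gauss := by
  refine Integrable.mono' ((integrable_const |P u|).add integrable_id_gauss.abs)
    (hP.continuous.comp (by fun_prop)).aestronglyMeasurable (ae_of_all _ fun s => ?_)
  have h := hP.abs_sub_le (u - s) u
  rw [show u - s - u = -s by ring, abs_neg] at h
  have := abs_sub_abs_le_abs_sub (P (u - s)) (P u)
  simp only [Real.norm_eq_abs, Pi.add_apply]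
  linarith

lemma gaussAvg : SlopeLeOne (gaussAvg P) := by
  refine ⟨fun u v huv => integral_mono (hP.integrable u) (hP.integrable v)
    fun s => hP.mono _ _ (by linarith), fun u v huv => ?_⟩
  have h1 : MeasuredFoliation.gaussAvg P u + (v - u) = ∫ s, (P (u - s) + (v - u)) ∂gauss := by
    rw [integral_add (hP.integrable u) (integrable_const _)]
    simp [MeasuredFoliation.gaussAvg]
  rw [h1]
  refine integral_mono (hP.integrable v) ((hP.integrable u).add (integrable_const _)) fun s => ?_
  have := hP.lip (u - s) (v - s) (by linarith)
  simp only
  linarith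

lemma abs_gaussAvg_sub_le (u : ℝ) :
    |MeasuredFoliation.gaussAvg P u - P u| ≤ ∫ s, |s| ∂gauss := by
  have h1 : MeasuredFoliation.gaussAvg P u - P u = ∫ s, (P (u - s) - P u) ∂gauss := by
    rw [integral_sub (hP.integrable u) (integrable_const _)]
    simp [MeasuredFoliation.gaussAvg]
  rw [h1]
  refine (abs_integral_le_integral_abs).trans (integral_mono
    ((hP.integrable u).sub (integrable_const _)).abs integrable_id_gauss.abs fun s => ?_)
  simpa using hP.abs_sub_le (u - s) u

lemma integrable_mollifier (u : ℝ) : Integrable (fun r => mollifier r * P (u - r)) :=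
  (continuous_mollifier.mul (hP.continuous.comp (by fun_prop))).integrable_of_hasCompactSupport
    hasCompactSupport_mollifier.mul_right

lemma abs_mollify_sub_le (u : ℝ) : |(∫ r, mollifier r * P (u - r)) - P u| ≤ 1 := by
  have h0 : Integrable mollifier :=
    continuous_mollifier.integrable_of_hasCompactSupport hasCompactSupport_mollifier
  have h1 : (∫ r, mollifier r * P (u - r)) - P u = ∫ r, mollifier r * (P (u - r) - P u) := by
    simp_rw [mul_sub]
    rw [integral_sub (hP.integrable_mollifier u) (h0.mul_const _), integral_mul_const,
      integral_mollifier, one_mul]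
  rw [h1]
  calc _ ≤ ∫ r, |mollifier r * (P (u - r) - P u)| := abs_integral_le_integral_abs
    _ ≤ ∫ r, mollifier r := by
      refine integral_mono ?_ h0 fun r => ?_
      · simp_rw [mul_sub]
        exact ((hP.integrable_mollifier u).sub (h0.mul_const _)).abs
      · simp only
        rw [abs_mul, abs_of_nonneg (mollifier_nonneg r)]
        by_cases hr : 1 < |r|
        · simp [mollifier_eq_zero hr]
        · have := hP.abs_sub_le (u - r) u
          rw [show u - r - u = -r by ring, abs_neg] at this
          exact mul_le_of_le_one_right (mollifier_nonneg r) (this.trans (not_lt.1 hr))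
    _ = 1 := integral_mollifier

/-- The Gaussian has a finite first absolute moment and the bump lives in `[-1, 1]`, so each average
moves a 1-Lipschitz function by a bounded amount. Smoothing therefore keeps the behaviour at
infinity. -/
lemma abs_smoothing_sub_le (u : ℝ) : |smoothing P u - P u| ≤ 1 + ∫ s, |s| ∂gauss := by
  have h1 := hP.gaussAvg.abs_mollify_sub_le u
  have h2 := hP.abs_gaussAvg_sub_le u
  calc |smoothing P u - P u| = |(smoothing P u - MeasuredFoliation.gaussAvg P u) +
        (MeasuredFoliation.gaussAvg P u - P u)| := by ring_nf
    _ ≤ _ := (abs_add_le _ _).trans (add_le_add h1 h2)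

lemma contDiff_smoothing : ContDiff ℝ ((⊤ : ℕ∞) : WithTop ℕ∞) (smoothing P) :=
  hasCompactSupport_mollifier.contDiff_convolution_left (ContinuousLinearMap.lsmul ℝ ℝ)
    contDiff_mollifier hP.gaussAvg.continuous.locallyIntegrable

/-- Both kernels have mass one and mean zero, so the identity is left unchanged. This makes the
smoothing treat the two coordinates of a curve parametrized by their sum alike. -/
lemma smoothing_id_sub (u : ℝ) : smoothing (fun u => u - P u) u = u - smoothing P u := by
  have h0 : Integrable mollifier :=
    continuous_mollifier.integrable_of_hasCompactSupport hasCompactSupport_mollifier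
  have h1 : ∀ u, MeasuredFoliation.gaussAvg (fun u => u - P u) u =
      u - MeasuredFoliation.gaussAvg P u := by
    intro u
    have i1 : Integrable (fun s : ℝ => u - s) gauss := (integrable_const u).sub integrable_id_gauss
    have i2 : ∫ s, (u - s) ∂gauss = u := by
      rw [integral_sub (integrable_const _) integrable_id_gauss, integral_id_gauss]
      simp
    exact (integral_sub i1 (hP.integrable u)).trans (by rw [i2]; rfl)
  have h2 : Integrable (fun r => mollifier r * r) :=
    (continuous_mollifier.mul continuous_id).integrable_of_hasCompactSupport
      hasCompactSupport_mollifier.mul_right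
  have h3 : ∫ r, mollifier r * r = 0 := by
    have := integral_neg_eq_self (fun r => mollifier r * r) volume
    simp only [mollifier_neg, mul_neg, integral_neg] at this
    linarith
  unfold smoothing
  simp_rw [h1, mul_sub]
  have h4 : Integrable (fun r => mollifier r * u - mollifier r * r) := (h0.mul_const u).sub h2
  rw [integral_sub h4 (hP.gaussAvg.integrable_mollifier u), integral_sub (h0.mul_const _) h2, h3,
    integral_mul_const, integral_mollifier]
  ring

/-- The function `P` may be constant on long intervals, but its total increase is at least one, and
the Gaussian density is bounded below on the compact interval in which that increase is seen. This
gives a slope bound uniform near `u₀`. -/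
lemma gaussAvg_growth (htop : ∀ N, ∃ u, N ≤ P u) (hbot : ∀ N, ∃ u, P u ≤ N) (u₀ : ℝ) :
    ∃ c > 0, ∀ u δ, |u - u₀| ≤ 1 → 0 ≤ δ → δ ≤ 1 →
      c * δ ≤ MeasuredFoliation.gaussAvg P (u + δ) - MeasuredFoliation.gaussAvg P u := by
  obtain ⟨a, ha⟩ := hbot 0
  obtain ⟨b, hb⟩ := htop 1
  -- For `|u - u₀| ≤ 1` and `0 ≤ δ ≤ 1`, this places `u - R + δ` to the left of `a`, where `P ≤ 0`,
  -- and `u + R` to the right of `b`, where `P ≥ 1`.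
  set R : ℝ := |u₀| + |a| + |b| + 2 with hR
  have hR0 : 0 < R := by positivity
  have hcont : Continuous (ProbabilityTheory.gaussianPDFReal 0 1) := by
    unfold ProbabilityTheory.gaussianPDFReal; fun_prop
  obtain ⟨x, -, hx⟩ := isCompact_Icc.exists_isMinOn (nonempty_Icc.2 (show -R ≤ R by linarith))
    hcont.continuousOn
  set c := ProbabilityTheory.gaussianPDFReal 0 1 x with hc
  have hc0 : 0 < c := ProbabilityTheory.gaussianPDFReal_pos _ _ _ one_ne_zero
  refine ⟨c, hc0, fun u δ hu hδ hδ1 => ?_⟩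
  set g : ℝ → ℝ := fun s => P (u + δ - s) - P (u - s) with hg
  have hg0 : ∀ s, 0 ≤ g s := fun s => by
    have := hP.mono (u - s) (u + δ - s) (by linarith)
    simp only [hg]; linarith
  have hgc : Continuous g := (hP.continuous.comp (by fun_prop)).sub (hP.continuous.comp (by fun_prop))
  have hgi : Integrable g gauss := (hP.integrable _).sub (hP.integrable _)
  have e1 : MeasuredFoliation.gaussAvg P (u + δ) - MeasuredFoliation.gaussAvg P u =
      ∫ s, g s ∂gauss := (integral_sub (hP.integrable _) (hP.integrable _)).symm
  have e2 : ∫ s, g s ∂gauss = ∫ s, ProbabilityTheory.gaussianPDFReal 0 1 s * g s := by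
    rw [ProbabilityTheory.integral_gaussianReal_eq_integral_smul one_ne_zero]; rfl
  have hgi' : Integrable (fun s => ProbabilityTheory.gaussianPDFReal 0 1 s * g s) := by
    have : Integrable g (volume.withDensity (ProbabilityTheory.gaussianPDF 0 1)) := by
      rw [← ProbabilityTheory.gaussianReal_of_var_ne_zero _ one_ne_zero]; exact hgi
    rw [integrable_withDensity_iff_integrable_smul' (ProbabilityTheory.measurable_gaussianPDF _ _)
      (ae_of_all _ fun _ => ProbabilityTheory.gaussianPDF_lt_top)] at this
    simpa [ProbabilityTheory.toReal_gaussianPDF] using this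
  have e3 : ∫ s in Ioc (-R) R, c * g s ≤ ∫ s, ProbabilityTheory.gaussianPDFReal 0 1 s * g s := by
    refine le_trans ?_ (setIntegral_le_integral (s := Ioc (-R) R) hgi' (ae_of_all _ fun s =>
      mul_nonneg (ProbabilityTheory.gaussianPDFReal_nonneg _ _ _) (hg0 s)))
    refine setIntegral_mono_on ?_ hgi'.integrableOn measurableSet_Ioc fun s hs =>
      mul_le_mul_of_nonneg_right (hx (Ioc_subset_Icc_self hs)) (hg0 s)
    exact ((continuous_const.mul hgc).integrableOn_Icc).mono_set Ioc_subset_Icc_self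
  have e4 : ∫ s in Ioc (-R) R, c * g s = c * ∫ s in (-R)..R, g s := by
    rw [intervalIntegral.integral_of_le (by linarith), integral_const_mul]
  have hint : ∀ x y, IntervalIntegrable P volume x y := fun x y => hP.continuous.intervalIntegrable _ _
  -- The integral of a difference of translates telescopes to two boundary integrals over intervals
  -- of length `δ`.
  have e5 : ∫ s in (-R)..R, g s =
      (∫ x in (u + R)..(u + R + δ), P x) - ∫ x in (u - R)..(u - R + δ), P x := by
    have i1 : Continuous fun s => P (u + δ - s) := hP.continuous.comp (by fun_prop)
    have i2 : Continuous fun s => P (u - s) := hP.continuous.comp (by fun_prop)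
    simp only [hg]
    rw [intervalIntegral.integral_sub (i1.intervalIntegrable _ _) (i2.intervalIntegrable _ _),
      intervalIntegral.integral_comp_sub_left, intervalIntegral.integral_comp_sub_left,
      ← intervalIntegral.integral_add_adjacent_intervals (hint (u + δ - R) (u + R))
        (hint (u + R) (u + δ - -R)),
      ← intervalIntegral.integral_add_adjacent_intervals (hint (u - R) (u + δ - R))
        (hint (u + δ - R) (u - -R))]
    rw [show u - -R = u + R by ring, show u + δ - -R = u + R + δ by ring,
      show u + δ - R = u - R + δ by ring]
    ring
  have hu' := abs_le.1 hu
  have h1 : δ * P (u + R) ≤ ∫ x in (u + R)..(u + R + δ), P x := by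
    have := intervalIntegral.integral_mono_on (a := u + R) (b := u + R + δ) (by linarith)
      (intervalIntegrable_const (c := P (u + R)) (μ := volume)) (hint _ _)
      (fun x hx => hP.mono _ _ hx.1)
    simpa using this
  have h2 : ∫ x in (u - R)..(u - R + δ), P x ≤ δ * P (u - R + δ) := by
    have := intervalIntegral.integral_mono_on (a := u - R) (b := u - R + δ) (by linarith)
      (hint _ _) (intervalIntegrable_const (c := P (u - R + δ)) (μ := volume))
      (fun x hx => hP.mono _ _ hx.2)
    simpa using this
  have h3 : P b ≤ P (u + R) := hP.mono _ _ (by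
    linarith [le_abs_self b, neg_abs_le u₀, abs_nonneg a])
  have h4 : P (u - R + δ) ≤ P a := hP.mono _ _ (by
    linarith [neg_abs_le a, le_abs_self u₀, abs_nonneg b])
  rw [e1, e2]
  refine le_trans ?_ e3
  rw [e4, e5]
  refine mul_le_mul_of_nonneg_left ?_ hc0.le
  have h5 : δ * P (u - R + δ) ≤ δ * P a := mul_le_mul_of_nonneg_left h4 hδ
  have h6 : δ * P b ≤ δ * P (u + R) := mul_le_mul_of_nonneg_left h3 hδ
  have h7 : δ * P a ≤ δ * 0 := mul_le_mul_of_nonneg_left ha hδ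
  have h8 : δ * 1 ≤ δ * P b := mul_le_mul_of_nonneg_left hb hδ
  linarith

/-- The bump vanishes outside `[-1, 1]`, so the uniform growth of the Gaussian average near `u`
passes to every small difference quotient of its convolution. -/
lemma deriv_smoothing_pos (htop : ∀ N, ∃ u, N ≤ P u) (hbot : ∀ N, ∃ u, P u ≤ N) (u : ℝ) :
    0 < deriv (smoothing P) u := by
  obtain ⟨c, hc, hgr⟩ := hP.gaussAvg_growth htop hbot u
  have hd : HasDerivAt (smoothing P) (deriv (smoothing P) u) u :=
    ((hP.contDiff_smoothing.differentiable (by simp)) u).hasDerivAt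
  refine hc.trans_le ?_
  have h0 : Integrable mollifier :=
    continuous_mollifier.integrable_of_hasCompactSupport hasCompactSupport_mollifier
  refine ge_of_tendsto (hasDerivAt_iff_tendsto_slope_zero.1 hd |>.mono_left
    (nhdsWithin_mono 0 (fun x hx => ne_of_gt hx) : 𝓝[>] 0 ≤ 𝓝[≠] (0 : ℝ))) ?_
  filter_upwards [Ioo_mem_nhdsGT (show (0 : ℝ) < 1 by norm_num)] with δ hδ
  rw [smul_eq_mul, ← div_eq_inv_mul, le_div_iff₀ hδ.1]
  have e : smoothing P (u + δ) - smoothing P u =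
      ∫ r, mollifier r * (MeasuredFoliation.gaussAvg P (u - r + δ) -
        MeasuredFoliation.gaussAvg P (u - r)) := by
    unfold smoothing
    rw [← integral_sub (hP.gaussAvg.integrable_mollifier _) (hP.gaussAvg.integrable_mollifier _)]
    refine integral_congr_ae (ae_of_all _ fun r => ?_)
    simp only
    rw [show u + δ - r = u - r + δ by ring]; ring
  have e' : c * δ = ∫ r, mollifier r * (c * δ) := by
    rw [integral_mul_const, integral_mollifier, one_mul]
  rw [e, e']
  refine integral_mono (h0.mul_const _) ?_ fun r => ?_
  · have := (hP.gaussAvg.integrable_mollifier (u + δ)).sub (hP.gaussAvg.integrable_mollifier u)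
    refine this.congr (ae_of_all _ fun r => ?_)
    simp only [Pi.sub_apply]
    rw [show u + δ - r = u - r + δ by ring]; ring
  · simp only
    by_cases hr : 1 < |r|
    · simp [mollifier_eq_zero hr]
    · refine mul_le_mul_of_nonneg_left (hgr _ _ ?_ hδ.1.le hδ.2.le) (mollifier_nonneg r)
      rw [show u - r - u = -r by ring, abs_neg]
      exact not_lt.1 hr

end SlopeLeOne

lemma smoothing_neg (P : ℝ → ℝ) (u : ℝ) :
    smoothing (fun v => -P (-v)) u = -smoothing P (-u) := by
  have h1 : ∀ u, gaussAvg (fun v => -P (-v)) u = -gaussAvg P (-u) := by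
    intro u
    unfold gaussAvg
    rw [integral_neg, ← integral_comp_neg_gauss]
    simp only [sub_neg_eq_add]
    congr 2; ext s; congr 1; ring
  unfold smoothing
  simp_rw [h1]
  rw [← integral_neg_eq_self, ← integral_neg]
  congr 1; ext r
  rw [mollifier_neg, show -(u - -r) = -u - r by ring]; ring

lemma SlopeLeOne.smoothing_add {P : ℝ → ℝ} (hP : SlopeLeOne P) (a c u : ℝ) :
    smoothing (fun v => P (v - a) + c) u = smoothing P (u - a) + c := by
  have h1 : ∀ u, MeasuredFoliation.gaussAvg (fun v => P (v - a) + c) u =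
      MeasuredFoliation.gaussAvg P (u - a) + c := by
    intro u
    unfold MeasuredFoliation.gaussAvg
    simp_rw [show ∀ s, u - s - a = u - a - s from fun s => by ring]
    rw [integral_add (hP.integrable _) (integrable_const _)]
    simp
  have h0 : Integrable mollifier :=
    continuous_mollifier.integrable_of_hasCompactSupport hasCompactSupport_mollifier
  unfold smoothing
  simp_rw [h1, mul_add, show ∀ s, u - s - a = u - a - s from fun s => by ring]
  rw [integral_add (hP.gaussAvg.integrable_mollifier _) (h0.mul_const _), integral_mul_const,
    integral_mollifier, one_mul]

/-! ### Canonical diffeomorphisms from coarse correspondences of the line -/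

/-- The two coordinates of the points of `Z` tend to `+∞` together and to `-∞` together. -/
structure EndsMatched (Z : Set (ℝ × ℝ)) : Prop where
  fst_above : ∀ N : ℝ, ∃ z ∈ Z, N ≤ z.1
  fst_below : ∀ N : ℝ, ∃ z ∈ Z, z.1 ≤ N
  snd_le : ∀ N : ℝ, ∃ B, ∀ z ∈ Z, z.1 ≤ N → z.2 ≤ B
  le_snd : ∀ N : ℝ, ∃ B, ∀ z ∈ Z, N ≤ z.1 → B ≤ z.2
  fst_le : ∀ N : ℝ, ∃ B, ∀ z ∈ Z, z.2 ≤ N → z.1 ≤ B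
  le_fst : ∀ N : ℝ, ∃ B, ∀ z ∈ Z, N ≤ z.2 → B ≤ z.1

/-- A monotone curve through the coarse correspondence `Z`, parametrized by the sum of the
coordinates; this is its first coordinate. -/
noncomputable def midCurve (Z : Set (ℝ × ℝ)) (u : ℝ) : ℝ :=
  (sSup ((fun z : ℝ × ℝ => min z.1 (u - z.2)) '' Z) +
    sInf ((fun z : ℝ × ℝ => max z.1 (u - z.2)) '' Z)) / 2

/-- The smoothed monotone curve. -/
noncomputable def junction (Z : Set (ℝ × ℝ)) : ℝ → ℝ := smoothing (midCurve Z)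

namespace EndsMatched
variable {Z : Set (ℝ × ℝ)}

lemma swap (h : EndsMatched Z) : EndsMatched (Prod.swap '' Z) where
  fst_above N := by
    obtain ⟨B, hB⟩ := h.fst_le N
    obtain ⟨z, hz, h1⟩ := h.fst_above (B + 1)
    exact ⟨_, ⟨z, hz, rfl⟩, le_of_not_ge fun hN => by have := hB z hz hN; linarith⟩
  fst_below N := by
    obtain ⟨B, hB⟩ := h.le_fst N
    obtain ⟨z, hz, h1⟩ := h.fst_below (B - 1)
    exact ⟨_, ⟨z, hz, rfl⟩, le_of_not_ge fun hN => by have := hB z hz hN; linarith⟩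
  snd_le N := by
    obtain ⟨B, hB⟩ := h.fst_le N
    exact ⟨B, by rintro _ ⟨z, hz, rfl⟩; exact hB z hz⟩
  le_snd N := by
    obtain ⟨B, hB⟩ := h.le_fst N
    exact ⟨B, by rintro _ ⟨z, hz, rfl⟩; exact hB z hz⟩
  fst_le N := by
    obtain ⟨B, hB⟩ := h.snd_le N
    exact ⟨B, by rintro _ ⟨z, hz, rfl⟩; exact hB z hz⟩
  le_fst N := by
    obtain ⟨B, hB⟩ := h.le_snd N
    exact ⟨B, by rintro _ ⟨z, hz, rfl⟩; exact hB z hz⟩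

lemma nonempty (h : EndsMatched Z) : Z.Nonempty := by
  obtain ⟨z, hz, -⟩ := h.fst_above 0
  exact ⟨z, hz⟩

/-- Points with nonpositive first coordinate contribute at most `0`. For the others the second
coordinate is bounded below, by matching of the ends, hence `u - z.2` is bounded above. -/
lemma bddAbove (h : EndsMatched Z) (u : ℝ) :
    BddAbove ((fun z : ℝ × ℝ => min z.1 (u - z.2)) '' Z) := by
  obtain ⟨B, hB⟩ := h.le_snd 0
  refine ⟨max 0 (u - B), ?_⟩
  rintro _ ⟨z, hz, rfl⟩
  rcases le_total z.1 0 with h0 | h0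
  · exact (min_le_left _ _).trans (h0.trans (le_max_left _ _))
  · exact (min_le_right _ _).trans (le_trans (by linarith [hB z hz h0]) (le_max_right _ _))

lemma bddBelow (h : EndsMatched Z) (u : ℝ) :
    BddBelow ((fun z : ℝ × ℝ => max z.1 (u - z.2)) '' Z) := by
  obtain ⟨B, hB⟩ := h.snd_le 0
  refine ⟨min 0 (u - B), ?_⟩
  rintro _ ⟨z, hz, rfl⟩
  rcases le_total z.1 0 with h0 | h0
  · exact (min_le_right _ _).trans (le_trans (by linarith [hB z hz h0]) (le_max_right _ _))
  · exact (min_le_left _ _).trans (h0.trans (le_max_left _ _))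

/-- For fixed `z`, both `min z.1 (u - z.2)` and `max z.1 (u - z.2)` are nondecreasing in `u` with
slope at most one, a property preserved by suprema, infima and means. -/
lemma slopeLeOne (h : EndsMatched Z) : SlopeLeOne (midCurve Z) := by
  have hne : ∀ f : ℝ × ℝ → ℝ, (f '' Z).Nonempty := fun f => h.nonempty.image f
  refine ⟨fun u v huv => ?_, fun u v huv => ?_⟩
  · have h1 : sSup ((fun z : ℝ × ℝ => min z.1 (u - z.2)) '' Z) ≤
        sSup ((fun z : ℝ × ℝ => min z.1 (v - z.2)) '' Z) := by
      refine csSup_le (hne _) ?_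
      rintro _ ⟨z, hz, rfl⟩
      exact le_trans (min_le_min le_rfl (by linarith)) (le_csSup (h.bddAbove v) ⟨z, hz, rfl⟩)
    have h2 : sInf ((fun z : ℝ × ℝ => max z.1 (u - z.2)) '' Z) ≤
        sInf ((fun z : ℝ × ℝ => max z.1 (v - z.2)) '' Z) := by
      refine le_csInf (hne _) ?_
      rintro _ ⟨z, hz, rfl⟩
      exact le_trans (csInf_le (h.bddBelow u) ⟨z, hz, rfl⟩) (max_le_max le_rfl (by linarith))
    unfold midCurve
    linarith
  · have h1 : sSup ((fun z : ℝ × ℝ => min z.1 (v - z.2)) '' Z) ≤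
        sSup ((fun z : ℝ × ℝ => min z.1 (u - z.2)) '' Z) + (v - u) := by
      refine csSup_le (hne _) ?_
      rintro _ ⟨z, hz, rfl⟩
      have := le_csSup (h.bddAbove u) ⟨z, hz, rfl⟩
      refine le_trans ?_ (add_le_add_left this _)
      simp only
      rw [min_add_add_right _ _ _ |>.symm]
      exact min_le_min (by linarith) (by linarith)
    have h2 : sInf ((fun z : ℝ × ℝ => max z.1 (v - z.2)) '' Z) - (v - u) ≤
        sInf ((fun z : ℝ × ℝ => max z.1 (u - z.2)) '' Z) := by
      refine le_csInf (hne _) ?_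
      rintro _ ⟨z, hz, rfl⟩
      have := csInf_le (h.bddBelow v) ⟨z, hz, rfl⟩
      rw [sub_le_iff_le_add]
      refine le_trans this ?_
      simp only
      rw [max_add_add_right _ _ _ |>.symm]
      exact max_le_max (by linarith) (by linarith)
    unfold midCurve
    linarith

/-- The reflection `x ↦ u - x` exchanges the supremum of the minima with the infimum of the maxima.
Taking the mean of the two is what makes the curve symmetric in the factors. -/
lemma midCurve_swap (h : EndsMatched Z) (u : ℝ) :
    midCurve (Prod.swap '' Z) u = u - midCurve Z u := by
  have h1 : (fun z : ℝ × ℝ => min z.1 (u - z.2)) '' (Prod.swap '' Z) =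
      (fun x => u - x) '' ((fun z : ℝ × ℝ => max z.1 (u - z.2)) '' Z) := by
    rw [image_image, image_image]
    refine image_congr fun z _ => ?_
    simp only [Prod.fst_swap, Prod.snd_swap]
    rw [← min_sub_sub_left, sub_sub_cancel, min_comm]
  have h2 : (fun z : ℝ × ℝ => max z.1 (u - z.2)) '' (Prod.swap '' Z) =
      (fun x => u - x) '' ((fun z : ℝ × ℝ => min z.1 (u - z.2)) '' Z) := by
    rw [image_image, image_image]
    refine image_congr fun z _ => ?_
    simp only [Prod.fst_swap, Prod.snd_swap]
    rw [← max_sub_sub_left, sub_sub_cancel, max_comm]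
  have hanti : Antitone fun x : ℝ => u - x := fun x y hxy => by simp only; linarith
  have hc : Continuous fun x : ℝ => u - x := by fun_prop
  unfold midCurve
  rw [h1, h2, ← hanti.map_csInf_of_continuousAt hc.continuousAt (h.nonempty.image _) (h.bddBelow u),
    ← hanti.map_csSup_of_continuousAt hc.continuousAt (h.nonempty.image _) (h.bddAbove u)]
  ring

lemma exists_le_midCurve (h : EndsMatched Z) (N : ℝ) : ∃ u, N ≤ midCurve Z u := by
  obtain ⟨z, hz, h1⟩ := h.fst_above N
  obtain ⟨B, hB⟩ := h.snd_le N
  -- The first term makes the point `z` push the supremum up to `N`. The second forces every maximum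
  -- up to `N`: a point whose first coordinate is below `N` has second coordinate at most `B`.
  refine ⟨max (N + z.2) (N + B), ?_⟩
  set u := max (N + z.2) (N + B)
  have h2 : N ≤ sSup ((fun z : ℝ × ℝ => min z.1 (u - z.2)) '' Z) := by
    refine le_trans ?_ (le_csSup (h.bddAbove u) ⟨z, hz, rfl⟩)
    exact le_min h1 (by linarith [le_max_left (N + z.2) (N + B)])
  have h3 : N ≤ sInf ((fun z : ℝ × ℝ => max z.1 (u - z.2)) '' Z) := by
    refine le_csInf (h.nonempty.image _) ?_
    rintro _ ⟨w, hw, rfl⟩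
    rcases le_total w.1 N with h4 | h4
    · exact le_trans (by linarith [hB w hw h4, le_max_right (N + z.2) (N + B)]) (le_max_right _ _)
    · exact h4.trans (le_max_left _ _)
  unfold midCurve
  linarith

lemma exists_midCurve_le (h : EndsMatched Z) (N : ℝ) : ∃ u, midCurve Z u ≤ N := by
  obtain ⟨z, hz, h1⟩ := h.fst_below N
  obtain ⟨B, hB⟩ := h.le_snd N
  refine ⟨min (N + z.2) (N + B), ?_⟩
  set u := min (N + z.2) (N + B)
  have h2 : sInf ((fun z : ℝ × ℝ => max z.1 (u - z.2)) '' Z) ≤ N := by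
    refine le_trans (csInf_le (h.bddBelow u) ⟨z, hz, rfl⟩) ?_
    exact max_le h1 (by linarith [min_le_left (N + z.2) (N + B)])
  have h3 : sSup ((fun z : ℝ × ℝ => min z.1 (u - z.2)) '' Z) ≤ N := by
    refine csSup_le (h.nonempty.image _) ?_
    rintro _ ⟨w, hw, rfl⟩
    rcases le_total w.1 N with h4 | h4
    · exact (min_le_left _ _).trans h4
    · exact le_trans (min_le_right _ _) (by linarith [hB w hw h4, min_le_right (N + z.2) (N + B)])
  unfold midCurve
  linarith

lemma junction_swap (h : EndsMatched Z) (u : ℝ) :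
    junction (Prod.swap '' Z) u = u - junction Z u := by
  unfold junction
  rw [← h.slopeLeOne.smoothing_id_sub]
  congr 1
  funext v
  exact h.midCurve_swap v

lemma contDiff_junction (h : EndsMatched Z) :
    ContDiff ℝ ((⊤ : ℕ∞) : WithTop ℕ∞) (junction Z) := h.slopeLeOne.contDiff_smoothing

lemma deriv_junction_pos (h : EndsMatched Z) (u : ℝ) : 0 < deriv (junction Z) u :=
  h.slopeLeOne.deriv_smoothing_pos h.exists_le_midCurve h.exists_midCurve_le u

lemma strictMono_junction (h : EndsMatched Z) : StrictMono (junction Z) :=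
  strictMono_of_deriv_pos h.deriv_junction_pos

/-- The smoothed curve stays at bounded distance from `midCurve`, which is unbounded in both
directions. -/
lemma surjective_junction (h : EndsMatched Z) : Function.Surjective (junction Z) := by
  intro y
  obtain ⟨a, ha⟩ := h.exists_midCurve_le (y - (1 + ∫ s, |s| ∂gauss))
  obtain ⟨b, hb⟩ := h.exists_le_midCurve (y + (1 + ∫ s, |s| ∂gauss))
  have h1 := abs_le.1 (h.slopeLeOne.abs_smoothing_sub_le a)
  have h2 := abs_le.1 (h.slopeLeOne.abs_smoothing_sub_le b)
  refine mem_range_of_exists_le_of_exists_ge h.contDiff_junction.continuous ⟨a, ?_⟩ ⟨b, ?_⟩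
  · unfold junction; linarith [h1.2]
  · unfold junction; linarith [h2.1]

/-- The junction curve as a homeomorphism. -/
noncomputable def junctionHomeo (h : EndsMatched Z) : ℝ ≃ₜ ℝ :=
  (h.strictMono_junction.orderIsoOfSurjective _ h.surjective_junction).toHomeomorph

@[simp] lemma junctionHomeo_apply (h : EndsMatched Z) (u : ℝ) :
    h.junctionHomeo u = junction Z u := rfl

lemma contDiff_junctionHomeo_symm (h : EndsMatched Z) :
    ContDiff ℝ ((⊤ : ℕ∞) : WithTop ℕ∞) h.junctionHomeo.symm :=
  h.junctionHomeo.contDiff_symm_deriv (f' := deriv (junction Z))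
    (fun u => (h.deriv_junction_pos u).ne')
    (fun u => ((h.contDiff_junction.differentiable (by simp)) u).hasDerivAt)
    h.contDiff_junction

end EndsMatched

lemma midCurve_neg (Z : Set (ℝ × ℝ)) (u : ℝ) :
    midCurve ((fun z : ℝ × ℝ => (-z.1, -z.2)) '' Z) u = -midCurve Z (-u) := by
  have h1 : (fun z : ℝ × ℝ => min z.1 (u - z.2)) '' ((fun z : ℝ × ℝ => (-z.1, -z.2)) '' Z) =
      -((fun z : ℝ × ℝ => max z.1 (-u - z.2)) '' Z) := by
    rw [image_image, ← Set.image_neg_eq_neg, image_image]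
    refine image_congr fun z _ => ?_
    simp only
    rw [← min_neg_neg]; congr 1; ring
  have h2 : (fun z : ℝ × ℝ => max z.1 (u - z.2)) '' ((fun z : ℝ × ℝ => (-z.1, -z.2)) '' Z) =
      -((fun z : ℝ × ℝ => min z.1 (-u - z.2)) '' Z) := by
    rw [image_image, ← Set.image_neg_eq_neg, image_image]
    refine image_congr fun z _ => ?_
    simp only
    rw [← max_neg_neg]; congr 1; ring
  unfold midCurve
  rw [h1, h2, Real.sInf_neg, Real.sSup_neg]
  ring

lemma junction_neg (Z : Set (ℝ × ℝ)) (u : ℝ) :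
    junction ((fun z : ℝ × ℝ => (-z.1, -z.2)) '' Z) (-u) = -junction Z u := by
  unfold junction
  have := smoothing_neg (midCurve Z) (-u)
  rw [neg_neg] at this
  rw [← this]
  congr 1
  funext v
  exact midCurve_neg Z v

lemma EndsMatched.midCurve_add {Z : Set (ℝ × ℝ)} (h : EndsMatched Z) (c d u : ℝ) :
    midCurve ((fun z : ℝ × ℝ => (z.1 + c, z.2 + d)) '' Z) u = midCurve Z (u - (c + d)) + c := by
  have h1 : (fun z : ℝ × ℝ => min z.1 (u - z.2)) '' ((fun z : ℝ × ℝ => (z.1 + c, z.2 + d)) '' Z) =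
      (fun x => x + c) '' ((fun z : ℝ × ℝ => min z.1 (u - (c + d) - z.2)) '' Z) := by
    rw [image_image, image_image]
    refine image_congr fun z _ => ?_
    simp only
    rw [← min_add_add_right]; congr 1; ring
  have h2 : (fun z : ℝ × ℝ => max z.1 (u - z.2)) '' ((fun z : ℝ × ℝ => (z.1 + c, z.2 + d)) '' Z) =
      (fun x => x + c) '' ((fun z : ℝ × ℝ => max z.1 (u - (c + d) - z.2)) '' Z) := by
    rw [image_image, image_image]
    refine image_congr fun z _ => ?_
    simp only
    rw [← max_add_add_right]; congr 1; ring
  have hm : Monotone fun x : ℝ => x + c := fun x y hxy => by simp only; linarith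
  have hc : Continuous fun x : ℝ => x + c := by fun_prop
  unfold midCurve
  rw [h1, h2,
    ← hm.map_csInf_of_continuousAt hc.continuousAt (h.nonempty.image _) (h.bddBelow _),
    ← hm.map_csSup_of_continuousAt hc.continuousAt (h.nonempty.image _) (h.bddAbove _)]
  ring

lemma EndsMatched.junction_add {Z : Set (ℝ × ℝ)} (h : EndsMatched Z) (c d u : ℝ) :
    junction ((fun z : ℝ × ℝ => (z.1 + c, z.2 + d)) '' Z) (u + (c + d)) = junction Z u + c := by
  have h1 := h.slopeLeOne.smoothing_add (c + d) c (u + (c + d))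
  rw [add_sub_cancel_right] at h1
  unfold junction
  rw [← h1]
  congr 1
  funext v
  exact h.midCurve_add c d v

lemma EndsMatched.neg {Z : Set (ℝ × ℝ)} (h : EndsMatched Z) :
    EndsMatched ((fun z : ℝ × ℝ => (-z.1, -z.2)) '' Z) where
  fst_above N := by
    obtain ⟨z, hz, h1⟩ := h.fst_below (-N)
    exact ⟨_, ⟨z, hz, rfl⟩, by simp only; linarith⟩
  fst_below N := by
    obtain ⟨z, hz, h1⟩ := h.fst_above (-N)
    exact ⟨_, ⟨z, hz, rfl⟩, by simp only; linarith⟩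
  snd_le N := by
    obtain ⟨B, hB⟩ := h.le_snd (-N)
    exact ⟨-B, by rintro _ ⟨z, hz, rfl⟩ hN; exact neg_le_neg (hB z hz (by simp only at hN; linarith))⟩
  le_snd N := by
    obtain ⟨B, hB⟩ := h.snd_le (-N)
    exact ⟨-B, by rintro _ ⟨z, hz, rfl⟩ hN; exact neg_le_neg (hB z hz (by simp only at hN; linarith))⟩
  fst_le N := by
    obtain ⟨B, hB⟩ := h.le_fst (-N)
    exact ⟨-B, by rintro _ ⟨z, hz, rfl⟩ hN; exact neg_le_neg (hB z hz (by simp only at hN; linarith))⟩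
  le_fst N := by
    obtain ⟨B, hB⟩ := h.fst_le (-N)
    exact ⟨-B, by rintro _ ⟨z, hz, rfl⟩ hN; exact neg_le_neg (hB z hz (by simp only at hN; linarith))⟩

/-- Equivariance of the junction curve under isometries of the two factors. -/
lemma EndsMatched.junction_affine {Z : Set (ℝ × ℝ)} (h : EndsMatched Z) {σ : ℝ}
    (hσ : σ = 1 ∨ σ = -1) (c d u : ℝ) :
    junction ((fun z : ℝ × ℝ => (σ * z.1 + c, σ * z.2 + d)) '' Z) (σ * u + (c + d)) =
      σ * junction Z u + c := by
  rcases hσ with rfl | rfl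
  · simpa using h.junction_add c d u
  · have := h.neg.junction_add c d (-u)
    rw [junction_neg, image_image] at this
    simpa using this

/-- Two matchings of the same correspondence differ by isometries of the same sign. -/
lemma EndsMatched.sign_eq {Z : Set (ℝ × ℝ)} (h : EndsMatched Z) {σ σ' c d : ℝ}
    (hσ : σ = 1 ∨ σ = -1) (hσ' : σ' = 1 ∨ σ' = -1)
    (h' : EndsMatched ((fun z : ℝ × ℝ => (σ * z.1 + c, σ' * z.2 + d)) '' Z)) : σ = σ' := by
  rcases hσ with rfl | rfl <;> rcases hσ' with rfl | rfl
  · rfl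
  · exfalso
    -- With opposite signs, points of `Z` whose first coordinate is large have image with
    -- nonnegative first coordinate, so the image has second coordinate at least `B`. This bounds
    -- `z.2` above, hence bounds `z.1` above, which is absurd.
    obtain ⟨B, hB⟩ := h'.le_snd 0
    obtain ⟨B', hB'⟩ := h.fst_le (d - B)
    obtain ⟨z, hz, h1⟩ := h.fst_above (max (-c) (B' + 1))
    have h2 := hB _ ⟨z, hz, rfl⟩ (by simp only; linarith [le_max_left (-c) (B' + 1)])
    simp only at h2
    have h3 := hB' z hz (by linarith)
    linarith [le_max_right (-c) (B' + 1)]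
  · exfalso
    obtain ⟨B, hB⟩ := h'.snd_le 0
    obtain ⟨B', hB'⟩ := h.fst_le (B - d)
    obtain ⟨z, hz, h1⟩ := h.fst_above (max c (B' + 1))
    have h2 := hB _ ⟨z, hz, rfl⟩ (by simp only; linarith [le_max_left c (B' + 1)])
    simp only at h2
    have h3 := hB' z hz (by linarith)
    linarith [le_max_right c (B' + 1)]
  · rfl

/-! ### Replacing a correspondence by a dense subset -/

section Dense
variable {Z Z' : Set (ℝ × ℝ)} (h1 : Z' ⊆ Z) (h2 : Z ⊆ closure Z')
include h1 h2

/-- Each condition is quantified over all `N`, so shifting `N` by one makes the relevant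
inequalities open, and open conditions are detected on a dense subset. -/
lemma endsMatched_iff_of_dense : EndsMatched Z' ↔ EndsMatched Z := by
  have ap : ∀ O : Set (ℝ × ℝ), IsOpen O → ∀ z ∈ Z, z ∈ O → ∃ z' ∈ Z', z' ∈ O := by
    intro O hO z hz hzO
    obtain ⟨w, hw1, hw2⟩ := mem_closure_iff.1 (h2 hz) O hO hzO
    exact ⟨w, hw2, hw1⟩
  constructor
  · intro h
    refine ⟨fun N => ?_, fun N => ?_, fun N => ?_, fun N => ?_, fun N => ?_, fun N => ?_⟩
    · obtain ⟨z, hz, hh⟩ := h.fst_above N; exact ⟨z, h1 hz, hh⟩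
    · obtain ⟨z, hz, hh⟩ := h.fst_below N; exact ⟨z, h1 hz, hh⟩
    · obtain ⟨B, hB⟩ := h.snd_le (N + 1)
      refine ⟨B, fun z hz hN => le_of_not_gt fun hlt => ?_⟩
      obtain ⟨w, hw, hw1, hw2⟩ := ap {w | w.1 < N + 1 ∧ B < w.2}
        (by
          rw [ofPred_and]
          exact (isOpen_lt (by fun_prop) (by fun_prop)).inter (isOpen_lt (by fun_prop) (by fun_prop)))
        z hz ⟨by linarith, hlt⟩
      linarith [hB w hw hw1.le]
    · obtain ⟨B, hB⟩ := h.le_snd (N - 1)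
      refine ⟨B, fun z hz hN => le_of_not_gt fun hlt => ?_⟩
      obtain ⟨w, hw, hw1, hw2⟩ := ap {w | N - 1 < w.1 ∧ w.2 < B}
        (by
          rw [ofPred_and]
          exact (isOpen_lt (by fun_prop) (by fun_prop)).inter (isOpen_lt (by fun_prop) (by fun_prop)))
        z hz ⟨by linarith, hlt⟩
      linarith [hB w hw hw1.le]
    · obtain ⟨B, hB⟩ := h.fst_le (N + 1)
      refine ⟨B, fun z hz hN => le_of_not_gt fun hlt => ?_⟩
      obtain ⟨w, hw, hw1, hw2⟩ := ap {w | w.2 < N + 1 ∧ B < w.1}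
        (by
          rw [ofPred_and]
          exact (isOpen_lt (by fun_prop) (by fun_prop)).inter (isOpen_lt (by fun_prop) (by fun_prop)))
        z hz ⟨by linarith, hlt⟩
      linarith [hB w hw hw1.le]
    · obtain ⟨B, hB⟩ := h.le_fst (N - 1)
      refine ⟨B, fun z hz hN => le_of_not_gt fun hlt => ?_⟩
      obtain ⟨w, hw, hw1, hw2⟩ := ap {w | N - 1 < w.2 ∧ w.1 < B}
        (by
          rw [ofPred_and]
          exact (isOpen_lt (by fun_prop) (by fun_prop)).inter (isOpen_lt (by fun_prop) (by fun_prop)))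
        z hz ⟨by linarith, hlt⟩
      linarith [hB w hw hw1.le]
  · intro h
    refine ⟨fun N => ?_, fun N => ?_, fun N => ?_, fun N => ?_, fun N => ?_, fun N => ?_⟩
    · obtain ⟨z, hz, hh⟩ := h.fst_above (N + 1)
      obtain ⟨w, hw, hw1⟩ := ap {w | N < w.1} (isOpen_lt (by fun_prop) (by fun_prop)) z hz
        (show N < z.1 by linarith)
      exact ⟨w, hw, le_of_lt hw1⟩
    · obtain ⟨z, hz, hh⟩ := h.fst_below (N - 1)
      obtain ⟨w, hw, hw1⟩ := ap {w | w.1 < N} (isOpen_lt (by fun_prop) (by fun_prop)) z hz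
        (show z.1 < N by linarith)
      exact ⟨w, hw, le_of_lt hw1⟩
    · obtain ⟨B, hB⟩ := h.snd_le N; exact ⟨B, fun z hz => hB z (h1 hz)⟩
    · obtain ⟨B, hB⟩ := h.le_snd N; exact ⟨B, fun z hz => hB z (h1 hz)⟩
    · obtain ⟨B, hB⟩ := h.fst_le N; exact ⟨B, fun z hz => hB z (h1 hz)⟩
    · obtain ⟨B, hB⟩ := h.le_fst N; exact ⟨B, fun z hz => hB z (h1 hz)⟩

lemma EndsMatched.midCurve_eq_of_dense (h : EndsMatched Z) : midCurve Z' = midCurve Z := by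
  have h' := (endsMatched_iff_of_dense h1 h2).2 h
  funext u
  unfold midCurve
  congr 2
  · refine le_antisymm (csSup_le_csSup (h.bddAbove u) (h'.nonempty.image _) (image_mono h1)) ?_
    refine csSup_le (h.nonempty.image _) ?_
    rintro _ ⟨z, hz, rfl⟩
    have hcl : IsClosed {z : ℝ × ℝ | min z.1 (u - z.2) ≤
        sSup ((fun z : ℝ × ℝ => min z.1 (u - z.2)) '' Z')} :=
      isClosed_le (by fun_prop) (by fun_prop)
    exact closure_minimal (fun w hw => le_csSup (h'.bddAbove u) ⟨w, hw, rfl⟩) hcl (h2 hz)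
  · refine le_antisymm ?_ (csInf_le_csInf (h.bddBelow u) (h'.nonempty.image _) (image_mono h1))
    refine le_csInf (h.nonempty.image _) ?_
    rintro _ ⟨z, hz, rfl⟩
    have hcl : IsClosed {z : ℝ × ℝ | sInf ((fun z : ℝ × ℝ => max z.1 (u - z.2)) '' Z') ≤
        max z.1 (u - z.2)} :=
      isClosed_le (by fun_prop) (by fun_prop)
    exact closure_minimal (fun w hw => csInf_le (h'.bddBelow u) ⟨w, hw, rfl⟩) hcl (h2 hz)

end Dense

/-! ### Measurability of the junction curve in the data -/

lemma measurable_midCurve :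
    Measurable fun q : (ℕ → ℝ × ℝ) × ℝ => midCurve (range q.1) q.2 := by
  unfold midCurve
  simp_rw [← range_comp, sSup_range, sInf_range]
  refine Measurable.div_const (Measurable.add ?_ ?_) 2
  · refine Measurable.iSup fun k => ?_
    simp only [Function.comp_apply]
    fun_prop
  · refine Measurable.iInf fun k => ?_
    simp only [Function.comp_apply]
    fun_prop

lemma measurable_junction :
    Measurable fun q : (ℕ → ℝ × ℝ) × ℝ => junction (range q.1) q.2 := by
  have h1 : Measurable fun q : (ℕ → ℝ × ℝ) × ℝ => gaussAvg (midCurve (range q.1)) q.2 := by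
    unfold gaussAvg
    refine (StronglyMeasurable.integral_prod_right (f := fun (q : (ℕ → ℝ × ℝ) × ℝ) (s : ℝ) =>
      midCurve (range q.1) (q.2 - s)) ?_).measurable
    exact (measurable_midCurve.comp (g := fun p : (ℕ → ℝ × ℝ) × ℝ => midCurve (range p.1) p.2)
      (f := fun p : ((ℕ → ℝ × ℝ) × ℝ) × ℝ => (p.1.1, p.1.2 - p.2)) (by fun_prop)).stronglyMeasurable
  unfold junction smoothing
  refine (StronglyMeasurable.integral_prod_right (f := fun (q : (ℕ → ℝ × ℝ) × ℝ) (r : ℝ) =>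
      mollifier r * gaussAvg (midCurve (range q.1)) (q.2 - r)) ?_).measurable
  refine Measurable.stronglyMeasurable ?_
  refine (continuous_mollifier.measurable.comp measurable_snd).mul ?_
  exact h1.comp (g := fun p : (ℕ → ℝ × ℝ) × ℝ => gaussAvg (midCurve (range p.1)) p.2)
      (f := fun p : ((ℕ → ℝ × ℝ) × ℝ) × ℝ => (p.1.1, p.1.2 - p.2)) (by fun_prop)

/-! ### One-dimensional manifolds with a length structure -/

/-- Local coordinates of a one-manifold that are defined up to sign and translation. -/
structure IsLengthAtlas {Y : Type*} [TopologicalSpace Y] (𝒩 : Set (Set Y × (Y → ℝ))) : Prop where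
  isOpen : ∀ q ∈ 𝒩, IsOpen q.1
  isPreconnected : ∀ q ∈ 𝒩, IsPreconnected q.1
  injOn : ∀ q ∈ 𝒩, InjOn q.2 q.1
  continuousOn : ∀ q ∈ 𝒩, ContinuousOn q.2 q.1
  isOpen_image : ∀ q ∈ 𝒩, ∀ O ⊆ q.1, IsOpen O → IsOpen (q.2 '' O)
  compat : ∀ q ∈ 𝒩, ∀ q' ∈ 𝒩, ∀ y ∈ q.1, y ∈ q'.1 → ∃ σ : ℝ, (σ = 1 ∨ σ = -1) ∧
    ∀ᶠ z in 𝓝 y, q'.2 z - q'.2 y = σ * (q.2 z - q.2 y)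
  cover : ∀ y, ∃ q ∈ 𝒩, y ∈ q.1

/-! ### Unit speed curves and parametrization of noncompact leaves -/

section Line

variable {Y : Type*} {𝒩 : Set (Set Y × (Y → ℝ))}

/-- The curve `c` has unit speed near `t`. -/
def UnitAt (𝒩 : Set (Set Y × (Y → ℝ))) (c : ℝ → Y) (t : ℝ) : Prop :=
  ∃ q ∈ 𝒩, c t ∈ q.1 ∧ ∃ σ : ℝ, (σ = 1 ∨ σ = -1) ∧
    ∀ᶠ s in 𝓝 t, c s ∈ q.1 ∧ q.2 (c s) = q.2 (c t) + σ * (s - t)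

lemma mul_self_sign {σ : ℝ} (hσ : σ = 1 ∨ σ = -1) : σ * σ = 1 := by
  rcases hσ with rfl | rfl <;> norm_num

lemma abs_sign {σ : ℝ} (hσ : σ = 1 ∨ σ = -1) : |σ| = 1 := by
  rcases hσ with rfl | rfl <;> norm_num

lemma sign_mul {σ σ' : ℝ} (hσ : σ = 1 ∨ σ = -1) (hσ' : σ' = 1 ∨ σ' = -1) :
    σ * σ' = 1 ∨ σ * σ' = -1 := by
  rcases hσ with rfl | rfl <;> rcases hσ' with rfl | rfl <;> norm_num

lemma tendsto_affine (σ t : ℝ) {a : ℝ} : Tendsto (fun x => t + σ * (x - a)) (𝓝 a) (𝓝 t) := by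
  have : Continuous fun x : ℝ => t + σ * (x - a) := by fun_prop
  simpa using this.tendsto a

lemma UnitAt.congr {c c' : ℝ → Y} {t : ℝ} (h : UnitAt 𝒩 c t) (hcc : c =ᶠ[𝓝 t] c') :
    UnitAt 𝒩 c' t := by
  obtain ⟨q, hq, hct, σ, hσ, hev⟩ := h
  have e := hcc.self_of_nhds
  refine ⟨q, hq, e ▸ hct, σ, hσ, ?_⟩
  filter_upwards [hev, hcc] with s h1 h2
  rw [← h2, ← e]; exact h1

lemma UnitAt.comp_affine {c : ℝ → Y} {σ τ t : ℝ} (hσ : σ = 1 ∨ σ = -1)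
    (h : UnitAt 𝒩 c (σ * t + τ)) : UnitAt 𝒩 (fun s => c (σ * s + τ)) t := by
  obtain ⟨q, hq, hct, σ', hσ', hev⟩ := h
  refine ⟨q, hq, hct, σ' * σ, sign_mul hσ' hσ, ?_⟩
  have hc : Tendsto (fun s : ℝ => σ * s + τ) (𝓝 t) (𝓝 (σ * t + τ)) :=
    (by fun_prop : Continuous fun s : ℝ => σ * s + τ).tendsto t
  filter_upwards [hc.eventually hev] with s hs
  refine ⟨hs.1, ?_⟩
  rw [hs.2]; ring

lemma UnitAt.exists_injOn {c : ℝ → Y} {t : ℝ} (h : UnitAt 𝒩 c t) : ∃ O ∈ 𝓝 t, InjOn c O := by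
  obtain ⟨q, hq, hct, σ, hσ, hev⟩ := h
  refine ⟨_, hev, fun x hx y hy hxy => ?_⟩
  have h1 : q.2 (c t) + σ * (x - t) = q.2 (c t) + σ * (y - t) := by
    rw [← hx.2, ← hy.2, hxy]
  rcases hσ with rfl | rfl <;> linarith

variable [TopologicalSpace Y]

namespace IsLengthAtlas
variable (h𝒩 : IsLengthAtlas 𝒩)
include h𝒩

lemma continuousAt {c : ℝ → Y} {t : ℝ} (h : UnitAt 𝒩 c t) : ContinuousAt c t := by
  obtain ⟨q, hq, hct, σ, hσ, hev⟩ := h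
  intro O hO
  obtain ⟨O', hO', hO'o, hctO'⟩ := mem_nhds_iff.1 (inter_mem hO ((h𝒩.isOpen q hq).mem_nhds hct))
  have h1 : q.2 '' O' ∈ 𝓝 (q.2 (c t)) := (h𝒩.isOpen_image q hq O'
    (fun x hx => (hO' hx).2) hO'o).mem_nhds ⟨_, hctO', rfl⟩
  have h2 := (tendsto_affine σ (q.2 (c t)) (a := t)).eventually h1
  rw [Filter.mem_map]
  filter_upwards [hev, h2] with s hs1 hs2
  obtain ⟨z, hz, hzz⟩ := hs2
  have : z = c s := h𝒩.injOn q hq (hO' hz).2 hs1.1 (by rw [hzz, hs1.2])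
  change c s ∈ O
  rw [← this]
  exact (hO' hz).1

/-- A unit speed curve has the continuous local inverse `z ↦ t + σ * (q.2 z - q.2 (c t))`, so it is
open as well as continuous. -/
lemma map_nhds {c : ℝ → Y} {t : ℝ} (h : UnitAt 𝒩 c t) : map c (𝓝 t) = 𝓝 (c t) := by
  refine le_antisymm (h𝒩.continuousAt h) ?_
  obtain ⟨q, hq, hct, σ, hσ, hev⟩ := h
  intro O hO
  rw [Filter.mem_map] at hO
  have hqn := (h𝒩.isOpen q hq).mem_nhds hct
  have h1 : ContinuousAt q.2 (c t) := (h𝒩.continuousOn q hq).continuousAt hqn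
  have h2 : Tendsto (fun z => t + σ * (q.2 z - q.2 (c t))) (𝓝 (c t)) (𝓝 t) :=
    (tendsto_affine σ t).comp h1
  filter_upwards [hqn, h2.eventually hev, h2.eventually hO] with z hz1 hz2 hz3
  have : c (t + σ * (q.2 z - q.2 (c t))) = z := by
    refine h𝒩.injOn q hq hz2.1 hz1 ?_
    rw [hz2.2]
    linear_combination (q.2 z - q.2 (c t)) * mul_self_sign hσ
  exact this ▸ hz3

lemma unitAt_of_mem {c : ℝ → Y} {t : ℝ} (h : UnitAt 𝒩 c t) {q : Set Y × (Y → ℝ)} (hq : q ∈ 𝒩)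
    (hct : c t ∈ q.1) : ∃ σ : ℝ, (σ = 1 ∨ σ = -1) ∧
      ∀ᶠ s in 𝓝 t, c s ∈ q.1 ∧ q.2 (c s) = q.2 (c t) + σ * (s - t) := by
  have hcont := h𝒩.continuousAt h
  obtain ⟨q', hq', hct', σ, hσ, hev⟩ := h
  obtain ⟨σ', hσ', hev'⟩ := h𝒩.compat q' hq' q hq (c t) hct' hct
  refine ⟨σ' * σ, sign_mul hσ' hσ, ?_⟩
  filter_upwards [hev, hcont.eventually hev', hcont.eventually ((h𝒩.isOpen q hq).mem_nhds hct)]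
    with s h1 h2 h3
  refine ⟨h3, ?_⟩
  rw [h1.2] at h2
  linear_combination h2

/-- In a chart containing the common point both curves are affine with slope `±1`, and the chart
coordinate is injective. -/
lemma eventually_eq_of_eq {c c' : ℝ → Y} {t t' : ℝ} (h : UnitAt 𝒩 c t) (h' : UnitAt 𝒩 c' t')
    (e : c t = c' t') : ∃ σ : ℝ, (σ = 1 ∨ σ = -1) ∧
      ∀ᶠ s in 𝓝 t, c s = c' (t' + σ * (s - t)) := by
  obtain ⟨q, hq, hct⟩ := h𝒩.cover (c t)
  obtain ⟨σ, hσ, hev⟩ := h𝒩.unitAt_of_mem h hq hct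
  obtain ⟨σ', hσ', hev'⟩ := h𝒩.unitAt_of_mem h' hq (e ▸ hct)
  refine ⟨σ' * σ, sign_mul hσ' hσ, ?_⟩
  filter_upwards [hev, (tendsto_affine (σ' * σ) t' (a := t)).eventually hev'] with s h1 h2
  refine h𝒩.injOn q hq h1.1 h2.1 ?_
  rw [h1.2, h2.2, e]
  linear_combination -σ * (s - t) * mul_self_sign hσ'

lemma unitAt_invFunOn [Nonempty Y] {q : Set Y × (Y → ℝ)} (hq : q ∈ 𝒩) {r : ℝ}
    (hr : r ∈ q.2 '' q.1) : UnitAt 𝒩 (Function.invFunOn q.2 q.1) r := by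
  have key : ∀ x ∈ q.2 '' q.1, Function.invFunOn q.2 q.1 x ∈ q.1 ∧
      q.2 (Function.invFunOn q.2 q.1 x) = x :=
    fun x hx => ⟨Function.invFunOn_mem hx, Function.invFunOn_eq hx⟩
  refine ⟨q, hq, (key r hr).1, 1, Or.inl rfl, ?_⟩
  filter_upwards [(h𝒩.isOpen_image q hq _ subset_rfl (h𝒩.isOpen q hq)).mem_nhds hr] with s hs
  refine ⟨(key s hs).1, ?_⟩
  rw [(key s hs).2, (key r hr).2]; ring

variable [T2Space Y]

/-- Unit speed curves are determined by their germ at a point. -/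
lemma eqOn_of_germ {J : Set ℝ} (hJ : IsPreconnected J) {c c' : ℝ → Y}
    (h : ∀ t ∈ J, UnitAt 𝒩 c t) (h' : ∀ t ∈ J, UnitAt 𝒩 c' t) {t₀ : ℝ} (ht₀ : t₀ ∈ J)
    (e : c =ᶠ[𝓝 t₀] c') : EqOn c c' J := by
  set E : Set ℝ := {t | c =ᶠ[𝓝 t] c'} with hE
  have hEo : IsOpen E := isOpen_iff_mem_nhds.2 fun t ht => eventually_eventually_nhds.2 ht
  have hsub : J ⊆ E := by
    refine hJ.subset_of_closure_inter_subset hEo ⟨t₀, ht₀, e⟩ ?_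
    rintro t ⟨htc, htJ⟩
    have hcl : ∃ᶠ s in 𝓝 t, s ∈ E := mem_closure_iff_frequently.1 htc
    have hct : c t = c' t := by
      have := mem_closure_iff_frequently.1 htc
      by_contra hne
      obtain ⟨U, V, hU, hV, hcU, hcV, hUV⟩ := t2_separation hne
      have h1 := (h𝒩.continuousAt (h t htJ)).eventually (hU.mem_nhds hcU)
      have h2 := (h𝒩.continuousAt (h' t htJ)).eventually (hV.mem_nhds hcV)
      obtain ⟨s, hs1, hs2, hs3⟩ := (hcl.and_eventually (h1.and h2)).exists
      have hs4 : c s = c' s := hs1.self_of_nhds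
      exact disjoint_left.1 hUV hs2 (hs4 ▸ hs3)
    obtain ⟨σ, hσ, hev⟩ := h𝒩.eventually_eq_of_eq (h t htJ) (h' t htJ) hct
    rcases hσ with rfl | rfl
    · refine hev.mono fun s hs => ?_
      rw [hs]; congr 1; ring
    -- Opposite directions: `c s = c' (2 * t - s)` near `t`. At a nearby `s` where the two curves
    -- agree, local injectivity of `c'` forces `s = t`.
    · by_cases htE : t ∈ E
      · exact htE
      obtain ⟨O, hO, hinj⟩ := (h' t htJ).exists_injOn
      have h3 := (tendsto_affine (-1) t (a := t)).eventually hO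
      obtain ⟨s, hs1, hs2, hs3, hs4⟩ := (hcl.and_eventually (hev.and (h3.and hO))).exists
      have hs5 : c s = c' s := hs1.self_of_nhds
      have hs6 := hinj hs3 hs4 (hs2.symm.trans hs5)
      have hst : s = t := by linarith
      exact absurd (hst ▸ hs1) htE
  exact fun t ht => (hsub ht).self_of_nhds

/-- A unit speed curve that is not injective covers a compact leaf. -/
lemma injOn_of_not_isCompact {J : Set ℝ} (hJc : J.OrdConnected) {c : ℝ → Y}
    (h : ∀ t ∈ J, UnitAt 𝒩 c t)
    (hnc : ∀ t ∈ J, ¬ IsCompact (connectedComponent (c t))) : InjOn c J := by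
  have key : ∀ t ∈ J, ∀ t' ∈ J, t < t' → c t ≠ c t' := by
    intro t ht t' ht' hlt e
    have hIcc : Icc t t' ⊆ J := hJc.out ht ht'
    obtain ⟨σ, hσ, hev⟩ := h𝒩.eventually_eq_of_eq (h t ht) (h t' ht') e
    rcases hσ with rfl | rfl
    -- Same direction: the curve closes up. The arc over `[t, t']` is compact, and it is open, even
    -- at its endpoint, because the piece just before `t` is repeated just before `t'`. It thus
    -- contains the whole leaf, which would be compact.
    · have hK : IsCompact (c '' Icc t t') := isCompact_Icc.image_of_continuousOn fun s hs =>
        (h𝒩.continuousAt (h s (hIcc hs))).continuousWithinAt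
      have hopen : IsOpen (c '' Icc t t') := by
        have hend : c '' Icc t t' ∈ 𝓝 (c t) := by
          rw [← h𝒩.map_nhds (h t ht), Filter.mem_map]
          filter_upwards [hev, Ioo_mem_nhds (show t - (t' - t) < t by linarith) hlt] with s hs hs'
          rcases le_total t s with hts | hts
          · exact ⟨s, ⟨hts, hs'.2.le⟩, rfl⟩
          · exact ⟨_, ⟨by linarith [hs'.1], by linarith⟩, hs.symm⟩
        rw [isOpen_iff_mem_nhds]
        rintro _ ⟨s, hs, rfl⟩
        rcases eq_or_lt_of_le hs.1 with rfl | h1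
        · exact hend
        rcases eq_or_lt_of_le hs.2 with rfl | h2
        · rw [← e]; exact hend
        rw [← h𝒩.map_nhds (h s (hIcc hs))]
        exact image_mem_map (Icc_mem_nhds h1 h2)
      have hsub := IsClopen.connectedComponent_subset ⟨hK.isClosed, hopen⟩
        (mem_image_of_mem c (left_mem_Icc.2 hlt.le))
      exact hnc t ht (hK.of_isClosed_subset isClosed_connectedComponent hsub)
    -- Opposite direction: `c s = c (t + t' - s)` propagates from `t` along the whole interval, so
    -- the curve folds at the midpoint, against local injectivity.
    · set J' : Set ℝ := Icc t t' with hJ'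
      have h1 : ∀ s ∈ J', UnitAt 𝒩 c s := fun s hs => h s (hIcc hs)
      have h2 : ∀ s ∈ J', UnitAt 𝒩 (fun x => c (-1 * x + (t + t'))) s := fun s hs =>
        UnitAt.comp_affine (Or.inr rfl) (h _ (hIcc ⟨by linarith [hs.2], by linarith [hs.1]⟩))
      have h3 := h𝒩.eqOn_of_germ isPreconnected_Icc h1 h2 (left_mem_Icc.2 hlt.le)
        (hev.mono fun s hs => by rw [hs]; simp only; congr 1; ring)
      set m := (t + t') / 2 with hm
      have hmJ : m ∈ J' := ⟨by rw [hm]; linarith, by rw [hm]; linarith⟩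
      obtain ⟨O, hO, hinj⟩ := (h1 m hmJ).exists_injOn
      have h4 := (tendsto_affine (-1) m (a := m)).eventually hO
      have h5 : Icc t t' ∈ 𝓝 m := Icc_mem_nhds (by rw [hm]; linarith) (by rw [hm]; linarith)
      obtain ⟨ε, hε, hball⟩ := Metric.mem_nhds_iff.1 (inter_mem (inter_mem hO h4) h5)
      have hs : m + ε / 2 ∈ Metric.ball m ε := by
        rw [Metric.mem_ball, Real.dist_eq, show m + ε / 2 - m = ε / 2 by ring,
          abs_of_pos (by positivity)]; linarith
      obtain ⟨⟨hs1, hs2⟩, hs3⟩ := hball hs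
      have hs4 := h3 hs3
      simp only at hs4
      rw [show -1 * (m + ε / 2) + (t + t') = m + -1 * (m + ε / 2 - m) by rw [hm]; ring] at hs4
      have := hinj hs1 hs2 hs4
      linarith
  intro t ht t' ht' e
  rcases lt_trichotomy t t' with hlt | rfl | hlt
  · exact absurd e (key t ht t' ht' hlt)
  · rfl
  · exact absurd e.symm (key t' ht' t ht hlt)

end IsLengthAtlas

/-- A unit speed parametrization of a leaf by an open interval. -/
structure IsRawParam (𝒩 : Set (Set Y × (Y → ℝ))) (J : Set ℝ) (c : ℝ → Y) : Prop where
  isOpen : IsOpen J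
  ordConnected : J.OrdConnected
  nonempty : J.Nonempty
  unitAt : ∀ t ∈ J, UnitAt 𝒩 c t
  injOn : InjOn c J
  image_eq : ∀ t ∈ J, c '' J = connectedComponent (c t)

/-- A noncompact leaf is parametrized by an open interval. -/
theorem IsLengthAtlas.exists_isRawParam [T2Space Y] (h𝒩 : IsLengthAtlas 𝒩) (y : Y)
    (hnc : ¬ IsCompact (connectedComponent y)) :
    ∃ J c, IsRawParam 𝒩 J c ∧ c '' J = connectedComponent y := by
  have : Nonempty Y := ⟨y⟩
  obtain ⟨q₀, hq₀, hy₀⟩ := h𝒩.cover y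
  set I₀ := q₀.2 '' q₀.1
  set p₀ := Function.invFunOn q₀.2 q₀.1 with hp₀
  set a₀ := q₀.2 y with ha₀
  have ordI : ∀ q ∈ 𝒩, (q.2 '' q.1).OrdConnected := fun q hq =>
    ((h𝒩.isPreconnected q hq).image _ (h𝒩.continuousOn q hq)).ordConnected
  have opI : ∀ q ∈ 𝒩, IsOpen (q.2 '' q.1) := fun q hq =>
    h𝒩.isOpen_image q hq _ subset_rfl (h𝒩.isOpen q hq)
  -- All unit speed extensions of one germ at `a₀`. Any two agree where both are defined, so they
  -- glue to a maximal one; no appeal to Zorn's lemma is needed.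
  set 𝒞 : Set (Set ℝ × (ℝ → Y)) := {p | IsOpen p.1 ∧ p.1.OrdConnected ∧ a₀ ∈ p.1 ∧
    (∀ t ∈ p.1, UnitAt 𝒩 p.2 t) ∧ p.2 =ᶠ[𝓝 a₀] p₀} with h𝒞
  have agree : ∀ p ∈ 𝒞, ∀ p' ∈ 𝒞, ∀ t ∈ p.1, t ∈ p'.1 → p.2 t = p'.2 t := by
    rintro p ⟨-, hc1, ha1, hu1, hg1⟩ p' ⟨-, hc2, ha2, hu2, hg2⟩ t ht ht'
    exact h𝒩.eqOn_of_germ (hc1.inter hc2).isPreconnected (fun t ht => hu1 t ht.1)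
      (fun t ht => hu2 t ht.2) ⟨ha1, ha2⟩ (hg1.trans hg2.symm) ⟨ht, ht'⟩
  have hbase : (I₀, p₀) ∈ 𝒞 := ⟨opI _ hq₀, ordI _ hq₀, ⟨y, hy₀, rfl⟩,
    fun t ht => h𝒩.unitAt_invFunOn hq₀ ht, EventuallyEq.rfl⟩
  set J : Set ℝ := ⋃ p ∈ 𝒞, p.1 with hJdef
  have hJo : IsOpen J := isOpen_biUnion fun p hp => hp.1
  have hJc : J.OrdConnected := by
    refine IsPreconnected.ordConnected ?_
    rw [hJdef, ← sUnion_image]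
    refine isPreconnected_sUnion a₀ _ ?_ ?_
    · rintro _ ⟨p, hp, rfl⟩; exact hp.2.2.1
    · rintro _ ⟨p, hp, rfl⟩; exact hp.2.1.isPreconnected
  choose! P hP1 hP2 using fun t (ht : t ∈ J) => mem_iUnion₂.1 ht
  set c : ℝ → Y := fun t => (P t).2 t with hc
  have hcp : ∀ p ∈ 𝒞, ∀ t ∈ p.1, c t = p.2 t := fun p hp t ht =>
    agree _ (hP1 t (mem_biUnion hp ht)) p hp t (hP2 t (mem_biUnion hp ht)) ht
  have hcgerm : ∀ p ∈ 𝒞, ∀ t ∈ p.1, p.2 =ᶠ[𝓝 t] c := fun p hp t ht => by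
    filter_upwards [hp.1.mem_nhds ht] with s hs using (hcp p hp s hs).symm
  have hunit : ∀ t ∈ J, UnitAt 𝒩 c t := fun t ht =>
    ((hP1 t ht).2.2.2.1 t (hP2 t ht)).congr (hcgerm _ (hP1 t ht) t (hP2 t ht))
  have ha₀J : a₀ ∈ J := mem_biUnion hbase hbase.2.2.1
  have hmax : ∀ p ∈ 𝒞, p.1 ⊆ J := fun p hp t ht => mem_biUnion hp ht
  have hcy : c a₀ = y := by
    rw [hcp _ hbase a₀ hbase.2.2.1]
    exact h𝒩.injOn _ hq₀ (Function.invFunOn_mem ⟨y, hy₀, rfl⟩) hy₀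
      (Function.invFunOn_eq ⟨y, hy₀, rfl⟩)
  have hcont : ContinuousOn c J := fun t ht => (h𝒩.continuousAt (hunit t ht)).continuousWithinAt
  have himo : IsOpen (c '' J) := by
    rw [isOpen_iff_mem_nhds]
    rintro _ ⟨t, ht, rfl⟩
    rw [← h𝒩.map_nhds (hunit t ht)]
    exact image_mem_map (hJo.mem_nhds ht)
  -- A chart around a limit point `z` meets the image at some `c t`. Its inverse, reparametrized to
  -- have the germ of `c` at `t`, extends `c`; by maximality the extension was already included, so
  -- `z` lies in the image. The image is then clopen and fills the leaf.
  have himc : IsClosed (c '' J) := by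
    refine isClosed_of_closure_subset fun z hz => ?_
    obtain ⟨q, hq, hzq⟩ := h𝒩.cover z
    obtain ⟨_, hct, t, ht, rfl⟩ := mem_closure_iff.1 hz q.1 (h𝒩.isOpen q hq) hzq
    set I := q.2 '' q.1 with hI
    set p := Function.invFunOn q.2 q.1 with hp
    have hpq : ∀ w ∈ q.1, p (q.2 w) = w := fun w hw =>
      h𝒩.injOn _ hq (Function.invFunOn_mem ⟨w, hw, rfl⟩) hw (Function.invFunOn_eq ⟨w, hw, rfl⟩)
    set s := q.2 (c t) with hs
    have hsI : s ∈ I := ⟨_, hct, rfl⟩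
    obtain ⟨σ, hσ, hev⟩ := h𝒩.eventually_eq_of_eq (hunit t ht) (h𝒩.unitAt_invFunOn hq hsI)
      (hpq _ hct).symm
    set J' : Set ℝ := (fun x => s + σ * (x - t)) ⁻¹' I with hJ'
    have hσ0 := mul_self_sign hσ
    have hJ'o : IsOpen J' := (opI q hq).preimage (by fun_prop)
    have hJ'c : J'.OrdConnected := by
      refine ⟨fun x hx x' hx' w hw => ?_⟩
      have hI := ordI q hq
      rcases hσ with rfl | rfl
      · exact hI.out hx hx' ⟨by linarith [hw.1], by linarith [hw.2]⟩
      · exact hI.out hx' hx ⟨by linarith [hw.2], by linarith [hw.1]⟩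
    have htJ' : t ∈ J' := by simpa [hJ'] using hsI
    set d : ℝ → Y := fun x => p (σ * x + (s - σ * t)) with hd
    have hdu : ∀ x ∈ J', UnitAt 𝒩 d x := fun x hx => UnitAt.comp_affine hσ (by
      refine h𝒩.unitAt_invFunOn hq ?_
      rw [show σ * x + (s - σ * t) = s + σ * (x - t) by ring]; exact hx)
    have hcd : c =ᶠ[𝓝 t] d := hev.mono fun x hx => by
      rw [hx, hd]; simp only; congr 1; ring
    have hEq : EqOn c d (J ∩ J') := h𝒩.eqOn_of_germ (hJc.inter hJ'c).isPreconnected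
      (fun x hx => hunit x hx.1) (fun x hx => hdu x hx.2) ⟨ht, htJ'⟩ hcd
    classical
    set c' : ℝ → Y := fun x => if x ∈ J then c x else d x with hc'
    have hc'1 : EqOn c' c J := fun x hx => if_pos hx
    have hc'2 : EqOn c' d J' := fun x hx => by
      by_cases hxJ : x ∈ J
      · rw [hc'1 hxJ]; exact hEq ⟨hxJ, hx⟩
      · exact if_neg hxJ
    have hmem : (J ∪ J', c') ∈ 𝒞 := by
      refine ⟨hJo.union hJ'o, (hJc.isPreconnected.union t ht htJ'
        hJ'c.isPreconnected).ordConnected, Or.inl ha₀J, ?_, ?_⟩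
      · rintro x (hx | hx)
        · exact (hunit x hx).congr (by
            filter_upwards [hJo.mem_nhds hx] with w hw using (hc'1 hw).symm)
        · exact (hdu x hx).congr (by
            filter_upwards [hJ'o.mem_nhds hx] with w hw using (hc'2 hw).symm)
      · have h1 := hcgerm _ hbase a₀ hbase.2.2.1
        filter_upwards [hJo.mem_nhds ha₀J, h1] with w hw hw'
        rw [hc'1 hw, ← hw']
    have hJJ' : J' ⊆ J := fun x hx => hmax _ hmem (Or.inr hx)
    set x := t + σ * (q.2 z - s) with hx
    have hxJ' : x ∈ J' := by
      change s + σ * (x - t) ∈ I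
      rw [show s + σ * (x - t) = q.2 z by rw [hx]; linear_combination (q.2 z - s) * hσ0]
      exact ⟨z, hzq, rfl⟩
    refine ⟨x, hJJ' hxJ', ?_⟩
    rw [hEq ⟨hJJ' hxJ', hxJ'⟩, hd]
    simp only
    rw [show σ * x + (s - σ * t) = q.2 z by rw [hx]; linear_combination (q.2 z - s) * hσ0,
      hpq z hzq]
  have him : c '' J = connectedComponent y := by
    refine Subset.antisymm ?_ ?_
    · exact (hJc.isPreconnected.image c hcont).subset_connectedComponent ⟨a₀, ha₀J, hcy⟩
    · exact IsClopen.connectedComponent_subset ⟨himc, himo⟩ ⟨a₀, ha₀J, hcy⟩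
  have hcomp : ∀ t ∈ J, connectedComponent (c t) = connectedComponent y := fun t ht =>
    (connectedComponent_eq (him ▸ mem_image_of_mem c ht)).symm
  refine ⟨J, c, ⟨hJo, hJc, ⟨a₀, ha₀J⟩, hunit, ?_, fun t ht => by rw [hcomp t ht, him]⟩, him⟩
  exact h𝒩.injOn_of_not_isCompact hJc hunit fun t ht => by rwa [hcomp t ht]

end Line

/-! ### Parametrizations of leaves by the whole line -/

section LeafParam

variable {Y : Type*} [TopologicalSpace Y] {𝒩 : Set (Set Y × (Y → ℝ))}

/-- A parametrization of a leaf by the whole line, obtained from a unit speed parametrization by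
stretching its domain. -/
def IsLeafParam (𝒩 : Set (Set Y × (Y → ℝ))) (C : ℝ → Y) : Prop :=
  ∃ J c, IsRawParam 𝒩 J c ∧ ∀ s ∈ J, C (stretch J s) = c s

lemma IsRawParam.comp_affine {J : Set ℝ} {c : ℝ → Y} (h : IsRawParam 𝒩 J c) {σ τ : ℝ}
    (hσ : σ = 1 ∨ σ = -1) :
    IsRawParam 𝒩 ((fun x => σ * x + τ) ⁻¹' J) (fun x => c (σ * x + τ)) := by
  have hσ0 := mul_self_sign hσ
  have him : (fun x => c (σ * x + τ)) '' ((fun x => σ * x + τ) ⁻¹' J) = c '' J := by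
    have hs : Function.Surjective fun x : ℝ => σ * x + τ := fun y =>
      ⟨σ * (y - τ), by simp only; linear_combination (y - τ) * hσ0⟩
    rw [show (fun x => c (σ * x + τ)) = c ∘ fun x => σ * x + τ from rfl, image_comp,
      image_preimage_eq _ hs]
  refine ⟨h.isOpen.preimage (by fun_prop), ?_, ?_, fun t ht => (h.unitAt _ ht).comp_affine hσ,
    fun x hx y hy hxy => ?_, fun t ht => ?_⟩
  · refine ⟨fun x hx x' hx' w hw => ?_⟩
    rcases hσ with rfl | rfl
    · exact h.ordConnected.out hx hx' ⟨by linarith [hw.1], by linarith [hw.2]⟩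
    · exact h.ordConnected.out hx' hx ⟨by linarith [hw.2], by linarith [hw.1]⟩
  · obtain ⟨t, ht⟩ := h.nonempty
    refine ⟨σ * (t - τ), ?_⟩
    rw [mem_preimage, show σ * (σ * (t - τ)) + τ = t by linear_combination (t - τ) * hσ0]
    exact ht
  · have : σ * x + τ = σ * y + τ := h.injOn hx hy hxy
    have h2 : σ * (σ * x + τ) = σ * (σ * y + τ) := by rw [this]
    linear_combination h2 + (y - x) * hσ0
  · rw [him]; exact h.image_eq _ ht

lemma image_affine_preimage {J : Set ℝ} {σ τ : ℝ} (hσ : σ = 1 ∨ σ = -1) :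
    (fun x => σ * x + τ) '' ((fun x => σ * x + τ) ⁻¹' J) = J := by
  refine image_preimage_eq _ fun y => ⟨σ * (y - τ), ?_⟩
  linear_combination (y - τ) * mul_self_sign hσ

/-- The coordinates of a dense part of a leaf, after stretching. -/
noncomputable def stretchSeq {ι : Type*} (α : ι → ℝ) (k : ι) : ℝ := stretch (range α) (α k)

namespace IsLeafParam
variable {C C' : ℝ → Y}

lemma comp_affine (h : IsLeafParam 𝒩 C) {σ τ : ℝ} (hσ : σ = 1 ∨ σ = -1) :
    IsLeafParam 𝒩 (fun t => C (σ * t + τ)) := by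
  obtain ⟨J, c, hc, hCc⟩ := h
  refine ⟨_, _, hc.comp_affine (τ := τ) hσ, fun s hs => ?_⟩
  have hne : ((fun x => σ * x + τ) ⁻¹' J).Nonempty := ⟨s, hs⟩
  have := stretch_affine hne hσ s τ
  rw [image_affine_preimage hσ] at this
  change C (σ * _ + τ) = _
  rw [← this]
  exact hCc _ hs

lemma injective (h : IsLeafParam 𝒩 C) : Function.Injective C := by
  obtain ⟨J, c, hc, hCc⟩ := h
  intro x y hxy
  obtain ⟨s, hs, rfl⟩ := surjOn_stretch hc.isOpen hc.ordConnected hc.nonempty (mem_univ x)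
  obtain ⟨t, ht, rfl⟩ := surjOn_stretch hc.isOpen hc.ordConnected hc.nonempty (mem_univ y)
  rw [hCc s hs, hCc t ht] at hxy
  rw [hc.injOn hs ht hxy]

lemma range_eq_image {J : Set ℝ} {c : ℝ → Y} (hc : IsRawParam 𝒩 J c)
    (hCc : ∀ s ∈ J, C (stretch J s) = c s) : range C = c '' J := by
  ext y
  constructor
  · rintro ⟨x, rfl⟩
    obtain ⟨s, hs, rfl⟩ := surjOn_stretch hc.isOpen hc.ordConnected hc.nonempty (mem_univ x)
    exact ⟨s, hs, (hCc s hs).symm⟩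
  · rintro ⟨s, hs, rfl⟩
    exact ⟨_, hCc s hs⟩

lemma isOpenEmbedding (h𝒩 : IsLengthAtlas 𝒩) (h : IsLeafParam 𝒩 C) :
    Topology.IsOpenEmbedding C := by
  have hinj := h.injective
  obtain ⟨J, c, hc, hCc⟩ := h
  have hmap : ∀ s ∈ J, map (stretch J) (𝓝 s) = 𝓝 (stretch J s) := fun s hs => by
    obtain ⟨d, hd, hder⟩ := hasDerivAt_stretch hc.isOpen hs
    have h1 := (contDiffAt_stretch hc.isOpen hs (n := 1)).hasStrictDerivAt (by simp)
    rw [hder.deriv] at h1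
    exact h1.map_nhds_eq hd.ne'
  have hmapC : ∀ s ∈ J, map C (𝓝 (stretch J s)) = 𝓝 (C (stretch J s)) := fun s hs => by
    rw [← hmap s hs, Filter.map_map, hCc s hs, ← h𝒩.map_nhds (hc.unitAt s hs)]
    refine Filter.map_congr ?_
    filter_upwards [hc.isOpen.mem_nhds hs] with x hx using hCc x hx
  have hmapC' : ∀ t, map C (𝓝 t) = 𝓝 (C t) := fun t => by
    obtain ⟨s, hs, rfl⟩ := surjOn_stretch hc.isOpen hc.ordConnected hc.nonempty (mem_univ t)
    exact hmapC s hs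
  refine Topology.IsOpenEmbedding.of_continuous_injective_isOpenMap
    (continuous_iff_continuousAt.2 fun t => (hmapC' t).le) hinj ?_
  exact isOpenMap_iff_nhds_le.2 fun t => (hmapC' t).ge

/-- Parametrizations of a leaf are unique up to an isometry of the line. -/
theorem exists_affine (h𝒩 : IsLengthAtlas 𝒩) (h : IsLeafParam 𝒩 C) (h' : IsLeafParam 𝒩 C')
    (hr : range C = range C') :
    ∃ σ τ : ℝ, (σ = 1 ∨ σ = -1) ∧ ∀ t, C' t = C (σ * t + τ) := by
  obtain ⟨J, c, hc, hCc⟩ := h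
  obtain ⟨J', c', hc', hCc'⟩ := h'
  rw [range_eq_image hc hCc, range_eq_image hc' hCc'] at hr
  have hex : ∀ x ∈ J', ∃ s ∈ J, c s = c' x := fun x hx => by
    rw [← mem_image, hr]; exact ⟨x, hx, rfl⟩
  choose! s hsJ hs using hex
  obtain ⟨σ, τ, hσ, haff⟩ := exists_affine_of_locally_isometric hc'.isOpen
    hc'.ordConnected.isPreconnected (s := fun k : J' => (k : ℝ)) (α := fun k : J' => s k)
    (fun k => k.2) (by simpa using subset_closure) (by
      intro t ht
      obtain ⟨σ, hσ, hev⟩ := h𝒩.eventually_eq_of_eq (hc'.unitAt t ht) (hc.unitAt _ (hsJ t ht))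
        (hs t ht).symm
      have h1 := (tendsto_affine σ (s t) (a := t)).eventually (hc.isOpen.mem_nhds (hsJ t ht))
      obtain ⟨δ, hδ, hball⟩ := Metric.eventually_nhds_iff.1 (hev.and h1)
      refine ⟨δ, hδ, fun k l hk hl => ?_⟩
      have key : ∀ k : J', |(k : ℝ) - t| < δ → s k = s t + σ * (k - t) := fun k hk => by
        obtain ⟨h2, h3⟩ := hball (show dist (k : ℝ) t < δ from hk)
        exact hc.injOn (hsJ k k.2) h3 ((hs k k.2).trans h2)
      rw [key k hk, key l hl, show s t + σ * (k - t) - (s t + σ * (l - t)) = σ * (k - l) by ring,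
        abs_mul, abs_sign hσ, one_mul])
  refine ⟨σ, τ, hσ, fun t => ?_⟩
  -- The isometry carries the whole domain `J'` onto `J`, which is what `stretch_affine` requires to
  -- produce the same isometry between the stretched parameters.
  have hJ : (fun x => σ * x + τ) '' J' = J := by
    refine Subset.antisymm ?_ fun y hy => ?_
    · rintro _ ⟨x, hx, rfl⟩
      simp only
      rw [← haff ⟨x, hx⟩]
      exact hsJ x hx
    · obtain ⟨x, hx, hxy⟩ : c y ∈ c' '' J' := hr ▸ mem_image_of_mem c hy
      refine ⟨x, hx, ?_⟩
      simp only
      rw [← haff ⟨x, hx⟩]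
      exact hc.injOn (hsJ x hx) hy ((hs x hx).trans hxy)
  obtain ⟨x, hx, rfl⟩ := surjOn_stretch hc'.isOpen hc'.ordConnected hc'.nonempty (mem_univ t)
  rw [hCc' x hx, ← stretch_affine hc'.nonempty hσ, hJ, ← hs x hx, ← haff ⟨x, hx⟩]
  exact (hCc _ (hsJ x hx)).symm

end IsLeafParam

theorem IsLengthAtlas.exists_isLeafParam [T2Space Y] (h𝒩 : IsLengthAtlas 𝒩) (y : Y)
    (hnc : ¬ IsCompact (connectedComponent y)) :
    ∃ C, IsLeafParam 𝒩 C ∧ range C = connectedComponent y := by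
  obtain ⟨J, c, hc, him⟩ := h𝒩.exists_isRawParam y hnc
  have hinj := (strictMonoOn_stretch hc.isOpen hc.ordConnected).injOn
  have hex : ∀ t, ∃ s ∈ J, stretch J s = t := fun t =>
    surjOn_stretch hc.isOpen hc.ordConnected hc.nonempty (mem_univ t)
  choose g hg hgs using hex
  have hC : ∀ s ∈ J, (fun t => c (g t)) (stretch J s) = c s := fun s hs => by
    simp only
    rw [hinj (hg _) hs (hgs _)]
  exact ⟨fun t => c (g t), ⟨J, c, hc, hC⟩, by
    rw [IsLeafParam.range_eq_image (C := fun t => c (g t)) hc hC, him]⟩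

/-- A sequence of reals which is locally isometric to a dense sequence of a leaf is, after
stretching, its sequence of coordinates. -/
theorem IsLengthAtlas.exists_isLeafParam_of_seq [T2Space Y] (h𝒩 : IsLengthAtlas 𝒩) {ι : Type*}
    {w : ι → Y} {α : ι → ℝ} {y : Y} (hnc : ¬ IsCompact (connectedComponent y))
    (hw : ∀ k, w k ∈ connectedComponent y) (hd : connectedComponent y ⊆ closure (range w))
    (hα : ∀ z ∈ connectedComponent y, ∃ O ∈ 𝓝 z, ∃ q ∈ 𝒩, z ∈ q.1 ∧ ∀ k l, w k ∈ O → w l ∈ O →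
      |α k - α l| = |q.2 (w k) - q.2 (w l)|) :
    ∃ C, IsLeafParam 𝒩 C ∧ range C = connectedComponent y ∧ ∀ k, C (stretchSeq α k) = w k := by
  obtain ⟨J, c, hc, him⟩ := h𝒩.exists_isRawParam y hnc
  have hex : ∀ k, ∃ s ∈ J, c s = w k := fun k => by rw [← mem_image, him]; exact hw k
  choose s hsJ hs using hex
  have hcJ : ∀ t ∈ J, c t ∈ connectedComponent y := fun t ht => him ▸ mem_image_of_mem c ht
  have hds : J ⊆ closure (range s) := by
    intro t ht
    rw [mem_closure_iff]
    intro O hO htO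
    have h1 : c '' (O ∩ J) ∈ 𝓝 (c t) := by
      rw [← h𝒩.map_nhds (hc.unitAt t ht)]
      exact image_mem_map (inter_mem (hO.mem_nhds htO) (hc.isOpen.mem_nhds ht))
    obtain ⟨_, ⟨x, hx, hxk⟩, k, rfl⟩ := mem_closure_iff_nhds.1 (hd (hcJ t ht)) _ h1
    have : s k = x := hc.injOn (hsJ k) hx.2 ((hs k).trans hxk.symm)
    exact ⟨s k, this ▸ hx.1, k, rfl⟩
  obtain ⟨σ, τ, hσ, haff⟩ := exists_affine_of_locally_isometric hc.isOpen
    hc.ordConnected.isPreconnected hsJ hds (α := α) (by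
      intro t ht
      obtain ⟨O, hO, q, hq, hzq, hiso⟩ := hα (c t) (hcJ t ht)
      obtain ⟨σ, hσ, hev⟩ := h𝒩.unitAt_of_mem (hc.unitAt t ht) hq hzq
      have h1 := (h𝒩.continuousAt (hc.unitAt t ht)).eventually hO
      obtain ⟨δ, hδ, hball⟩ := Metric.eventually_nhds_iff.1 (hev.and h1)
      refine ⟨δ, hδ, fun k l hk hl => ?_⟩
      obtain ⟨h2, h3⟩ := hball (show dist (s k) t < δ from hk)
      obtain ⟨h4, h5⟩ := hball (show dist (s l) t < δ from hl)
      rw [hiso k l (hs k ▸ h3) (hs l ▸ h5), ← hs k, ← hs l, h2.2, h4.2, add_sub_add_left_eq_sub,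
        ← mul_sub, abs_mul, abs_sign hσ, one_mul]
      congr 1; ring)
  have hσ0 := mul_self_sign hσ
  -- Since `σ * σ = 1`, the map `x ↦ σ * x - σ * τ` is inverse to `s ↦ σ * s + τ`; the
  -- reparametrized curve takes the value `w k` at `α k`.
  have hraw := hc.comp_affine (σ := σ) (τ := -σ * τ) hσ
  set J' := (fun x => σ * x + -σ * τ) ⁻¹' J with hJ'
  have hinv : ∀ x, σ * (σ * x + τ) + -σ * τ = x := fun x => by linear_combination x * hσ0
  have hαJ : range α ⊆ J' := by
    rintro _ ⟨k, rfl⟩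
    rw [hJ', mem_preimage, haff k, hinv]
    exact hsJ k
  have hαd : J' ⊆ closure (range α) := by
    intro x hx
    have h1 := hds hx
    have h2 : Continuous fun x : ℝ => σ * x + τ := by fun_prop
    have h3 := image_closure_subset_closure_image h2 (mem_image_of_mem _ h1)
    rw [← range_comp] at h3
    have h4 : (fun x => σ * x + τ) ∘ s = α := funext fun k => (haff k).symm
    rw [h4] at h3
    have h5 : σ * (σ * x + -σ * τ) + τ = x := by linear_combination (x - τ) * hσ0
    simpa only [h5] using h3
  have hne : (range α).Nonempty := by
    obtain ⟨x, hx⟩ := hraw.nonempty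
    exact closure_nonempty_iff.1 ⟨x, hαd hx⟩
  have hstr := stretch_eq_of_dense hαJ hαd hne
  have hinj := (strictMonoOn_stretch hraw.isOpen hraw.ordConnected).injOn
  have hex : ∀ t, ∃ s ∈ J', stretch J' s = t := fun t =>
    surjOn_stretch hraw.isOpen hraw.ordConnected hraw.nonempty (mem_univ t)
  choose g hg hgs using hex
  have hC : ∀ s ∈ J', (fun t => c (σ * g t + -σ * τ)) (stretch J' s) = c (σ * s + -σ * τ) :=
    fun s hs => by
      simp only
      rw [hinj (hg _) hs (hgs _)]
  refine ⟨fun t => c (σ * g t + -σ * τ), ⟨J', _, hraw, hC⟩, ?_, fun k => ?_⟩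
  · rw [IsLeafParam.range_eq_image (C := fun t => c (σ * g t + -σ * τ)) hraw hC, ← him]
    ext z
    constructor
    · rintro ⟨x, hx, rfl⟩; exact ⟨_, hx, rfl⟩
    · rintro ⟨x, hx, rfl⟩
      refine ⟨σ * x + τ, ?_, ?_⟩
      · rw [hJ', mem_preimage, hinv]; exact hx
      · simp only [hinv]
  · unfold stretchSeq
    rw [hstr]
    refine (hC _ (hαJ ⟨k, rfl⟩)).trans ?_
    rw [haff k, hinv, hs k]

/-- Coordinates of points of a leaf come from isometric coordinates by stretching. -/
theorem IsLeafParam.exists_seq (h𝒩 : IsLengthAtlas 𝒩) {ι : Type*} {C : ℝ → Y}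
    (h : IsLeafParam 𝒩 C) {w : ι → Y} {β : ι → ℝ} (hβ : ∀ k, C (β k) = w k)
    (hd : range C ⊆ closure (range w)) :
    ∃ α : ι → ℝ, stretchSeq α = β ∧ ∀ q ∈ 𝒩, ∀ k l, w k ∈ q.1 → w l ∈ q.1 →
      |α k - α l| = |q.2 (w k) - q.2 (w l)| := by
  have hCinj := h.injective
  obtain ⟨J, c, hc, hCc⟩ := h
  have hrange := IsLeafParam.range_eq_image hc hCc
  have hex : ∀ k, ∃ s ∈ J, stretch J s = β k := fun k =>
    surjOn_stretch hc.isOpen hc.ordConnected hc.nonempty (mem_univ _)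
  choose α hαJ hα using hex
  have hcα : ∀ k, c (α k) = w k := fun k => by rw [← hCc _ (hαJ k), hα, hβ]
  have hds : J ⊆ closure (range α) := by
    intro t ht
    rw [mem_closure_iff]
    intro O hO htO
    have h1 : c '' (O ∩ J) ∈ 𝓝 (c t) := by
      rw [← h𝒩.map_nhds (hc.unitAt t ht)]
      exact image_mem_map (inter_mem (hO.mem_nhds htO) (hc.isOpen.mem_nhds ht))
    obtain ⟨_, ⟨x, hx, hxk⟩, k, rfl⟩ := mem_closure_iff_nhds.1
      (hd (hrange ▸ mem_image_of_mem c ht)) _ h1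
    have : α k = x := hc.injOn (hαJ k) hx.2 ((hcα k).trans hxk.symm)
    exact ⟨α k, this ▸ hx.1, k, rfl⟩
  have hne : (range α).Nonempty := by
    obtain ⟨x, hx⟩ := hc.nonempty
    exact closure_nonempty_iff.1 ⟨x, hds hx⟩
  have hstr := stretch_eq_of_dense (by rintro _ ⟨k, rfl⟩; exact hαJ k) hds hne
  refine ⟨α, ?_, fun q hq k l hk hl => ?_⟩
  · funext k
    unfold stretchSeq
    rw [hstr, hα]
  have : Nonempty Y := ⟨w k⟩
  set I := q.2 '' q.1 with hI
  set p := Function.invFunOn q.2 q.1 with hp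
  have hpq : ∀ x ∈ q.1, p (q.2 x) = x := fun x hx =>
    h𝒩.injOn _ hq (Function.invFunOn_mem ⟨x, hx, rfl⟩) hx (Function.invFunOn_eq ⟨x, hx, rfl⟩)
  have hIo : IsOpen I := h𝒩.isOpen_image q hq _ subset_rfl (h𝒩.isOpen q hq)
  have hIc : IsPreconnected I := (h𝒩.isPreconnected q hq).image _ (h𝒩.continuousOn q hq)
  have hsub : q.1 ⊆ c '' J := by
    rw [hc.image_eq _ (hαJ k), hcα]
    exact (h𝒩.isPreconnected q hq).subset_connectedComponent hk
  have hex : ∀ x ∈ I, ∃ s ∈ J, c s = p x := by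
    rintro _ ⟨z, hz, rfl⟩
    rw [hpq z hz]
    exact hsub hz
  choose! s hsJ hs using hex
  -- Charts are compatible with `c` only locally. Since the image of the chart is an interval, the
  -- parameter of `c` is one affine function of the coordinate on the entire chart.
  obtain ⟨σ, τ, hσ, haff⟩ := exists_affine_of_locally_isometric hIo hIc
    (s := fun k : I => (k : ℝ)) (α := fun k : I => s k)
    (fun k => k.2) (by simpa using subset_closure) (by
      intro t ht
      obtain ⟨σ, hσ, hev⟩ := h𝒩.eventually_eq_of_eq (h𝒩.unitAt_invFunOn hq ht)
        (hc.unitAt _ (hsJ t ht)) (hs t ht).symm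
      have h1 := (tendsto_affine σ (s t) (a := t)).eventually (hc.isOpen.mem_nhds (hsJ t ht))
      obtain ⟨δ, hδ, hball⟩ := Metric.eventually_nhds_iff.1 (hev.and h1)
      refine ⟨δ, hδ, fun k l hk hl => ?_⟩
      have key : ∀ k : I, |(k : ℝ) - t| < δ → s k = s t + σ * (k - t) := fun k hk => by
        obtain ⟨h2, h3⟩ := hball (show dist (k : ℝ) t < δ from hk)
        exact hc.injOn (hsJ k k.2) h3 ((hs k k.2).trans h2)
      rw [key k hk, key l hl, show s t + σ * (k - t) - (s t + σ * (l - t)) = σ * (k - l) by ring,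
        abs_mul, abs_sign hσ, one_mul])
  have key : ∀ m, w m ∈ q.1 → α m = σ * q.2 (w m) + τ := fun m hm => by
    have hmI : q.2 (w m) ∈ I := ⟨_, hm, rfl⟩
    rw [← haff ⟨_, hmI⟩]
    exact hc.injOn (hαJ m) (hsJ _ hmI) (by rw [hs _ hmI, hpq _ hm, hcα])
  rw [key k hk, key l hl, add_sub_add_right_eq_sub, ← mul_sub, abs_mul, abs_sign hσ, one_mul]

end LeafParam

/-! ### Measurability of stretched coordinates -/

lemma measurable_stretchSeq :
    Measurable fun α : ℕ → ℝ => stretchSeq α := by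
  refine measurable_pi_lambda _ fun k => ?_
  unfold stretchSeq stretch
  have hb : MeasurableSet {α : ℕ → ℝ | BddBelow (range α)} := by
    have : {α : ℕ → ℝ | BddBelow (range α)} = ⋃ N : ℕ, ⋂ k, {α | -(N : ℝ) ≤ α k} := by
      ext α
      simp only [mem_ofPred_eq, mem_iUnion, mem_iInter]
      constructor
      · rintro ⟨b, hb⟩
        obtain ⟨N, hN⟩ := exists_nat_ge (-b)
        exact ⟨N, fun k => by linarith [hb ⟨k, rfl⟩]⟩
      · rintro ⟨N, hN⟩
        exact ⟨-N, by rintro _ ⟨k, rfl⟩; exact hN k⟩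
    rw [this]
    exact .iUnion fun N => .iInter fun k => measurableSet_le measurable_const (by fun_prop)
  have ha : MeasurableSet {α : ℕ → ℝ | BddAbove (range α)} := by
    have : {α : ℕ → ℝ | BddAbove (range α)} = ⋃ N : ℕ, ⋂ k, {α | α k ≤ (N : ℝ)} := by
      ext α
      simp only [mem_ofPred_eq, mem_iUnion, mem_iInter]
      constructor
      · rintro ⟨b, hb⟩
        obtain ⟨N, hN⟩ := exists_nat_ge b
        exact ⟨N, fun k => by linarith [hb ⟨k, rfl⟩]⟩
      · rintro ⟨N, hN⟩
        exact ⟨N, by rintro _ ⟨k, rfl⟩; exact hN k⟩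
    rw [this]
    exact .iUnion fun N => .iInter fun k => measurableSet_le (by fun_prop) measurable_const
  have hinf : Measurable fun α : ℕ → ℝ => sInf (range α) := by
    simp_rw [sInf_range]; exact Measurable.iInf fun k => by fun_prop
  have hsup : Measurable fun α : ℕ → ℝ => sSup (range α) := by
    simp_rw [sSup_range]; exact Measurable.iSup fun k => by fun_prop
  refine Measurable.sub (Measurable.add (by fun_prop) ?_) ?_
  · exact Measurable.ite hb (by fun_prop) measurable_const
  · exact Measurable.ite ha (by fun_prop) measurable_const

/-! ### Local structure of Borel foliations -/

attribute [instance] PrismChart.measurableSpaceV PrismChart.standardBorelSpaceV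
  PrismChart.topologicalSpaceV PrismChart.discreteTopologyV

instance standardBorelSpace_disc (n : ℕ) : StandardBorelSpace (Disc n) :=
  Metric.isClosed_closedBall.measurableSet.standardBorel

/-- The centre of the disc. -/
def Disc.center (n : ℕ) : Disc n := ⟨0, by simp⟩

instance (n : ℕ) : Nonempty (Disc n) := ⟨Disc.center n⟩

instance (n : ℕ) : CompactSpace (Disc n) :=
  isCompact_iff_compactSpace.1 (ProperSpace.isCompact_closedBall _ _)

instance (n : ℕ) : PreconnectedSpace (Disc n) :=
  Subtype.preconnectedSpace (convex_closedBall _ _).isPreconnected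

namespace PrismChart

variable {n : ℕ} {X : Type u} [TopologicalSpace X] [MeasurableSpace X] (a : PrismChart n X)

/-- The interior of the plaque labelled by `v`. -/
def plaque (v : a.V) : Set X :=
  a.toFun '' {p | ‖(p.1 : EuclideanSpace ℝ (Fin n))‖ < 1 ∧ p.2 = v}

lemma mem_core_iff {x : X} : x ∈ a.core ↔ ∃ v, x ∈ a.plaque v := by
  constructor
  · rintro ⟨⟨p, v⟩, hp, rfl⟩
    exact ⟨v, ⟨(p, v), ⟨hp, rfl⟩, rfl⟩⟩
  · rintro ⟨v, ⟨p, hp, rfl⟩⟩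
    exact ⟨p, hp.1, rfl⟩

lemma isOpen_plaque (v : a.V) : IsOpen (a.plaque v) := by
  have h1 : IsOpen {p : Disc n × a.V | ‖(p.1 : EuclideanSpace ℝ (Fin n))‖ < 1 ∧ p.2 = v} := by
    rw [ofPred_and]
    exact (isOpen_lt (by fun_prop) continuous_const).inter
      ((isOpen_discrete {v}).preimage continuous_snd)
  obtain ⟨O, hO, hOe⟩ := a.isClosedEmbedding.isInducing.isOpen_iff.1 h1
  have : a.plaque v = O ∩ a.core := by
    ext x
    constructor
    · rintro ⟨p, hp, rfl⟩
      refine ⟨?_, p, hp.1, rfl⟩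
      rw [← hOe] at hp
      exact hp
    · rintro ⟨hxO, p, hp, rfl⟩
      refine ⟨p, ?_, rfl⟩
      rw [← hOe]
      exact hxO
  rw [this]
  exact hO.inter a.isOpen_core

/-- A plaque, as an embedding of the open ball. -/
def ballMap (v : a.V) (e : Metric.ball (0 : EuclideanSpace ℝ (Fin n)) 1) : X :=
  a.toFun (⟨e, Metric.ball_subset_closedBall e.2⟩, v)

lemma isOpenEmbedding_ballMap (v : a.V) : Topology.IsOpenEmbedding (a.ballMap v) := by
  refine ⟨a.isClosedEmbedding.isEmbedding.comp ((isEmbedding_prodMkLeft v).comp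
    (Topology.IsEmbedding.inclusion Metric.ball_subset_closedBall)), ?_⟩
  convert a.isOpen_plaque v using 1
  ext x
  constructor
  · rintro ⟨e, rfl⟩
    exact ⟨(⟨e, Metric.ball_subset_closedBall e.2⟩, v), ⟨mem_ball_zero_iff.1 e.2, rfl⟩, rfl⟩
  · rintro ⟨⟨p, w⟩, ⟨hp, rfl⟩, rfl⟩
    exact ⟨⟨p, by simpa using hp⟩, rfl⟩

lemma isPreconnected_closedPlaque (v : a.V) : IsPreconnected (range fun p => a.toFun (p, v)) :=
  isPreconnected_range (a.isClosedEmbedding.continuous.comp (by fun_prop))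

lemma mem_connectedComponent (p q : Disc n) (v : a.V) :
    a.toFun (q, v) ∈ connectedComponent (a.toFun (p, v)) :=
  (a.isPreconnected_closedPlaque v).subset_connectedComponent ⟨p, rfl⟩ ⟨q, rfl⟩

lemma measurableSet_core : MeasurableSet a.core :=
  a.measurableEmbedding.measurableSet_image.2
    (measurableSet_lt (by fun_prop) measurable_const)

end PrismChart

/-! ### Unions of leaves -/

section Saturated

variable {X : Type u} [TopologicalSpace X]

lemma IsSaturated.compl {A : Set X} (hA : IsSaturated A) : IsSaturated Aᶜ := fun _ hx y hy hyA =>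
  hx (hA y hyA (connectedComponent_eq hy ▸ mem_connectedComponent))

lemma IsSaturated.inter {A B : Set X} (hA : IsSaturated A) (hB : IsSaturated B) :
    IsSaturated (A ∩ B) := fun x hx => subset_inter (hA x hx.1) (hB x hx.2)

lemma IsSaturated.mem_of_eq {A : Set X} (hA : IsSaturated A) {x y : X} (hx : x ∈ A)
    (h : connectedComponent x = connectedComponent y) : y ∈ A :=
  hA x hx (h ▸ mem_connectedComponent)

lemma IsSaturated.image_connectedComponent {A : Set X} (hA : IsSaturated A) (x : A) :
    (↑) '' connectedComponent x = connectedComponent (x : X) := by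
  refine Subset.antisymm ?_ ?_
  · exact (isPreconnected_connectedComponent.image _
      continuous_subtype_val.continuousOn).subset_connectedComponent ⟨x, mem_connectedComponent, rfl⟩
  · have hsub := hA x x.2
    have h1 : IsPreconnected ((↑) ⁻¹' connectedComponent (x : X) : Set A) := by
      rw [← Topology.IsInducing.subtypeVal.isPreconnected_image,
        Subtype.image_preimage_coe, inter_eq_right.2 hsub]
      exact isPreconnected_connectedComponent
    intro y hy
    exact ⟨⟨y, hsub hy⟩, h1.subset_connectedComponent mem_connectedComponent hy, rfl⟩

lemma IsSaturated.mem_connectedComponent_iff {A : Set X} (hA : IsSaturated A) {x y : A} :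
    y ∈ connectedComponent x ↔ (y : X) ∈ connectedComponent (x : X) := by
  rw [← hA.image_connectedComponent x, Subtype.val_injective.mem_set_image]

lemma IsSaturated.connectedComponent_eq_iff {A : Set X} (hA : IsSaturated A) {x y : A} :
    connectedComponent x = connectedComponent y ↔
      connectedComponent (x : X) = connectedComponent (y : X) := by
  rw [connectedComponent_eq_iff_mem, connectedComponent_eq_iff_mem, hA.mem_connectedComponent_iff]

end Saturated

section Basic

variable {n : ℕ} {X : Type u} [TopologicalSpace X] [MeasurableSpace X]

lemma BorelFoliation.exists_ballMap (h : BorelFoliation n X) (x : X) :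
    ∃ (a : PrismChart n X) (v : a.V) (e : _), a.ballMap v e = x := by
  obtain ⟨φ, hφ⟩ := h.exists_atlas
  obtain ⟨i, ⟨p, v⟩, hp, rfl⟩ := hφ x
  exact ⟨φ i, v, ⟨p, by simpa using hp⟩, rfl⟩

theorem BorelFoliation.locallyConnectedSpace (h : BorelFoliation n X) :
    LocallyConnectedSpace X := by
  have hball : LocallyConnectedSpace (Metric.ball (0 : EuclideanSpace ℝ (Fin n)) 1) :=
    Metric.isOpen_ball.isOpenEmbedding_subtypeVal.locallyConnectedSpace
  rw [locallyConnectedSpace_iff_subsets_isOpen_isConnected]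
  intro x U hU
  obtain ⟨a, v, e, rfl⟩ := h.exists_ballMap x
  have he := a.isOpenEmbedding_ballMap v
  obtain ⟨V, hVU, hVo, heV, hVc⟩ := locallyConnectedSpace_iff_subsets_isOpen_isConnected.1 hball e
    (a.ballMap v ⁻¹' U) (he.continuous.continuousAt hU)
  exact ⟨a.ballMap v '' V, image_subset_iff.2 hVU, he.isOpenMap _ hVo, ⟨e, heV, rfl⟩,
    hVc.image _ he.continuous.continuousOn⟩

theorem BorelFoliation.locallyCompactSpace (h : BorelFoliation n X) : LocallyCompactSpace X := by
  have := h.t2Space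
  have hball : LocallyCompactSpace (Metric.ball (0 : EuclideanSpace ℝ (Fin n)) 1) :=
    Metric.isOpen_ball.locallyCompactSpace
  have : WeaklyLocallyCompactSpace X := ⟨fun x => by
    obtain ⟨a, v, e, rfl⟩ := h.exists_ballMap x
    have he := a.isOpenEmbedding_ballMap v
    obtain ⟨K, hK, hKe⟩ := exists_compact_mem_nhds e
    exact ⟨_, hK.image he.continuous, he.isOpenMap.image_mem_nhds hKe⟩⟩
  infer_instance

theorem BorelFoliation.isOpen_connectedComponent (h : BorelFoliation n X) (x : X) :
    IsOpen (connectedComponent x) := by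
  have := h.locallyConnectedSpace
  exact _root_.isOpen_connectedComponent

lemma BorelFoliation.isOpen (h : BorelFoliation n X) {A : Set X} (hA : IsSaturated A) :
    IsOpen A := isOpen_iff_mem_nhds.2 fun x hx =>
  mem_of_superset ((h.isOpen_connectedComponent x).mem_nhds mem_connectedComponent) (hA x hx)

lemma BorelFoliation.isClosed (h : BorelFoliation n X) {A : Set X} (hA : IsSaturated A) :
    IsClosed A := isOpen_compl_iff.1 (h.isOpen hA.compl)

/-! ### Restriction to a Borel union of leaves -/

/-- The labels of the plaques of a prism contained in a union of leaves. -/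
def PrismChart.labels (a : PrismChart n X) (A : Set X) : Set a.V :=
  {v | a.toFun (Disc.center n, v) ∈ A}

/-- Each closed plaque is connected, so a union of leaves contains it entirely or misses it. A prism
can therefore be restricted by restricting its labels. -/
lemma PrismChart.mem_labels (a : PrismChart n X) {A : Set X} (hA : IsSaturated A) {v : a.V}
    (p : Disc n) : v ∈ a.labels A ↔ a.toFun (p, v) ∈ A :=
  ⟨fun h => hA _ h (a.mem_connectedComponent _ _ _),
    fun h => hA _ h (a.mem_connectedComponent _ _ _)⟩

lemma PrismChart.measurableSet_labels (a : PrismChart n X) {A : Set X} (hAm : MeasurableSet A) :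
    MeasurableSet (a.labels A) :=
  (a.measurableEmbedding.measurable.comp measurable_prodMk_left) hAm

/-- The restriction of a prism to a Borel union of leaves. -/
def PrismChart.restrict [StandardBorelSpace X] (a : PrismChart n X) {A : Set X}
    (hAm : MeasurableSet A) (hA : IsSaturated A) : PrismChart n A :=
  have hst : StandardBorelSpace (a.labels A) := (a.measurableSet_labels hAm).standardBorel
  have hc : Continuous fun p : Disc n × a.labels A => (p.1, (p.2 : a.V)) := by fun_prop
  have hcl : Topology.IsClosedEmbedding fun p : Disc n × a.labels A => a.toFun (p.1, (p.2 : a.V)) :=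
    a.isClosedEmbedding.comp (Topology.IsClosedEmbedding.id.prodMap
      (IsClosed.isClosedEmbedding_subtypeVal (isClosed_discrete _)))
  have hmem : ∀ p : Disc n × a.labels A, a.toFun (p.1, (p.2 : a.V)) ∈ A := fun p =>
    (a.mem_labels hA p.1).1 p.2.2
  { V := a.labels A
    toFun := fun p => ⟨a.toFun (p.1, p.2), hmem p⟩
    isClosedEmbedding := by
      refine ⟨Topology.IsEmbedding.of_comp (hcl.continuous.subtype_mk _) continuous_subtype_val
        hcl.isEmbedding, ?_⟩
      have h2 := hcl.isClosed_range.preimage (continuous_subtype_val (p := (· ∈ A)))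
      convert h2 using 1
      ext x
      simp [Subtype.ext_iff]
    measurableEmbedding := by
      have hAs : StandardBorelSpace A := hAm.standardBorel
      refine Measurable.measurableEmbedding ?_ ?_
      · exact (a.measurableEmbedding.measurable.comp (by fun_prop)).subtype_mk
      · intro p q hpq
        exact hcl.injective (Subtype.ext_iff.1 hpq)
    isOpen_core := by
      have h2 := a.isOpen_core.preimage (continuous_subtype_val (p := (· ∈ A)))
      convert h2 using 1
      ext x
      constructor
      · rintro ⟨p, hp, rfl⟩
        exact ⟨(p.1, p.2), hp, rfl⟩
      · rintro ⟨⟨p, v⟩, hp, hx⟩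
        refine ⟨(p, ⟨v, (a.mem_labels hA p).2 ?_⟩), hp, Subtype.ext hx⟩
        rw [hx]; exact x.2 }

lemma PrismChart.mem_restrict_core [StandardBorelSpace X] (a : PrismChart n X) {A : Set X}
    (hAm : MeasurableSet A) (hA : IsSaturated A) (x : A) :
    x ∈ (a.restrict hAm hA).core ↔ (x : X) ∈ a.core := by
  constructor
  · rintro ⟨⟨p, v⟩, hp, rfl⟩
    exact ⟨(p, v.1), hp, rfl⟩
  · rintro ⟨⟨p, v⟩, hp, hx⟩
    refine ⟨(p, ⟨v, (a.mem_labels hA p).2 ?_⟩), hp, Subtype.ext hx⟩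
    rw [hx]; exact x.2

theorem BorelFoliation.restrict (h : BorelFoliation n X) {A : Set X} (hAm : MeasurableSet A)
    (hA : IsSaturated A) : BorelFoliation n A where
  standardBorelSpace := have := h.standardBorelSpace; hAm.standardBorel
  t2Space := have := h.t2Space; inferInstance
  secondCountable_leaf x := by
    have h2 := h.secondCountable_leaf x
    have hmem : ∀ y : connectedComponent x, ((y : A) : X) ∈ connectedComponent (x : X) := fun y =>
      hA.mem_connectedComponent_iff.1 y.2
    have hemb : Topology.IsEmbedding fun y : connectedComponent x =>
        (⟨((y : A) : X), hmem y⟩ : connectedComponent (x : X)) :=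
      Topology.IsEmbedding.of_comp (by fun_prop) continuous_subtype_val
        ((Topology.IsEmbedding.subtypeVal (p := (· ∈ A))).comp
          (Topology.IsEmbedding.subtypeVal (p := (· ∈ connectedComponent x))))
    exact hemb.secondCountableTopology
  exists_atlas := by
    have := h.standardBorelSpace
    obtain ⟨φ, hφ⟩ := h.exists_atlas
    refine ⟨fun i => (φ i).restrict hAm hA, fun x => ?_⟩
    obtain ⟨i, hi⟩ := hφ x
    exact ⟨i, ((φ i).mem_restrict_core hAm hA x).2 hi⟩

/-! ### Dense Borel families of points in the leaves -/

/-- The Borel map sending each point of the prism to the point of its plaque with coordinate `q`,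
and fixing the other points. -/
noncomputable def PrismChart.step (a : PrismChart n X) (q : Disc n) : X → X :=
  Function.extend a.toFun (fun p => a.toFun (q, p.2)) id

lemma PrismChart.step_apply (a : PrismChart n X) (q p : Disc n) (v : a.V) :
    a.step q (a.toFun (p, v)) = a.toFun (q, v) :=
  a.isClosedEmbedding.injective.extend_apply _ _ _

lemma PrismChart.step_mem (a : PrismChart n X) (q : Disc n) (x : X) :
    a.step q x ∈ connectedComponent x := by
  by_cases hx : ∃ p, a.toFun p = x
  · obtain ⟨⟨p, v⟩, rfl⟩ := hx
    rw [a.step_apply]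
    exact a.mem_connectedComponent _ _ _
  · rw [PrismChart.step, Function.extend_apply' _ _ _ hx]
    exact _root_.mem_connectedComponent

lemma PrismChart.measurable_step (a : PrismChart n X) (q : Disc n) : Measurable (a.step q) := by
  have h : Measurable fun p : Disc n × a.V => a.toFun (q, p.2) :=
    a.measurableEmbedding.measurable.comp (measurable_const.prodMk measurable_snd)
  exact a.measurableEmbedding.measurable_extend h measurable_id

/-- Countably many Borel maps preserving the leaves whose values at each point are dense in the
leaf of that point. -/
theorem BorelFoliation.exists_dense_maps (h : BorelFoliation n X) : ∃ g : ℕ → X → X,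
    (∀ k, Measurable (g k)) ∧ (∀ k x, g k x ∈ connectedComponent x) ∧
    ∀ x, connectedComponent x ⊆ closure (range fun k => g k x) := by
  obtain ⟨φ, hφ⟩ := h.exists_atlas
  let d : ℕ → Disc n := denseSeq (Disc n)
  -- A list codes a finite chain of prisms: at each link the point is moved inside its plaque to a
  -- point with coordinate in a fixed dense sequence.
  let G : List (ℕ × ℕ) → X → X := fun l => l.foldr (fun ik f => (φ ik.1).step (d ik.2) ∘ f) id
  have hGm : ∀ l, Measurable (G l) := by
    intro l
    induction l with
    | nil => exact measurable_id
    | cons ik l ih => exact ((φ ik.1).measurable_step _).comp ih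
  have hGc : ∀ l x, G l x ∈ connectedComponent x := by
    intro l x
    induction l with
    | nil => exact mem_connectedComponent
    | cons ik l ih =>
      rw [connectedComponent_eq ih]
      exact (φ ik.1).step_mem _ _
  -- The closure of the orbit is open: near any of its points some orbit point lies in the same
  -- plaque, and one more link of the chain gives a dense subset of that plaque. Being clopen, the
  -- closure contains the leaf.
  have hGd : ∀ x, connectedComponent x ⊆ closure (range fun l => G l x) := by
    intro x
    refine IsClopen.connectedComponent_subset ⟨isClosed_closure, ?_⟩
      (subset_closure ⟨[], rfl⟩)
    rw [isOpen_iff_mem_nhds]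
    intro y hy
    obtain ⟨i, hi⟩ := hφ y
    obtain ⟨v, hv⟩ := (φ i).mem_core_iff.1 hi
    obtain ⟨_, ⟨⟨p, v'⟩, ⟨-, hv'⟩, hp⟩, l, rfl⟩ :=
      mem_closure_iff.1 hy _ ((φ i).isOpen_plaque v) hv
    simp only at hp hv'
    refine mem_of_superset (((φ i).isOpen_plaque v).mem_nhds hv) ?_
    subst hv'
    rintro _ ⟨⟨q, w⟩, ⟨-, hw⟩, rfl⟩
    simp only at hw
    subst hw
    have hcont : Continuous fun q => (φ i).toFun (q, w) :=
      (φ i).isClosedEmbedding.continuous.comp (by fun_prop)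
    have h1 : q ∈ closure (range d) := denseRange_denseSeq (Disc n) q
    have h2 := image_closure_subset_closure_image hcont (mem_image_of_mem _ h1)
    refine closure_mono ?_ h2
    rintro _ ⟨_, ⟨k, rfl⟩, rfl⟩
    refine ⟨(i, k) :: l, ?_⟩
    change (φ i).step (d k) (G l x) = _
    rw [← hp, (φ i).step_apply]
  obtain ⟨e, he⟩ := exists_surjective_nat (List (ℕ × ℕ))
  refine ⟨fun k => G (e k), fun k => hGm _, fun k x => hGc _ x, fun x => ?_⟩
  refine (hGd x).trans (closure_mono ?_)
  rintro _ ⟨l, rfl⟩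
  obtain ⟨k, rfl⟩ := he l
  exact ⟨k, rfl⟩

end Basic

/-! ### Borel sections of leafwise proper maps -/

section Near

variable {m : ℕ} {Y : Type v} [TopologicalSpace Y] [MeasurableSpace Y]

/-- Pairs of points of a common plaque whose coordinates are at distance less than `r`. -/
def PrismChart.near (b : PrismChart m Y) (r : ℝ) : Set (Y × Y) :=
  Prod.map b.toFun b.toFun '' {p | p.1.2 = p.2.2 ∧ dist p.1.1 p.2.1 < r}

lemma PrismChart.measurableSet_near (b : PrismChart m Y) (r : ℝ) :
    MeasurableSet (b.near r) := by
  refine (b.measurableEmbedding.prodMap b.measurableEmbedding).measurableSet_image.2 ?_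
  rw [ofPred_and]
  exact (measurableSet_eq_fun (by fun_prop) (by fun_prop)).inter
    (measurableSet_lt (by fun_prop) measurable_const)

/-- The set swept by a compact family of Borel maps to a foliation is Borel. -/
theorem BorelFoliation.measurableSet_exists_eq (h : BorelFoliation m Y)
    {X : Type*} [MeasurableSpace X] {K : Type*} [TopologicalSpace K] [CompactSpace K]
    [SeparableSpace K] (F : K → X → Y) (hF : ∀ c, Measurable (F c))
    (hFc : ∀ x, Continuous fun c => F c x) :
    MeasurableSet {p : X × Y | ∃ c, F c p.1 = p.2} := by
  rcases isEmpty_or_nonempty K with hK | hK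
  · simp
  have := h.t2Space
  obtain ⟨ψ, hψ⟩ := h.exists_atlas
  let d := denseSeq K
  -- The swept set over `x` is compact, so `y` belongs to it exactly when points of a dense
  -- countable subfamily come arbitrarily close to `y` in the plaque of `y`. Closeness is read
  -- inside a prism, where it is a Borel condition.
  have key : {p : X × Y | ∃ c, F c p.1 = p.2} = ⋃ j, (Prod.snd ⁻¹' (ψ j).core ∩
      ⋂ l : ℕ, ⋃ k, (fun p : X × Y => (F (d k) p.1, p.2)) ⁻¹' (ψ j).near (1 / (l + 1 : ℝ))) := by
    ext ⟨x, y⟩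
    simp only [mem_ofPred_eq, mem_iUnion, mem_inter_iff, mem_preimage, mem_iInter]
    constructor
    · rintro ⟨c, rfl⟩
      obtain ⟨j, hj⟩ := hψ (F c x)
      refine ⟨j, hj, fun l => ?_⟩
      obtain ⟨⟨w, t⟩, hw, hwe⟩ := hj
      have hl : (0 : ℝ) < 1 / (l + 1) := by positivity
      have hO : IsOpen ((ψ j).toFun '' {p | (‖(p.1 : EuclideanSpace ℝ (Fin m))‖ < 1 ∧ p.2 = t) ∧
          dist p.1 w < 1 / (l + 1)}) := by
        have h1 : IsOpen {p : Disc m × (ψ j).V | dist p.1 w < 1 / ((l : ℝ) + 1)} :=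
          isOpen_lt (by fun_prop) continuous_const
        obtain ⟨O, hO, hOe⟩ := (ψ j).isClosedEmbedding.isInducing.isOpen_iff.1 h1
        convert hO.inter ((ψ j).isOpen_plaque t) using 1
        ext z
        constructor
        · rintro ⟨p, ⟨hp1, hp2⟩, rfl⟩
          refine ⟨?_, p, hp1, rfl⟩
          have : p ∈ (ψ j).toFun ⁻¹' O := hOe ▸ hp2
          exact this
        · rintro ⟨hz, p, hp, rfl⟩
          have : p ∈ (ψ j).toFun ⁻¹' O := hz
          rw [hOe] at this
          exact ⟨p, ⟨hp, this⟩, rfl⟩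
      have hmem : F c x ∈ (ψ j).toFun '' {p | (‖(p.1 : EuclideanSpace ℝ (Fin m))‖ < 1 ∧ p.2 = t) ∧
          dist p.1 w < 1 / ((l : ℝ) + 1)} :=
        ⟨(w, t), ⟨⟨hw, rfl⟩, by simpa using hl⟩, hwe⟩
      obtain ⟨k, hk⟩ := (denseRange_denseSeq K).exists_mem_open (hO.preimage (hFc x)) ⟨c, hmem⟩
      obtain ⟨⟨w', t'⟩, ⟨⟨-, ht'⟩, hd⟩, he⟩ := hk
      exact ⟨k, ⟨(⟨w', t'⟩, ⟨w, t⟩), ⟨ht', hd⟩, Prod.ext he hwe⟩⟩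
    · rintro ⟨j, ⟨⟨w, t⟩, -, hw⟩, hl⟩
      have hcl : IsClosed (range fun c => F c x) := (isCompact_range (hFc x)).isClosed
      suffices y ∈ closure (range fun c => F c x) by
        rwa [hcl.closure_eq] at this
      choose k hk using hl
      have h1 : ∀ l, ∃ w', (ψ j).toFun (w', t) = F (d (k l)) x ∧ dist w' w < 1 / ((l : ℝ) + 1) := by
        intro l
        obtain ⟨⟨⟨w1, t1⟩, ⟨w2, t2⟩⟩, ⟨h12, hd⟩, he⟩ := hk l
        have e1 := congrArg Prod.fst he
        have e2 := congrArg Prod.snd he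
        simp only [Prod.map_apply] at e1 e2 h12 hd
        have e3 := (ψ j).isClosedEmbedding.injective (e2.trans hw.symm)
        simp only [Prod.mk.injEq] at e3
        obtain ⟨rfl, rfl⟩ := e3
        subst h12
        exact ⟨w1, e1, hd⟩
      choose w' hw' hd using h1
      have hlim : Tendsto w' atTop (𝓝 w) := by
        rw [tendsto_iff_dist_tendsto_zero]
        exact squeeze_zero (fun _ => dist_nonneg) (fun l => (hd l).le)
          tendsto_one_div_add_atTop_nhds_zero_nat
      have hc : Continuous fun q => (ψ j).toFun (q, t) :=
        (ψ j).isClosedEmbedding.continuous.comp (by fun_prop)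
      refine mem_closure_of_tendsto (hw ▸ (hc.tendsto w).comp hlim)
        (Eventually.of_forall fun l => ⟨d (k l), (hw' l).symm⟩)
  rw [key]
  refine MeasurableSet.iUnion fun j => (measurable_snd (ψ j).measurableSet_core).inter
    (MeasurableSet.iInter fun l => MeasurableSet.iUnion fun k => ?_)
  exact (((hF _).comp measurable_fst).prodMk measurable_snd) ((ψ j).measurableSet_near _)

end Near

instance : CompactSpace cantorSet := isCompact_iff_compactSpace.1 isCompact_cantorSet

instance : StandardBorelSpace cantorSet := isClosed_cantorSet.measurableSet.standardBorel

/-- The Cantor set is compact and linearly ordered. Parametrizing the disc by it gives a rule for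
selecting a point in a nonempty closed subset of a plaque: take the least parameter. -/
lemma exists_cantor_surjection (n : ℕ) : ∃ κ : cantorSet → Disc n,
    Continuous κ ∧ Function.Surjective κ := by
  obtain ⟨f, hf, hs⟩ := exists_nat_bool_continuous_surjective_of_compact (Disc n)
  exact ⟨f ∘ cantorSetHomeomorphNatToBool, hf.comp cantorSetHomeomorphNatToBool.continuous,
    hs.comp cantorSetHomeomorphNatToBool.surjective⟩

section Section

variable {n m : ℕ} {X : Type u} [TopologicalSpace X] [MeasurableSpace X]
  {Y : Type v} [TopologicalSpace Y] [MeasurableSpace Y]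

lemma PrismChart.continuous_step (a : PrismChart n X) (x : X) :
    Continuous fun q => a.step q x := by
  by_cases hx : ∃ p, a.toFun p = x
  · obtain ⟨⟨p, v⟩, rfl⟩ := hx
    simp only [a.step_apply]
    exact a.isClosedEmbedding.continuous.comp (by fun_prop)
  · simp only [PrismChart.step, Function.extend_apply' _ _ _ hx]
    exact continuous_const

/-- A Borel real-valued function separating the plaques of a prism. -/
noncomputable def PrismChart.code (a : PrismChart n X) : X → ℝ :=
  Function.extend a.toFun (fun p => embeddingReal a.V p.2) 0

lemma PrismChart.code_apply (a : PrismChart n X) (p : Disc n) (v : a.V) :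
    a.code (a.toFun (p, v)) = embeddingReal a.V v :=
  a.isClosedEmbedding.injective.extend_apply _ _ _

lemma PrismChart.measurable_code (a : PrismChart n X) : Measurable a.code :=
  a.measurableEmbedding.measurable_extend
    ((measurableEmbedding_embeddingReal a.V).measurable.comp measurable_snd) measurable_const

lemma PrismChart.exists_mem_plaque (a : PrismChart n X) (v : a.V) {s : ℕ → X} {p : Disc n}
    (h : a.toFun (p, v) ∈ closure (range s)) (h' : connectedComponent (a.toFun (p, v)) ⊆
      closure (range s)) : ∃ k q, s k = a.toFun (q, v) := by
  have h0 : a.toFun (Disc.center n, v) ∈ a.plaque v := ⟨_, ⟨by simp [Disc.center], rfl⟩, rfl⟩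
  obtain ⟨_, ⟨⟨q, w⟩, ⟨-, hw⟩, rfl⟩, k, hk⟩ :=
    mem_closure_iff.1 (h' (a.mem_connectedComponent p _ v)) _ (a.isOpen_plaque v) h0
  simp only at hw
  subst hw
  exact ⟨k, q, hk⟩

/-- A leafwise proper Borel map whose fibres are contained in leaves has a Borel section. -/
theorem BorelFoliation.exists_section (hX : BorelFoliation n X) (hY : BorelFoliation m Y)
    {f : X → Y} (hf : Measurable f) (hfc : Continuous f) (hcomp : ∀ y, IsCompact (f ⁻¹' {y}))
    (hleaf : ∀ x x', f x = f x' → connectedComponent x = connectedComponent x') :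
    ∃ M, MeasurableSet M ∧ InjOn f M ∧ f '' M = range f := by
  have := hX.standardBorelSpace
  have := hY.standardBorelSpace
  have := hX.t2Space
  have := hY.t2Space
  obtain ⟨φ, hφ⟩ := hX.exists_atlas
  obtain ⟨g, hgm, hgc, hgd⟩ := hX.exists_dense_maps
  obtain ⟨κ, hκ, hκs⟩ := exists_cantor_surjection n
  have hgd' : ∀ i (p : Disc n) (v : (φ i).V) x,
      connectedComponent x = connectedComponent ((φ i).toFun (p, v)) →
      ∃ k q, g k x = (φ i).toFun (q, v) := fun i p v x hx =>
    (φ i).exists_mem_plaque v (p := p) (hgd x (hx ▸ mem_connectedComponent)) (hx ▸ hgd x)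
  -- the fibre of `f z` meets the plaque of `x`
  let E : ℕ → Set (X × Y) := fun i => {p | ∃ c, f ((φ i).step (κ c) p.1) = p.2}
  have hE : ∀ i, MeasurableSet (E i) := fun i =>
    hY.measurableSet_exists_eq (fun c x => f ((φ i).step (κ c) x))
      (fun c => hf.comp ((φ i).measurable_step _))
      (fun x => hfc.comp (((φ i).continuous_step x).comp hκ))
  -- The same condition with the Cantor parameter at most `q`, again a compact family. Excluding it
  -- for each rational `q` below a given parameter says that no smaller parameter reaches the same
  -- fibre in this plaque.
  let E' : ℕ → ℚ → Set (X × Y) := fun i q =>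
    {p | ∃ c : {c : cantorSet // (c : ℝ) ≤ q}, f ((φ i).step (κ c) p.1) = p.2}
  have hE' : ∀ i q, MeasurableSet (E' i q) := fun i q => by
    have hcl : IsClosed {c : cantorSet | (c : ℝ) ≤ q} :=
      isClosed_le continuous_subtype_val continuous_const
    have : CompactSpace {c : cantorSet // (c : ℝ) ≤ q} :=
      isCompact_iff_compactSpace.1 hcl.isCompact
    exact hY.measurableSet_exists_eq (fun (c : {c : cantorSet // (c : ℝ) ≤ q}) x => f ((φ i).step (κ c.1) x))
      (fun c => hf.comp ((φ i).measurable_step _))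
      (fun x => hfc.comp (((φ i).continuous_step x).comp (hκ.comp continuous_subtype_val)))
  -- In each fibre a point is selected by three successive minimizations: the first prism that meets
  -- the fibre (`A1`), then the plaque of least code (`A2`), then the least Cantor parameter (`E'`).
  -- Plaques of the leaf are enumerated by the orbit points `g k z`, since every plaque of the leaf
  -- contains one; the conditions are thus countable in number.
  let A1 : ℕ → ℕ → ℕ → Set X := fun i j k =>
    {z | j < i → g k z ∈ range (φ j).toFun → (g k z, f z) ∉ E j}
  let A2 : ℕ → ℕ → Set X := fun i k =>
    {z | g k z ∈ range (φ i).toFun → (φ i).code (g k z) < (φ i).code z → (g k z, f z) ∉ E i}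
  let P : ∀ i, cantorSet × (φ i).V → X := fun i p => (φ i).toFun (κ p.1, p.2)
  have hPm : ∀ i, Measurable (P i) := fun i =>
    (φ i).measurableEmbedding.measurable.comp ((hκ.measurable.comp measurable_fst).prodMk
      measurable_snd)
  let D : ∀ i, Set (cantorSet × (φ i).V) := fun i =>
    P i ⁻¹' ((⋂ j, ⋂ k, A1 i j k) ∩ ⋂ k, A2 i k) ∩
      ⋂ q : ℚ, {p | (q : ℝ) < p.1 → (P i p, f (P i p)) ∉ E' i q}
  have hA1 : ∀ i j k, MeasurableSet (A1 i j k) := fun i j k => by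
    refine MeasurableSet.imp (MeasurableSet.const _) (MeasurableSet.imp
      (hgm k (φ j).measurableEmbedding.measurableSet_range) (MeasurableSet.compl ?_))
    exact ((hgm k).prodMk hf) (hE j)
  have hA2 : ∀ i k, MeasurableSet (A2 i k) := fun i k => by
    refine MeasurableSet.imp (hgm k (φ i).measurableEmbedding.measurableSet_range)
      (MeasurableSet.imp (measurableSet_lt ((φ i).measurable_code.comp (hgm k))
        (φ i).measurable_code) (MeasurableSet.compl ?_))
    exact ((hgm k).prodMk hf) (hE i)
  have hD : ∀ i, MeasurableSet (D i) := fun i => by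
    refine (hPm i ((MeasurableSet.iInter fun j => MeasurableSet.iInter fun k => hA1 i j k).inter
      (MeasurableSet.iInter fun k => hA2 i k))).inter (MeasurableSet.iInter fun q =>
      MeasurableSet.imp (measurableSet_lt measurable_const (by fun_prop)) (MeasurableSet.compl ?_))
    exact ((hPm i).prodMk (hf.comp (hPm i))) (hE' i q)
  have hmem : ∀ i p, p ∈ D i ↔ (∀ j k, P i p ∈ A1 i j k) ∧ (∀ k, P i p ∈ A2 i k) ∧
      ∀ q : ℚ, (q : ℝ) < p.1 → (P i p, f (P i p)) ∉ E' i q := by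
    intro i p
    simp only [D, mem_inter_iff, mem_preimage, mem_iInter, mem_ofPred_eq, and_assoc]
  have hindex : ∀ i p, p ∈ D i → ∀ j x, x ∈ range (φ j).toFun → f x = f (P i p) → ¬ j < i := by
    rintro i p hp j _ ⟨⟨d, v⟩, rfl⟩ hx hji
    obtain ⟨k, q, hk⟩ := hgd' j d v (P i p) (hleaf _ _ hx.symm)
    obtain ⟨c, hc⟩ := hκs d
    refine ((hmem i p).1 hp).1 j k hji ⟨_, hk.symm⟩ ⟨c, ?_⟩
    change f ((φ j).step (κ c) (g k (P i p))) = f (P i p)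
    rw [hk, (φ j).step_apply, hc, hx]
  have hcode : ∀ i p p', p ∈ D i → f (P i p') = f (P i p) →
      ¬ embeddingReal _ p'.2 < embeddingReal _ p.2 := by
    rintro i p ⟨c', v'⟩ hp hx hlt
    obtain ⟨k, q, hk⟩ := hgd' i (κ c') v' (P i p) (hleaf _ _ hx.symm)
    refine ((hmem i p).1 hp).2.1 k ⟨_, hk.symm⟩ ?_ ⟨c', ?_⟩
    · rw [hk, (φ i).code_apply, (φ i).code_apply]
      exact hlt
    · change f ((φ i).step (κ c') (g k (P i p))) = f (P i p)
      rw [hk, (φ i).step_apply]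
      exact hx
  have hcant : ∀ i (p : cantorSet × (φ i).V) (c' : cantorSet), p ∈ D i →
      f (P i (c', p.2)) = f (P i p) → ¬ (c' : ℝ) < p.1 := by
    intro i p c' hp hx hlt
    obtain ⟨q, hq, hq'⟩ := exists_rat_btwn hlt
    refine ((hmem i p).1 hp).2.2 q hq' ⟨⟨c', hq.le⟩, ?_⟩
    change f ((φ i).step (κ c') ((φ i).toFun (κ p.1, p.2))) = f (P i p)
    rw [(φ i).step_apply]
    exact hx
  have hinj : ∀ i, InjOn (fun p => f (P i p)) (D i) := by
    intro i p hp p' hp' he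
    have h1 : p.2 = p'.2 := (measurableEmbedding_embeddingReal _).injective
      (le_antisymm (not_lt.1 (hcode i p p' hp he.symm)) (not_lt.1 (hcode i p' p hp' he)))
    obtain ⟨c, v⟩ := p
    obtain ⟨c', v'⟩ := p'
    simp only at h1
    subst h1
    have h2 : c = c' := Subtype.ext (le_antisymm (not_lt.1 (hcant i _ c' hp he.symm))
      (not_lt.1 (hcant i _ c hp' he)))
    rw [h2]
  refine ⟨⋃ i, P i '' D i, MeasurableSet.iUnion fun i => ?_, ?_, ?_⟩
  · exact (hD i).image_of_measurable_injOn (hPm i) fun p hp p' hp' he =>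
      hinj i hp hp' (congrArg f he)
  · intro x hx x' hx' he
    obtain ⟨i, p, hp, rfl⟩ := mem_iUnion.1 hx
    obtain ⟨j, p', hp', rfl⟩ := mem_iUnion.1 hx'
    have hij : i = j := le_antisymm
      (not_lt.1 (hindex i p hp j _ ⟨_, rfl⟩ he.symm)) (not_lt.1 (hindex j p' hp' i _ ⟨_, rfl⟩ he))
    subst hij
    rw [hinj i hp hp' he]
  · refine Subset.antisymm (image_subset_range _ _) ?_
    rintro _ ⟨x, rfl⟩
    have hex : ∃ i, ∃ z ∈ range (φ i).toFun, f z = f x := by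
      obtain ⟨i, p, -, hp⟩ := hφ x
      exact ⟨i, x, ⟨p, hp⟩, rfl⟩
    classical
    let i := Nat.find hex
    obtain ⟨_, ⟨⟨d0, v0⟩, rfl⟩, hz⟩ := Nat.find_spec hex
    -- Compactness of the fibre and discreteness of the labels leave finitely many plaques, so a
    -- least code exists.
    have hcA : IsCompact {p : Disc n × (φ i).V | f ((φ i).toFun p) = f x} :=
      (φ i).isClosedEmbedding.isCompact_preimage (hcomp (f x))
    have hfin := (hcA.image continuous_snd).finite_of_discrete
    obtain ⟨v, ⟨⟨d, w⟩, hd, hw⟩, hvmin⟩ :=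
      Set.exists_min_image _ (embeddingReal (φ i).V) hfin ⟨v0, ⟨(d0, v0), hz, rfl⟩⟩
    simp only at hw
    subst hw
    have hcl : IsClosed {c : cantorSet | f (P i (c, w)) = f x} := by
      have : Continuous fun c : cantorSet => f (P i (c, w)) :=
        hfc.comp ((φ i).isClosedEmbedding.continuous.comp (hκ.prodMk continuous_const))
      exact isClosed_eq this continuous_const
    obtain ⟨c0, hc0⟩ := hκs d
    have hne : {c : cantorSet | f (P i (c, w)) = f x}.Nonempty := by
      refine ⟨c0, ?_⟩
      change f ((φ i).toFun (κ c0, w)) = f x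
      rw [hc0]; exact hd
    obtain ⟨c, hc, hcmin⟩ := hcl.isCompact.exists_isMinOn hne
      (f := fun c : cantorSet => (c : ℝ)) continuous_subtype_val.continuousOn
    refine ⟨P i (c, w), mem_iUnion.2 ⟨i, _, (hmem i _).2 ⟨?_, ?_, ?_⟩, rfl⟩, hc⟩
    · rintro j k hji ⟨⟨q, u⟩, hq⟩ ⟨c', hc'⟩
      change f ((φ j).step (κ c') (g k (P i (c, w)))) = f (P i (c, w)) at hc'
      rw [← hq, (φ j).step_apply] at hc'
      exact Nat.find_min hex hji ⟨_, ⟨_, rfl⟩, hc'.trans hc⟩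
    · rintro k ⟨⟨q, u⟩, hq⟩ hlt ⟨c', hc'⟩
      change f ((φ i).step (κ c') (g k (P i (c, w)))) = f (P i (c, w)) at hc'
      rw [← hq, (φ i).step_apply] at hc'
      rw [← hq, (φ i).code_apply, (φ i).code_apply] at hlt
      exact (hvmin u ⟨(κ c', u), hc'.trans hc, rfl⟩).not_gt hlt
    · rintro q hq ⟨⟨c', hc'q⟩, hc'⟩
      change f ((φ i).step (κ c') ((φ i).toFun (κ c, w))) = f (P i (c, w)) at hc'
      rw [(φ i).step_apply] at hc'
      exact (hcmin (show f (P i (c', w)) = f x from hc'.trans hc)).not_gt (hc'q.trans_lt hq)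

/-- The transversals of the target of a leafwise proper map with fibres in leaves can be lifted. -/
theorem BorelFoliation.exists_lift (hX : BorelFoliation n X) (hY : BorelFoliation m Y)
    {f : X → Y} (hf : Measurable f) (hfc : Continuous f) (hcomp : ∀ y, IsCompact (f ⁻¹' {y}))
    (hleaf : ∀ x x', f x = f x' → connectedComponent x = connectedComponent x')
    (hsurj : Function.Surjective f) {S : Set Y} (hS : IsTransversal S) :
    ∃ T, IsTransversal T ∧ BijOn f T S := by
  have := hX.t2Space
  obtain ⟨M, hM, hinj, himg⟩ := hX.exists_section hY hf hfc hcomp hleaf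
  have hiso : ∀ y ∈ S, ∃ O, IsOpen O ∧ O ∩ S = {y} := by
    intro y hy
    have := hS.discreteTopology
    obtain ⟨O, hO, hOe⟩ := isOpen_induced_iff.1 (isOpen_discrete ({⟨y, hy⟩} : Set S))
    refine ⟨O, hO, ?_⟩
    rw [inter_comm, ← Subtype.image_preimage_coe, hOe, image_singleton]
  refine ⟨M ∩ f ⁻¹' S, ⟨hM.inter (hf hS.measurableSet), ?_, ?_⟩, ?_, hinj.mono inter_subset_left, ?_⟩
  -- Let `O` isolate `f x` in `S`. Over `O` the lift contains only the point of `M` in the fibre of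
  -- `f x`; this yields closedness here and discreteness below.
  · rw [← isOpen_compl_iff, isOpen_iff_mem_nhds]
    intro x hx
    by_cases hxS : f x ∈ S
    · obtain ⟨O, hO, hOe⟩ := hiso _ hxS
      have hxO : f x ∈ O := (hOe.symm ▸ rfl : f x ∈ O ∩ S).1
      obtain ⟨t, ht, hte⟩ : f x ∈ f '' M := himg ▸ mem_range_self x
      have htx : x ≠ t := by
        rintro rfl
        exact hx ⟨ht, hxS⟩
      filter_upwards [hfc.continuousAt (hO.mem_nhds hxO), isOpen_ne.mem_nhds htx]
        with z hzO hzt hz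
      have : f z ∈ O ∩ S := ⟨hzO, hz.2⟩
      rw [hOe] at this
      exact hzt (hinj hz.1 ht (this.trans hte.symm))
    · filter_upwards [(hS.isClosed.isOpen_compl.preimage hfc).mem_nhds hxS] with z hz hz'
      exact hz hz'.2
  · rw [discreteTopology_iff_isOpen_singleton]
    rintro ⟨x, hxM, hxS⟩
    obtain ⟨O, hO, hOe⟩ := hiso _ hxS
    have hxO : f x ∈ O := (hOe.symm ▸ rfl : f x ∈ O ∩ S).1
    convert (hO.preimage hfc).preimage continuous_subtype_val using 1
    ext ⟨z, hzM, hzS⟩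
    rw [mem_singleton_iff, Subtype.ext_iff]
    change z = x ↔ f z ∈ O
    constructor
    · intro hzx
      rw [hzx]
      exact hxO
    · intro hz
      have : f z ∈ O ∩ S := ⟨hz, hzS⟩
      rw [hOe] at this
      exact hinj hzM hxM this
  · exact fun x hx => hx.2
  · intro y hy
    obtain ⟨x, rfl⟩ := hsurj y
    obtain ⟨t, ht, hte⟩ : f x ∈ f '' M := himg ▸ mem_range_self x
    refine ⟨t, ⟨ht, ?_⟩, hte⟩
    rw [mem_preimage, hte]
    exact hy

end Section

/-! ### Coordinates in one-dimensional prisms -/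

/-- The point of the one-dimensional disc with coordinate `t`, for `|t| ≤ 1`. -/
noncomputable def Disc.pt (t : ℝ) : Disc 1 :=
  ⟨EuclideanSpace.single 0 (max (-1) (min 1 t)), by
    rw [mem_closedBall_zero_iff, PiLp.norm_single, Real.norm_eq_abs, abs_le]
    exact ⟨le_max_left _ _, max_le (by norm_num) (min_le_left _ _)⟩⟩

/-- The coordinate of a point of the one-dimensional disc. -/
def Disc.co (p : Disc 1) : ℝ := (p : EuclideanSpace ℝ (Fin 1)) 0

namespace Disc

lemma norm_eq (p : Disc 1) : ‖(p : EuclideanSpace ℝ (Fin 1))‖ = |p.co| := by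
  rw [EuclideanSpace.norm_eq]
  simp [Real.sqrt_sq_eq_abs, co]

lemma co_mem (p : Disc 1) : p.co ∈ Icc (-1 : ℝ) 1 := by
  have := mem_closedBall_zero_iff.1 p.2
  rw [norm_eq] at this
  exact abs_le.1 this

lemma norm_lt_one_iff (p : Disc 1) :
    ‖(p : EuclideanSpace ℝ (Fin 1))‖ < 1 ↔ p.co ∈ Ioo (-1 : ℝ) 1 := by
  rw [norm_eq, abs_lt]; rfl

lemma co_pt {t : ℝ} (ht : t ∈ Icc (-1 : ℝ) 1) : (pt t).co = t := by
  simp [pt, co, ht.1, ht.2]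

lemma pt_co (p : Disc 1) : pt p.co = p := by
  have h := p.co_mem
  refine Subtype.ext ?_
  ext i
  rw [Subsingleton.elim i 0]
  exact co_pt h

lemma continuous_co : Continuous co := by
  unfold co; fun_prop

lemma continuous_pt : Continuous pt := by
  refine Continuous.subtype_mk ?_ _
  have h : Continuous fun x : ℝ => (EuclideanSpace.single (0 : Fin 1) x : EuclideanSpace ℝ (Fin 1)) :=
    by
    have h1 : Continuous fun x : ℝ => (Pi.single 0 x : Fin 1 → ℝ) := continuous_pi fun i => by
      rw [Subsingleton.elim i 0]; simpa using continuous_id'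
    exact (PiLp.continuous_toLp 2 _).comp h1
  exact h.comp (by fun_prop)

end Disc

namespace PrismChart

variable {Y : Type v} [TopologicalSpace Y] [MeasurableSpace Y] (a b : PrismChart 1 Y)

/-- The plaque labelled by `u`, parametrized by its coordinate. -/
noncomputable def line (u : b.V) (t : ℝ) : Y := b.toFun (Disc.pt t, u)

/-- The coordinate of a point of a prism. -/
noncomputable def coord : Y → ℝ := Function.extend b.toFun (fun p => p.1.co) 0

lemma coord_apply (p : Disc 1) (u : b.V) : b.coord (b.toFun (p, u)) = p.co :=
  b.isClosedEmbedding.injective.extend_apply _ _ _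

lemma coord_line (u : b.V) {t : ℝ} (ht : t ∈ Icc (-1 : ℝ) 1) : b.coord (b.line u t) = t := by
  rw [line, coord_apply, Disc.co_pt ht]

lemma line_co (p : Disc 1) (u : b.V) : b.line u p.co = b.toFun (p, u) := by
  rw [line, Disc.pt_co]

lemma continuous_line (u : b.V) : Continuous (b.line u) :=
  b.isClosedEmbedding.continuous.comp (Disc.continuous_pt.prodMk continuous_const)

lemma injOn_line (u : b.V) : InjOn (b.line u) (Icc (-1) 1) := fun s hs t ht h => by
  rw [← b.coord_line u hs, h, b.coord_line u ht]

lemma plaque_eq (u : b.V) : b.plaque u = b.line u '' Ioo (-1) 1 := by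
  ext y
  constructor
  · rintro ⟨⟨p, w⟩, ⟨hp, hw⟩, rfl⟩
    simp only at hp hw
    subst hw
    exact ⟨p.co, p.norm_lt_one_iff.1 hp, b.line_co p w⟩
  · rintro ⟨t, ht, rfl⟩
    refine ⟨(Disc.pt t, u), ⟨?_, rfl⟩, rfl⟩
    change ‖((Disc.pt t : Disc 1) : EuclideanSpace ℝ (Fin 1))‖ < 1
    rw [Disc.norm_lt_one_iff, Disc.co_pt (Ioo_subset_Icc_self ht)]
    exact ht

lemma line_mem_core (u : b.V) {t : ℝ} (ht : t ∈ Ioo (-1 : ℝ) 1) : b.line u t ∈ b.core :=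
  b.mem_core_iff.2 ⟨u, b.plaque_eq u ▸ ⟨t, ht, rfl⟩⟩

lemma mem_core_iff_line {y : Y} : y ∈ b.core ↔ ∃ u, ∃ t ∈ Ioo (-1 : ℝ) 1, b.line u t = y := by
  simp_rw [mem_core_iff, plaque_eq, mem_image]

lemma line_inj {u u' : b.V} {t t' : ℝ} (ht : t ∈ Icc (-1 : ℝ) 1) (ht' : t' ∈ Icc (-1 : ℝ) 1)
    (h : b.line u t = b.line u' t') : u = u' ∧ t = t' := by
  have := b.isClosedEmbedding.injective h
  simp only [Prod.mk.injEq] at this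
  refine ⟨this.2, ?_⟩
  rw [← Disc.co_pt ht, this.1, Disc.co_pt ht']

lemma continuousOn_range {Z : Type*} [TopologicalSpace Z] {f : Y → Z}
    (hf : Continuous (f ∘ b.toFun)) : ContinuousOn f (range b.toFun) := by
  rw [continuousOn_iff_isClosed]
  intro F hF
  refine ⟨b.toFun '' ((f ∘ b.toFun) ⁻¹' F), b.isClosedEmbedding.isClosedMap _ (hF.preimage hf), ?_⟩
  ext y
  constructor
  · rintro ⟨h1, p, rfl⟩
    exact ⟨⟨p, h1, rfl⟩, p, rfl⟩
  · rintro ⟨⟨p, h1, rfl⟩, -⟩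
    exact ⟨h1, p, rfl⟩

lemma core_subset_range : b.core ⊆ range b.toFun := by
  rintro _ ⟨p, -, rfl⟩
  exact ⟨p, rfl⟩

lemma continuousOn_coord : ContinuousOn b.coord (range b.toFun) := by
  refine b.continuousOn_range ?_
  have : b.coord ∘ b.toFun = fun p => p.1.co := funext fun p => b.coord_apply p.1 p.2
  rw [this]
  exact Disc.continuous_co.comp continuous_fst

lemma isOpen_line_image (u : b.V) {O : Set ℝ} (hO : IsOpen O) (hO1 : O ⊆ Ioo (-1) 1) :
    IsOpen (b.line u '' O) := by
  have h := (b.continuousOn_coord.mono ((b.plaque_eq u).symm.subset.trans ?_)).isOpen_inter_preimage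
    (b.plaque_eq u ▸ b.isOpen_plaque u) hO
  · convert h using 1
    ext y
    constructor
    · rintro ⟨t, ht, rfl⟩
      refine ⟨⟨t, hO1 ht, rfl⟩, ?_⟩
      rw [mem_preimage, b.coord_line u (Ioo_subset_Icc_self (hO1 ht))]
      exact ht
    · rintro ⟨⟨t, ht, rfl⟩, h2⟩
      rw [mem_preimage, b.coord_line u (Ioo_subset_Icc_self ht)] at h2
      exact ⟨t, h2, rfl⟩
  · exact fun y hy => b.core_subset_range (b.mem_core_iff.2 ⟨u, hy⟩)

lemma map_line_nhds (u : b.V) {t : ℝ} (ht : t ∈ Ioo (-1 : ℝ) 1) :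
    map (b.line u) (𝓝 t) = 𝓝 (b.line u t) := by
  refine le_antisymm (b.continuous_line u).continuousAt fun O hO => ?_
  obtain ⟨U, hU, hUo, htU⟩ := mem_nhds_iff.1 (inter_mem (mem_map.1 hO) (isOpen_Ioo.mem_nhds ht))
  refine mem_of_superset ((b.isOpen_line_image u hUo fun s hs => (hU hs).2).mem_nhds ⟨t, htU, rfl⟩) ?_
  rintro _ ⟨s, hs, rfl⟩
  exact (hU hs).1

/-- Inside the core of `b`, a connected part of a plaque of `a` is contained in a plaque of `b`. -/
lemma exists_label {v : a.V} {J : Set ℝ} (hJ : IsPreconnected J) (hne : J.Nonempty)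
    (h : a.line v '' J ⊆ b.core) : ∃ u, ∀ t ∈ J, b.coord (a.line v t) ∈ Ioo (-1 : ℝ) 1 ∧
      b.line u (b.coord (a.line v t)) = a.line v t := by
  obtain ⟨t₀, ht₀⟩ := hne
  obtain ⟨u, hu⟩ := b.mem_core_iff.1 (h ⟨t₀, ht₀, rfl⟩)
  refine ⟨u, fun t ht => ?_⟩
  have hsub : a.line v '' J ⊆ b.plaque u := by
    refine (hJ.image _ (a.continuous_line v).continuousOn).subset_left_of_subset_union
      (b.isOpen_plaque u) (isOpen_iUnion fun u' : {u' // u' ≠ u} => b.isOpen_plaque u'.1) ?_ ?_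
      ⟨_, ⟨t₀, ht₀, rfl⟩, hu⟩
    · rw [Set.disjoint_left]
      intro y hy hy'
      obtain ⟨⟨u', hu'⟩, hy'⟩ := mem_iUnion.1 hy'
      rw [plaque_eq] at hy hy'
      obtain ⟨s, hs, rfl⟩ := hy
      obtain ⟨s', hs', he⟩ := hy'
      exact hu' (b.line_inj (Ioo_subset_Icc_self hs') (Ioo_subset_Icc_self hs) he).1
    · intro y hy
      obtain ⟨u', hu'⟩ := b.mem_core_iff.1 (h hy)
      by_cases e : u' = u
      · exact Or.inl (e ▸ hu')
      · exact Or.inr (mem_iUnion.2 ⟨⟨u', e⟩, hu'⟩)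
  have hmem := hsub ⟨t, ht, rfl⟩
  rw [plaque_eq] at hmem
  obtain ⟨s, hs, he⟩ := hmem
  rw [← he, b.coord_line u (Ioo_subset_Icc_self hs)]
  exact ⟨hs, rfl⟩

/-- The change of coordinates from `a` to `b` is monotone on intervals. -/
lemma strictMonoOn_or_strictAntiOn {v : a.V} {r r' : ℝ} (hr : r < r')
    (hJ : Ioo r r' ⊆ Ioo (-1) 1) (h : a.line v '' Ioo r r' ⊆ b.core) :
    ContinuousOn (fun t => b.coord (a.line v t)) (Ioo r r') ∧
    (StrictMonoOn (fun t => b.coord (a.line v t)) (Ioo r r') ∨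
      StrictAntiOn (fun t => b.coord (a.line v t)) (Ioo r r')) := by
  have hc : ContinuousOn (fun t => b.coord (a.line v t)) (Ioo r r') :=
    b.continuousOn_coord.comp (a.continuous_line v).continuousOn
      fun t ht => b.core_subset_range (h ⟨t, ht, rfl⟩)
  refine ⟨hc, hc.strictMonoOn_of_injOn_Ioo hr fun s hs t ht he => ?_⟩
  obtain ⟨u, hu⟩ := a.exists_label b isPreconnected_Ioo (nonempty_Ioo.2 hr) h
  refine a.injOn_line v (Ioo_subset_Icc_self (hJ hs)) (Ioo_subset_Icc_self (hJ ht)) ?_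
  rw [← (hu s hs).2, ← (hu t ht).2]
  exact congrArg _ he

/-! ### Primitives along the plaques -/

/-- The primitive of the function `w` along the plaques of `b`. -/
noncomputable def prim (w : Y → ℝ) : Y → ℝ :=
  Function.extend b.toFun (fun p => ∫ s in (-1)..p.1.co, w (b.line p.2 s)) 0

lemma prim_line (w : Y → ℝ) (u : b.V) {t : ℝ} (ht : t ∈ Icc (-1 : ℝ) 1) :
    b.prim w (b.line u t) = ∫ s in (-1)..t, w (b.line u s) := by
  rw [prim, line, b.isClosedEmbedding.injective.extend_apply, Disc.co_pt ht]

lemma measurable_prim {w : Y → ℝ} (hw : Measurable w) : Measurable (b.prim w) := by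
  refine b.measurableEmbedding.measurable_extend ?_ measurable_const
  have hl : Measurable fun q : (Disc 1 × b.V) × ℝ => w (b.line q.1.2 q.2) :=
    hw.comp (b.measurableEmbedding.measurable.comp
      ((Disc.continuous_pt.measurable.comp measurable_snd).prodMk
        (measurable_snd.comp measurable_fst)))
  have hset : MeasurableSet {q : (Disc 1 × b.V) × ℝ | q.2 ∈ Ioc (-1) q.1.1.co} := by
    have h1 : Measurable fun q : (Disc 1 × b.V) × ℝ => q.1.1.co :=
      Disc.continuous_co.measurable.comp (measurable_fst.comp measurable_fst)
    exact (measurableSet_lt measurable_const measurable_snd).inter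
      (measurableSet_le measurable_snd h1)
  have h2 : Measurable fun p : Disc 1 × b.V => ∫ s, {q : (Disc 1 × b.V) × ℝ |
      q.2 ∈ Ioc (-1) q.1.1.co}.indicator (fun q => w (b.line q.1.2 q.2)) (p, s) :=
    (StronglyMeasurable.integral_prod_right (f := fun (p : Disc 1 × b.V) (s : ℝ) =>
      {q : (Disc 1 × b.V) × ℝ | q.2 ∈ Ioc (-1) q.1.1.co}.indicator
        (fun q => w (b.line q.1.2 q.2)) (p, s)) (hl.indicator hset).stronglyMeasurable).measurable
  convert h2 using 2 with p
  rw [intervalIntegral.integral_of_le p.1.co_mem.1, ← integral_indicator measurableSet_Ioc]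
  rfl

variable {b} in
lemma prim_sub {w : Y → ℝ} (hw : Continuous w) (u : b.V) {s t : ℝ} (hs : s ∈ Icc (-1 : ℝ) 1)
    (ht : t ∈ Icc (-1 : ℝ) 1) :
    b.prim w (b.line u t) - b.prim w (b.line u s) = ∫ x in s..t, w (b.line u x) := by
  have hi : ∀ x y, IntervalIntegrable (fun x => w (b.line u x)) volume x y := fun x y =>
    (hw.comp (b.continuous_line u)).intervalIntegrable x y
  rw [prim_line _ _ _ ht, prim_line _ _ _ hs, intervalIntegral.integral_interval_sub_left
    (hi _ _) (hi _ _)]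

variable {b} in
lemma prim_mono {w : Y → ℝ} (hw : Continuous w) (h0 : ∀ y, 0 ≤ w y) (u : b.V) :
    MonotoneOn (fun t => b.prim w (b.line u t)) (Icc (-1) 1) := fun s hs t ht hst => by
  have := prim_sub hw u hs ht
  have h1 : 0 ≤ ∫ x in s..t, w (b.line u x) :=
    intervalIntegral.integral_nonneg hst fun x _ => h0 _
  simp only
  linarith

variable {b} in
lemma prim_lt {w : Y → ℝ} (hw : Continuous w) (h0 : ∀ y, 0 ≤ w y) (u : b.V) {s t : ℝ}
    (hs : s ∈ Icc (-1 : ℝ) 1) (ht : t ∈ Icc (-1 : ℝ) 1) (hst : s < t)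
    (hpos : 0 < w (b.line u s)) : b.prim w (b.line u s) < b.prim w (b.line u t) := by
  have := prim_sub hw u hs ht
  have h1 : 0 < ∫ x in s..t, w (b.line u x) :=
    intervalIntegral.integral_pos hst (hw.comp (b.continuous_line u)).continuousOn
      (fun x _ => h0 _) ⟨s, ⟨le_rfl, hst.le⟩, hpos⟩
  linarith

variable {b} in
lemma hasDerivAt_prim {w : Y → ℝ} (hw : Continuous w) (u : b.V) {t : ℝ}
    (ht : t ∈ Ioo (-1 : ℝ) 1) :
    HasDerivAt (fun t => b.prim w (b.line u t)) (w (b.line u t)) t := by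
  have h := (hw.comp (b.continuous_line u)).integral_hasStrictDerivAt (-1) t
  refine h.hasDerivAt.congr_of_eventuallyEq ?_
  filter_upwards [isOpen_Ioo.mem_nhds ht] with s hs
  rw [prim_line _ _ _ (Ioo_subset_Icc_self hs)]
  rfl

end PrismChart

/-! ### The length atlas defined by a system of weights -/

section Weights

variable {Y : Type v} [TopologicalSpace Y] [MeasurableSpace Y]

/-- Locally finite Borel weights supported in the prisms of an atlas. -/
structure IsWeightSystem (b : ℕ → PrismChart 1 Y) (w : ℕ → Y → ℝ) : Prop where
  continuous : ∀ k, Continuous (w k)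
  measurable : ∀ k, Measurable (w k)
  nonneg : ∀ k y, 0 ≤ w k y
  core_or : ∀ k y, y ∈ (b k).core ∨ ∀ᶠ z in 𝓝 y, w k z = 0
  locallyFinite : ∀ y, ∃ m, ∀ᶠ z in 𝓝 y, ∀ k ≥ m, w k z = 0
  pos : ∀ y, ∃ k, 0 < w k y

/-- An interval in a plaque on which the weights outside `S` vanish, which is contained in the
prisms of `S`, and on which the weight `k₀` is positive. -/
structure IsLengthInterval (b : ℕ → PrismChart 1 Y) (w : ℕ → Y → ℝ) (i : ℕ) (v : (b i).V)
    (r r' : ℝ) (S : Finset ℕ) (k₀ : ℕ) : Prop where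
  lt : r < r'
  subset : Ioo r r' ⊆ Ioo (-1) 1
  zero : ∀ k ∉ S, ∀ t ∈ Ioo r r', w k ((b i).line v t) = 0
  core : ∀ k ∈ S, ∀ t ∈ Ioo r r', (b i).line v t ∈ (b k).core
  mem : k₀ ∈ S
  pos : ∀ t ∈ Ioo r r', 0 < w k₀ ((b i).line v t)

/-- The length coordinate with signs `σ`. -/
noncomputable def lengthCoord (b : ℕ → PrismChart 1 Y) (w : ℕ → Y → ℝ) (S : Finset ℕ) (σ : ℕ → ℝ)
    (z : Y) : ℝ := ∑ k ∈ S, σ k * (b k).prim (w k) z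

/-- The unsigned distance read in the prisms of `S`. -/
noncomputable def lengthDist (b : ℕ → PrismChart 1 Y) (w : ℕ → Y → ℝ) (S : Finset ℕ)
    (p : Y × Y) : ℝ := ∑ k ∈ S, |(b k).prim (w k) p.1 - (b k).prim (w k) p.2|

/-- The signs `σ` make the primitives increasing along the interval. -/
structure IsSigned (b : ℕ → PrismChart 1 Y) (w : ℕ → Y → ℝ) (i : ℕ) (v : (b i).V)
    (r r' : ℝ) (S : Finset ℕ) (σ : ℕ → ℝ) : Prop where
  sign : ∀ k, σ k = 1 ∨ σ k = -1
  mono : ∀ k ∈ S, MonotoneOn (fun t => σ k * (b k).prim (w k) ((b i).line v t)) (Ioo r r')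

/-- The length charts. -/
def lengthAtlas (b : ℕ → PrismChart 1 Y) (w : ℕ → Y → ℝ) : Set (Set Y × (Y → ℝ)) :=
  {q | ∃ i v r r' S k₀ σ, IsLengthInterval b w i v r r' S k₀ ∧ IsSigned b w i v r r' S σ ∧
    q = ((b i).line v '' Ioo r r', lengthCoord b w S σ)}

variable {b : ℕ → PrismChart 1 Y} {w : ℕ → Y → ℝ}

/-- Where a weight vanishes its primitive is locally constant. Hence a prism present in only one of
two overlapping length charts contributes nothing to distances there. -/
lemma PrismChart.eventually_prim_eq {b : PrismChart 1 Y} {w : Y → ℝ} (hw : Continuous w) {y : Y}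
    (hy : y ∈ b.core) (h0 : ∀ᶠ z in 𝓝 y, w z = 0) : ∀ᶠ z in 𝓝 y, b.prim w z = b.prim w y := by
  obtain ⟨u, t, ht, rfl⟩ := b.mem_core_iff_line.1 hy
  rw [← b.map_line_nhds u ht] at h0 ⊢
  rw [eventually_map] at h0 ⊢
  obtain ⟨ε, hε, hball⟩ := Metric.mem_nhds_iff.1 (inter_mem h0 (isOpen_Ioo.mem_nhds ht))
  filter_upwards [Metric.ball_mem_nhds t hε] with s hs
  have hsub : uIcc t s ⊆ Metric.ball t ε := by
    rw [Real.ball_eq_Ioo] at hs ⊢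
    exact ordConnected_Ioo.uIcc_subset ⟨by linarith, by linarith⟩ hs
  rw [← sub_eq_zero, PrismChart.prim_sub hw u (Ioo_subset_Icc_self ht)
    (Ioo_subset_Icc_self (hball hs).2)]
  exact intervalIntegral.integral_zero_ae
    (Eventually.of_forall fun x hx => (hball (hsub (uIoc_subset_uIcc hx))).1)

namespace IsLengthInterval
variable {i : ℕ} {v : (b i).V} {r r' : ℝ} {S : Finset ℕ} {k₀ : ℕ} {σ : ℕ → ℝ}

lemma core_subset (h : IsLengthInterval b w i v r r' S k₀) {k : ℕ} (hk : k ∈ S) :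
    (b i).line v '' Ioo r r' ⊆ (b k).core := by
  rintro _ ⟨t, ht, rfl⟩
  exact h.core k hk t ht

lemma continuousOn_prim (h : IsLengthInterval b w i v r r' S k₀) (hw : IsWeightSystem b w) {k : ℕ}
    (hk : k ∈ S) : ContinuousOn (fun t => (b k).prim (w k) ((b i).line v t)) (Ioo r r') := by
  obtain ⟨u, hu⟩ := (b i).exists_label (b k) isPreconnected_Ioo (nonempty_Ioo.2 h.lt)
    (h.core_subset hk)
  have hτ := ((b i).strictMonoOn_or_strictAntiOn (b k) h.lt h.subset (h.core_subset hk)).1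
  have h1 : ContinuousOn (fun t => (b k).prim (w k) ((b k).line u t)) (Ioo (-1) 1) := fun t ht =>
    (PrismChart.hasDerivAt_prim (hw.continuous k) u ht).continuousAt.continuousWithinAt
  refine (h1.comp hτ fun t ht => (hu t ht).1).congr fun t ht => ?_
  simp only [Function.comp_apply, (hu t ht).2]

lemma exists_isSigned (h : IsLengthInterval b w i v r r' S k₀) (hw : IsWeightSystem b w) :
    ∃ σ, IsSigned b w i v r r' S σ := by
  have key : ∀ k, ∃ σ : ℝ, (σ = 1 ∨ σ = -1) ∧ (k ∈ S →
      MonotoneOn (fun t => σ * (b k).prim (w k) ((b i).line v t)) (Ioo r r')) := by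
    intro k
    by_cases hk : k ∈ S
    swap
    · exact ⟨1, Or.inl rfl, fun h => (hk h).elim⟩
    obtain ⟨u, hu⟩ := (b i).exists_label (b k) isPreconnected_Ioo (nonempty_Ioo.2 h.lt)
      (h.core_subset hk)
    have hm := PrismChart.prim_mono (b := b k) (hw.continuous k) (hw.nonneg k) u
    rcases ((b i).strictMonoOn_or_strictAntiOn (b k) h.lt h.subset (h.core_subset hk)).2 with hτ | hτ
    · refine ⟨1, Or.inl rfl, fun _ s hs t ht hst => ?_⟩
      have := hm (Ioo_subset_Icc_self (hu s hs).1) (Ioo_subset_Icc_self (hu t ht).1)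
        (hτ.monotoneOn hs ht hst)
      simp only [(hu s hs).2, (hu t ht).2] at this
      simpa using this
    · refine ⟨-1, Or.inr rfl, fun _ s hs t ht hst => ?_⟩
      have := hm (Ioo_subset_Icc_self (hu t ht).1) (Ioo_subset_Icc_self (hu s hs).1)
        (hτ.antitoneOn hs ht hst)
      simp only [(hu s hs).2, (hu t ht).2] at this
      simpa using this
  choose σ hσ hmono using key
  exact ⟨σ, hσ, hmono⟩

lemma prim_ne (h : IsLengthInterval b w i v r r' S k₀) (hw : IsWeightSystem b w) {s t : ℝ}
    (hs : s ∈ Ioo r r') (ht : t ∈ Ioo r r') (hst : s ≠ t) :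
    (b k₀).prim (w k₀) ((b i).line v s) ≠ (b k₀).prim (w k₀) ((b i).line v t) := by
  obtain ⟨u, hu⟩ := (b i).exists_label (b k₀) isPreconnected_Ioo (nonempty_Ioo.2 h.lt)
    (h.core_subset h.mem)
  have key : ∀ s ∈ Ioo r r', ∀ t ∈ Ioo r r',
      (b k₀).coord ((b i).line v s) < (b k₀).coord ((b i).line v t) →
      (b k₀).prim (w k₀) ((b i).line v s) < (b k₀).prim (w k₀) ((b i).line v t) := by
    intro s hs t ht hlt
    have := PrismChart.prim_lt (hw.continuous k₀) (hw.nonneg k₀) u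
      (Ioo_subset_Icc_self (hu s hs).1) (Ioo_subset_Icc_self (hu t ht).1) hlt
      (by rw [(hu s hs).2]; exact h.pos s hs)
    rwa [(hu s hs).2, (hu t ht).2] at this
  have hne : (b k₀).coord ((b i).line v s) ≠ (b k₀).coord ((b i).line v t) := fun e => hst
    ((b i).injOn_line v (Ioo_subset_Icc_self (h.subset hs)) (Ioo_subset_Icc_self (h.subset ht))
      (by rw [← (hu s hs).2, e, (hu t ht).2]))
  rcases hne.lt_or_gt with hlt | hlt
  · exact (key s hs t ht hlt).ne
  · exact (key t ht s hs hlt).ne'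

lemma strictMonoOn (h : IsLengthInterval b w i v r r' S k₀) (hw : IsWeightSystem b w)
    (hσ : IsSigned b w i v r r' S σ) :
    StrictMonoOn (fun t => lengthCoord b w S σ ((b i).line v t)) (Ioo r r') := by
  intro s hs t ht hst
  refine Finset.sum_lt_sum (fun k hk => hσ.mono k hk hs ht hst.le) ⟨k₀, h.mem, ?_⟩
  refine lt_of_le_of_ne (hσ.mono k₀ h.mem hs ht hst.le) fun e => ?_
  refine h.prim_ne hw hs ht hst.ne (mul_left_cancel₀ (a := σ k₀) ?_ e)
  rcases hσ.sign k₀ with h1 | h1 <;> rw [h1] <;> norm_num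

lemma continuousOn (h : IsLengthInterval b w i v r r' S k₀) (hw : IsWeightSystem b w) :
    ContinuousOn (fun t => lengthCoord b w S σ ((b i).line v t)) (Ioo r r') :=
  continuousOn_finsetSum _ fun _ hk => (h.continuousOn_prim hw hk).const_mul _

/-- With the chosen signs all primitives are nondecreasing along the interval, so their differences
have a common sign and the absolute value of the sum is the sum of the absolute values. The left
side involves no choice of signs, which is what allows it to be Borel. -/
lemma lengthDist_eq (hσ : IsSigned b w i v r r' S σ) {y y' : Y}
    (hy : y ∈ (b i).line v '' Ioo r r') (hy' : y' ∈ (b i).line v '' Ioo r r') :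
    lengthDist b w S (y, y') = |lengthCoord b w S σ y - lengthCoord b w S σ y'| := by
  obtain ⟨s, hs, rfl⟩ := hy
  obtain ⟨t, ht, rfl⟩ := hy'
  have habs : ∀ k, ∀ x : ℝ, |x| = |σ k * x| := fun k x => by
    rw [abs_mul, abs_sign (hσ.sign k), one_mul]
  have hd : lengthCoord b w S σ ((b i).line v s) - lengthCoord b w S σ ((b i).line v t) =
      ∑ k ∈ S, σ k * ((b k).prim (w k) ((b i).line v s) - (b k).prim (w k) ((b i).line v t)) := by
    unfold lengthCoord
    rw [← Finset.sum_sub_distrib]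
    exact Finset.sum_congr rfl fun k _ => by ring
  rw [hd]
  unfold lengthDist
  rcases le_total s t with hst | hst
  · have hle : ∀ k ∈ S,
        σ k * ((b k).prim (w k) ((b i).line v s) - (b k).prim (w k) ((b i).line v t)) ≤ 0 := by
      intro k hk
      have := hσ.mono k hk hs ht hst
      simp only at this
      linarith
    rw [abs_of_nonpos (Finset.sum_nonpos hle), ← Finset.sum_neg_distrib]
    exact Finset.sum_congr rfl fun k hk => by rw [habs k, abs_of_nonpos (hle k hk)]
  · have hle : ∀ k ∈ S,
        0 ≤ σ k * ((b k).prim (w k) ((b i).line v s) - (b k).prim (w k) ((b i).line v t)) := by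
      intro k hk
      have := hσ.mono k hk ht hs hst
      simp only at this
      linarith
    rw [abs_of_nonneg (Finset.sum_nonneg hle)]
    exact Finset.sum_congr rfl fun k hk => by rw [habs k, abs_of_nonneg (hle k hk)]

lemma isOpen (h : IsLengthInterval b w i v r r' S k₀) : IsOpen ((b i).line v '' Ioo r r') :=
  (b i).isOpen_line_image v isOpen_Ioo h.subset

/-- For `k` in `S` but not in `S'`, the weight vanishes on the second interval and its primitive is
constant near `y`. Only the common prisms count, so the two charts measure the same distance. -/
lemma lengthDist_sub {i' : ℕ} {v' : (b i').V} {s s' : ℝ} {S' : Finset ℕ} {k₀' : ℕ}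
    (h : IsLengthInterval b w i v r r' S k₀) (h' : IsLengthInterval b w i' v' s s' S' k₀')
    (hw : IsWeightSystem b w) {y : Y} (hy : y ∈ (b i).line v '' Ioo r r')
    (hy' : y ∈ (b i').line v' '' Ioo s s') :
    ∀ᶠ z in 𝓝 y, lengthDist b w S (z, y) = lengthDist b w (S ∩ S') (z, y) := by
  have key : ∀ k ∈ S, ∀ᶠ z in 𝓝 y, k ∉ S' → (b k).prim (w k) z = (b k).prim (w k) y := by
    intro k hk
    by_cases hk' : k ∈ S'
    · exact Eventually.of_forall fun z hz => (hz hk').elim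
    · refine (PrismChart.eventually_prim_eq (hw.continuous k) (h.core_subset hk hy) ?_).mono
        fun z hz _ => hz
      filter_upwards [h'.isOpen.mem_nhds hy']
      rintro _ ⟨t, ht, rfl⟩
      exact h'.zero k hk' t ht
  filter_upwards [(Filter.eventually_all_finset S).2 key] with z hz
  refine (Finset.sum_subset Finset.inter_subset_left fun k hk hkn => ?_).symm
  have : k ∉ S' := fun hk' => hkn (Finset.mem_inter.2 ⟨hk, hk'⟩)
  simp only
  rw [hz k hk this, sub_self, abs_zero]

end IsLengthInterval

lemma StrictMonoOn.isOpen_image_of_continuousOn {f : ℝ → ℝ} {r r' : ℝ}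
    (hf : StrictMonoOn f (Ioo r r')) (hc : ContinuousOn f (Ioo r r')) {O : Set ℝ} (hO : IsOpen O)
    (hsub : O ⊆ Ioo r r') : IsOpen (f '' O) := by
  rw [isOpen_iff_mem_nhds]
  rintro _ ⟨t, ht, rfl⟩
  obtain ⟨ε, hε, hball⟩ := Metric.isOpen_iff.1 hO t ht
  rw [Real.ball_eq_Ioo] at hball
  have hI : Icc (t - ε / 2) (t + ε / 2) ⊆ O := fun s hs => hball ⟨by linarith [hs.1], by linarith [hs.2]⟩
  have ha : t - ε / 2 ∈ O := hI ⟨le_rfl, by linarith⟩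
  have hb : t + ε / 2 ∈ O := hI ⟨by linarith, le_rfl⟩
  have h1 := intermediate_value_Icc (by linarith) (hc.mono (hI.trans hsub))
  refine mem_of_superset (Icc_mem_nhds (hf (hsub ha) (hsub ht) (by linarith))
    (hf (hsub ht) (hsub hb) (by linarith))) (h1.trans (image_mono hI))

/-- Take for `S` the indices below the bound of local finiteness whose core contains `y`. An omitted
index either lies beyond the bound or has `y` outside its core; in both cases its weight vanishes
near `y`. -/
theorem IsWeightSystem.exists_isLengthInterval (hw : IsWeightSystem b w) (y : Y) :
    ∃ (S : Finset ℕ) (k₀ : ℕ), k₀ ∈ S ∧ 0 < w k₀ y ∧ (∀ k ∈ S, y ∈ (b k).core) ∧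
      ∀ᶠ z in 𝓝 y, ∀ k ∉ S, w k z = 0 := by
  classical
  obtain ⟨m, hm⟩ := hw.locallyFinite y
  obtain ⟨k₀, hk₀⟩ := hw.pos y
  have hcore : y ∈ (b k₀).core := (hw.core_or k₀ y).resolve_right fun h =>
    hk₀.ne' h.self_of_nhds
  have hlt : k₀ < m := lt_of_not_ge fun h => hk₀.ne' (hm.self_of_nhds k₀ h)
  refine ⟨(Finset.range m).filter fun k => y ∈ (b k).core, k₀, by simp [hlt, hcore], hk₀,
    fun k hk => (Finset.mem_filter.1 hk).2, ?_⟩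
  have h1 : ∀ᶠ z in 𝓝 y, ∀ k ∈ Finset.range m, y ∉ (b k).core → w k z = 0 := by
    refine (Filter.eventually_all_finset _).2 fun k _ => ?_
    rcases hw.core_or k y with h | h
    · exact Eventually.of_forall fun z hz => (hz h).elim
    · exact h.mono fun z hz _ => hz
  filter_upwards [hm, h1] with z hz hz' k hk
  rcases le_or_gt m k with hmk | hmk
  · exact hz k hmk
  · exact hz' k (Finset.mem_range.2 hmk) fun hc =>
      hk (Finset.mem_filter.2 ⟨Finset.mem_range.2 hmk, hc⟩)

theorem IsWeightSystem.isLengthAtlas (hw : IsWeightSystem b w) :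
    IsLengthAtlas (lengthAtlas b w) where
  isOpen := by
    rintro _ ⟨i, v, r, r', S, k₀, σ, h, hσ, rfl⟩
    exact h.isOpen
  isPreconnected := by
    rintro _ ⟨i, v, r, r', S, k₀, σ, h, hσ, rfl⟩
    exact isPreconnected_Ioo.image _ ((b i).continuous_line v).continuousOn
  injOn := by
    rintro _ ⟨i, v, r, r', S, k₀, σ, h, hσ, rfl⟩
    rintro _ ⟨s, hs, rfl⟩ _ ⟨t, ht, rfl⟩ he
    rw [(h.strictMonoOn hw hσ).injOn hs ht he]
  continuousOn := by
    rintro _ ⟨i, v, r, r', S, k₀, σ, h, hσ, rfl⟩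
    rintro _ ⟨t, ht, rfl⟩
    refine ContinuousAt.continuousWithinAt ?_
    have h1 := ((h.continuousOn hw (σ := σ)).continuousAt (isOpen_Ioo.mem_nhds ht)).tendsto
    rw [ContinuousAt, ← (b i).map_line_nhds v (h.subset ht), tendsto_map'_iff]
    exact h1
  isOpen_image := by
    rintro _ ⟨i, v, r, r', S, k₀, σ, h, hσ, rfl⟩ O hO hOo
    have := StrictMonoOn.isOpen_image_of_continuousOn (h.strictMonoOn hw hσ) (h.continuousOn hw)
      ((hOo.preimage ((b i).continuous_line v)).inter isOpen_Ioo) inter_subset_right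
    convert this using 1
    ext x
    constructor
    · rintro ⟨y, hy, rfl⟩
      obtain ⟨t, ht, rfl⟩ := hO hy
      exact ⟨t, ⟨hy, ht⟩, rfl⟩
    · rintro ⟨t, ⟨ht, -⟩, rfl⟩
      exact ⟨_, ht, rfl⟩
  compat := by
    rintro _ ⟨i, v, r, r', S, k₀, σ, h, hσ, rfl⟩ _ ⟨i', v', s, s', S', k₀', σ', h', hσ', rfl⟩ y hy hy'
    have hd := h.lengthDist_sub h' hw hy hy'
    have hd' := h'.lengthDist_sub h hw hy' hy
    rw [Finset.inter_comm] at hd'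
    -- The two coordinates measure equal distances to `y`. Both are continuous and injective along
    -- the plaque, hence monotone, so the sign relating them is the same on both sides of `y`.
    have habs : ∀ᶠ z in 𝓝 y, |lengthCoord b w S' σ' z - lengthCoord b w S' σ' y| =
        |lengthCoord b w S σ z - lengthCoord b w S σ y| := by
      filter_upwards [hd, hd', h.isOpen.mem_nhds hy, h'.isOpen.mem_nhds hy'] with z h1 h2 h3 h4
      rw [← IsLengthInterval.lengthDist_eq hσ h3 hy, ← IsLengthInterval.lengthDist_eq hσ' h4 hy',
        h1, h2]
    have hmem' := h'.isOpen.mem_nhds hy'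
    obtain ⟨t, ht, rfl⟩ := hy
    rw [← (b i).map_line_nhds v (h.subset ht)] at habs hmem' ⊢
    rw [eventually_map] at habs
    simp only [eventually_map]
    obtain ⟨ε, hε, hball⟩ := Metric.mem_nhds_iff.1
      (inter_mem (inter_mem habs (mem_map.1 hmem')) (isOpen_Ioo.mem_nhds ht))
    rw [Real.ball_eq_Ioo] at hball
    have htε : t ∈ Ioo (t - ε) (t + ε) := ⟨by linarith, by linarith⟩
    have hA := (h.strictMonoOn hw hσ).mono fun x hx => (hball hx).2
    have hc' : ContinuousOn (fun x => lengthCoord b w S' σ' ((b i).line v x))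
        (Ioo (t - ε) (t + ε)) := by
      intro x hx
      refine ContinuousAt.continuousWithinAt ?_
      obtain ⟨t', ht', he⟩ : (b i).line v x ∈ (b i').line v' '' Ioo s s' := (hball hx).1.2
      have h1 := ((h'.continuousOn hw (σ := σ')).continuousAt (isOpen_Ioo.mem_nhds ht')).tendsto
      have h2 : Tendsto (lengthCoord b w S' σ') (𝓝 ((b i).line v x))
          (𝓝 (lengthCoord b w S' σ' ((b i).line v x))) := by
        rw [← he, ← (b i').map_line_nhds v' (h'.subset ht'), tendsto_map'_iff]
        exact h1
      exact h2.comp ((b i).continuous_line v).continuousAt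
    have hinj' : InjOn (fun x => lengthCoord b w S' σ' ((b i).line v x))
        (Ioo (t - ε) (t + ε)) := by
      intro x hx x' hx' he
      refine (b i).injOn_line v (Ioo_subset_Icc_self (h.subset (hball hx).2))
        (Ioo_subset_Icc_self (h.subset (hball hx').2)) ?_
      obtain ⟨t1, ht1, he1⟩ : (b i).line v x ∈ (b i').line v' '' Ioo s s' := (hball hx).1.2
      obtain ⟨t2, ht2, he2⟩ : (b i).line v x' ∈ (b i').line v' '' Ioo s s' := (hball hx').1.2
      simp only at he
      rw [← he1, ← he2] at he ⊢
      rw [(h'.strictMonoOn hw hσ').injOn ht1 ht2 he]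
    -- The first coordinate increases along the plaque; the sign is positive or negative according
    -- to the monotonicity of the second.
    rcases hc'.strictMonoOn_of_injOn_Ioo (by linarith) hinj' with hB | hB
    · refine ⟨1, Or.inl rfl, ?_⟩
      filter_upwards [isOpen_Ioo.mem_nhds htε] with x hx
      have e := (hball hx).1.1
      simp only [mem_ofPred_eq] at e
      rcases le_total x t with hxt | hxt
      · have h1 := hA.monotoneOn hx htε hxt
        have h2 := hB.monotoneOn hx htε hxt
        rw [abs_of_nonpos (by linarith), abs_of_nonpos (by linarith)] at e
        linarith
      · have h1 := hA.monotoneOn htε hx hxt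
        have h2 := hB.monotoneOn htε hx hxt
        rw [abs_of_nonneg (by linarith), abs_of_nonneg (by linarith)] at e
        linarith
    · refine ⟨-1, Or.inr rfl, ?_⟩
      filter_upwards [isOpen_Ioo.mem_nhds htε] with x hx
      have e := (hball hx).1.1
      simp only [mem_ofPred_eq] at e
      rcases le_total x t with hxt | hxt
      · have h1 := hA.monotoneOn hx htε hxt
        have h2 := hB.antitoneOn hx htε hxt
        rw [abs_of_nonneg (by linarith), abs_of_nonpos (by linarith)] at e
        linarith
      · have h1 := hA.monotoneOn htε hx hxt
        have h2 := hB.antitoneOn htε hx hxt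
        rw [abs_of_nonpos (by linarith), abs_of_nonneg (by linarith)] at e
        linarith
  cover := by
    intro y
    obtain ⟨S, k₀, hk₀, hpos, hcore, hzero⟩ := hw.exists_isLengthInterval y
    obtain ⟨u, t, ht, rfl⟩ := (b k₀).mem_core_iff_line.1 (hcore k₀ hk₀)
    have h1 : ∀ᶠ z in 𝓝 ((b k₀).line u t), ∀ k ∈ S, z ∈ (b k).core :=
      (Filter.eventually_all_finset S).2 fun k hk => (b k).isOpen_core.mem_nhds (hcore k hk)
    have h2 : ∀ᶠ z in 𝓝 ((b k₀).line u t), 0 < w k₀ z :=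
      (hw.continuous k₀).continuousAt.eventually (lt_mem_nhds hpos)
    have h3 := ((b k₀).continuous_line u).continuousAt.eventually (h1.and (h2.and hzero))
    obtain ⟨ε, hε, hball⟩ := Metric.mem_nhds_iff.1 (inter_mem h3 (isOpen_Ioo.mem_nhds ht))
    rw [Real.ball_eq_Ioo] at hball
    have hI : IsLengthInterval b w k₀ u (t - ε) (t + ε) S k₀ :=
      ⟨by linarith, fun x hx => (hball hx).2, fun k hk x hx => (hball hx).1.2.2 k hk,
        fun k hk x hx => (hball hx).1.1 k hk, hk₀, fun x hx => (hball hx).1.2.1⟩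
    obtain ⟨σ, hσ⟩ := hI.exists_isSigned hw
    exact ⟨_, ⟨k₀, u, _, _, S, k₀, σ, hI, hσ, rfl⟩, t, ⟨by linarith, by linarith⟩, rfl⟩

end Weights

section

variable {Y : Type v} [TopologicalSpace Y] [MeasurableSpace Y]

/-! ### Weights attached to an atlas -/

namespace PrismChart
variable (b : PrismChart 1 Y)

/-- The square of the coordinate, extended by `1` outside the prism. -/
noncomputable def sq : Y → ℝ := Function.extend b.toFun (fun p => p.1.co ^ 2) 1

lemma sq_apply (p : Disc 1 × b.V) : b.sq (b.toFun p) = p.1.co ^ 2 :=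
  b.isClosedEmbedding.injective.extend_apply _ _ _

lemma sq_le_one (y : Y) : b.sq y ≤ 1 := by
  by_cases hy : ∃ p, b.toFun p = y
  · obtain ⟨p, rfl⟩ := hy
    rw [sq_apply, sq_le_one_iff_abs_le_one, abs_le]
    exact p.1.co_mem
  · rw [sq, Function.extend_apply' _ _ _ hy]
    exact le_rfl

lemma mem_core_iff_sq {y : Y} : y ∈ b.core ↔ b.sq y < 1 := by
  constructor
  · rintro ⟨p, hp, rfl⟩
    rw [sq_apply, sq_lt_one_iff_abs_lt_one, ← Disc.norm_eq]
    exact hp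
  · intro h
    by_cases hy : ∃ p, b.toFun p = y
    · obtain ⟨p, rfl⟩ := hy
      rw [sq_apply, sq_lt_one_iff_abs_lt_one, ← Disc.norm_eq] at h
      exact ⟨p, h, rfl⟩
    · rw [sq, Function.extend_apply' _ _ _ hy] at h
      exact (lt_irrefl _ h).elim

lemma measurable_sq : Measurable b.sq :=
  b.measurableEmbedding.measurable_extend
    ((Disc.continuous_co.measurable.comp measurable_fst).pow_const 2) measurable_const

/-- The closed prism and the complement of its core are two closed sets covering the space. The
function is continuous on the first and equal to `1` on the second. -/
lemma continuous_sq : Continuous b.sq := by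
  have h1 : ContinuousOn b.sq (range b.toFun) := by
    refine b.continuousOn_range ?_
    rw [show b.sq ∘ b.toFun = fun p => p.1.co ^ 2 from funext b.sq_apply]
    exact (Disc.continuous_co.comp continuous_fst).pow 2
  have h2 : ContinuousOn b.sq b.coreᶜ :=
    (continuousOn_const (c := (1 : ℝ))).congr fun y hy =>
      le_antisymm (b.sq_le_one y) (not_lt.1 fun h => hy (b.mem_core_iff_sq.2 h))
  have h3 := h1.union_of_isClosed h2 b.isClosedEmbedding.isClosed_range b.isOpen_core.isClosed_compl
  rw [← continuousOn_univ]
  refine h3.mono fun y _ => ?_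
  by_cases hy : y ∈ b.core
  · exact Or.inl (b.core_subset_range hy)
  · exact Or.inr hy

end PrismChart

/-- The cutoff function numbered `k` of the atlas `φ`. -/
noncomputable def cutoff (φ : ℕ → PrismChart 1 Y) (k : ℕ) (y : Y) : ℝ :=
  Real.smoothTransition (k.unpair.2 * (1 - (φ k.unpair.1).sq y) - 1)

/-- The weights of the atlas `φ`. -/
noncomputable def weight (φ : ℕ → PrismChart 1 Y) (k : ℕ) (y : Y) : ℝ :=
  cutoff φ k y * ∏ j ∈ Finset.range k, (1 - cutoff φ j y)

variable {φ : ℕ → PrismChart 1 Y}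

/-- If `k` codes `(i, m)`, the cutoff vanishes where `m * (1 - sq) ≤ 1` and equals one where `m * (1
- sq) ≥ 2`. Its support thus stays inside the core of prism `i`, and the cutoffs equal to one cover
that core as `m` grows. -/
lemma eventually_cutoff_eq_zero {k : ℕ} {y : Y} (hy : y ∉ (φ k.unpair.1).core) :
    ∀ᶠ z in 𝓝 y, cutoff φ k z = 0 := by
  have hy1 : (φ k.unpair.1).sq y = 1 :=
    le_antisymm ((φ _).sq_le_one y) (not_lt.1 fun h => hy ((φ _).mem_core_iff_sq.2 h))
  have hc : Continuous fun z => (k.unpair.2 : ℝ) * (1 - (φ k.unpair.1).sq z) - 1 := by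
    have := (φ k.unpair.1).continuous_sq
    fun_prop
  have h0 : (k.unpair.2 : ℝ) * (1 - (φ k.unpair.1).sq y) - 1 < 0 := by rw [hy1]; norm_num
  filter_upwards [hc.continuousAt.eventually (gt_mem_nhds h0)] with z hz
  exact Real.smoothTransition.zero_of_nonpos hz.le

lemma exists_cutoff_eq_one (hφ : ∀ y, ∃ i, y ∈ (φ i).core) (y : Y) :
    ∃ k, ∀ᶠ z in 𝓝 y, cutoff φ k z = 1 := by
  obtain ⟨i, hi⟩ := hφ y
  have hlt := (φ i).mem_core_iff_sq.1 hi
  obtain ⟨m, hm⟩ := exists_nat_gt (2 / (1 - (φ i).sq y))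
  refine ⟨Nat.pair i m, ?_⟩
  have hc : Continuous fun z => (m : ℝ) * (1 - (φ i).sq z) - 1 := by
    have := (φ i).continuous_sq
    fun_prop
  have h1 : 1 < (m : ℝ) * (1 - (φ i).sq y) - 1 := by
    rw [div_lt_iff₀ (by linarith)] at hm
    linarith
  filter_upwards [hc.continuousAt.eventually (lt_mem_nhds h1)] with z hz
  simp only [cutoff, Nat.unpair_pair]
  exact Real.smoothTransition.one_of_one_le hz.le

lemma continuous_cutoff (k : ℕ) : Continuous (cutoff φ k) := by
  have := (φ k.unpair.1).continuous_sq
  exact Real.smoothTransition.continuous.comp (by fun_prop)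

lemma measurable_cutoff (k : ℕ) : Measurable (cutoff φ k) := by
  have := (φ k.unpair.1).measurable_sq
  exact Real.smoothTransition.continuous.measurable.comp (by fun_prop)

/-- The factor `∏ j < k, (1 - cutoff j)` kills all weights after the first cutoff that equals one
near `y`, which gives local finiteness. It is equal to one at the first index where a cutoff is
positive, which gives positivity. -/
theorem isWeightSystem (hφ : ∀ y, ∃ i, y ∈ (φ i).core) :
    IsWeightSystem (fun k => φ k.unpair.1) (weight φ) where
  continuous k := (continuous_cutoff k).mul
    (continuous_finsetProd _ fun j _ => continuous_const.sub (continuous_cutoff j))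
  measurable k := (measurable_cutoff k).mul
    (Finset.measurable_fun_prod _ fun j _ => measurable_const.sub (measurable_cutoff j))
  nonneg k y := mul_nonneg (Real.smoothTransition.nonneg _)
    (Finset.prod_nonneg fun j _ => sub_nonneg.2 (Real.smoothTransition.le_one _))
  core_or k y := by
    by_cases hy : y ∈ (φ k.unpair.1).core
    · exact Or.inl hy
    · refine Or.inr ((eventually_cutoff_eq_zero hy).mono fun z hz => ?_)
      rw [weight, hz, zero_mul]
  locallyFinite y := by
    obtain ⟨k, hk⟩ := exists_cutoff_eq_one hφ y
    refine ⟨k + 1, hk.mono fun z hz l hl => ?_⟩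
    rw [weight, Finset.prod_eq_zero (i := k) (Finset.mem_range.2 (by omega)) (by rw [hz, sub_self]),
      mul_zero]
  pos y := by
    classical
    have hex : ∃ k, 0 < cutoff φ k y := by
      obtain ⟨k, hk⟩ := exists_cutoff_eq_one hφ y
      exact ⟨k, by rw [hk.self_of_nhds]; norm_num⟩
    refine ⟨Nat.find hex, ?_⟩
    have hone : ∏ j ∈ Finset.range (Nat.find hex), (1 - cutoff φ j y) = 1 := by
      refine Finset.prod_eq_one fun j hj => ?_
      have h0 : cutoff φ j y = 0 := le_antisymm
        (not_lt.1 (Nat.find_min hex (Finset.mem_range.1 hj))) (Real.smoothTransition.nonneg _)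
      rw [h0, sub_zero]
    rw [weight, hone, mul_one]
    exact Nat.find_spec hex

/-! ### Borel length atlases -/

/-- A length atlas described by countably many Borel sets and functions. -/
structure IsBorelLengthAtlas (𝒩 : Set (Set Y × (Y → ℝ))) (R : ℕ → Set (Y × Y))
    (D : ℕ → Y × Y → ℝ) : Prop where
  isLengthAtlas : IsLengthAtlas 𝒩
  measurableSet : ∀ j, MeasurableSet (R j)
  measurable : ∀ j, Measurable (D j)
  exists_chart : ∀ j y y', (y, y') ∈ R j → ∃ q ∈ 𝒩, y ∈ q.1 ∧ y' ∈ q.1 ∧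
    D j (y, y') = |q.2 y - q.2 y'|
  exists_index : ∀ z, ∃ j, ∃ q ∈ 𝒩, z ∈ q.1 ∧ ∀ y ∈ q.1, ∀ y' ∈ q.1, (y, y') ∈ R j ∧
    D j (y, y') = |q.2 y - q.2 y'|

/-- The plaques of `a` are smooth regular curves in the length coordinates. -/
def SmoothAlong (𝒩 : Set (Set Y × (Y → ℝ))) (a : PrismChart 1 Y) : Prop :=
  ∀ v, ∀ t ∈ Ioo (-1 : ℝ) 1, ∃ q ∈ 𝒩, a.line v t ∈ q.1 ∧
    ContDiffAt ℝ ((⊤ : ℕ∞) : WithTop ℕ∞) (fun s => q.2 (a.line v s)) t ∧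
    deriv (fun s => q.2 (a.line v s)) t ≠ 0

section Good

variable (b : ℕ → PrismChart 1 Y) (w : ℕ → Y → ℝ)

/-- A closed condition on points implying the conditions of `IsLengthInterval`. -/
def goodPoints (S : Finset ℕ) (k₀ l : ℕ) : Set Y :=
  (⋂ k, ⋂ _ : k ∉ S, {y | w k y = 0}) ∩ (⋂ k ∈ S, {y | (b k).sq y ≤ 1 - 1 / (l + 1 : ℝ)}) ∩
    {y | 1 / (l + 1 : ℝ) ≤ w k₀ y}

variable {b w}

lemma mem_goodPoints {S : Finset ℕ} {k₀ l : ℕ} {y : Y} : y ∈ goodPoints b w S k₀ l ↔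
    (∀ k ∉ S, w k y = 0) ∧ (∀ k ∈ S, (b k).sq y ≤ 1 - 1 / (l + 1 : ℝ)) ∧
      1 / (l + 1 : ℝ) ≤ w k₀ y := by
  simp only [goodPoints, mem_inter_iff, mem_iInter, mem_ofPred_eq, and_assoc]

lemma isClosed_goodPoints (hw : IsWeightSystem b w) (S : Finset ℕ) (k₀ l : ℕ) :
    IsClosed (goodPoints b w S k₀ l) := by
  refine ((isClosed_iInter fun k => isClosed_iInter fun _ =>
    isClosed_eq (hw.continuous k) continuous_const).inter (isClosed_iInter fun k =>
    isClosed_iInter fun _ => isClosed_le (b k).continuous_sq continuous_const)).inter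
    (isClosed_le continuous_const (hw.continuous k₀))

lemma measurableSet_goodPoints (hw : IsWeightSystem b w) (S : Finset ℕ) (k₀ l : ℕ) :
    MeasurableSet (goodPoints b w S k₀ l) := by
  refine ((MeasurableSet.iInter fun k => MeasurableSet.iInter fun _ =>
    measurableSet_eq_fun (hw.measurable k) measurable_const).inter (MeasurableSet.iInter fun k =>
    MeasurableSet.iInter fun _ => measurableSet_le (b k).measurable_sq measurable_const)).inter
    (measurableSet_le measurable_const (hw.measurable k₀))

/-- A closed condition along an interval need only be tested at its rational points; this is why
`goodPoints` uses wide inequalities. -/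
lemma measurableSet_forall_line (a : PrismChart 1 Y) {F : Set Y} (hF : IsClosed F)
    (hFm : MeasurableSet F) (r r' : ℝ) :
    MeasurableSet {v : a.V | ∀ t ∈ Ioo r r', a.line v t ∈ F} := by
  have : {v : a.V | ∀ t ∈ Ioo r r', a.line v t ∈ F} =
      ⋂ q : ℚ, {v | (q : ℝ) ∈ Ioo r r' → a.line v q ∈ F} := by
    ext v
    simp only [mem_ofPred_eq, mem_iInter]
    refine ⟨fun h q hq => h q hq, fun h t ht => ?_⟩
    have h1 : t ∈ closure (Ioo r r' ∩ range ((↑) : ℚ → ℝ)) :=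
      isOpen_Ioo.inter_closure ⟨ht, Rat.denseRange_cast (𝕜 := ℝ) t⟩
    refine closure_minimal ?_ (hF.preimage (a.continuous_line v)) h1
    rintro _ ⟨hq, q, rfl⟩
    exact h q hq
  rw [this]
  refine MeasurableSet.iInter fun q => MeasurableSet.imp (MeasurableSet.const _) ?_
  exact (a.measurableEmbedding.measurable.comp measurable_prodMk_left) hFm

lemma isLengthInterval_of_goodPoints {i : ℕ} {v : (b i).V} {r r' : ℝ} {S : Finset ℕ} {k₀ l : ℕ}
    (hr : r < r') (hJ : Ioo r r' ⊆ Ioo (-1) 1) (hk : k₀ ∈ S)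
    (h : ∀ t ∈ Ioo r r', (b i).line v t ∈ goodPoints b w S k₀ l) :
    IsLengthInterval b w i v r r' S k₀ := by
  have hl : (0 : ℝ) < 1 / (l + 1) := by positivity
  refine ⟨hr, hJ, fun k hk t ht => (mem_goodPoints.1 (h t ht)).1 k hk, fun k hk t ht => ?_, hk,
    fun t ht => hl.trans_le (mem_goodPoints.1 (h t ht)).2.2⟩
  rw [PrismChart.mem_core_iff_sq]
  linarith [(mem_goodPoints.1 (h t ht)).2.1 k hk]

/-- The strict conditions at a point leave room for a margin `1 / (l + 1)` and for rational
endpoints, so countably many codes describe enough length intervals to cover all the plaques. -/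
lemma exists_goodPoints (hw : IsWeightSystem b w) (i : ℕ) (v : (b i).V) {t : ℝ}
    (ht : t ∈ Ioo (-1 : ℝ) 1) : ∃ (r r' : ℚ) (S : Finset ℕ) (k₀ l : ℕ), t ∈ Ioo (r : ℝ) r' ∧
      Ioo (r : ℝ) r' ⊆ Ioo (-1) 1 ∧ k₀ ∈ S ∧
      ∀ s ∈ Ioo (r : ℝ) r', (b i).line v s ∈ goodPoints b w S k₀ l := by
  obtain ⟨S, k₀, hk₀, hpos, hcore, hzero⟩ := hw.exists_isLengthInterval ((b i).line v t)
  have hlim : Tendsto (fun l : ℕ => 1 / ((l : ℝ) + 1)) atTop (𝓝 0) :=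
    tendsto_one_div_add_atTop_nhds_zero_nat
  have h1 : ∀ᶠ l : ℕ in atTop, ∀ k ∈ S, 1 / ((l : ℝ) + 1) < 1 - (b k).sq ((b i).line v t) :=
    (Filter.eventually_all_finset S).2 fun k hk => hlim.eventually
      (gt_mem_nhds (sub_pos.2 ((b k).mem_core_iff_sq.1 (hcore k hk))))
  obtain ⟨l, hl, hl'⟩ := (h1.and (hlim.eventually (gt_mem_nhds hpos))).exists
  have h2 : ∀ᶠ z in 𝓝 ((b i).line v t), z ∈ goodPoints b w S k₀ l := by
    have h3 : ∀ᶠ z in 𝓝 ((b i).line v t), ∀ k ∈ S, (b k).sq z < 1 - 1 / ((l : ℝ) + 1) :=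
      (Filter.eventually_all_finset S).2 fun k hk =>
        (b k).continuous_sq.continuousAt.eventually (gt_mem_nhds (by linarith [hl k hk]))
    filter_upwards [hzero, h3, (hw.continuous k₀).continuousAt.eventually (lt_mem_nhds hl')]
      with z hz1 hz2 hz3
    exact mem_goodPoints.2 ⟨hz1, fun k hk => (hz2 k hk).le, hz3.le⟩
  have h4 := ((b i).continuous_line v).continuousAt.eventually h2
  obtain ⟨ε, hε, hball⟩ := Metric.mem_nhds_iff.1 (inter_mem h4 (isOpen_Ioo.mem_nhds ht))
  rw [Real.ball_eq_Ioo] at hball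
  obtain ⟨r, hr, hr'⟩ := exists_rat_btwn (show t - ε < t by linarith)
  obtain ⟨q, hq, hq'⟩ := exists_rat_btwn (show t < t + ε by linarith)
  have hsub : Ioo (r : ℝ) q ⊆ Ioo (t - ε) (t + ε) := Ioo_subset_Ioo hr.le hq'.le
  exact ⟨r, q, S, k₀, l, ⟨hr', hq⟩, fun s hs => (hball (hsub hs)).2, hk₀,
    fun s hs => (hball (hsub hs)).1⟩

/-- Pairs of points of a common good interval. -/
def goodPairs (b : ℕ → PrismChart 1 Y) (w : ℕ → Y → ℝ) (i : ℕ) (r r' : ℝ) (S : Finset ℕ)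
    (k₀ l : ℕ) : Set (Y × Y) :=
  Prod.map (b i).toFun (b i).toFun '' {p | (Ioo r r' ⊆ Ioo (-1) 1 ∧ k₀ ∈ S) ∧ p.1.2 = p.2.2 ∧
    p.1.1.co ∈ Ioo r r' ∧ p.2.1.co ∈ Ioo r r' ∧
    p.1.2 ∈ {v | ∀ t ∈ Ioo r r', (b i).line v t ∈ goodPoints b w S k₀ l}}

lemma measurableSet_goodPairs (hw : IsWeightSystem b w) (i : ℕ) (r r' : ℝ) (S : Finset ℕ)
    (k₀ l : ℕ) : MeasurableSet (goodPairs b w i r r' S k₀ l) := by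
  refine ((b i).measurableEmbedding.prodMap (b i).measurableEmbedding).measurableSet_image.2 ?_
  have h1 : Measurable fun p : (Disc 1 × (b i).V) × (Disc 1 × (b i).V) => p.1.1.co :=
    Disc.continuous_co.measurable.comp (measurable_fst.comp measurable_fst)
  have h2 : Measurable fun p : (Disc 1 × (b i).V) × (Disc 1 × (b i).V) => p.2.1.co :=
    Disc.continuous_co.measurable.comp (measurable_fst.comp measurable_snd)
  have h3 : Measurable fun p : (Disc 1 × (b i).V) × (Disc 1 × (b i).V) => p.1.2 :=
    measurable_snd.comp measurable_fst
  exact (MeasurableSet.const _).inter ((measurableSet_eq_fun (by fun_prop) (by fun_prop)).inter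
    ((h1 measurableSet_Ioo).inter ((h2 measurableSet_Ioo).inter
    (h3 (measurableSet_forall_line _ (isClosed_goodPoints hw S k₀ l)
      (measurableSet_goodPoints hw S k₀ l) r r')))))

/-- Only the unsigned distance is recorded, so no Borel choice of signs is needed. The sets `R j`
run over the countably many codes of good intervals. -/
theorem IsWeightSystem.exists_isBorelLengthAtlas (hw : IsWeightSystem b w) :
    ∃ R D, IsBorelLengthAtlas (lengthAtlas b w) R D := by
  obtain ⟨e, he⟩ := exists_surjective_nat (ℕ × ℚ × ℚ × Finset ℕ × ℕ × ℕ)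
  refine ⟨fun j => goodPairs b w (e j).1 (e j).2.1 (e j).2.2.1 (e j).2.2.2.1 (e j).2.2.2.2.1
    (e j).2.2.2.2.2, fun j => lengthDist b w (e j).2.2.2.1, hw.isLengthAtlas,
    fun j => measurableSet_goodPairs hw _ _ _ _ _ _, fun j => ?_, fun j => ?_, fun z => ?_⟩
  · unfold lengthDist
    refine Finset.measurable_fun_sum _ fun k _ => ?_
    have := (b k).measurable_prim (hw.measurable k)
    exact ((this.comp measurable_fst).sub (this.comp measurable_snd)).abs
  · obtain ⟨i, r, r', S, k₀, l⟩ := e j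
    rintro _ _ ⟨⟨⟨p, v⟩, ⟨p', v'⟩⟩, ⟨⟨hJ, hk⟩, hv, hp, hp', hgood⟩, ⟨rfl, rfl⟩⟩
    simp only at hJ hk hv hp hp' hgood ⊢
    subst hv
    have hI := isLengthInterval_of_goodPoints (hp.1.trans hp.2) hJ hk hgood
    obtain ⟨σ, hσ⟩ := hI.exists_isSigned hw
    have h1 : (b i).toFun (p, v) ∈ (b i).line v '' Ioo (r : ℝ) r' := ⟨_, hp, (b i).line_co p v⟩
    have h2 : (b i).toFun (p', v) ∈ (b i).line v '' Ioo (r : ℝ) r' := ⟨_, hp', (b i).line_co p' v⟩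
    exact ⟨_, ⟨i, v, _, _, S, k₀, σ, hI, hσ, rfl⟩, h1, h2, IsLengthInterval.lengthDist_eq hσ h1 h2⟩
  · obtain ⟨k, hk⟩ := hw.pos z
    have hz : z ∈ (b k).core := (hw.core_or k z).resolve_right fun h => hk.ne' h.self_of_nhds
    obtain ⟨v, t, ht, rfl⟩ := (b k).mem_core_iff_line.1 hz
    obtain ⟨r, r', S, k₀, l, htr, hJ, hk₀, hgood⟩ := exists_goodPoints hw k v ht
    have hI := isLengthInterval_of_goodPoints (htr.1.trans htr.2) hJ hk₀ hgood
    obtain ⟨σ, hσ⟩ := hI.exists_isSigned hw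
    obtain ⟨j, hj⟩ := he (k, r, r', S, k₀, l)
    refine ⟨j, _, ⟨k, v, _, _, S, k₀, σ, hI, hσ, rfl⟩, ⟨t, htr, rfl⟩, ?_⟩
    intro y hy y' hy'
    rw [hj]
    refine ⟨?_, IsLengthInterval.lengthDist_eq hσ hy hy'⟩
    obtain ⟨s, hs, rfl⟩ := hy
    obtain ⟨s', hs', rfl⟩ := hy'
    refine ⟨((Disc.pt s, v), (Disc.pt s', v)), ⟨⟨hJ, hk₀⟩, rfl, ?_, ?_, hgood⟩, rfl⟩
    · simp only
      rw [Disc.co_pt (Ioo_subset_Icc_self (hJ hs))]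
      exact hs
    · simp only
      rw [Disc.co_pt (Ioo_subset_Icc_self (hJ hs'))]
      exact hs'

end Good

end

open scoped ContDiff

/-! ### Smoothness along the leaves -/

/-- By the inverse function theorem `h` has a smooth local inverse, and `y` is locally that inverse
composed with `h ∘ y`. -/
lemma ContDiffAt.of_comp_left {h y : ℝ → ℝ} {x : ℝ} (hh : ContDiffAt ℝ ∞ h (y x))
    (hd : deriv h (y x) ≠ 0) (hy : ContinuousAt y x) (hc : ContDiffAt ℝ ∞ (fun s => h (y s)) x) :
    ContDiffAt ℝ ∞ y x := by
  have hder : HasFDerivAt h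
      ((ContinuousLinearEquiv.unitsEquivAut ℝ (Units.mk0 _ hd) : ℝ ≃L[ℝ] ℝ) : ℝ →L[ℝ] ℝ) (y x) :=
    (hh.differentiableAt (by simp)).hasDerivAt.hasFDerivAt_equiv hd
  have hs := hh.hasStrictFDerivAt' hder (by simp)
  have hinv := hh.to_localInverse hder (by simp)
  have hleft := hs.eventually_left_inverse
  refine ContDiffAt.congr_of_eventuallyEq (ContDiffAt.comp x hinv hc) ?_
  filter_upwards [hy.eventually hleft] with s hs
  exact hs.symm

section

variable {X : Type u} [TopologicalSpace X] [MeasurableSpace X]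
  {Y : Type v} [TopologicalSpace Y] [MeasurableSpace Y]

/-- An atlas whose changes of coordinates are smooth along the plaques. -/
def SmoothAtlas (φ : ℕ → PrismChart 1 Y) : Prop :=
  ∀ i j v, ∀ t ∈ Ioo (-1 : ℝ) 1, (φ i).line v t ∈ (φ j).core →
    ContDiffAt ℝ ∞ (fun s => (φ j).coord ((φ i).line v s)) t

lemma smoothInCharts_of_contDiffAt {a : PrismChart 1 X} {b : PrismChart 1 Y} {R : X → Y → Prop}
    (h : ∀ s t, ∃ f : ℝ → ℝ, ∀ x ∈ Ioo (-1 : ℝ) 1, ∀ y ∈ Ioo (-1 : ℝ) 1,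
      R (a.line s x) (b.line t y) → ContDiffAt ℝ ∞ f x ∧ f x = y) : SmoothInCharts a b R := by
  intro s t
  obtain ⟨f, hf⟩ := h s t
  have key : ∀ p q : Disc 1, ‖(p : EuclideanSpace ℝ (Fin 1))‖ < 1 →
      ‖(q : EuclideanSpace ℝ (Fin 1))‖ < 1 → R (a.toFun (p, s)) (b.toFun (q, t)) →
      ContDiffAt ℝ ∞ f p.co ∧ f p.co = q.co := by
    intro p q hp hq hR
    rw [← a.line_co, ← b.line_co] at hR
    exact hf _ (p.norm_lt_one_iff.1 hp) _ (q.norm_lt_one_iff.1 hq) hR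
  refine ⟨fun d => EuclideanSpace.single 0 (f (d 0)), ?_, ?_⟩
  · rintro _ ⟨p, q, hp, hq, hR, rfl⟩
    refine ContDiffAt.contDiffWithinAt ?_
    rw [contDiffAt_euclidean]
    intro i
    rw [Subsingleton.elim i 0]
    simp only [PiLp.single_apply, if_true]
    refine ContDiffAt.comp (g := f) (f := fun d : EuclideanSpace ℝ (Fin 1) => d 0) _
      (key p q hp hq hR).1 ?_
    exact (EuclideanSpace.proj (𝕜 := ℝ) (0 : Fin 1)).contDiff.contDiffAt
  · intro p q hp hq hR
    ext i
    rw [Subsingleton.elim i 0]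
    simp only [PiLp.single_apply, if_true]
    exact (key p q hp hq hR).2

lemma contDiffAt_of_smoothInCharts {a b : PrismChart 1 Y}
    (h : SmoothInCharts a b fun x y => x = y) {v : a.V} {t : ℝ} (ht : t ∈ Ioo (-1 : ℝ) 1)
    (htb : a.line v t ∈ b.core) : ContDiffAt ℝ ∞ (fun s => b.coord (a.line v s)) t := by
  obtain ⟨u, hu⟩ := b.mem_core_iff.1 htb
  obtain ⟨g, hg, hgp⟩ := h v u
  have hmem : ∀ᶠ s in 𝓝 t, s ∈ Ioo (-1 : ℝ) 1 ∧ a.line v s ∈ b.plaque u :=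
    (isOpen_Ioo.eventually_mem ht).and
      ((a.continuous_line v).continuousAt.eventually ((b.isOpen_plaque u).mem_nhds hu))
  have hex : ∀ s, s ∈ Ioo (-1 : ℝ) 1 → a.line v s ∈ b.plaque u →
      ‖((Disc.pt s : Disc 1) : EuclideanSpace ℝ (Fin 1))‖ < 1 ∧
      ∃ q : Disc 1, ‖(q : EuclideanSpace ℝ (Fin 1))‖ < 1 ∧
        a.toFun (Disc.pt s, v) = b.toFun (q, u) := by
    intro s hs hsu
    refine ⟨?_, ?_⟩
    · rw [Disc.norm_lt_one_iff, Disc.co_pt (Ioo_subset_Icc_self hs)]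
      exact hs
    · obtain ⟨⟨q, u'⟩, ⟨hq, hu'⟩, he⟩ := hsu
      simp only at hq hu'
      subst hu'
      exact ⟨q, hq, he.symm⟩
  have hpt : ∀ s ∈ Ioo (-1 : ℝ) 1,
      ((Disc.pt s : Disc 1) : EuclideanSpace ℝ (Fin 1)) = EuclideanSpace.single 0 s := by
    intro s hs
    simp [Disc.pt, hs.1.le, hs.2.le]
  have hcs : ContDiff ℝ ∞ fun s : ℝ => (EuclideanSpace.single 0 s : EuclideanSpace ℝ (Fin 1)) := by
    rw [contDiff_euclidean]
    intro i
    rw [Subsingleton.elim i 0]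
    simp only [PiLp.single_apply, if_true]
    exact contDiff_id
  have hnhds : {d : EuclideanSpace ℝ (Fin 1) | ∃ (p : Disc 1) (q : Disc 1),
      ‖(p : EuclideanSpace ℝ (Fin 1))‖ < 1 ∧ ‖(q : EuclideanSpace ℝ (Fin 1))‖ < 1 ∧
      a.toFun (p, v) = b.toFun (q, u) ∧ (p : _) = d} ∈
      𝓝 (EuclideanSpace.single 0 t : EuclideanSpace ℝ (Fin 1)) := by
    have hc0 : ContinuousAt (fun d : EuclideanSpace ℝ (Fin 1) => d 0) (EuclideanSpace.single 0 t) := by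
      fun_prop
    have h0 : (EuclideanSpace.single 0 t : EuclideanSpace ℝ (Fin 1)) 0 = t := by simp
    rw [ContinuousAt, h0] at hc0
    filter_upwards [hc0.eventually hmem] with d hd
    obtain ⟨hp, q, hq, he⟩ := hex _ hd.1 hd.2
    refine ⟨_, q, hp, hq, he, ?_⟩
    rw [hpt _ hd.1]
    ext i
    rw [Subsingleton.elim i 0]
    simp
  have hgc : ContDiffAt ℝ ∞ (fun s : ℝ => g (EuclideanSpace.single 0 s) 0) t := by
    have h1 := ContDiffAt.comp t (hg.contDiffAt hnhds) hcs.contDiffAt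
    exact contDiffAt_euclidean.1 h1 0
  refine hgc.congr_of_eventuallyEq ?_
  filter_upwards [hmem] with s hs
  obtain ⟨hp, q, hq, he⟩ := hex _ hs.1 hs.2
  have h1 := hgp _ q hp hq he
  rw [PrismChart.line, he, PrismChart.coord_apply, Disc.co, ← hpt s hs.1, h1]

lemma LeafwiseSmoothStructure.smoothAtlas (𝒜 : LeafwiseSmoothStructure 1 Y) :
    SmoothAtlas 𝒜.chart := fun i j _ _ ht htb => contDiffAt_of_smoothInCharts (𝒜.smooth i j) ht htb

variable {φ : ℕ → PrismChart 1 Y}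

/-- Inside the core of its prism a cutoff is a smooth function of a smooth coordinate; outside the
core it vanishes near the point. -/
lemma SmoothAtlas.contDiffAt_weight (hs : SmoothAtlas φ) (i k : ℕ) (v : (φ i).V) {t : ℝ}
    (ht : t ∈ Ioo (-1 : ℝ) 1) : ContDiffAt ℝ ∞ (fun s => weight φ k ((φ i).line v s)) t := by
  have hcut : ∀ k, ContDiffAt ℝ ∞ (fun s => cutoff φ k ((φ i).line v s)) t := by
    intro k
    by_cases hk : (φ i).line v t ∈ (φ k.unpair.1).core
    · have h1 := hs i k.unpair.1 v t ht hk
      have h2 : ContDiffAt ℝ ∞ (fun s => Real.smoothTransition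
          (k.unpair.2 * (1 - (φ k.unpair.1).coord ((φ i).line v s) ^ 2) - 1)) t := by
        refine ContDiffAt.comp t (g := Real.smoothTransition)
          (Real.smoothTransition.contDiff (n := ⊤)).contDiffAt ?_
        exact (contDiffAt_const.mul (contDiffAt_const.sub (h1.pow 2))).sub contDiffAt_const
      refine h2.congr_of_eventuallyEq ?_
      filter_upwards [((φ i).continuous_line v).continuousAt.eventually
        ((φ k.unpair.1).isOpen_core.mem_nhds hk)] with s hsk
      obtain ⟨p, -, hp⟩ := hsk
      rw [cutoff, ← hp, PrismChart.sq_apply, PrismChart.coord_apply]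
    · refine (contDiffAt_const (c := (0 : ℝ))).congr_of_eventuallyEq ?_
      exact ((φ i).continuous_line v).continuousAt.eventually (eventually_cutoff_eq_zero hk)
  unfold weight
  exact (hcut k).mul (contDiffAt_prod fun j _ => contDiffAt_const.sub (hcut j))

lemma SmoothAtlas.contDiffAt_prim (hs : SmoothAtlas φ) (hφ : ∀ y, ∃ i, y ∈ (φ i).core) (i k : ℕ)
    (v : (φ i).V) {t : ℝ} (ht : t ∈ Ioo (-1 : ℝ) 1)
    (htk : (φ i).line v t ∈ (φ k.unpair.1).core) :
    ContDiffAt ℝ ∞ (fun s => (φ k.unpair.1).prim (weight φ k) ((φ i).line v s)) t ∧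
      (0 < weight φ k ((φ i).line v t) →
        deriv (fun s => (φ k.unpair.1).prim (weight φ k) ((φ i).line v s)) t ≠ 0) := by
  have hw := isWeightSystem hφ
  have hb := hs i k.unpair.1 v t ht htk
  have hb' := hs k.unpair.1 i
  set b := φ k.unpair.1
  obtain ⟨u, hu⟩ := b.mem_core_iff.1 htk
  have hmem : ∀ᶠ s in 𝓝 t, (s ∈ Ioo (-1 : ℝ) 1 ∧ b.coord ((φ i).line v s) ∈ Ioo (-1 : ℝ) 1) ∧
      b.line u (b.coord ((φ i).line v s)) = (φ i).line v s := by
    filter_upwards [isOpen_Ioo.mem_nhds ht, ((φ i).continuous_line v).continuousAt.eventually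
      ((b.isOpen_plaque u).mem_nhds hu)] with s hs1 hs2
    replace hs2 : (φ i).line v s ∈ b.plaque u := hs2
    rw [b.plaque_eq] at hs2
    obtain ⟨x, hx, he⟩ := hs2
    rw [← he, b.coord_line u (Ioo_subset_Icc_self hx)]
    exact ⟨⟨hs1, hx⟩, rfl⟩
  have hP : ContDiffOn ℝ ∞ (fun s => b.prim (weight φ k) (b.line u s)) (Ioo (-1) 1) := by
    rw [contDiffOn_infty_iff_deriv_of_isOpen isOpen_Ioo]
    have hd : ∀ s ∈ Ioo (-1 : ℝ) 1, HasDerivAt (fun s => b.prim (weight φ k) (b.line u s))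
      (weight φ k (b.line u s)) s := fun s hs => PrismChart.hasDerivAt_prim (hw.continuous k) u hs
    refine ⟨fun s hs => (hd s hs).differentiableAt.differentiableWithinAt, fun s hs' => ?_⟩
    refine (hs.contDiffAt_weight k.unpair.1 k u hs').contDiffWithinAt.congr
      (fun x hx => (hd x hx).deriv) (hd s hs').deriv
  have hm := hmem.self_of_nhds
  have heq : (fun s => b.prim (weight φ k) ((φ i).line v s)) =ᶠ[𝓝 t]
      fun s => b.prim (weight φ k) (b.line u (b.coord ((φ i).line v s))) := by
    filter_upwards [hmem] with s hs
    rw [hs.2]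
  constructor
  · refine ContDiffAt.congr_of_eventuallyEq ?_ heq
    exact ContDiffAt.comp (g := fun s => b.prim (weight φ k) (b.line u s)) t
      (hP.contDiffAt (isOpen_Ioo.mem_nhds hm.1.2)) hb
  · intro hpos
    rw [heq.deriv_eq]
    have h1 := (hb.differentiableAt (by simp)).hasDerivAt
    have h2 := (PrismChart.hasDerivAt_prim (hw.continuous k) u hm.1.2).comp t h1
    rw [show (fun s => b.prim (weight φ k) (b.line u (b.coord ((φ i).line v s)))) =
      (fun s => b.prim (weight φ k) (b.line u s)) ∘ fun s => b.coord ((φ i).line v s) from rfl,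
      h2.deriv, hm.2]
    refine mul_ne_zero hpos.ne' fun h0 => ?_
    -- The reverse change of coordinates is smooth too. By the chain rule the product of the two
    -- derivatives is one, so neither vanishes.
    have h3 := hb' u _ hm.1.2 (by rw [hm.2]; exact (φ i).line_mem_core v ht)
    have h4 := (h3.differentiableAt (by simp)).hasDerivAt.comp t h1
    rw [h0, mul_zero] at h4
    have h5 : ((fun s => (φ i).coord (b.line u s)) ∘ fun s => b.coord ((φ i).line v s)) =ᶠ[𝓝 t]
        id := by
      filter_upwards [hmem] with s hs
      rw [Function.comp_apply, hs.2, (φ i).coord_line v (Ioo_subset_Icc_self hs.1.1)]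
      rfl
    exact zero_ne_one ((h4.congr_of_eventuallyEq h5.symm).unique (hasDerivAt_id t))

/-- The signs make every term of the length coordinate nondecreasing, hence of nonnegative
derivative, and the term `k₀`, whose weight is positive, has nonzero derivative. No cancellation can
occur. -/
theorem SmoothAtlas.smoothAlong (hs : SmoothAtlas φ) (hφ : ∀ y, ∃ i, y ∈ (φ i).core) (i : ℕ) :
    SmoothAlong (lengthAtlas (fun k => φ k.unpair.1) (weight φ)) (φ i) := by
  have hw := isWeightSystem hφ
  -- Length charts are indexed by codes of pairs, so the prism `i` has to appear as the first
  -- component of a code.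
  obtain ⟨m, rfl⟩ : ∃ m : ℕ, m.unpair.1 = i := ⟨Nat.pair i 0, by simp⟩
  intro v t ht
  obtain ⟨r, r', S, k₀, l, htr, hJ, hk₀, hgood⟩ := exists_goodPoints hw m v ht
  have hI := isLengthInterval_of_goodPoints (htr.1.trans htr.2) hJ hk₀ hgood
  obtain ⟨σ, hσ⟩ := hI.exists_isSigned hw
  have hp := fun k hk => hs.contDiffAt_prim hφ m.unpair.1 k v ht (hI.core k hk t htr)
  refine ⟨_, ⟨m, v, _, _, S, k₀, σ, hI, hσ, rfl⟩, ⟨t, htr, rfl⟩, ?_, ?_⟩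
  · exact ContDiffAt.sum fun k hk => contDiffAt_const.mul (hp k hk).1
  · have hd : ∀ k ∈ S, DifferentiableAt ℝ (fun s => σ k *
        (φ k.unpair.1).prim (weight φ k) ((φ m.unpair.1).line v s)) t := fun k hk =>
      (contDiffAt_const.mul (hp k hk).1).differentiableAt (by simp)
    unfold lengthCoord
    rw [deriv_fun_sum hd]
    refine (Finset.sum_pos' (fun k hk => ?_) ⟨k₀, hk₀, ?_⟩).ne'
    · rw [← derivWithin_of_isOpen isOpen_Ioo htr]
      exact (hσ.mono k hk).derivWithin_nonneg
    · refine lt_of_le_of_ne ?_ (Ne.symm ?_)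
      · rw [← derivWithin_of_isOpen isOpen_Ioo htr]
        exact (hσ.mono k₀ hk₀).derivWithin_nonneg
      · rw [deriv_const_mul _ ((hp k₀ hk₀).1.differentiableAt (by simp))]
        refine mul_ne_zero ?_ ((hp k₀ hk₀).2 (hI.pos t htr))
        rcases hσ.sign k₀ with h | h <;> rw [h] <;> norm_num

/-- The plaques of a smooth atlas are smooth regular curves in the leaf parameters. -/
theorem IsLeafParam.contDiffAt_invFun {𝒩 : Set (Set Y × (Y → ℝ))} (h𝒩 : IsLengthAtlas 𝒩)
    {C : ℝ → Y} (h : IsLeafParam 𝒩 C) {a : PrismChart 1 Y} (ha : SmoothAlong 𝒩 a) {v : a.V}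
    {t : ℝ} (ht : t ∈ Ioo (-1 : ℝ) 1) (hr : a.line v t ∈ range C) :
    ContDiffAt ℝ ∞ (fun s => Function.invFun C (a.line v s)) t ∧
      deriv (fun s => Function.invFun C (a.line v s)) t ≠ 0 := by
  have hinj := h.injective
  obtain ⟨J, c, hc, hCc⟩ := h
  rw [IsLeafParam.range_eq_image hc hCc] at hr
  obtain ⟨s₀, hs₀, hcs⟩ := hr
  obtain ⟨q, hq, hyq, hqc, hqd⟩ := ha v t ht
  obtain ⟨q', hq', hyq', σ, hσ, hev⟩ := hc.unitAt s₀ hs₀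
  rw [hcs] at hyq' hev
  obtain ⟨σ', hσ', hcomp⟩ := h𝒩.compat q hq q' hq' _ hyq hyq'
  -- The unit speed equation of `c` in `q'`, solved for the parameter and rewritten in the smooth
  -- chart `q`: near `t`, `c (f s)` is the point `a.line v s`.
  let f : ℝ → ℝ := fun s => s₀ + σ * σ' * (q.2 (a.line v s) - q.2 (a.line v t))
  have hf0 : f t = s₀ := by simp [f]
  have hfc : ContDiffAt ℝ ∞ f t :=
    contDiffAt_const.add (contDiffAt_const.mul (hqc.sub contDiffAt_const))
  have hfd : HasDerivAt f (σ * σ' * deriv (fun s => q.2 (a.line v s)) t) t :=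
    (((hqc.differentiableAt (by simp)).hasDerivAt.sub_const _).const_mul _).const_add _
  have hft : Tendsto f (𝓝 t) (𝓝 s₀) := by
    have := hfc.continuousAt.tendsto
    rwa [hf0] at this
  have heq : (fun s => Function.invFun C (a.line v s)) =ᶠ[𝓝 t] fun s => stretch J (f s) := by
    filter_upwards [hft.eventually hev, hft.eventually (hc.isOpen.mem_nhds hs₀),
      (a.continuous_line v).continuousAt.eventually hcomp,
      (a.continuous_line v).continuousAt.eventually ((h𝒩.isOpen q' hq').mem_nhds hyq')]
      with s h1 h2 h3 h4
    have h5 : c (f s) = a.line v s := by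
      refine h𝒩.injOn q' hq' h1.1 h4 ?_
      rw [h1.2]
      have e := mul_self_sign hσ
      simp only [f]
      linear_combination (σ' * (q.2 (a.line v s) - q.2 (a.line v t))) * e - h3
    rw [← h5, ← hCc _ h2, Function.leftInverse_invFun hinj]
  obtain ⟨d, hd, hder⟩ := hasDerivAt_stretch hc.isOpen hs₀
  constructor
  · refine ContDiffAt.congr_of_eventuallyEq ?_ heq
    refine ContDiffAt.comp t (g := stretch J) ?_ hfc
    rw [hf0]
    exact contDiffAt_stretch hc.isOpen hs₀
  · rw [heq.deriv_eq]
    rw [← hf0] at hder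
    have h1 := hder.comp t hfd
    rw [show (fun s => stretch J (f s)) = stretch J ∘ f from rfl, h1.deriv]
    refine mul_ne_zero hd.ne' (mul_ne_zero ?_ hqd)
    rcases sign_mul hσ hσ' with h | h <;> rw [h] <;> norm_num

end

/-! ### The canonical leafwise homeomorphism between two collapses -/

section Corr

variable {X Y₀ Y₁ : Type*} [TopologicalSpace X]
  {p₀ : X → Y₀} {p₁ : X → Y₁} {C₀ : ℝ → Y₀} {C₁ : ℝ → Y₁} {x : X}

/-- The correspondence between the lines `C₀` and `C₁` defined by the leaf of `x`. -/
def corr (p₀ : X → Y₀) (p₁ : X → Y₁) (C₀ : ℝ → Y₀) (C₁ : ℝ → Y₁) (x : X) : Set (ℝ × ℝ) :=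
  {z | ∃ ξ ∈ connectedComponent x, C₀ z.1 = p₀ ξ ∧ C₁ z.2 = p₁ ξ}

lemma corr_swap : corr p₁ p₀ C₁ C₀ x = Prod.swap '' corr p₀ p₁ C₀ C₁ x := by
  ext ⟨a, b⟩
  constructor
  · rintro ⟨ξ, hξ, h1, h0⟩
    exact ⟨(b, a), ⟨ξ, hξ, h0, h1⟩, rfl⟩
  · rintro ⟨⟨b, a⟩, ⟨ξ, hξ, h0, h1⟩, h⟩
    simp only [Prod.swap_prod_mk, Prod.mk.injEq] at h
    obtain ⟨rfl, rfl⟩ := h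
    exact ⟨ξ, hξ, h1, h0⟩

lemma corr_affine {σ σ' : ℝ} (hσ : σ = 1 ∨ σ = -1) (hσ' : σ' = 1 ∨ σ' = -1) (τ τ' : ℝ) :
    corr p₀ p₁ (fun t => C₀ (σ * t + τ)) (fun t => C₁ (σ' * t + τ')) x =
      (fun z : ℝ × ℝ => (σ * z.1 + -σ * τ, σ' * z.2 + -σ' * τ')) '' corr p₀ p₁ C₀ C₁ x := by
  have e := mul_self_sign hσ
  have e' := mul_self_sign hσ'
  ext ⟨a, b⟩
  constructor
  · rintro ⟨ξ, hξ, h0, h1⟩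
    refine ⟨(σ * a + τ, σ' * b + τ'), ⟨ξ, hξ, h0, h1⟩, ?_⟩
    simp only [Prod.mk.injEq]
    constructor
    · linear_combination a * e
    · linear_combination b * e'
  · rintro ⟨⟨s, r⟩, ⟨ξ, hξ, h0, h1⟩, h⟩
    simp only [Prod.mk.injEq] at h h0 h1
    obtain ⟨rfl, rfl⟩ := h
    refine ⟨ξ, hξ, ?_, ?_⟩
    · simp only
      rw [← h0]; congr 1; linear_combination s * e - τ * e
    · simp only
      rw [← h1]; congr 1; linear_combination r * e' - τ' * e'

lemma corr_congr {x' : X} (h : connectedComponent x = connectedComponent x') :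
    corr p₀ p₁ C₀ C₁ x = corr p₀ p₁ C₀ C₁ x' := by
  unfold corr; rw [h]

lemma corr_of_orbit {g : ℕ → X → X}
    (hgc : ∀ k x, g k x ∈ connectedComponent x) {a b : ℕ → ℝ}
    (ha : ∀ k, C₀ (a k) = p₀ (g k x)) (hb : ∀ k, C₁ (b k) = p₁ (g k x)) :
    (range fun k => (a k, b k)) ⊆ corr p₀ p₁ C₀ C₁ x := by
  rintro _ ⟨k, rfl⟩
  exact ⟨g k x, hgc k x, ha k, hb k⟩

variable [TopologicalSpace Y₀]

/-- In the parameter the image of the leaf is connected, hence an interval, and matching of the ends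
makes it unbounded in both directions. -/
lemma image_connectedComponent_of_corr (hC : Topology.IsOpenEmbedding C₀)
    (hr : range C₀ = connectedComponent (p₀ x)) (hp : ContinuousOn p₀ (connectedComponent x))
    (hZ : EndsMatched (corr p₀ p₁ C₀ C₁ x)) :
    p₀ '' connectedComponent x = connectedComponent (p₀ x) := by
  have hconn := isPreconnected_connectedComponent.image _ hp
  have hsub := hconn.subset_connectedComponent ⟨x, mem_connectedComponent, rfl⟩
  refine Subset.antisymm hsub ?_
  have hconn' : IsPreconnected (C₀ ⁻¹' (p₀ '' connectedComponent x)) :=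
    hconn.preimage_of_isOpenMap hC.injective hC.isOpenMap (hsub.trans hr.symm.subset)
  rw [← hr]
  rintro _ ⟨s, rfl⟩
  obtain ⟨z, ⟨ξ, hξ, h1, -⟩, hz⟩ := hZ.fst_above s
  obtain ⟨z', ⟨ξ', hξ', h1', -⟩, hz'⟩ := hZ.fst_below s
  exact hconn'.ordConnected.out (show z'.1 ∈ C₀ ⁻¹' _ from ⟨ξ', hξ', h1'.symm⟩)
    (show z.1 ∈ C₀ ⁻¹' _ from ⟨ξ, hξ, h1.symm⟩) ⟨hz', hz⟩

variable [TopologicalSpace Y₁]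

/-- Two maps onto foliations by lines, with fibres in the leaves, which match the ends of the
leaves in the same way. -/
structure EndsCompatible (p₀ : X → Y₀) (p₁ : X → Y₁) : Prop where
  continuous_fst : Continuous p₀
  continuous_snd : Continuous p₁
  surjective_fst : Function.Surjective p₀
  surjective_snd : Function.Surjective p₁
  leaf_fst : ∀ x x', p₀ x = p₀ x' → connectedComponent x = connectedComponent x'
  leaf_snd : ∀ x x', p₁ x = p₁ x' → connectedComponent x = connectedComponent x'
  noncompact_fst : ∀ y : Y₀, ¬ IsCompact (connectedComponent y)
  noncompact_snd : ∀ y : Y₁, ¬ IsCompact (connectedComponent y)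
  ends : ∀ x C₀ C₁, Topology.IsOpenEmbedding C₀ → range C₀ = connectedComponent (p₀ x) →
    Topology.IsOpenEmbedding C₁ → range C₁ = connectedComponent (p₁ x) →
    EndsMatched (corr p₀ p₁ C₀ C₁ x) ∨
      EndsMatched (corr p₀ p₁ C₀ (fun t => C₁ (-1 * t + 0)) x)

lemma EndsCompatible.swap (h : EndsCompatible p₀ p₁) : EndsCompatible p₁ p₀ where
  continuous_fst := h.continuous_snd
  continuous_snd := h.continuous_fst
  surjective_fst := h.surjective_snd
  surjective_snd := h.surjective_fst
  leaf_fst := h.leaf_snd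
  leaf_snd := h.leaf_fst
  noncompact_fst := h.noncompact_snd
  noncompact_snd := h.noncompact_fst
  ends x C₁ C₀ h1 hr1 h0 hr0 := by
    rcases h.ends x C₀ C₁ h0 hr0 h1 hr1 with he | he
    · left
      rw [corr_swap]
      exact he.swap
    · refine Or.inr ?_
      -- Matching survives a change of sign of both coordinates at once; this moves the reversal
      -- from `C₁` to `C₀`.
      have h2 := he.neg
      have h3 := corr_affine (p₀ := p₀) (p₁ := p₁) (C₀ := C₀) (C₁ := fun t => C₁ (-1 * t + 0))
        (x := x) (Or.inr rfl) (Or.inr rfl) 0 0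
      have h4 : (fun z : ℝ × ℝ => (-z.1, -z.2)) = fun z : ℝ × ℝ =>
          ((-1 : ℝ) * z.1 + - -1 * 0, (-1 : ℝ) * z.2 + - -1 * 0) := by
        funext z; simp
      rw [h4, ← h3] at h2
      rw [corr_swap]
      convert h2.swap using 4 with t
      simp

variable {𝒩₀ : Set (Set Y₀ × (Y₀ → ℝ))} {𝒩₁ : Set (Set Y₁ × (Y₁ → ℝ))}

/-- `C₀` and `C₁` are leaf parameters of the images of the leaf of `x` with matched ends. -/
structure IsMatchedPair (𝒩₀ : Set (Set Y₀ × (Y₀ → ℝ))) (𝒩₁ : Set (Set Y₁ × (Y₁ → ℝ)))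
    (p₀ : X → Y₀) (p₁ : X → Y₁) (C₀ : ℝ → Y₀) (C₁ : ℝ → Y₁) (x : X) : Prop where
  param_fst : IsLeafParam 𝒩₀ C₀
  range_fst : range C₀ = connectedComponent (p₀ x)
  param_snd : IsLeafParam 𝒩₁ C₁
  range_snd : range C₁ = connectedComponent (p₁ x)
  matched : EndsMatched (corr p₀ p₁ C₀ C₁ x)

lemma IsMatchedPair.swap (h : IsMatchedPair 𝒩₀ 𝒩₁ p₀ p₁ C₀ C₁ x) :
    IsMatchedPair 𝒩₁ 𝒩₀ p₁ p₀ C₁ C₀ x :=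
  ⟨h.param_snd, h.range_snd, h.param_fst, h.range_fst, by rw [corr_swap]; exact h.matched.swap⟩

/-- The graph of the canonical homeomorphism. -/
def JunctionRel (𝒩₀ : Set (Set Y₀ × (Y₀ → ℝ))) (𝒩₁ : Set (Set Y₁ × (Y₁ → ℝ)))
    (p₀ : X → Y₀) (p₁ : X → Y₁) (y : Y₀) (y' : Y₁) : Prop :=
  ∃ x C₀ C₁ u, IsMatchedPair 𝒩₀ 𝒩₁ p₀ p₁ C₀ C₁ x ∧
    C₀ (junction (corr p₀ p₁ C₀ C₁ x) u) = y ∧ C₁ (u - junction (corr p₀ p₁ C₀ C₁ x) u) = y'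

lemma JunctionRel.swap {y : Y₀} {y' : Y₁} (h : JunctionRel 𝒩₀ 𝒩₁ p₀ p₁ y y') :
    JunctionRel 𝒩₁ 𝒩₀ p₁ p₀ y' y := by
  obtain ⟨x, C₀, C₁, u, hm, h0, h1⟩ := h
  refine ⟨x, C₁, C₀, u, hm.swap, ?_, ?_⟩
  · rw [corr_swap, hm.matched.junction_swap, h1]
  · rw [corr_swap, hm.matched.junction_swap, sub_sub_cancel, h0]

/-- The orbit is dense in the leaf, both maps are continuous, and the parametrizations are open, so
the coordinates of the orbit are dense in the correspondence. -/
lemma EndsCompatible.corr_subset_closure (h : EndsCompatible p₀ p₁) (h𝒩₀ : IsLengthAtlas 𝒩₀)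
    (h𝒩₁ : IsLengthAtlas 𝒩₁) {g : ℕ → X → X} (hC₀ : IsLeafParam 𝒩₀ C₀)
    (hC₁ : IsLeafParam 𝒩₁ C₁)
    (hgd : ∀ x, connectedComponent x ⊆ closure (range fun k => g k x)) {a b : ℕ → ℝ}
    (ha : ∀ k, C₀ (a k) = p₀ (g k x)) (hb : ∀ k, C₁ (b k) = p₁ (g k x)) :
    corr p₀ p₁ C₀ C₁ x ⊆ closure (range fun k => (a k, b k)) := by
  rintro ⟨s, r⟩ ⟨ξ, hξ, hs, hr⟩
  simp only at hs hr
  rw [mem_closure_iff_nhds]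
  intro O hO
  obtain ⟨U, hU, V, hV, hUV⟩ := mem_nhds_prod_iff.1 hO
  have h1 : p₀ ⁻¹' (C₀ '' U) ∩ p₁ ⁻¹' (C₁ '' V) ∈ 𝓝 ξ := by
    refine inter_mem (h.continuous_fst.continuousAt ?_) (h.continuous_snd.continuousAt ?_)
    · rw [← hs]
      exact (hC₀.isOpenEmbedding h𝒩₀).isOpenMap.image_mem_nhds hU
    · rw [← hr]
      exact (hC₁.isOpenEmbedding h𝒩₁).isOpenMap.image_mem_nhds hV
  obtain ⟨_, ⟨⟨s', hs', hs''⟩, r', hr', hr''⟩, k, rfl⟩ :=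
    mem_closure_iff_nhds.1 (hgd x hξ) _ h1
  refine ⟨(a k, b k), hUV ⟨?_, ?_⟩, k, rfl⟩
  · rwa [hC₀.injective ((ha k).trans hs''.symm)]
  · rwa [hC₁.injective ((hb k).trans hr''.symm)]

variable [T2Space Y₀] [T2Space Y₁]

lemma EndsCompatible.exists_isMatchedPair (h : EndsCompatible p₀ p₁) (h𝒩₀ : IsLengthAtlas 𝒩₀)
    (h𝒩₁ : IsLengthAtlas 𝒩₁) (x : X) :
    ∃ C₀ C₁, IsMatchedPair 𝒩₀ 𝒩₁ p₀ p₁ C₀ C₁ x := by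
  obtain ⟨C₀, hC₀, hr₀⟩ := h𝒩₀.exists_isLeafParam (p₀ x) (h.noncompact_fst _)
  obtain ⟨C₁, hC₁, hr₁⟩ := h𝒩₁.exists_isLeafParam (p₁ x) (h.noncompact_snd _)
  rcases h.ends x C₀ C₁ (hC₀.isOpenEmbedding h𝒩₀) hr₀ (hC₁.isOpenEmbedding h𝒩₁) hr₁ with he | he
  · exact ⟨C₀, C₁, hC₀, hr₀, hC₁, hr₁, he⟩
  · refine ⟨C₀, _, hC₀, hr₀, hC₁.comp_affine (Or.inr rfl), ?_, he⟩
    rw [← hr₁]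
    exact Function.Surjective.range_comp (f := fun t : ℝ => -1 * t + 0)
      (fun t => ⟨-t, by ring⟩) C₁

lemma EndsCompatible.image_leaf (h : EndsCompatible p₀ p₁) (h𝒩₀ : IsLengthAtlas 𝒩₀)
    (h𝒩₁ : IsLengthAtlas 𝒩₁) (x : X) :
    p₀ '' connectedComponent x = connectedComponent (p₀ x) := by
  obtain ⟨C₀, C₁, hm⟩ := h.exists_isMatchedPair h𝒩₀ h𝒩₁ x
  exact image_connectedComponent_of_corr (hm.param_fst.isOpenEmbedding h𝒩₀) hm.range_fst
    h.continuous_fst.continuousOn hm.matched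

/-- Two matched pairs over `y` come from the same leaf of `X`, so their parametrizations differ by
isometries. The signs of these agree by `EndsMatched.sign_eq`, and the junction curve is equivariant
under such pairs of isometries. The choices made in the relation therefore do not affect the image
point. -/
lemma JunctionRel.unique (h : EndsCompatible p₀ p₁) (h𝒩₀ : IsLengthAtlas 𝒩₀)
    (h𝒩₁ : IsLengthAtlas 𝒩₁) {y : Y₀} {y' y'' : Y₁} (h1 : JunctionRel 𝒩₀ 𝒩₁ p₀ p₁ y y')
    (h2 : JunctionRel 𝒩₀ 𝒩₁ p₀ p₁ y y'') : y' = y'' := by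
  obtain ⟨x, C₀, C₁, u, hm, hy, rfl⟩ := h1
  obtain ⟨x', C₀', C₁', u', hm', hy', rfl⟩ := h2
  have hleaf : connectedComponent (p₀ x) = connectedComponent (p₀ x') := by
    have e1 : y ∈ connectedComponent (p₀ x) := hm.range_fst ▸ ⟨_, hy⟩
    have e2 : y ∈ connectedComponent (p₀ x') := hm'.range_fst ▸ ⟨_, hy'⟩
    rw [connectedComponent_eq e1, connectedComponent_eq e2]
  have hxx : connectedComponent x = connectedComponent x' := by
    have : p₀ x' ∈ p₀ '' connectedComponent x := by
      rw [h.image_leaf h𝒩₀ h𝒩₁, hleaf]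
      exact mem_connectedComponent
    obtain ⟨ξ, hξ, he⟩ := this
    rw [connectedComponent_eq hξ, h.leaf_fst _ _ he]
  have hleaf1 : connectedComponent (p₁ x) = connectedComponent (p₁ x') := by
    rw [← h.swap.image_leaf h𝒩₁ h𝒩₀, ← h.swap.image_leaf h𝒩₁ h𝒩₀, hxx]
  obtain ⟨σ, τ, hσ, hC₀⟩ := hm.param_fst.exists_affine h𝒩₀ hm'.param_fst
    (by rw [hm.range_fst, hm'.range_fst, hleaf])
  obtain ⟨σ', τ', hσ', hC₁⟩ := hm.param_snd.exists_affine h𝒩₁ hm'.param_snd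
    (by rw [hm.range_snd, hm'.range_snd, hleaf1])
  obtain rfl : C₀' = fun t => C₀ (σ * t + τ) := funext hC₀
  obtain rfl : C₁' = fun t => C₁ (σ' * t + τ') := funext hC₁
  have hZ := hm'.matched
  rw [← corr_congr hxx, corr_affine hσ hσ'] at hZ hy' ⊢
  obtain rfl := hm.matched.sign_eq hσ hσ' hZ
  set Z := corr p₀ p₁ C₀ C₁ x
  have e := mul_self_sign hσ
  obtain ⟨u₁, rfl⟩ : ∃ u₁, u' = σ * u₁ + (-σ * τ + -σ * τ') :=
    ⟨σ * u' + τ + τ', by linear_combination (-u') * e⟩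
  rw [hm.matched.junction_affine hσ] at hy' ⊢
  have h3 := hm.param_fst.injective (hy.trans hy'.symm)
  have h4 : u = u₁ := by
    refine hm.matched.strictMono_junction.injective ?_
    linear_combination h3 + (junction Z u₁ - τ) * e
  subst h4
  congr 1
  linear_combination (-u + junction Z u + τ') * e

lemma EndsCompatible.exists_junctionRel (h : EndsCompatible p₀ p₁) (h𝒩₀ : IsLengthAtlas 𝒩₀)
    (h𝒩₁ : IsLengthAtlas 𝒩₁) (y : Y₀) : ∃ y', JunctionRel 𝒩₀ 𝒩₁ p₀ p₁ y y' := by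
  obtain ⟨x, rfl⟩ := h.surjective_fst y
  obtain ⟨C₀, C₁, hm⟩ := h.exists_isMatchedPair h𝒩₀ h𝒩₁ x
  obtain ⟨s, hs⟩ : p₀ x ∈ range C₀ := hm.range_fst ▸ mem_connectedComponent
  obtain ⟨u, hu⟩ := hm.matched.surjective_junction s
  exact ⟨_, x, C₀, C₁, u, hm, by rw [hu, hs], rfl⟩

/-- By uniqueness the value can be computed with any matched pair on the leaf. Continuity and
leafwise smoothness are both read off this formula. -/
lemma EndsCompatible.comp_param_eq (h : EndsCompatible p₀ p₁) (h𝒩₀ : IsLengthAtlas 𝒩₀)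
    (h𝒩₁ : IsLengthAtlas 𝒩₁) {f : Y₀ → Y₁} (hf : ∀ y, JunctionRel 𝒩₀ 𝒩₁ p₀ p₁ y (f y))
    (hm : IsMatchedPair 𝒩₀ 𝒩₁ p₀ p₁ C₀ C₁ x) (s : ℝ) :
    f (C₀ s) = C₁ (hm.matched.junctionHomeo.symm s - s) := by
  refine JunctionRel.unique h h𝒩₀ h𝒩₁ (hf (C₀ s))
    ⟨x, C₀, C₁, hm.matched.junctionHomeo.symm s, hm, ?_, ?_⟩ <;>
  rw [← hm.matched.junctionHomeo_apply, Homeomorph.apply_symm_apply]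

lemma EndsCompatible.continuous_of_junctionRel (h : EndsCompatible p₀ p₁)
    (h𝒩₀ : IsLengthAtlas 𝒩₀) (h𝒩₁ : IsLengthAtlas 𝒩₁) {f : Y₀ → Y₁}
    (hf : ∀ y, JunctionRel 𝒩₀ 𝒩₁ p₀ p₁ y (f y)) : Continuous f := by
  rw [continuous_iff_continuousAt]
  intro y
  obtain ⟨x, C₀, C₁, u, hm, rfl, -⟩ := hf y
  have hC₀ := hm.param_fst.isOpenEmbedding h𝒩₀
  have hC₁ := hm.param_snd.isOpenEmbedding h𝒩₁
  rw [← hC₀.continuousAt_iff, show f ∘ C₀ = _ from funext (h.comp_param_eq h𝒩₀ h𝒩₁ hf hm)]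
  exact (hC₁.continuous.comp (by fun_prop)).continuousAt

theorem EndsCompatible.exists_homeomorph (h : EndsCompatible p₀ p₁) (h𝒩₀ : IsLengthAtlas 𝒩₀)
    (h𝒩₁ : IsLengthAtlas 𝒩₁) :
    ∃ e : Y₀ ≃ₜ Y₁, ∀ y y', e y = y' ↔ JunctionRel 𝒩₀ 𝒩₁ p₀ p₁ y y' := by
  choose f hf using h.exists_junctionRel h𝒩₀ h𝒩₁
  choose g hg using h.swap.exists_junctionRel h𝒩₁ h𝒩₀
  have hgf : ∀ y, g (f y) = y := fun y =>
    JunctionRel.unique h.swap h𝒩₁ h𝒩₀ (hg (f y)) (hf y).swap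
  have hfg : ∀ y, f (g y) = y := fun y => JunctionRel.unique h h𝒩₀ h𝒩₁ (hf (g y)) (hg y).swap
  refine ⟨⟨⟨f, g, hgf, hfg⟩, h.continuous_of_junctionRel h𝒩₀ h𝒩₁ hf,
    h.swap.continuous_of_junctionRel h𝒩₁ h𝒩₀ hg⟩, fun y y' => ?_⟩
  constructor
  · rintro rfl
    exact hf y
  · exact fun hy => JunctionRel.unique h h𝒩₀ h𝒩₁ (hf y) hy

/-- A sequence with first term `a`. -/
def consSeq {Y : Type*} (a : Y) (w : ℕ → Y) : ℕ → Y
  | 0 => a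
  | k + 1 => w k

lemma range_consSeq_subset {Y : Type*} (a : Y) (w : ℕ → Y) : range w ⊆ range (consSeq a w) := by
  rintro _ ⟨k, rfl⟩
  exact ⟨k + 1, rfl⟩

/-- The point `y` is prepended to the orbit so that its own coordinate appears, with index `0`, in
the sequence of coordinates; density is not affected. -/
lemma EndsCompatible.subset_closure_orbit (h : EndsCompatible p₀ p₁) (h𝒩₀ : IsLengthAtlas 𝒩₀)
    (h𝒩₁ : IsLengthAtlas 𝒩₁) {g : ℕ → X → X}
    (hgd : ∀ x, connectedComponent x ⊆ closure (range fun k => g k x))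
    (x : X) (y : Y₀) :
    connectedComponent (p₀ x) ⊆ closure (range (consSeq y fun k => p₀ (g k x))) := by
  rw [← h.image_leaf h𝒩₀ h𝒩₁]
  refine (image_mono (hgd x)).trans ((image_closure_subset_closure_image h.continuous_fst).trans
    (closure_mono ?_))
  rw [← range_comp]
  exact range_consSeq_subset y fun k => p₀ (g k x)

end Corr

/-! ### The canonical homeomorphism is Borel -/

/-- Real bounds are replaced by integral ones in order to have only countable quantifiers. -/
lemma endsMatched_range_iff (z : ℕ → ℝ × ℝ) : EndsMatched (range z) ↔
    (∀ N : ℤ, ∃ k, (N : ℝ) ≤ (z k).1) ∧ (∀ N : ℤ, ∃ k, (z k).1 ≤ N) ∧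
    (∀ N : ℤ, ∃ B : ℤ, ∀ k, (z k).1 ≤ N → (z k).2 ≤ B) ∧
    (∀ N : ℤ, ∃ B : ℤ, ∀ k, (N : ℝ) ≤ (z k).1 → (B : ℝ) ≤ (z k).2) ∧
    (∀ N : ℤ, ∃ B : ℤ, ∀ k, (z k).2 ≤ N → (z k).1 ≤ B) ∧
    (∀ N : ℤ, ∃ B : ℤ, ∀ k, (N : ℝ) ≤ (z k).2 → (B : ℝ) ≤ (z k).1) := by
  have up : ∀ f g : ℕ → ℝ, (∀ N : ℝ, ∃ B : ℝ, ∀ k, f k ≤ N → g k ≤ B) ↔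
      ∀ N : ℤ, ∃ B : ℤ, ∀ k, f k ≤ N → g k ≤ B := by
    refine fun f g => ⟨fun h N => ?_, fun h N => ?_⟩
    · obtain ⟨B, hB⟩ := h N
      exact ⟨⌈B⌉, fun k hk => (hB k hk).trans (Int.le_ceil B)⟩
    · obtain ⟨B, hB⟩ := h ⌈N⌉
      exact ⟨B, fun k hk => hB k (hk.trans (Int.le_ceil N))⟩
  have down : ∀ f g : ℕ → ℝ, (∀ N : ℝ, ∃ B : ℝ, ∀ k, N ≤ f k → B ≤ g k) ↔
      ∀ N : ℤ, ∃ B : ℤ, ∀ k, (N : ℝ) ≤ f k → (B : ℝ) ≤ g k := by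
    refine fun f g => ⟨fun h N => ?_, fun h N => ?_⟩
    · obtain ⟨B, hB⟩ := h N
      exact ⟨⌊B⌋, fun k hk => (Int.floor_le B).trans (hB k hk)⟩
    · obtain ⟨B, hB⟩ := h ⌊N⌋
      exact ⟨B, fun k hk => hB k ((Int.floor_le N).trans hk)⟩
  rw [← up (fun k => (z k).1), ← down (fun k => (z k).1), ← up (fun k => (z k).2),
    ← down (fun k => (z k).2)]
  constructor
  · rintro ⟨h1, h2, h3, h4, h5, h6⟩
    simp only [forall_mem_range, exists_range_iff] at h1 h2 h3 h4 h5 h6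
    exact ⟨fun N => h1 N, fun N => h2 N, h3, h4, h5, h6⟩
  · rintro ⟨h1, h2, h3, h4, h5, h6⟩
    refine ⟨fun N => ?_, fun N => ?_, ?_, ?_, ?_, ?_⟩
    · obtain ⟨k, hk⟩ := h1 ⌈N⌉
      exact ⟨_, ⟨k, rfl⟩, (Int.le_ceil N).trans hk⟩
    · obtain ⟨k, hk⟩ := h2 ⌊N⌋
      exact ⟨_, ⟨k, rfl⟩, hk.trans (Int.floor_le N)⟩
    all_goals simpa only [forall_mem_range]

lemma measurableSet_endsMatched : MeasurableSet {z : ℕ → ℝ × ℝ | EndsMatched (range z)} := by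
  simp_rw [endsMatched_range_iff]
  have m1 : ∀ k, Measurable fun z : ℕ → ℝ × ℝ => (z k).1 := fun k => by fun_prop
  have m2 : ∀ k, Measurable fun z : ℕ → ℝ × ℝ => (z k).2 := fun k => by fun_prop
  have up : ∀ f g : ℕ → (ℕ → ℝ × ℝ) → ℝ, (∀ k, Measurable (f k)) → (∀ k, Measurable (g k)) →
      MeasurableSet {z | ∀ N : ℤ, ∃ B : ℤ, ∀ k, f k z ≤ N → g k z ≤ B} := by
    intro f g hf hg
    simp only [ofPred_forall, ofPred_exists]
    exact MeasurableSet.iInter fun N => MeasurableSet.iUnion fun B => MeasurableSet.iInter fun k =>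
      (measurableSet_le (hf k) measurable_const).imp (measurableSet_le (hg k) measurable_const)
  have down : ∀ f g : ℕ → (ℕ → ℝ × ℝ) → ℝ, (∀ k, Measurable (f k)) → (∀ k, Measurable (g k)) →
      MeasurableSet {z | ∀ N : ℤ, ∃ B : ℤ, ∀ k, (N : ℝ) ≤ f k z → (B : ℝ) ≤ g k z} := by
    intro f g hf hg
    simp only [ofPred_forall, ofPred_exists]
    exact MeasurableSet.iInter fun N => MeasurableSet.iUnion fun B => MeasurableSet.iInter fun k =>
      (measurableSet_le measurable_const (hf k)).imp (measurableSet_le measurable_const (hg k))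
  have h1 : MeasurableSet {z : ℕ → ℝ × ℝ | ∀ N : ℤ, ∃ k, (N : ℝ) ≤ (z k).1} := by
    simp only [ofPred_forall, ofPred_exists]
    exact MeasurableSet.iInter fun N => MeasurableSet.iUnion fun k =>
      measurableSet_le measurable_const (m1 k)
  have h2 : MeasurableSet {z : ℕ → ℝ × ℝ | ∀ N : ℤ, ∃ k, (z k).1 ≤ N} := by
    simp only [ofPred_forall, ofPred_exists]
    exact MeasurableSet.iInter fun N => MeasurableSet.iUnion fun k =>
      measurableSet_le (m1 k) measurable_const
  exact h1.inter (h2.inter ((up _ _ m1 m2).inter ((down _ _ m1 m2).inter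
    ((up _ _ m2 m1).inter (down _ _ m2 m1)))))

section Seq

variable {Y : Type v} [TopologicalSpace Y] [MeasurableSpace Y] {𝒩 : Set (Set Y × (Y → ℝ))}
  {R : ℕ → Set (Y × Y)} {D : ℕ → Y × Y → ℝ}

/-- The numbers `α k` are length coordinates of the points `w k`. -/
def IsLengthSeq (R : ℕ → Set (Y × Y)) (D : ℕ → Y × Y → ℝ) (w : ℕ → Y) (α : ℕ → ℝ) : Prop :=
  ∀ j k l, (w k, w l) ∈ R j → |α k - α l| = D j (w k, w l)

lemma IsBorelLengthAtlas.exists_isLeafParam [T2Space Y] (h : IsBorelLengthAtlas 𝒩 R D) {y : Y}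
    {w : ℕ → Y} {α : ℕ → ℝ} (hα : IsLengthSeq R D w α) (hnc : ¬ IsCompact (connectedComponent y))
    (hw : ∀ k, w k ∈ connectedComponent y) (hd : connectedComponent y ⊆ closure (range w)) :
    ∃ C, IsLeafParam 𝒩 C ∧ range C = connectedComponent y ∧ ∀ k, C (stretchSeq α k) = w k := by
  refine h.isLengthAtlas.exists_isLeafParam_of_seq hnc hw hd fun z _ => ?_
  obtain ⟨j, q, hq, hz, hall⟩ := h.exists_index z
  refine ⟨q.1, (h.isLengthAtlas.isOpen q hq).mem_nhds hz, q, hq, hz, fun k l hk hl => ?_⟩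
  obtain ⟨h1, h2⟩ := hall _ hk _ hl
  rw [hα j k l h1, h2]

lemma IsBorelLengthAtlas.exists_isLengthSeq (h : IsBorelLengthAtlas 𝒩 R D) {C : ℝ → Y}
    (hC : IsLeafParam 𝒩 C) {w : ℕ → Y} (hw : ∀ k, w k ∈ range C)
    (hd : range C ⊆ closure (range w)) :
    ∃ α, IsLengthSeq R D w α ∧ ∀ k, C (stretchSeq α k) = w k := by
  choose β hβ using hw
  obtain ⟨α, hα, hq⟩ := hC.exists_seq h.isLengthAtlas hβ hd
  refine ⟨α, fun j k l hkl => ?_, fun k => by rw [hα, hβ]⟩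
  obtain ⟨q, hq', hk, hl, hD⟩ := h.exists_chart j _ _ hkl
  rw [hD, hq q hq' k l hk hl]

lemma IsBorelLengthAtlas.measurableSet_isLengthSeq (h : IsBorelLengthAtlas 𝒩 R D) {Ω : Type*}
    [MeasurableSpace Ω] {w : ℕ → Ω → Y} {α : Ω → ℕ → ℝ} (hw : ∀ k, Measurable (w k))
    (hα : Measurable α) : MeasurableSet {θ | IsLengthSeq R D (fun k => w k θ) (α θ)} := by
  unfold IsLengthSeq
  simp only [ofPred_forall]
  refine MeasurableSet.iInter fun j => MeasurableSet.iInter fun k => MeasurableSet.iInter fun l =>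
    MeasurableSet.imp (((hw k).prodMk (hw l)) (h.measurableSet j)) (measurableSet_eq_fun ?_
      ((h.measurable j).comp ((hw k).prodMk (hw l))))
  have := fun k => (measurable_pi_apply k).comp hα
  exact ((this k).sub (this l)).abs

end Seq

section Main

variable {n : ℕ} {X : Type*} [TopologicalSpace X] [MeasurableSpace X]
  {Y₀ : Type*} [TopologicalSpace Y₀] [MeasurableSpace Y₀]
  {Y₁ : Type*} [TopologicalSpace Y₁] [MeasurableSpace Y₁] {p₀ : X → Y₀} {p₁ : X → Y₁}
  {𝒩₀ : Set (Set Y₀ × (Y₀ → ℝ))} {R₀ : ℕ → Set (Y₀ × Y₀)} {D₀ : ℕ → Y₀ × Y₀ → ℝ}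
  {𝒩₁ : Set (Set Y₁ × (Y₁ → ℝ))} {R₁ : ℕ → Set (Y₁ × Y₁)} {D₁ : ℕ → Y₁ × Y₁ → ℝ}

/-- The points `(y, y', x, α, β, u)` for which the coordinates `α` and `β` of the orbits of `y` and
`y'` determine that `y'` corresponds to `y`. -/
def junctionData (R₀ : ℕ → Set (Y₀ × Y₀)) (D₀ : ℕ → Y₀ × Y₀ → ℝ) (R₁ : ℕ → Set (Y₁ × Y₁))
    (D₁ : ℕ → Y₁ × Y₁ → ℝ) (p₀ : X → Y₀) (p₁ : X → Y₁) (g : ℕ → X → X) :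
    Set (Y₀ × Y₁ × X × (ℕ → ℝ) × (ℕ → ℝ) × ℝ) :=
  {θ | (p₀ θ.2.2.1 = θ.1 ∧ ∃ j k, (θ.2.1, p₁ (g k θ.2.2.1)) ∈ R₁ j) ∧
    (IsLengthSeq R₀ D₀ (fun k => consSeq θ.1 (fun k => p₀ (g k θ.2.2.1)) k) θ.2.2.2.1 ∧
    IsLengthSeq R₁ D₁ (fun k => consSeq θ.2.1 (fun k => p₁ (g k θ.2.2.1)) k) θ.2.2.2.2.1) ∧
    EndsMatched (range fun k =>
      (stretchSeq θ.2.2.2.1 (k + 1), stretchSeq θ.2.2.2.2.1 (k + 1))) ∧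
    stretchSeq θ.2.2.2.1 0 = junction (range fun k =>
      (stretchSeq θ.2.2.2.1 (k + 1), stretchSeq θ.2.2.2.2.1 (k + 1))) θ.2.2.2.2.2 ∧
    stretchSeq θ.2.2.2.2.1 0 = θ.2.2.2.2.2 - junction (range fun k =>
      (stretchSeq θ.2.2.2.1 (k + 1), stretchSeq θ.2.2.2.2.1 (k + 1))) θ.2.2.2.2.2}

omit [TopologicalSpace X] in
lemma measurableSet_junctionData [StandardBorelSpace Y₀] (h₀ : IsBorelLengthAtlas 𝒩₀ R₀ D₀)
    (h₁ : IsBorelLengthAtlas 𝒩₁ R₁ D₁) (hp₀ : Measurable p₀) (hp₁ : Measurable p₁)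
    {g : ℕ → X → X} (hg : ∀ k, Measurable (g k)) :
    MeasurableSet (junctionData R₀ D₀ R₁ D₁ p₀ p₁ g) := by
  have mx : Measurable fun θ : Y₀ × Y₁ × X × (ℕ → ℝ) × (ℕ → ℝ) × ℝ => θ.2.2.1 := by fun_prop
  have mα : Measurable fun θ : Y₀ × Y₁ × X × (ℕ → ℝ) × (ℕ → ℝ) × ℝ => θ.2.2.2.1 := by fun_prop
  have mβ : Measurable fun θ : Y₀ × Y₁ × X × (ℕ → ℝ) × (ℕ → ℝ) × ℝ => θ.2.2.2.2.1 := by fun_prop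
  have mu : Measurable fun θ : Y₀ × Y₁ × X × (ℕ → ℝ) × (ℕ → ℝ) × ℝ => θ.2.2.2.2.2 := by fun_prop
  have my : Measurable fun θ : Y₀ × Y₁ × X × (ℕ → ℝ) × (ℕ → ℝ) × ℝ => θ.2.1 := by fun_prop
  have sα := fun k => (measurable_pi_apply k).comp (measurable_stretchSeq.comp mα)
  have sβ := fun k => (measurable_pi_apply k).comp (measurable_stretchSeq.comp mβ)
  have mz : Measurable fun θ : Y₀ × Y₁ × X × (ℕ → ℝ) × (ℕ → ℝ) × ℝ => fun k =>
      (stretchSeq θ.2.2.2.1 (k + 1), stretchSeq θ.2.2.2.2.1 (k + 1)) :=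
    measurable_pi_lambda _ fun k => (sα (k + 1)).prodMk (sβ (k + 1))
  have mj := measurable_junction.comp (mz.prodMk mu)
  refine MeasurableSet.inter (MeasurableSet.inter (measurableSet_eq_fun (hp₀.comp mx)
    measurable_fst) ?_) (MeasurableSet.inter (MeasurableSet.inter ?_ ?_)
    (MeasurableSet.inter (mz measurableSet_endsMatched) (MeasurableSet.inter
    (measurableSet_eq_fun (sα 0) mj) (measurableSet_eq_fun (sβ 0) (mu.sub mj)))))
  · have hU := MeasurableSet.iUnion fun j => MeasurableSet.iUnion fun k =>
      (my.prodMk (hp₁.comp ((hg k).comp mx))) (h₁.measurableSet j)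
    refine (congrArg MeasurableSet (Set.ext fun θ => ?_)).mp hU
    simp only [mem_iUnion]
    rfl
  · refine h₀.measurableSet_isLengthSeq (fun k => ?_) mα
    cases k with
    | zero => exact measurable_fst
    | succ k => exact hp₀.comp ((hg k).comp mx)
  · refine h₁.measurableSet_isLengthSeq (fun k => ?_) mβ
    cases k with
    | zero => exact my
    | succ k => exact hp₁.comp ((hg k).comp mx)

variable [T2Space Y₀] [T2Space Y₁] {g : ℕ → X → X}

omit [MeasurableSpace X] in
-- The length sequences determine parametrizations of the two leaves for which the stretched numbers
-- are coordinates: index `0` for `y` and `y'`, the others for the orbit. The clause on `R₁` places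
-- `y'` in the leaf of `p₁ x`. By density the junction of the orbit is that of the full
-- correspondence.
lemma junctionRel_of_mem (h : EndsCompatible p₀ p₁) (h₀ : IsBorelLengthAtlas 𝒩₀ R₀ D₀)
    (h₁ : IsBorelLengthAtlas 𝒩₁ R₁ D₁) (hgc : ∀ k x, g k x ∈ connectedComponent x)
    (hgd : ∀ x, connectedComponent x ⊆ closure (range fun k => g k x))
    {θ : Y₀ × Y₁ × X × (ℕ → ℝ) × (ℕ → ℝ) × ℝ} (hθ : θ ∈ junctionData R₀ D₀ R₁ D₁ p₀ p₁ g) :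
    JunctionRel 𝒩₀ 𝒩₁ p₀ p₁ θ.1 θ.2.1 := by
  have hA₀ := h₀.isLengthAtlas
  have hA₁ := h₁.isLengthAtlas
  obtain ⟨y, y', x, α, β, u⟩ := θ
  obtain ⟨⟨hy, j, k, hjk⟩, ⟨hα, hβ⟩, hE, h0, h1⟩ := hθ
  simp only at hy hjk hα hβ hE h0 h1 ⊢
  have hmem₀ : ∀ k, p₀ (g k x) ∈ connectedComponent (p₀ x) := fun k =>
    h.continuous_fst.image_connectedComponent_subset x ⟨_, hgc k x, rfl⟩
  have hmem₁ : ∀ k, p₁ (g k x) ∈ connectedComponent (p₁ x) := fun k =>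
    h.continuous_snd.image_connectedComponent_subset x ⟨_, hgc k x, rfl⟩
  have hy' : y' ∈ connectedComponent (p₁ x) := by
    obtain ⟨q, hq, hq1, hq2, -⟩ := h₁.exists_chart j _ _ hjk
    rw [connectedComponent_eq (hmem₁ k)]
    exact (hA₁.isPreconnected q hq).subset_connectedComponent hq2 hq1
  obtain ⟨C₀, hC₀, hr₀, hα'⟩ := h₀.exists_isLeafParam hα (h.noncompact_fst (p₀ x))
    (fun k => by
      cases k with
      | zero => exact hy ▸ mem_connectedComponent
      | succ k => exact hmem₀ k) (h.subset_closure_orbit hA₀ hA₁ hgd x y)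
  obtain ⟨C₁, hC₁, hr₁, hβ'⟩ := h₁.exists_isLeafParam hβ (h.noncompact_snd (p₁ x))
    (fun k => by
      cases k with
      | zero => exact hy'
      | succ k => exact hmem₁ k) (h.swap.subset_closure_orbit hA₁ hA₀ hgd x y')
  have hsub := corr_of_orbit hgc (fun k => hα' (k + 1)) (fun k => hβ' (k + 1))
  have hcl := h.corr_subset_closure hA₀ hA₁ hC₀ hC₁ hgd
    (fun k => hα' (k + 1)) (fun k => hβ' (k + 1))
  have hE' := (endsMatched_iff_of_dense hsub hcl).1 hE
  have hj : junction (range fun k => (stretchSeq α (k + 1), stretchSeq β (k + 1))) =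
      junction (corr p₀ p₁ C₀ C₁ x) := by
    unfold junction
    rw [EndsMatched.midCurve_eq_of_dense hsub hcl hE']
  rw [hj] at h0 h1
  exact ⟨x, C₀, C₁, u, ⟨hC₀, hr₀, hC₁, hr₁, hE'⟩, h0 ▸ hα' 0, h1 ▸ hβ' 0⟩

omit [MeasurableSpace X] in
-- Any matched pair provides data over `y`: length sequences are read off the parametrizations, and
-- some orbit point shares a length chart with `y'` because the orbit is dense in its leaf.
lemma exists_mem_junctionData (h : EndsCompatible p₀ p₁) (h₀ : IsBorelLengthAtlas 𝒩₀ R₀ D₀)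
    (h₁ : IsBorelLengthAtlas 𝒩₁ R₁ D₁) (hgc : ∀ k x, g k x ∈ connectedComponent x)
    (hgd : ∀ x, connectedComponent x ⊆ closure (range fun k => g k x)) (y : Y₀) :
    ∃ θ ∈ junctionData R₀ D₀ R₁ D₁ p₀ p₁ g, θ.1 = y := by
  have hA₀ := h₀.isLengthAtlas
  have hA₁ := h₁.isLengthAtlas
  obtain ⟨x, rfl⟩ := h.surjective_fst y
  obtain ⟨C₀, C₁, hm⟩ := h.exists_isMatchedPair hA₀ hA₁ x
  obtain ⟨s, hs⟩ : p₀ x ∈ range C₀ := hm.range_fst ▸ mem_connectedComponent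
  obtain ⟨u, rfl⟩ := hm.matched.surjective_junction s
  set y' := C₁ (u - junction (corr p₀ p₁ C₀ C₁ x) u) with hy'
  have hd₀ := h.subset_closure_orbit hA₀ hA₁ hgd x (p₀ x)
  have hd₁ := h.swap.subset_closure_orbit hA₁ hA₀ hgd x y'
  rw [← hm.range_fst] at hd₀
  rw [← hm.range_snd] at hd₁
  obtain ⟨α, hα, hα'⟩ := h₀.exists_isLengthSeq hm.param_fst (fun k => by
      cases k with
      | zero => exact ⟨_, hs⟩
      | succ k =>
        rw [hm.range_fst]
        exact h.continuous_fst.image_connectedComponent_subset x ⟨_, hgc k x, rfl⟩) hd₀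
  obtain ⟨β, hβ, hβ'⟩ := h₁.exists_isLengthSeq hm.param_snd (fun k => by
      cases k with
      | zero => exact ⟨_, rfl⟩
      | succ k =>
        rw [hm.range_snd]
        exact h.continuous_snd.image_connectedComponent_subset x ⟨_, hgc k x, rfl⟩) hd₁
  have hsub := corr_of_orbit hgc (fun k => hα' (k + 1)) (fun k => hβ' (k + 1))
  have hcl := h.corr_subset_closure hA₀ hA₁ hm.param_fst hm.param_snd hgd
    (fun k => hα' (k + 1)) (fun k => hβ' (k + 1))
  have hj : junction (range fun k => (stretchSeq α (k + 1), stretchSeq β (k + 1))) =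
      junction (corr p₀ p₁ C₀ C₁ x) := by
    unfold junction
    rw [EndsMatched.midCurve_eq_of_dense hsub hcl hm.matched]
  refine ⟨(p₀ x, y', x, α, β, u), ⟨⟨rfl, ?_⟩, ⟨hα, hβ⟩,
    (endsMatched_iff_of_dense hsub hcl).2 hm.matched, ?_, ?_⟩, rfl⟩
  · obtain ⟨j, q, hq, hyq, hall⟩ := h₁.exists_index y'
    have hmem : y' ∈ closure (range fun k => p₁ (g k x)) := by
      have h2 : y' ∈ p₁ '' connectedComponent x := by
        rw [h.swap.image_leaf hA₁ hA₀, ← hm.range_snd]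
        exact ⟨_, rfl⟩
      have h3 := (image_mono (hgd x)).trans (image_closure_subset_closure_image h.continuous_snd) h2
      rwa [← range_comp] at h3
    obtain ⟨_, hkq, k, rfl⟩ := mem_closure_iff.1 hmem q.1 (hA₁.isOpen q hq) hyq
    exact ⟨j, k, (hall _ hyq _ hkq).1⟩
  · simp only
    rw [hj]
    exact hm.param_fst.injective ((hα' 0).trans hs.symm)
  · simp only
    rw [hj]
    exact hm.param_snd.injective (hβ' 0)

/-- The data `x, α, β, u` need not be chosen measurably. They form a standard Borel space with a
Borel surjection to `Y₀`, on which `f` becomes the Borel projection to `y'`; a map to a standard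
Borel space that is Borel after such a surjection is Borel. -/
theorem EndsCompatible.measurable_of_junctionRel (hX : BorelFoliation n X)
    [StandardBorelSpace Y₀] [StandardBorelSpace Y₁] (h : EndsCompatible p₀ p₁)
    (hp₀ : Measurable p₀) (hp₁ : Measurable p₁)
    (h₀ : IsBorelLengthAtlas 𝒩₀ R₀ D₀) (h₁ : IsBorelLengthAtlas 𝒩₁ R₁ D₁) {f : Y₀ → Y₁}
    (hf : ∀ y, JunctionRel 𝒩₀ 𝒩₁ p₀ p₁ y (f y)) : Measurable f := by
  have := hX.standardBorelSpace
  obtain ⟨g, hgm, hgc, hgd⟩ := hX.exists_dense_maps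
  have hm := measurableSet_junctionData h₀ h₁ hp₀ hp₁ hgm
  have := hm.standardBorel
  have hfst : Measurable fun θ : junctionData R₀ D₀ R₁ D₁ p₀ p₁ g => θ.1.1 :=
    measurable_fst.comp measurable_subtype_coe
  have hsurj : Function.Surjective fun θ : junctionData R₀ D₀ R₁ D₁ p₀ p₁ g => θ.1.1 := by
    intro y
    obtain ⟨θ, hθ, he⟩ := exists_mem_junctionData h h₀ h₁ hgc hgd y
    exact ⟨⟨θ, hθ⟩, he⟩
  rw [← hfst.measurable_comp_iff_of_surjective hsurj]
  have heq : (f ∘ fun θ : junctionData R₀ D₀ R₁ D₁ p₀ p₁ g => θ.1.1) = fun θ => θ.1.2.1 := by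
    funext θ
    exact JunctionRel.unique h h₀.isLengthAtlas h₁.isLengthAtlas (hf θ.1.1)
      (junctionRel_of_mem h h₀ h₁ hgc hgd θ.2)
  rw [heq]
  exact (measurable_fst.comp measurable_snd).comp measurable_subtype_coe

end Main

/-! ### Leafwise smoothness of the canonical homeomorphism -/

section Smooth

variable {X : Type*} [TopologicalSpace X] {Y₀ : Type*} [TopologicalSpace Y₀] [MeasurableSpace Y₀]
  {Y₁ : Type*} [TopologicalSpace Y₁] [MeasurableSpace Y₁] [T2Space Y₀] [T2Space Y₁]
  {p₀ : X → Y₀} {p₁ : X → Y₁} {𝒩₀ : Set (Set Y₀ × (Y₀ → ℝ))} {𝒩₁ : Set (Set Y₁ × (Y₁ → ℝ))}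

/-- The canonical homeomorphism is smooth along the leaves. -/
theorem EndsCompatible.smoothInCharts_of_junctionRel (h : EndsCompatible p₀ p₁)
    (h𝒩₀ : IsLengthAtlas 𝒩₀) (h𝒩₁ : IsLengthAtlas 𝒩₁) {f : Y₀ → Y₁}
    (hf : ∀ y, JunctionRel 𝒩₀ 𝒩₁ p₀ p₁ y (f y)) {a : PrismChart 1 Y₀} {b : PrismChart 1 Y₁}
    (ha : SmoothAlong 𝒩₀ a) (hb : SmoothAlong 𝒩₁ b) :
    SmoothInCharts a b fun y y' => f y = y' := by
  refine smoothInCharts_of_contDiffAt fun s t => ⟨fun r => b.coord (f (a.line s r)), ?_⟩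
  intro r hr q hq he
  have hval : b.coord (f (a.line s r)) = q := by
    rw [he, b.coord_line t (Ioo_subset_Icc_self hq)]
  refine ⟨?_, hval⟩
  have hfc := h.continuous_of_junctionRel h𝒩₀ h𝒩₁ hf
  obtain ⟨x, C₀, C₁, u, hm, hy, hy'⟩ := hf (a.line s r)
  set Z := corr p₀ p₁ C₀ C₁ x
  have hcomp := h.comp_param_eq h𝒩₀ h𝒩₁ hf hm
  obtain ⟨h1, -⟩ := hm.param_fst.contDiffAt_invFun h𝒩₀ ha hr ⟨_, hy⟩
  obtain ⟨h2, h2'⟩ := hm.param_snd.contDiffAt_invFun h𝒩₁ hb (v := t) hq (he ▸ ⟨_, hy'⟩)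
  have hev : ∀ᶠ x in 𝓝 r, f (a.line s x) ∈ b.plaque t :=
    (hfc.comp (a.continuous_line s)).continuousAt.eventually
      ((b.isOpen_plaque t).mem_nhds (by
        rw [b.plaque_eq]; exact ⟨q, hq, he.symm⟩))
  have hev' : ∀ᶠ x in 𝓝 r, b.line t (b.coord (f (a.line s x))) = f (a.line s x) := by
    filter_upwards [hev] with x hx
    rw [b.plaque_eq] at hx
    obtain ⟨q', hq', he'⟩ := hx
    rw [← he', b.coord_line t (Ioo_subset_Icc_self hq')]
  -- The parameter of `C₁` is a regular smooth function of the coordinate of `b`, so it is enough to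
  -- prove smoothness after reading the image in that parameter, where the map is explicit.
  refine ContDiffAt.of_comp_left (h := fun x => Function.invFun C₁ (b.line t x)) ?_ ?_ ?_ ?_
  · rw [hval]; exact h2
  · rw [hval]; exact h2'
  · refine ContinuousAt.comp (f := fun x => f (a.line s x)) ?_
      (hfc.comp (a.continuous_line s)).continuousAt
    refine b.continuousOn_coord.continuousAt (mem_of_superset
      ((b.isOpen_plaque t).mem_nhds hev.self_of_nhds) fun y hy => ?_)
    exact b.core_subset_range (b.mem_core_iff.2 ⟨t, hy⟩)
  · have hr₀ : ∀ᶠ x in 𝓝 r, a.line s x ∈ range C₀ :=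
      (a.continuous_line s).continuousAt.eventually
        ((hm.param_fst.isOpenEmbedding h𝒩₀).isOpen_range.mem_nhds ⟨_, hy⟩)
    have h3 : ContDiffAt ℝ ∞ (fun x => hm.matched.junctionHomeo.symm
        (Function.invFun C₀ (a.line s x)) - Function.invFun C₀ (a.line s x)) r :=
      (ContDiffAt.comp r (hm.matched.contDiff_junctionHomeo_symm).contDiffAt h1).sub h1
    refine h3.congr_of_eventuallyEq ?_
    filter_upwards [hev', hr₀] with x hx hx₀
    obtain ⟨z, hz⟩ := hx₀
    rw [hx, ← hz, hcomp, Function.leftInverse_invFun hm.param_snd.injective,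
      Function.leftInverse_invFun hm.param_fst.injective]

end Smooth

/-! ### Ends -/

section Ends

variable {L : Type u} [TopologicalSpace L]

lemma TopEnd.ext_comp {ε ε' : TopEnd L} (h : ∀ K, ε.comp K = ε'.comp K) : ε = ε' := by
  cases ε; cases ε'
  simp only [TopEnd.mk.injEq]
  exact funext h

lemma TopEnd.nonempty_comp (ε : TopEnd L) (K : Compacts L) : (ε.comp K).Nonempty := by
  obtain ⟨x, hx, h⟩ := ε.isComponent K
  exact ⟨x, h ▸ mem_connectedComponentIn hx⟩

lemma TopEnd.comp_eq_of_inter {ε ε' : TopEnd L} {K : Compacts L}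
    (h : (ε.comp K ∩ ε'.comp K).Nonempty) : ε.comp K = ε'.comp K := by
  obtain ⟨x, hx, e⟩ := ε.isComponent K
  obtain ⟨x', hx', e'⟩ := ε'.isComponent K
  rw [e, e'] at h ⊢
  obtain ⟨z, hz, hz'⟩ := h
  rw [connectedComponentIn_eq hz, connectedComponentIn_eq hz']

lemma TopEnd.not_compactSpace (ε : TopEnd L) : ¬ CompactSpace L := by
  intro h
  obtain ⟨x, hx, -⟩ := ε.isComponent ⊤
  exact hx (by simp)

/-- In a connected, locally connected and locally compact space, finitely many components of the
complement of a compact set cover the complement of a larger one. -/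
lemma exists_component_mem_ultrafilter [T2Space L] [LocallyCompactSpace L] [LocallyConnectedSpace L]
    [PreconnectedSpace L] {U : Ultrafilter L} (hU : (U : Filter L) ≤ cocompact L)
    (K : Compacts L) : ∃ x ∈ (K : Set L)ᶜ, connectedComponentIn (K : Set L)ᶜ x ∈ U := by
  obtain ⟨K', hK', hKK'⟩ := exists_compact_superset K.isCompact
  have hKo : IsOpen (K : Set L)ᶜ := K.isCompact.isClosed.isOpen_compl
  have hfr : IsCompact (frontier K') :=
    hK'.of_isClosed_subset isClosed_frontier hK'.isClosed.frontier_subset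
  have hfrK : frontier K' ⊆ (K : Set L)ᶜ := fun x hx hxK => hx.2 (hKK' hxK)
  obtain ⟨t, hcov⟩ := hfr.elim_nhds_subcover' (fun x _ => connectedComponentIn (K : Set L)ᶜ x)
    fun x hx => hKo.connectedComponentIn.mem_nhds (mem_connectedComponentIn (hfrK hx))
  have hout : K'ᶜ ∈ U := hU hK'.compl_mem_cocompact
  -- This case occurs only for empty `K`. Otherwise no component of the complement of `K` can be
  -- clopen.
  by_cases hall : ∃ x ∈ (K : Set L)ᶜ, connectedComponentIn (K : Set L)ᶜ x = univ
  · obtain ⟨x, hx, h⟩ := hall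
    exact ⟨x, hx, h ▸ univ_mem⟩
  -- A component of `Kᶜ` reaching outside `K'` must cross the frontier of `K'`; otherwise it stays
  -- away from `K` and is clopen in `L`. Finitely many components cover that compact frontier, and
  -- an ultrafilter containing a finite union contains one of its members.
  have hsub : K'ᶜ ⊆ ⋃ x ∈ t, connectedComponentIn (K : Set L)ᶜ (x : L) := by
    intro z hz
    have hzK : z ∈ (K : Set L)ᶜ := fun h => hz (interior_subset (hKK' h))
    set W := connectedComponentIn (K : Set L)ᶜ z
    have hzW : z ∈ W := mem_connectedComponentIn hzK
    have hWc : IsPreconnected W := isPreconnected_connectedComponentIn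
    have hWo : IsOpen W := hKo.connectedComponentIn
    by_cases hmeet : (W ∩ frontier K').Nonempty
    · obtain ⟨y, hyW, hyf⟩ := hmeet
      obtain ⟨x, hx⟩ := mem_iUnion.1 (hcov hyf)
      obtain ⟨hxt, hyx⟩ := mem_iUnion.1 hx
      refine mem_iUnion₂.2 ⟨x, hxt, ?_⟩
      rw [connectedComponentIn_eq hyx, ← connectedComponentIn_eq hyW]
      exact hzW
    · exfalso
      have hWout : W ⊆ K'ᶜ := by
        refine hWc.subset_left_of_subset_union hK'.isClosed.isOpen_compl isOpen_interior
          (disjoint_compl_left_iff_subset.2 interior_subset) ?_ ⟨z, hzW, hz⟩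
        intro y hy
        by_cases hyK : y ∈ K'
        · right
          by_contra hyi
          exact hmeet ⟨y, hy, subset_closure hyK, hyi⟩
        · exact Or.inl hyK
      have hcl : IsClosed W := by
        refine closure_subset_iff_isClosed.1 fun y hy => ?_
        have hyK : y ∈ (K : Set L)ᶜ := fun h => by
          obtain ⟨y', hy', hy''⟩ := mem_closure_iff.1 hy _ isOpen_interior (hKK' h)
          exact hWout hy'' (interior_subset hy')
        obtain ⟨y', hy', hy''⟩ := mem_closure_iff.1 hy _ hKo.connectedComponentIn
          (mem_connectedComponentIn hyK)
        have := mem_connectedComponentIn hyK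
        rwa [connectedComponentIn_eq hy', ← connectedComponentIn_eq hy''] at this
      refine hall ⟨z, hzK, ?_⟩
      exact (isClopen_iff.1 ⟨hcl, hWo⟩).resolve_left (Nonempty.ne_empty ⟨z, hzW⟩)
  have h1 := mem_of_superset hout hsub
  obtain ⟨x, hxt, hx⟩ := (Ultrafilter.finite_biUnion_mem_iff t.finite_toSet).1 h1
  exact ⟨x, hfrK x.2, hx⟩

/-- An ultrafilter going to infinity converges to an end. -/
theorem TopEnd.exists_of_ultrafilter [T2Space L] [LocallyCompactSpace L] [LocallyConnectedSpace L]
    [PreconnectedSpace L] {U : Ultrafilter L} (hU : (U : Filter L) ≤ cocompact L) :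
    ∃ ε : TopEnd L, ∀ K, ε.comp K ∈ U := by
  choose x hx hxU using exists_component_mem_ultrafilter hU
  refine ⟨⟨fun K => connectedComponentIn (K : Set L)ᶜ (x K), fun K => ⟨x K, hx K, rfl⟩,
    fun K K' hKK' => ?_⟩, hxU⟩
  obtain ⟨z, hz, hz'⟩ := U.nonempty_of_mem (inter_mem (hxU K) (hxU K'))
  rw [connectedComponentIn_eq hz]
  exact isPreconnected_connectedComponentIn.subset_connectedComponentIn hz'
    ((connectedComponentIn_subset _ _).trans (compl_subset_compl.2 hKK'))

/-! ### The ends of a line -/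

/-- The image of the interval `[-N, N]`. -/
def lineCompact (C : ℝ ≃ₜ L) (N : ℕ) : Compacts L :=
  ⟨C '' Icc (-N : ℝ) N, isCompact_Icc.image C.continuous⟩

lemma TopEnd.comp_line (C : ℝ ≃ₜ L) (η : TopEnd L) (N : ℕ) :
    C ⁻¹' η.comp (lineCompact C N) = Ioi (N : ℝ) ∨
      C ⁻¹' η.comp (lineCompact C N) = Iio (-N : ℝ) := by
  obtain ⟨x, hx, h⟩ := η.isComponent (lineCompact C N)
  have hN : (0 : ℝ) ≤ N := N.cast_nonneg
  have hcompl : C ⁻¹' ((lineCompact C N : Set L)ᶜ) = Iio (-N : ℝ) ∪ Ioi (N : ℝ) := by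
    ext t
    simp only [lineCompact, Compacts.coe_mk, mem_preimage, mem_compl_iff, C.injective.mem_set_image,
      mem_Icc, mem_union, mem_Iio, mem_Ioi, not_and_or, not_le]
  have hpre : IsPreconnected (C ⁻¹' η.comp (lineCompact C N)) := by
    rw [C.isPreconnected_preimage, h]
    exact isPreconnected_connectedComponentIn
  have hsub : C ⁻¹' η.comp (lineCompact C N) ⊆ Iio (-N : ℝ) ∪ Ioi (N : ℝ) := by
    rw [← hcompl, h]
    exact preimage_mono (connectedComponentIn_subset _ _)
  have hmax : ∀ I : Set ℝ, IsPreconnected I → I ⊆ Iio (-N : ℝ) ∪ Ioi (N : ℝ) →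
      (I ∩ C ⁻¹' η.comp (lineCompact C N)).Nonempty → I ⊆ C ⁻¹' η.comp (lineCompact C N) := by
    rintro I hI hIs ⟨t, htI, ht⟩
    rw [h] at ht ⊢
    rw [← image_subset_iff, connectedComponentIn_eq (mem_preimage.1 ht)]
    refine (hI.image _ C.continuous.continuousOn).subset_connectedComponentIn ⟨t, htI, rfl⟩ ?_
    rw [image_subset_iff, hcompl]
    exact hIs
  have hdisj : Disjoint (Iio (-N : ℝ)) (Ioi (N : ℝ)) :=
    Set.disjoint_left.2 fun t h1 h2 => by
      have h1' : t < -N := h1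
      have h2' : N < t := h2
      linarith
  have hxs : C.symm x ∈ C ⁻¹' η.comp (lineCompact C N) := by
    rw [mem_preimage, C.apply_symm_apply, h]
    exact mem_connectedComponentIn hx
  rcases hsub hxs with hlt | hgt
  · right
    refine Subset.antisymm (hpre.subset_left_of_subset_union isOpen_Iio isOpen_Ioi hdisj hsub
      ⟨_, hxs, hlt⟩) (hmax _ isPreconnected_Iio subset_union_left ⟨_, hlt, hxs⟩)
  · left
    refine Subset.antisymm (hpre.subset_right_of_subset_union isOpen_Iio isOpen_Ioi hdisj hsub
      ⟨_, hxs, hgt⟩) (hmax _ isPreconnected_Ioi subset_union_right ⟨_, hgt, hxs⟩)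

/-- The end at `+∞`. -/
def IsPosEnd (C : ℝ ≃ₜ L) (η : TopEnd L) : Prop :=
  ∀ N : ℕ, C ⁻¹' η.comp (lineCompact C N) = Ioi (N : ℝ)

/-- The end at `-∞`. -/
def IsNegEnd (C : ℝ ≃ₜ L) (η : TopEnd L) : Prop :=
  ∀ N : ℕ, C ⁻¹' η.comp (lineCompact C N) = Iio (-N : ℝ)

lemma lineCompact_mono (C : ℝ ≃ₜ L) {N N' : ℕ} (h : N ≤ N') : lineCompact C N ≤ lineCompact C N' := by
  have h' : (N : ℝ) ≤ N' := by exact_mod_cast h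
  exact image_mono (Icc_subset_Icc (by linarith) h')

/-- The components attached to an end are nested, so the side chosen for `N = 0` is kept for all
`N`. -/
lemma isPosEnd_or_isNegEnd (C : ℝ ≃ₜ L) (η : TopEnd L) : IsPosEnd C η ∨ IsNegEnd C η := by
  have hsub : ∀ N : ℕ, C ⁻¹' η.comp (lineCompact C N) ⊆ C ⁻¹' η.comp (lineCompact C 0) :=
    fun N => preimage_mono (η.anti _ _ (lineCompact_mono C N.zero_le))
  rcases η.comp_line C 0 with h0 | h0
  · left
    intro N
    refine (η.comp_line C N).resolve_right fun hN => ?_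
    have h1 := hsub N
    rw [h0, hN] at h1
    have h2 : (-N - 1 : ℝ) ∈ Iio (-N : ℝ) := by simp
    have h3 : ((0 : ℕ) : ℝ) < -N - 1 := h1 h2
    have : (0 : ℝ) ≤ N := N.cast_nonneg
    push_cast at h3
    linarith
  · right
    intro N
    refine (η.comp_line C N).resolve_left fun hN => ?_
    have h1 := hsub N
    rw [h0, hN] at h1
    have h2 : (N + 1 : ℝ) ∈ Ioi (N : ℝ) := by simp
    have h3 : (N + 1 : ℝ) < -((0 : ℕ) : ℝ) := h1 h2
    have : (0 : ℝ) ≤ N := N.cast_nonneg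
    push_cast at h3
    linarith

lemma exists_le_lineCompact (C : ℝ ≃ₜ L) (K : Compacts L) : ∃ N, K ≤ lineCompact C N := by
  obtain ⟨r, hr⟩ := (K.isCompact.image C.symm.continuous).isBounded.subset_closedBall 0
  obtain ⟨N, hN⟩ := exists_nat_ge r
  refine ⟨N, fun z hz => ⟨C.symm z, ?_, C.apply_symm_apply z⟩⟩
  have := mem_closedBall_zero_iff.1 (hr ⟨z, hz, rfl⟩)
  exact abs_le.1 (this.trans hN)

/-- The compact intervals exhaust the line, and components of the complement of a compact set that
meet are equal. -/
lemma TopEnd.eq_of_comp_line (C : ℝ ≃ₜ L) {η η' : TopEnd L}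
    (h : ∀ N, C ⁻¹' η.comp (lineCompact C N) = C ⁻¹' η'.comp (lineCompact C N)) : η = η' := by
  refine TopEnd.ext_comp fun K => ?_
  obtain ⟨N, hN⟩ := exists_le_lineCompact C K
  have hN' := C.surjective.preimage_injective (h N)
  obtain ⟨z, hz⟩ := η.nonempty_comp (lineCompact C N)
  exact TopEnd.comp_eq_of_inter ⟨z, η.anti _ _ hN hz, η'.anti _ _ hN (hN' ▸ hz)⟩

lemma IsPosEnd.eq {C : ℝ ≃ₜ L} {η η' : TopEnd L} (h : IsPosEnd C η) (h' : IsPosEnd C η') : η = η' :=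
  TopEnd.eq_of_comp_line C fun N => by rw [h N, h' N]

lemma IsNegEnd.eq {C : ℝ ≃ₜ L} {η η' : TopEnd L} (h : IsNegEnd C η) (h' : IsNegEnd C η') : η = η' :=
  TopEnd.eq_of_comp_line C fun N => by rw [h N, h' N]

end Ends

/-! ### Maps to lines matching the ends -/

section Leafwise

variable {L : Type u} [TopologicalSpace L]

/-- The function `a` tends to `+∞` at the end `ε₁` and to `-∞` at the end `ε₂`. -/
structure Separates (a : L → ℝ) (ε₁ ε₂ : TopEnd L) : Prop where
  above : ∀ N : ℕ, ∃ K, ∀ z ∈ ε₁.comp K, (N : ℝ) < a z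
  below : ∀ N : ℕ, ∃ K, ∀ z ∈ ε₂.comp K, a z < -N

lemma Separates.neg {a : L → ℝ} {ε₁ ε₂ : TopEnd L} (h : Separates a ε₁ ε₂) :
    Separates (fun z => -a z) ε₂ ε₁ where
  above N := by
    obtain ⟨K, hK⟩ := h.below N
    exact ⟨K, fun z hz => by have := hK z hz; linarith⟩
  below N := by
    obtain ⟨K, hK⟩ := h.above N
    exact ⟨K, fun z hz => by have := hK z hz; linarith⟩

/-- The bijection of ends sends `ε₁` and `ε₂` to distinct ends of the line, and a line has at most
one end on each side. -/
lemma exists_separates {ℓ : Type v} [TopologicalSpace ℓ] (C : ℝ ≃ₜ ℓ) {ψ : L → ℓ}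
    (hψ : ∃ e : TopEnd L ≃ TopEnd ℓ, ∀ (ε : TopEnd L) (K' : Compacts ℓ), ∃ K : Compacts L,
      ψ '' ε.comp K ⊆ (e ε).comp K') {ε₁ ε₂ : TopEnd L} (hne : ε₁ ≠ ε₂) :
    Separates (fun z => C.symm (ψ z)) ε₁ ε₂ ∨ Separates (fun z => C.symm (ψ z)) ε₂ ε₁ := by
  obtain ⟨e, he⟩ := hψ
  have key : ∀ {ε ε'}, IsPosEnd C (e ε) → IsNegEnd C (e ε') →
      Separates (fun z => C.symm (ψ z)) ε ε' := by
    intro ε ε' hp hn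
    refine ⟨fun N => ?_, fun N => ?_⟩
    · obtain ⟨K, hK⟩ := he ε (lineCompact C N)
      refine ⟨K, fun z hz => ?_⟩
      have h1 : C.symm (ψ z) ∈ C ⁻¹' (e ε).comp (lineCompact C N) := by
        rw [mem_preimage, C.apply_symm_apply]
        exact hK ⟨z, hz, rfl⟩
      rw [hp N] at h1
      exact h1
    · obtain ⟨K, hK⟩ := he ε' (lineCompact C N)
      refine ⟨K, fun z hz => ?_⟩
      have h1 : C.symm (ψ z) ∈ C ⁻¹' (e ε').comp (lineCompact C N) := by
        rw [mem_preimage, C.apply_symm_apply]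
        exact hK ⟨z, hz, rfl⟩
      rw [hn N] at h1
      exact h1
  rcases isPosEnd_or_isNegEnd C (e ε₁) with h1 | h1 <;>
    rcases isPosEnd_or_isNegEnd C (e ε₂) with h2 | h2
  · exact (hne (e.injective (h1.eq h2))).elim
  · exact Or.inl (key h1 h2)
  · exact Or.inr (key h2 h1)
  · exact (hne (e.injective (h1.eq h2))).elim

variable [T2Space L] [LocallyCompactSpace L] [LocallyConnectedSpace L] [PreconnectedSpace L]

/-- If no compact set worked, some ultrafilter would go to infinity through points where the
conclusion fails. It converges to `ε₁` or `ε₂`, and near either end the two functions are large with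
the same sign. -/
lemma Separates.exists_isCompact {a b : L → ℝ} {ε₁ ε₂ : TopEnd L} (hε : ∀ ε, ε = ε₁ ∨ ε = ε₂)
    (ha : Separates a ε₁ ε₂) (hb : Separates b ε₁ ε₂) (N : ℕ) : ∃ K : Set L, IsCompact K ∧
      ∀ z ∉ K, ((N : ℝ) < a z ∧ (N : ℝ) < b z) ∨ (a z < -N ∧ b z < -N) := by
  by_contra! hcon
  set bad : Set L := {z | ¬ (((N : ℝ) < a z ∧ (N : ℝ) < b z) ∨ (a z < -N ∧ b z < -N))}
  have hne : (cocompact L ⊓ 𝓟 bad).NeBot := by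
    rw [(hasBasis_cocompact.inf_principal bad).neBot_iff]
    intro K hK
    obtain ⟨z, hz, h1, h2⟩ := hcon K hK
    refine ⟨z, hz, ?_⟩
    rintro (⟨h3, h4⟩ | ⟨h3, h4⟩)
    · exact (h1 h3).not_gt h4
    · exact (h2 h3).not_gt h4
  obtain ⟨U, hU⟩ := @Ultrafilter.exists_le _ _ hne
  obtain ⟨ε, hεU⟩ := TopEnd.exists_of_ultrafilter (hU.trans inf_le_left)
  have hbad : bad ∈ U := hU (mem_inf_of_right (mem_principal_self bad))
  rcases hε ε with rfl | rfl
  · obtain ⟨K, hK⟩ := ha.above N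
    obtain ⟨K', hK'⟩ := hb.above N
    obtain ⟨z, ⟨hz, hz'⟩, hzb⟩ := U.nonempty_of_mem
      (inter_mem (inter_mem (hεU K) (hεU K')) hbad)
    exact hzb (Or.inl ⟨hK z hz, hK' z hz'⟩)
  · obtain ⟨K, hK⟩ := ha.below N
    obtain ⟨K', hK'⟩ := hb.below N
    obtain ⟨z, ⟨hz, hz'⟩, hzb⟩ := U.nonempty_of_mem
      (inter_mem (inter_mem (hεU K) (hεU K')) hbad)
    exact hzb (Or.inr ⟨hK z hz, hK' z hz'⟩)

/-- Off a compact set the two functions are both above `M` or both below `-M`, and on the compact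
set both are bounded; the finiteness conditions follow, and the unboundedness comes from the ends.
-/
lemma Separates.endsMatched {a b : L → ℝ} {ε₁ ε₂ : TopEnd L} (hε : ∀ ε, ε = ε₁ ∨ ε = ε₂)
    (ha : Separates a ε₁ ε₂) (hb : Separates b ε₁ ε₂) (hac : Continuous a) (hbc : Continuous b) :
    EndsMatched (range fun z => (a z, b z)) := by
  have key : ∀ M : ℝ, ∃ B : ℝ, ∀ z, (M < a z ∧ M < b z) ∨ (a z < -M ∧ b z < -M) ∨
      (|a z| ≤ B ∧ |b z| ≤ B) := by
    intro M
    obtain ⟨N, hN⟩ := exists_nat_ge M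
    obtain ⟨K, hK, h⟩ := ha.exists_isCompact hε hb N
    obtain ⟨B, hB⟩ := hK.exists_bound_of_continuousOn hac.continuousOn
    obtain ⟨B', hB'⟩ := hK.exists_bound_of_continuousOn hbc.continuousOn
    refine ⟨max B B', fun z => ?_⟩
    by_cases hz : z ∈ K
    · exact Or.inr (Or.inr ⟨(hB z hz).trans (le_max_left _ _), (hB' z hz).trans (le_max_right _ _)⟩)
    · rcases h z hz with ⟨h1, h2⟩ | ⟨h1, h2⟩
      · exact Or.inl ⟨by linarith, by linarith⟩
      · exact Or.inr (Or.inl ⟨by linarith, by linarith⟩)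
  constructor
  · intro N
    obtain ⟨M, hM⟩ := exists_nat_ge N
    obtain ⟨K, hK⟩ := ha.above M
    obtain ⟨z, hz⟩ := ε₁.nonempty_comp K
    exact ⟨_, ⟨z, rfl⟩, hM.trans (hK z hz).le⟩
  · intro N
    obtain ⟨M, hM⟩ := exists_nat_ge (-N)
    obtain ⟨K, hK⟩ := ha.below M
    obtain ⟨z, hz⟩ := ε₂.nonempty_comp K
    exact ⟨_, ⟨z, rfl⟩, by have := hK z hz; simp only; linarith⟩
  all_goals
    intro N
    obtain ⟨B, hB⟩ := key |N|
    have hN := abs_le.1 (le_refl |N|)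
  · refine ⟨max B (-|N|), ?_⟩
    rintro _ ⟨z, rfl⟩ hz
    simp only at hz ⊢
    rcases hB z with ⟨h1, h2⟩ | ⟨h1, h2⟩ | ⟨h1, h2⟩
    · linarith
    · exact h2.le.trans (le_max_right _ _)
    · exact (abs_le.1 h2).2.trans (le_max_left _ _)
  · refine ⟨min (-B) |N|, ?_⟩
    rintro _ ⟨z, rfl⟩ hz
    simp only at hz ⊢
    rcases hB z with ⟨h1, h2⟩ | ⟨h1, h2⟩ | ⟨h1, h2⟩
    · exact (min_le_right _ _).trans h2.le
    · linarith
    · exact (min_le_left _ _).trans (abs_le.1 h2).1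
  · refine ⟨max B (-|N|), ?_⟩
    rintro _ ⟨z, rfl⟩ hz
    simp only at hz ⊢
    rcases hB z with ⟨h1, h2⟩ | ⟨h1, h2⟩ | ⟨h1, h2⟩
    · linarith
    · exact h1.le.trans (le_max_right _ _)
    · exact (abs_le.1 h1).2.trans (le_max_left _ _)
  · refine ⟨min (-B) |N|, ?_⟩
    rintro _ ⟨z, rfl⟩ hz
    simp only at hz ⊢
    rcases hB z with ⟨h1, h2⟩ | ⟨h1, h2⟩ | ⟨h1, h2⟩
    · exact (min_le_right _ _).trans h1.le
    · linarith
    · exact (min_le_left _ _).trans (abs_le.1 h1).1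

end Leafwise

/-! ### Ends of the leaves and collapses -/

section Leaf

variable {n : ℕ} {X : Type*} [TopologicalSpace X] [MeasurableSpace X]
  {Y₀ : Type*} [TopologicalSpace Y₀] {Y₁ : Type*} [TopologicalSpace Y₁]

/-- A homeomorphism from the line onto a leaf. -/
noncomputable def leafHomeo {Y : Type*} [TopologicalSpace Y] {C : ℝ → Y} {y : Y}
    (hC : Topology.IsOpenEmbedding C) (hr : range C = connectedComponent y) :
    ℝ ≃ₜ connectedComponent y :=
  hC.isEmbedding.toHomeomorph.trans (Homeomorph.setCongr hr)

lemma leafHomeo_apply {Y : Type*} [TopologicalSpace Y] {C : ℝ → Y} {y : Y}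
    (hC : Topology.IsOpenEmbedding C) (hr : range C = connectedComponent y) (t : ℝ) :
    (leafHomeo hC hr t : Y) = C t := rfl

lemma eq_leafHomeo_symm {Y : Type*} [TopologicalSpace Y] {C : ℝ → Y} {y : Y}
    (hC : Topology.IsOpenEmbedding C) (hr : range C = connectedComponent y) (t : ℝ)
    (z : connectedComponent y) : C t = z ↔ t = (leafHomeo hC hr).symm z := by
  rw [← leafHomeo_apply hC hr, ← Subtype.ext_iff, Homeomorph.eq_symm_apply]

lemma corr_eq_range {X : Type*} [TopologicalSpace X] {Y₀ Y₁ : Type*} {p₀ : X → Y₀} {p₁ : X → Y₁}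
    {C₀ : ℝ → Y₀} {C₁ : ℝ → Y₁} {x : X} {a b : connectedComponent x → ℝ}
    (ha : ∀ (z : connectedComponent x) (t : ℝ), C₀ t = p₀ z ↔ t = a z)
    (hb : ∀ (z : connectedComponent x) (t : ℝ), C₁ t = p₁ z ↔ t = b z) :
    corr p₀ p₁ C₀ C₁ x = range fun z => (a z, b z) := by
  ext ⟨s, r⟩
  constructor
  · rintro ⟨ξ, hξ, h0, h1⟩
    exact ⟨⟨ξ, hξ⟩, Prod.ext ((ha ⟨ξ, hξ⟩ s).1 h0).symm ((hb ⟨ξ, hξ⟩ r).1 h1).symm⟩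
  · rintro ⟨z, hz⟩
    simp only [Prod.mk.injEq] at hz
    exact ⟨z, z.2, (ha z s).2 hz.1.symm, (hb z r).2 hz.2.symm⟩

omit [MeasurableSpace X] in
lemma MatchesEnds.exists_separates {π : X → Y₀} {x : X} (h : MatchesEnds π x)
    (hπ : ContinuousOn π (connectedComponent x)) {C : ℝ → Y₀} (hC : Topology.IsOpenEmbedding C)
    (hr : range C = connectedComponent (π x)) {ε₁ ε₂ : TopEnd (connectedComponent x)}
    (hne : ε₁ ≠ ε₂) : ∃ a : connectedComponent x → ℝ, Continuous a ∧
      (∀ (z : connectedComponent x) (t : ℝ), C t = π z ↔ t = a z) ∧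
      (Separates a ε₁ ε₂ ∨ Separates a ε₂ ε₁) := by
  have hmaps : ∀ z : connectedComponent x, π z ∈ connectedComponent (π x) := fun z =>
    (isPreconnected_connectedComponent.image _ hπ).subset_connectedComponent
      ⟨x, mem_connectedComponent, rfl⟩ ⟨z, z.2, rfl⟩
  let ψ : connectedComponent x → connectedComponent (π x) := fun z => ⟨π z, hmaps z⟩
  have hψ : Continuous ψ := (continuousOn_iff_continuous_domRestrict.1 hπ).subtype_mk _
  refine ⟨fun z => (leafHomeo hC hr).symm (ψ z), (leafHomeo hC hr).symm.continuous.comp hψ,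
    fun (z : connectedComponent x) t => eq_leafHomeo_symm hC hr t (ψ z), MeasuredFoliation.exists_separates _ ?_ hne⟩
  obtain ⟨e, he⟩ := h
  refine ⟨e, fun ε K' => ?_⟩
  obtain ⟨K, hK⟩ := he ε K'
  refine ⟨K, ?_⟩
  rintro _ ⟨z, hz, rfl⟩
  obtain ⟨w, hw, hwz⟩ := hK ⟨z, ⟨z, hz, rfl⟩, rfl⟩
  have : w = ψ z := Subtype.ext hwz
  exact this ▸ hw

/-- Two maps matching the ends of a two-ended leaf with those of lines have matched ends, up to the
orientation of one of the lines. -/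
theorem endsMatched_corr (hX : BorelFoliation n X) {π₀ : X → Y₀} {π₁ : X → Y₁} {x : X}
    (h₀ : MatchesEnds π₀ x) (h₁ : MatchesEnds π₁ x) (hπ₀ : ContinuousOn π₀ (connectedComponent x))
    (hπ₁ : ContinuousOn π₁ (connectedComponent x))
    (hcard : Nat.card (TopEnd (connectedComponent x)) = 2) {C₀ : ℝ → Y₀} {C₁ : ℝ → Y₁}
    (hC₀ : Topology.IsOpenEmbedding C₀) (hr₀ : range C₀ = connectedComponent (π₀ x))
    (hC₁ : Topology.IsOpenEmbedding C₁) (hr₁ : range C₁ = connectedComponent (π₁ x)) :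
    EndsMatched (corr π₀ π₁ C₀ C₁ x) ∨
      EndsMatched (corr π₀ π₁ C₀ (fun t => C₁ (-1 * t + 0)) x) := by
  have := hX.t2Space
  have := hX.locallyCompactSpace
  have := hX.locallyConnectedSpace
  have hopen := (hX.isOpen_connectedComponent x).isOpenEmbedding_subtypeVal
  have : LocallyCompactSpace (connectedComponent x) := hopen.locallyCompactSpace
  have : LocallyConnectedSpace (connectedComponent x) := hopen.locallyConnectedSpace
  have : PreconnectedSpace (connectedComponent x) :=
    Subtype.preconnectedSpace isPreconnected_connectedComponent
  obtain ⟨ε₁, ε₂, hne, huniv⟩ := Nat.card_eq_two_iff.1 hcard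
  have hε : ∀ ε, ε = ε₁ ∨ ε = ε₂ := fun ε => by
    have : ε ∈ ({ε₁, ε₂} : Set _) := huniv ▸ mem_univ ε
    simpa using this
  have hε' : ∀ ε, ε = ε₂ ∨ ε = ε₁ := fun ε => (hε ε).symm
  obtain ⟨a, hac, ha, hsa⟩ := h₀.exists_separates hπ₀ hC₀ hr₀ hne
  obtain ⟨b, hbc, hb, hsb⟩ := h₁.exists_separates hπ₁ hC₁ hr₁ hne
  have hb' : ∀ (z : connectedComponent x) (t : ℝ), C₁ (-1 * t + 0) = π₁ z ↔ t = -b z :=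
    fun z t => by
    rw [hb]
    constructor <;> intro h <;> linarith
  rw [corr_eq_range ha hb, corr_eq_range (C₁ := fun t => C₁ (-1 * t + 0)) ha hb']
  -- Either both maps order the two ends in the same way, or they do so once `C₁` is reversed.
  rcases hsa with hsa | hsa <;> rcases hsb with hsb | hsb
  · exact Or.inl (hsa.endsMatched hε hsb hac hbc)
  · exact Or.inr (hsa.endsMatched hε hsb.neg hac hbc.neg)
  · exact Or.inr (hsa.endsMatched hε' hsb.neg hac hbc.neg)
  · exact Or.inl (hsa.endsMatched hε' hsb hac hbc)

omit [MeasurableSpace X] in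
-- The bijection gives an end to the leaf of `π x`, whereas a compact space has none: nothing
-- remains after removing the whole space.
lemma MatchesEnds.not_isCompact {π : X → Y₀} {x : X} (h : MatchesEnds π x)
    (hcard : Nat.card (TopEnd (connectedComponent x)) = 2) :
    ¬ IsCompact (connectedComponent (π x)) := by
  intro hc
  obtain ⟨ε, -⟩ := Nat.card_eq_two_iff.1 hcard
  obtain ⟨e, -⟩ := h
  exact (e ε).not_compactSpace (isCompact_iff_compactSpace.1 hc)

theorem BorelFoliation.exists_isOpenEmbedding [MeasurableSpace Y₀] (hY : BorelFoliation 1 Y₀)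
    {y : Y₀} (hnc : ¬ IsCompact (connectedComponent y)) :
    ∃ C : ℝ → Y₀, Topology.IsOpenEmbedding C ∧ range C = connectedComponent y := by
  have := hY.t2Space
  obtain ⟨φ, hφ⟩ := hY.exists_atlas
  have h𝒩 := (isWeightSystem hφ).isLengthAtlas
  obtain ⟨C, hC, hr⟩ := h𝒩.exists_isLeafParam y hnc
  exact ⟨C, hC.isOpenEmbedding h𝒩, hr⟩

/-- The correspondence of `π` with itself has matched ends, possibly after a reversal, so the image
of the leaf is unbounded in both directions of the line. -/
lemma MatchesEnds.image_connectedComponent [MeasurableSpace Y₀] (hX : BorelFoliation n X)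
    (hY : BorelFoliation 1 Y₀) {π : X → Y₀} {x : X} (h : MatchesEnds π x)
    (hπ : ContinuousOn π (connectedComponent x))
    (hcard : Nat.card (TopEnd (connectedComponent x)) = 2) :
    π '' connectedComponent x = connectedComponent (π x) := by
  obtain ⟨C, hC, hr⟩ := hY.exists_isOpenEmbedding (h.not_isCompact hcard)
  rcases endsMatched_corr hX h h hπ hπ hcard hC hr hC hr with he | he
  · exact image_connectedComponent_of_corr hC hr hπ he
  · exact image_connectedComponent_of_corr hC hr hπ he

end Leaf

/-! ### Transversals, negligible sets and total parts -/

section Transversals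

variable {n : ℕ} {X : Type*} [TopologicalSpace X] [MeasurableSpace X]

lemma IsTransversal.mono {S T : Set X} (hT : IsTransversal T) (hS : MeasurableSet S) (h : S ⊆ T) :
    IsTransversal S := by
  have := hT.discreteTopology
  refine ⟨hS, ?_, DiscreteTopology.of_subset hT.discreteTopology h⟩
  have h1 : IsClosed ((↑) '' ((↑) ⁻¹' S : Set T) : Set X) :=
    hT.isClosed.isClosedEmbedding_subtypeVal.isClosedMap _ (isClosed_discrete _)
  rwa [Subtype.image_preimage_coe, inter_eq_right.2 h] at h1

lemma isTransversal_empty : IsTransversal (∅ : Set X) :=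
  ⟨MeasurableSet.empty, isClosed_empty, inferInstance⟩

lemma InvTransverseMeasure.inter_add_diff (μ : InvTransverseMeasure X) {T A : Set X}
    (hT : IsTransversal T) (hA : MeasurableSet A) : μ T = μ (T ∩ A) + μ (T \ A) := by
  -- Finite additivity is obtained from the countable one by completing the two pieces with empty
  -- sets.
  let F : ℕ → Set X := fun k => if k = 0 then T ∩ A else if k = 1 then T \ A else ∅
  have h0 : F 0 = T ∩ A := rfl
  have h1 : F 1 = T \ A := rfl
  have h2 : ∀ k, 2 ≤ k → F k = ∅ := fun k hk => by
    simp only [F]; rw [if_neg (by omega), if_neg (by omega)]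
  have hF : ⋃ k, F k = T := by
    refine Subset.antisymm (iUnion_subset fun k => ?_) fun x hx => ?_
    · rcases Nat.lt_or_ge k 2 with hk | hk
      · interval_cases k
        · exact inter_subset_left
        · exact sdiff_subset
      · rw [h2 k hk]; exact empty_subset _
    · by_cases hxA : x ∈ A
      · exact mem_iUnion.2 ⟨0, hx, hxA⟩
      · exact mem_iUnion.2 ⟨1, hx, hxA⟩
  have hFt : ∀ k, IsTransversal (F k) := by
    intro k
    rcases Nat.lt_or_ge k 2 with hk | hk
    · interval_cases k
      · exact hT.mono (hT.measurableSet.inter hA) inter_subset_left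
      · exact hT.mono (hT.measurableSet.diff hA) sdiff_subset
    · rw [h2 k hk]; exact isTransversal_empty
  have hdisj : Pairwise (Function.onFun Disjoint F) := by
    intro j k hjk
    change Disjoint (F j) (F k)
    rcases Nat.lt_or_ge j 2 with hj | hj
    · rcases Nat.lt_or_ge k 2 with hk | hk
      · interval_cases j <;> interval_cases k
        · exact (hjk rfl).elim
        · exact disjoint_sdiff_inter.symm
        · exact disjoint_sdiff_inter
        · exact (hjk rfl).elim
      · rw [h2 k hk]; exact disjoint_empty _
    · rw [h2 j hj]; exact empty_disjoint _
  have h := μ.iUnion F hFt hdisj (hF ▸ hT)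
  rw [hF, tsum_eq_sum (s := Finset.range 2) fun k hk => ?_] at h
  · rw [h, Finset.sum_range_succ, Finset.sum_range_one, h0, h1]
  · rw [h2 k (not_lt.1 fun hlt => hk (Finset.mem_range.2 hlt)), μ.empty]

lemma IsNegligible.union {μ : InvTransverseMeasure X} {A B : Set X} (hA : IsNegligible μ A)
    (hAm : MeasurableSet A) (hB : IsNegligible μ B) : IsNegligible μ (A ∪ B) := by
  intro T hT hTAB
  rw [μ.inter_add_diff hT hAm,
    hA _ (hT.mono (hT.measurableSet.inter hAm) inter_subset_left) inter_subset_right,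
    hB _ (hT.mono (hT.measurableSet.diff hAm) sdiff_subset)
      (fun x hx => (hTAB hx.1).resolve_left hx.2), add_zero]

lemma IsTotal.inter {μ : InvTransverseMeasure X} {A B : Set X} (hA : IsTotal μ A)
    (hB : IsTotal μ B) : IsTotal μ (A ∩ B) where
  measurableSet := hA.measurableSet.inter hB.measurableSet
  isSaturated := hA.isSaturated.inter hB.isSaturated
  negligible_compl := by
    rw [compl_inter]
    exact hA.negligible_compl.union hA.measurableSet.compl hB.negligible_compl

lemma IsTransversal.image_val (hX : BorelFoliation n X) {A : Set X} (hA : IsSaturated A)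
    (hAm : MeasurableSet A) {S : Set A} (hS : IsTransversal S) :
    IsTransversal ((↑) '' S : Set X) := by
  have := hS.discreteTopology
  refine ⟨hAm.subtype_image hS.measurableSet,
    (hX.isClosed hA).isClosedEmbedding_subtypeVal.isClosedMap _ hS.isClosed, ?_⟩
  have hmem : ∀ z : ((↑) '' S : Set X), ∃ h : (z : X) ∈ A, (⟨z, h⟩ : A) ∈ S := by
    rintro ⟨_, ⟨z, hz, rfl⟩⟩
    exact ⟨z.2, hz⟩
  have hemb : Topology.IsEmbedding fun z : ((↑) '' S : Set X) =>
      (⟨⟨z, (hmem z).1⟩, (hmem z).2⟩ : S) :=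
    Topology.IsEmbedding.of_comp (by fun_prop) (by fun_prop : Continuous fun s : S => ((s : A) : X))
      Topology.IsEmbedding.subtypeVal
  exact hemb.discreteTopology

lemma IsTransversal.preimage_val {A : Set X} {T : Set X} (hT : IsTransversal T) :
    IsTransversal (Subtype.val ⁻¹' T : Set A) := by
  have := hT.discreteTopology
  refine ⟨measurable_subtype_coe hT.measurableSet, hT.isClosed.preimage continuous_subtype_val, ?_⟩
  have hemb : Topology.IsEmbedding fun z : (Subtype.val ⁻¹' T : Set A) => (⟨((z : A) : X), z.2⟩ : T) :=
    Topology.IsEmbedding.of_comp (by fun_prop) continuous_subtype_val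
      ((Topology.IsEmbedding.subtypeVal (p := (· ∈ A))).comp Topology.IsEmbedding.subtypeVal)
  exact hemb.discreteTopology

end Transversals

/-! ### Restriction of collapses -/

namespace IsCollapseOn

variable {n : ℕ} {X : Type*} [TopologicalSpace X] [MeasurableSpace X]
  {Y : Type*} [TopologicalSpace Y] [MeasurableSpace Y] {μ : InvTransverseMeasure X}
  {ν : InvTransverseMeasure Y} {π : X → Y} {A : Set X} {B : Set Y}

lemma measurable_restrict (h : IsCollapseOn μ ν π A B) : Measurable h.mapsTo.restrict :=
  h.measurable.subtype_mk

lemma continuous_restrict (h : IsCollapseOn μ ν π A B) : Continuous h.mapsTo.restrict :=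
  h.continuousOn.mapsToRestrict h.mapsTo

lemma surjective_restrict (h : IsCollapseOn μ ν π A B) :
    Function.Surjective h.mapsTo.restrict :=
  h.mapsTo.restrict_surjective_iff.2 h.surjOn

lemma isCompact_restrict_preimage (h : IsCollapseOn μ ν π A B) (y : B) :
    IsCompact (h.mapsTo.restrict ⁻¹' {y}) := by
  rw [Subtype.isCompact_iff]
  convert h.isCompact_fibre y y.2 using 1
  ext x
  constructor
  · rintro ⟨z, hz, rfl⟩
    exact ⟨z.2, congrArg Subtype.val hz⟩
  · rintro ⟨hx, hxy⟩
    exact ⟨⟨x, hx⟩, Subtype.ext hxy, rfl⟩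

lemma leaf_restrict (h : IsCollapseOn μ ν π A B) (x x' : A)
    (hxx : (h.mapsTo.restrict) x = (h.mapsTo.restrict) x') :
    connectedComponent x = connectedComponent x' :=
  h.isTotal_source.isSaturated.connectedComponent_eq_iff.2
    (h.fibre_in_leaf x x.2 x' x'.2 (congrArg Subtype.val hxx))

/-- The transversals of the target of a collapse lift to the source. -/
theorem exists_lift (h : IsCollapseOn μ ν π A B) (hX : BorelFoliation n X)
    (hY : BorelFoliation 1 Y) {S : Set Y} (hS : IsTransversal S) (hSB : S ⊆ B) :
    ∃ T ⊆ A, IsTransversal T ∧ BijOn π T S := by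
  have hA := h.isTotal_source
  have hB := h.isTotal_target
  obtain ⟨T, hT, hTS⟩ := (hX.restrict hA.measurableSet hA.isSaturated).exists_lift
    (hY.restrict hB.measurableSet hB.isSaturated) h.measurable_restrict h.continuous_restrict
    h.isCompact_restrict_preimage h.leaf_restrict h.surjective_restrict
    (IsTransversal.preimage_val (A := B) hS)
  refine ⟨(↑) '' T, Subtype.coe_image_subset A T,
    hT.image_val hX hA.isSaturated hA.measurableSet, ?_, ?_, ?_⟩
  · rintro _ ⟨z, hz, rfl⟩
    exact hTS.mapsTo hz
  · rintro _ ⟨z, hz, rfl⟩ _ ⟨w, hw, rfl⟩ hzw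
    rw [hTS.injOn hz hw (Subtype.ext hzw)]
  · intro y hy
    obtain ⟨z, hz, hzy⟩ := hTS.surjOn (show (⟨y, hSB hy⟩ : B) ∈ _ from hy)
    exact ⟨z, ⟨z, hz, rfl⟩, congrArg Subtype.val hzy⟩

/-- Fibres lie in leaves and `G` is a union of leaves, so a Borel section has the same image over
`G` as the whole of `A`. That image is an injective Borel image. -/
theorem measurableSet_image (h : IsCollapseOn μ ν π A B) (hX : BorelFoliation n X)
    (hY : BorelFoliation 1 Y) {G : Set X} (hG : MeasurableSet G) (hGs : IsSaturated G) :
    MeasurableSet (π '' (A ∩ G)) := by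
  have hA := h.isTotal_source
  have hB := h.isTotal_target
  have hXA := hX.restrict hA.measurableSet hA.isSaturated
  have hYB := hY.restrict hB.measurableSet hB.isSaturated
  have := hXA.standardBorelSpace
  have := hYB.standardBorelSpace
  obtain ⟨M, hM, hinj, himg⟩ := hXA.exists_section hYB h.measurable_restrict h.continuous_restrict
    h.isCompact_restrict_preimage h.leaf_restrict
  have hMG : MeasurableSet (M ∩ (↑) ⁻¹' G) := hM.inter (measurable_subtype_coe hG)
  convert hB.measurableSet.subtype_image
    (hMG.image_of_measurable_injOn h.measurable_restrict (hinj.mono inter_subset_left)) using 1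
  ext y
  constructor
  · rintro ⟨x, ⟨hxA, hxG⟩, rfl⟩
    obtain ⟨m, hm, hmx⟩ := himg.ge (mem_range_self (⟨x, hxA⟩ : A))
    exact ⟨_, ⟨m, ⟨hm, hGs.mem_of_eq hxG
      (h.fibre_in_leaf x hxA m m.2 (congrArg Subtype.val hmx).symm)⟩, rfl⟩,
      congrArg Subtype.val hmx⟩
  · rintro ⟨_, ⟨m, ⟨-, hmG⟩, rfl⟩, rfl⟩
    exact ⟨m, ⟨m.2, hmG⟩, rfl⟩

lemma image_connectedComponent (h : IsCollapseOn μ ν π A B) (hX : BorelFoliation n X)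
    (hY : BorelFoliation 1 Y) {x : X} (hx : x ∈ A)
    (hcard : Nat.card (TopEnd (connectedComponent x)) = 2) :
    π '' connectedComponent x = connectedComponent (π x) :=
  (h.matchesEnds x hx).image_connectedComponent hX hY
    (h.continuousOn.mono (h.isTotal_source.isSaturated x hx)) hcard

/-- A collapse restricts to a collapse of any smaller total part of two-ended leaves. -/
theorem restrict (h : IsCollapseOn μ ν π A B) (hX : BorelFoliation n X)
    (hY : BorelFoliation 1 Y) {G : Set X} (hG : IsTotal μ G)
    (hcard : ∀ x ∈ G, Nat.card (TopEnd (connectedComponent x)) = 2) :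
    IsCollapseOn μ ν π (A ∩ G) (π '' (A ∩ G)) where
  isTotal_source := h.isTotal_source.inter hG
  isTotal_target := by
    refine ⟨h.measurableSet_image hX hY hG.measurableSet hG.isSaturated, ?_, fun S hS hSG => ?_⟩
    · rintro _ ⟨x, hx, rfl⟩
      rw [← h.image_connectedComponent hX hY hx.1 (hcard x hx.2)]
      exact image_mono ((h.isTotal_source.inter hG).isSaturated x hx)
    -- The part of `S` outside `B` is null. The part inside lifts to a transversal which avoids `G`,
    -- since otherwise `S` would meet the image of `A ∩ G`; the lift is therefore null.
    · have hBm := h.isTotal_target.measurableSet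
      have hSB := hS.mono (hS.measurableSet.inter hBm) inter_subset_left
      obtain ⟨T, hTA, hT, hTS⟩ := h.exists_lift hX hY hSB inter_subset_right
      rw [ν.inter_add_diff hS hBm, h.isTotal_target.negligible_compl _
        (hS.mono (hS.measurableSet.diff hBm) sdiff_subset) (fun y hy => hy.2), add_zero,
        h.measure_eq T _ hT hSB hTA inter_subset_right hTS]
      exact hG.negligible_compl T hT fun x hx hxG => hSG (hTS.mapsTo hx).1 ⟨x, ⟨hTA hx, hxG⟩, rfl⟩
  mapsTo := mapsTo_image π _
  surjOn := surjOn_image π _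
  measurable := h.measurable.comp (measurable_inclusion inter_subset_left)
  continuousOn := h.continuousOn.mono inter_subset_left
  isCompact_fibre := by
    rintro _ ⟨x, hx, rfl⟩
    convert h.isCompact_fibre (π x) (h.mapsTo hx.1) using 1
    refine Subset.antisymm (fun z hz => ⟨hz.1.1, hz.2⟩) fun z hz => ⟨⟨hz.1, ?_⟩, hz.2⟩
    exact hG.isSaturated.mem_of_eq hx.2 (h.fibre_in_leaf x hx.1 z hz.1 hz.2.symm)
  fibre_in_leaf x hx x' hx' := h.fibre_in_leaf x hx.1 x' hx'.1
  matchesEnds x hx := h.matchesEnds x hx.1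
  measure_eq T S hT hS hTA hSB := h.measure_eq T S hT hS (hTA.trans inter_subset_left)
    (hSB.trans (image_subset_iff.2 fun _ hx => h.mapsTo hx.1))

end IsCollapseOn

/-! ### Leafwise smooth structures and restriction -/

section Smooth

variable {n m : ℕ} {X : Type*} [TopologicalSpace X] [MeasurableSpace X] [StandardBorelSpace X]
  {Y : Type*} [TopologicalSpace Y] [MeasurableSpace Y] [StandardBorelSpace Y]

lemma SmoothInCharts.of_restrict {a : PrismChart n X} {b : PrismChart m Y} {A : Set X} {B : Set Y}
    (hAm : MeasurableSet A) (hA : IsSaturated A) (hBm : MeasurableSet B) (hB : IsSaturated B)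
    {R : A → B → Prop} (h : SmoothInCharts (a.restrict hAm hA) (b.restrict hBm hB) R)
    {R' : X → Y → Prop} (hR : ∀ x y, R' x y → ∃ (hx : x ∈ A) (hy : y ∈ B), R ⟨x, hx⟩ ⟨y, hy⟩) :
    SmoothInCharts a b R' := by
  intro s t
  by_cases hst : s ∈ a.labels A ∧ t ∈ b.labels B
  · obtain ⟨g, hg, hgp⟩ := h ⟨s, hst.1⟩ ⟨t, hst.2⟩
    refine ⟨g, hg.mono ?_, fun p q hp hq hpq => hgp p q hp hq (hR _ _ hpq).choose_spec.choose_spec⟩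
    rintro _ ⟨p, q, hp, hq, hpq, rfl⟩
    exact ⟨p, q, hp, hq, (hR _ _ hpq).choose_spec.choose_spec, rfl⟩
  · have hno : ∀ p q, ¬ R' (a.toFun (p, s)) (b.toFun (q, t)) := fun p q hpq => by
      obtain ⟨hx, hy, -⟩ := hR _ _ hpq
      exact hst ⟨(a.mem_labels hA p).2 hx, (b.mem_labels hB q).2 hy⟩
    exact ⟨0, contDiffOn_const, fun p q _ _ hpq => (hno p q hpq).elim⟩

lemma SmoothInCharts.restrict {a b : PrismChart n X} {A : Set X}
    (h : SmoothInCharts a b fun x y => x = y) (hAm : MeasurableSet A) (hA : IsSaturated A) :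
    SmoothInCharts (a.restrict hAm hA) (b.restrict hAm hA) fun x y => x = y := by
  intro s t
  obtain ⟨g, hg, hgp⟩ := h s.1 t.1
  refine ⟨g, hg.mono ?_, fun p q hp hq hpq => hgp p q hp hq (congrArg Subtype.val hpq)⟩
  rintro _ ⟨p, q, hp, hq, hpq, rfl⟩
  exact ⟨p, q, hp, hq, congrArg Subtype.val hpq, rfl⟩

/-- The restriction of a leafwise smooth structure to a Borel union of leaves. -/
def LeafwiseSmoothStructure.restrict (𝒜 : LeafwiseSmoothStructure n X) {A : Set X}
    (hAm : MeasurableSet A) (hA : IsSaturated A) : LeafwiseSmoothStructure n A where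
  chart i := (𝒜.chart i).restrict hAm hA
  cover x := (𝒜.cover x).imp fun i hi => ((𝒜.chart i).mem_restrict_core hAm hA x).2 hi
  smooth i j := (𝒜.smooth i j).restrict hAm hA

end Smooth

/-! ### Comparison of two collapses with the same source -/

lemma exists_measurableEquiv_of_range_eq {α β γ : Type*} [MeasurableSpace α] [MeasurableSpace β]
    [MeasurableSpace γ] {f : α → γ} {g : β → γ} (hf : MeasurableEmbedding f)
    (hg : MeasurableEmbedding g) (h : range f = range g) : ∃ e : α ≃ᵐ β, ∀ a, g (e a) = f a := by
  have hmem : ∀ a, f a ∈ range g := fun a => h ▸ mem_range_self a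
  have hmem' : ∀ b, g b ∈ range f := fun b => h ▸ mem_range_self b
  have hf' : ∀ z, f (hf.equivRange.symm z) = z := fun z =>
    congrArg Subtype.val ((hf.equivRange_apply _).symm.trans (hf.equivRange.apply_symm_apply z))
  have hg' : ∀ z, g (hg.equivRange.symm z) = z := fun z =>
    congrArg Subtype.val ((hg.equivRange_apply _).symm.trans (hg.equivRange.apply_symm_apply z))
  exact ⟨⟨⟨fun a => hg.equivRange.symm ⟨f a, hmem a⟩,
    fun b => hf.equivRange.symm ⟨g b, hmem' b⟩, fun a => hf.injective ((hf' _).trans (hg' _)),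
    fun b => hg.injective ((hg' _).trans (hf' _))⟩,
    hg.equivRange.symm.measurable.comp hf.measurable.subtype_mk,
    hf.equivRange.symm.measurable.comp hg.measurable.subtype_mk⟩, fun a => hg' _⟩

lemma IsTransversal.image_homeomorph {X Y : Type*} [TopologicalSpace X] [MeasurableSpace X]
    [TopologicalSpace Y] [MeasurableSpace Y] (e : X ≃ₜ Y) (he : Measurable e.symm) {S : Set X}
    (hS : IsTransversal S) : IsTransversal (e '' S) := by
  have := hS.discreteTopology
  refine ⟨?_, e.isClosedMap _ hS.isClosed, (e.image S).symm.isEmbedding.discreteTopology⟩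
  rw [← e.preimage_symm]
  exact he hS.measurableSet

/-- Points related by the canonical map lie over the same leaf of `X`. This is what makes the lifts
of a transversal and of its image equivalent. -/
lemma EndsCompatible.leaf_of_junctionRel {X Y₀ Y₁ : Type*} [TopologicalSpace X]
    [TopologicalSpace Y₀] [T2Space Y₀] [TopologicalSpace Y₁] [T2Space Y₁] {p₀ : X → Y₀} {p₁ : X → Y₁}
    {𝒩₀ : Set (Set Y₀ × (Y₀ → ℝ))} {𝒩₁ : Set (Set Y₁ × (Y₁ → ℝ))} (h : EndsCompatible p₀ p₁)
    (h𝒩₀ : IsLengthAtlas 𝒩₀) (h𝒩₁ : IsLengthAtlas 𝒩₁) {t t' : X}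
    (ht : JunctionRel 𝒩₀ 𝒩₁ p₀ p₁ (p₀ t) (p₁ t')) :
    connectedComponent t = connectedComponent t' := by
  obtain ⟨x, C₀, C₁, u, hm, h0, h1⟩ := ht
  obtain ⟨ξ, hξ, he⟩ : p₀ t ∈ p₀ '' connectedComponent x := by
    rw [h.image_leaf h𝒩₀ h𝒩₁, ← hm.range_fst, ← h0]
    exact mem_range_self _
  obtain ⟨ξ', hξ', he'⟩ : p₁ t' ∈ p₁ '' connectedComponent x := by
    rw [h.swap.image_leaf h𝒩₁ h𝒩₀, ← hm.range_snd, ← h1]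
    exact mem_range_self _
  rw [← h.leaf_fst _ _ he, ← h.leaf_snd _ _ he', ← connectedComponent_eq hξ,
    ← connectedComponent_eq hξ']

section Compare

variable {n : ℕ} {X : Type*} [TopologicalSpace X] [MeasurableSpace X]
  {Y₀ : Type*} [TopologicalSpace Y₀] [MeasurableSpace Y₀]
  {Y₁ : Type*} [TopologicalSpace Y₁] [MeasurableSpace Y₁]
  {μ : InvTransverseMeasure X} {ν₀ : InvTransverseMeasure Y₀} {ν₁ : InvTransverseMeasure Y₁}
  {π₀ : X → Y₀} {π₁ : X → Y₁} {A : Set X} {B₀ : Set Y₀} {B₁ : Set Y₁}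

lemma IsCollapseOn.not_isCompact_leaf {Y : Type*} [TopologicalSpace Y] [MeasurableSpace Y]
    {ν : InvTransverseMeasure Y} {π : X → Y} {B : Set Y} (h : IsCollapseOn μ ν π A B)
    (hcard : ∀ x ∈ A, Nat.card (TopEnd (connectedComponent x)) = 2) (y : B) :
    ¬ IsCompact (connectedComponent y) := by
  obtain ⟨x, rfl⟩ := h.surjective_restrict y
  intro hc
  refine (h.matchesEnds x x.2).not_isCompact (hcard x x.2) ?_
  have := hc.image continuous_subtype_val
  rwa [h.isTotal_target.isSaturated.image_connectedComponent] at this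

lemma IsCollapseOn.range_val_comp {Y : Type*} [TopologicalSpace Y] [MeasurableSpace Y]
    {ν : InvTransverseMeasure Y} {π : X → Y} {B : Set Y} (h : IsCollapseOn μ ν π A B) {x : A}
    {C : ℝ → B} (hC : range C = connectedComponent ((h.mapsTo.restrict) x)) :
    range (fun t => (C t : Y)) = connectedComponent (π x) := by
  rw [range_comp' Subtype.val C, hC, h.isTotal_target.isSaturated.image_connectedComponent]
  rfl

theorem IsCollapseOn.endsCompatible (h₀ : IsCollapseOn μ ν₀ π₀ A B₀)
    (h₁ : IsCollapseOn μ ν₁ π₁ A B₁) (hX : BorelFoliation n X) (hY₀ : BorelFoliation 1 Y₀)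
    (hY₁ : BorelFoliation 1 Y₁)
    (hcard : ∀ x ∈ A, Nat.card (TopEnd (connectedComponent x)) = 2) :
    EndsCompatible h₀.mapsTo.restrict h₁.mapsTo.restrict where
  continuous_fst := h₀.continuous_restrict
  continuous_snd := h₁.continuous_restrict
  surjective_fst := h₀.surjective_restrict
  surjective_snd := h₁.surjective_restrict
  leaf_fst := h₀.leaf_restrict
  leaf_snd := h₁.leaf_restrict
  noncompact_fst := h₀.not_isCompact_leaf hcard
  noncompact_snd := h₁.not_isCompact_leaf hcard
  ends x C₀ C₁ hC₀ hr₀ hC₁ hr₁ := by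
    have hA := h₀.isTotal_source.isSaturated
    have hemb₀ := (hY₀.isOpen h₀.isTotal_target.isSaturated).isOpenEmbedding_subtypeVal.comp hC₀
    have hemb₁ := (hY₁.isOpen h₁.isTotal_target.isSaturated).isOpenEmbedding_subtypeVal.comp hC₁
    have hcorr : ∀ C₁ : ℝ → B₁, corr h₀.mapsTo.restrict h₁.mapsTo.restrict C₀ C₁ x =
        corr π₀ π₁ (fun t => (C₀ t : Y₀)) (fun t => (C₁ t : Y₁)) (x : X) := by
      intro C₁
      ext ⟨s, r⟩
      constructor
      · rintro ⟨ξ, hξ, e0, e1⟩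
        exact ⟨ξ, hA.mem_connectedComponent_iff.1 hξ, congrArg Subtype.val e0,
          congrArg Subtype.val e1⟩
      · rintro ⟨ξ, hξ, e0, e1⟩
        exact ⟨⟨ξ, hA x x.2 hξ⟩, hA.mem_connectedComponent_iff.2 hξ, Subtype.ext e0,
          Subtype.ext e1⟩
    rw [hcorr, hcorr]
    exact endsMatched_corr hX (h₀.matchesEnds x x.2) (h₁.matchesEnds x x.2)
      (h₀.continuousOn.mono (hA x x.2)) (h₁.continuousOn.mono (hA x x.2)) (hcard x x.2)
      hemb₀ (h₀.range_val_comp hr₀) hemb₁ (h₁.range_val_comp hr₁)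

/-- The atlases enter as data because the arc lengths, hence the homeomorphism, are built from them.
The same construction serves in the Borel and smooth cases; smooth atlases only add regularity to
its output. -/
theorem IsCollapseOn.exists_isMeasuredIso (h₀ : IsCollapseOn μ ν₀ π₀ A B₀)
    (h₁ : IsCollapseOn μ ν₁ π₁ A B₁) (hX : BorelFoliation n X) (hY₀ : BorelFoliation 1 Y₀)
    (hY₁ : BorelFoliation 1 Y₁)
    (hcard : ∀ x ∈ A, Nat.card (TopEnd (connectedComponent x)) = 2)
    {φ₀ : ℕ → PrismChart 1 B₀} (hφ₀ : ∀ y, ∃ i, y ∈ (φ₀ i).core)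
    {φ₁ : ℕ → PrismChart 1 B₁} (hφ₁ : ∀ y, ∃ i, y ∈ (φ₁ i).core) :
    ∃ e : B₀ ≃ₜ B₁, IsMeasuredIso ν₀ ν₁ e ∧ (SmoothAtlas φ₀ → SmoothAtlas φ₁ → ∀ i j,
      SmoothInCharts (φ₀ i) (φ₁ j) (fun y y' => e y = y') ∧
      SmoothInCharts (φ₁ j) (φ₀ i) fun y y' => e.symm y = y') := by
  have hA := h₀.isTotal_source
  have hB₀ := h₀.isTotal_target
  have hB₁ := h₁.isTotal_target
  have hXA := hX.restrict hA.measurableSet hA.isSaturated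
  have hYB₀ := hY₀.restrict hB₀.measurableSet hB₀.isSaturated
  have hYB₁ := hY₁.restrict hB₁.measurableSet hB₁.isSaturated
  have := hX.standardBorelSpace
  have := hYB₀.standardBorelSpace
  have := hYB₁.standardBorelSpace
  have := hYB₀.t2Space
  have := hYB₁.t2Space
  have h := h₀.endsCompatible h₁ hX hY₀ hY₁ hcard
  obtain ⟨R₀, D₀, hD₀⟩ := (isWeightSystem hφ₀).exists_isBorelLengthAtlas
  obtain ⟨R₁, D₁, hD₁⟩ := (isWeightSystem hφ₁).exists_isBorelLengthAtlas
  have h𝒩₀ := hD₀.isLengthAtlas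
  have h𝒩₁ := hD₁.isLengthAtlas
  obtain ⟨e, he⟩ := h.exists_homeomorph h𝒩₀ h𝒩₁
  have hf := fun y => (he y _).1 rfl
  have hf' := fun y => ((he (e.symm y) y).1 (e.apply_symm_apply y)).swap
  have hem := h.measurable_of_junctionRel hXA h₀.measurable_restrict h₁.measurable_restrict hD₀ hD₁
    hf
  have hem' := h.swap.measurable_of_junctionRel hXA h₁.measurable_restrict h₀.measurable_restrict
    hD₁ hD₀ hf'
  refine ⟨e, ⟨hB₀, hB₁, hem, hem', fun S hS => ?_⟩, fun hs₀ hs₁ i j => ⟨?_, ?_⟩⟩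
  · have hS' : IsTransversal S := by
      have := IsTransversal.preimage_val (A := B₀) hS
      rwa [preimage_image_eq _ Subtype.val_injective] at this
    have heS := (hS'.image_homeomorph e hem').image_val hY₁ hB₁.isSaturated hB₁.measurableSet
    obtain ⟨T, hTA, hT, hTS⟩ := h₀.exists_lift hX hY₀ hS (Subtype.coe_image_subset B₀ S)
    obtain ⟨T', hTA', hT', hTS'⟩ := h₁.exists_lift hX hY₁ heS (Subtype.coe_image_subset B₁ _)
    rw [h₀.measure_eq T _ hT hS hTA (Subtype.coe_image_subset B₀ S) hTS,
      h₁.measure_eq T' _ hT' heS hTA' (Subtype.coe_image_subset B₁ _) hTS']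
    -- `T` projects bijectively onto `S` and `T'` onto `e '' S`, so `e` lifts to a bijection `γ : T
    -- → T'`. It is Borel in both directions because injective Borel maps between standard Borel
    -- spaces are Borel embeddings.
    refine (μ.invariant T T' hT hT' ?_).symm
    let p : T → B₀ := fun t => (h₀.mapsTo.restrict) ⟨t, hTA t.2⟩
    let q : T' → B₁ := fun t => (h₁.mapsTo.restrict) ⟨t, hTA' t.2⟩
    have hp : Measurable p := h₀.measurable_restrict.comp (measurable_inclusion hTA)
    have hq : Measurable q := h₁.measurable_restrict.comp (measurable_inclusion hTA')
    have hpi : Function.Injective p := fun s t hst =>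
      Subtype.ext (hTS.injOn s.2 t.2 (congrArg Subtype.val hst))
    have hqi : Function.Injective q := fun s t hst =>
      Subtype.ext (hTS'.injOn s.2 t.2 (congrArg Subtype.val hst))
    have := hT.measurableSet.standardBorel
    have := hT'.measurableSet.standardBorel
    have hpr : range p = S := by
      ext y
      constructor
      · rintro ⟨t, rfl⟩
        obtain ⟨z, hz, hzt⟩ := hTS.mapsTo t.2
        rwa [show p t = z from Subtype.ext hzt.symm]
      · intro hy
        obtain ⟨t, ht, hty⟩ := hTS.surjOn ⟨y, hy, rfl⟩
        exact ⟨⟨t, ht⟩, Subtype.ext hty⟩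
    have hqr : range q = e '' S := by
      ext y
      constructor
      · rintro ⟨t, rfl⟩
        obtain ⟨z, hz, hzt⟩ := hTS'.mapsTo t.2
        rwa [show q t = z from Subtype.ext hzt.symm]
      · intro hy
        obtain ⟨t, ht, hty⟩ := hTS'.surjOn ⟨y, hy, rfl⟩
        exact ⟨⟨t, ht⟩, Subtype.ext hty⟩
    obtain ⟨γ, hγ⟩ := exists_measurableEquiv_of_range_eq
      ((hem.comp hp).measurableEmbedding (e.injective.comp hpi)) (hq.measurableEmbedding hqi)
      (by rw [range_comp, hpr, hqr])
    refine ⟨γ, fun t => ?_⟩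
    have hleaf := h.leaf_of_junctionRel h𝒩₀ h𝒩₁ (t := ⟨t, hTA t.2⟩) (t' := ⟨γ t, hTA' (γ t).2⟩)
      ((he _ _).1 (hγ t).symm)
    exact (hA.isSaturated.connectedComponent_eq_iff.1 hleaf).symm
  · exact h.smoothInCharts_of_junctionRel h𝒩₀ h𝒩₁ hf (hs₀.smoothAlong hφ₀ i)
      (hs₁.smoothAlong hφ₁ j)
  · exact h.swap.smoothInCharts_of_junctionRel h𝒩₁ h𝒩₀ hf' (hs₁.smoothAlong hφ₁ j)
      (hs₀.smoothAlong hφ₀ i)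

/-- Two collapses defined on the same total part of two-ended leaves have isomorphic targets. -/
theorem IsCollapseOn.isomorphic (h₀ : IsCollapseOn μ ν₀ π₀ A B₀)
    (h₁ : IsCollapseOn μ ν₁ π₁ A B₁) (hX : BorelFoliation n X) (hY₀ : BorelFoliation 1 Y₀)
    (hY₁ : BorelFoliation 1 Y₁)
    (hcard : ∀ x ∈ A, Nat.card (TopEnd (connectedComponent x)) = 2) : Isomorphic ν₀ ν₁ := by
  have hB₀ := h₀.isTotal_target
  have hB₁ := h₁.isTotal_target
  obtain ⟨φ₀, hφ₀⟩ := (hY₀.restrict hB₀.measurableSet hB₀.isSaturated).exists_atlas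
  obtain ⟨φ₁, hφ₁⟩ := (hY₁.restrict hB₁.measurableSet hB₁.isSaturated).exists_atlas
  obtain ⟨e, he, -⟩ := h₀.exists_isMeasuredIso h₁ hX hY₀ hY₁ hcard hφ₀ hφ₁
  exact ⟨B₀, B₁, e, he⟩

theorem IsCollapseOn.diffIsomorphic (h₀ : IsCollapseOn μ ν₀ π₀ A B₀)
    (h₁ : IsCollapseOn μ ν₁ π₁ A B₁) (hX : BorelFoliation n X) (hY₀ : BorelFoliation 1 Y₀)
    (hY₁ : BorelFoliation 1 Y₁)
    (hcard : ∀ x ∈ A, Nat.card (TopEnd (connectedComponent x)) = 2)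
    (𝒜₀ : LeafwiseSmoothStructure 1 Y₀) (𝒜₁ : LeafwiseSmoothStructure 1 Y₁) :
    DiffIsomorphic ν₀ 𝒜₀ ν₁ 𝒜₁ := by
  have hB₀ := h₀.isTotal_target
  have hB₁ := h₁.isTotal_target
  have := hY₀.standardBorelSpace
  have := hY₁.standardBorelSpace
  let ℛ₀ := 𝒜₀.restrict hB₀.measurableSet hB₀.isSaturated
  let ℛ₁ := 𝒜₁.restrict hB₁.measurableSet hB₁.isSaturated
  obtain ⟨e, he, hs⟩ := h₀.exists_isMeasuredIso h₁ hX hY₀ hY₁ hcard ℛ₀.cover ℛ₁.cover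
  have hs := hs ℛ₀.smoothAtlas ℛ₁.smoothAtlas
  refine ⟨B₀, B₁, e, he, fun i j => (hs i j).1.of_restrict hB₀.measurableSet hB₀.isSaturated
    hB₁.measurableSet hB₁.isSaturated ?_, fun i j => (hs i j).2.of_restrict hB₁.measurableSet
    hB₁.isSaturated hB₀.measurableSet hB₀.isSaturated ?_⟩
  · rintro x _ ⟨hx, rfl⟩
    exact ⟨hx, Subtype.coe_prop _, rfl⟩
  · rintro _ x ⟨hx, rfl⟩
    exact ⟨Subtype.coe_prop _, hx, e.symm_apply_apply _⟩

end Compare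

/-! ### Transport of collapses by isomorphisms -/

section EndsCongr

variable {L : Type*} [TopologicalSpace L] {L' : Type*} [TopologicalSpace L']

/-- The image of an end by a homeomorphism. -/
def TopEnd.map (f : L ≃ₜ L') (ε : TopEnd L) : TopEnd L' where
  comp K := f '' ε.comp (K.map f.symm f.symm.continuous)
  isComponent K := by
    obtain ⟨x, hx, h⟩ := ε.isComponent (K.map f.symm f.symm.continuous)
    have hK : f '' ((K.map f.symm f.symm.continuous : Compacts L) : Set L)ᶜ = (K : Set L')ᶜ := by
      rw [image_compl_eq f.bijective, Compacts.coe_map, f.image_symm, f.image_preimage]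
    refine ⟨f x, hK ▸ mem_image_of_mem f hx, ?_⟩
    rw [h, f.image_connectedComponentIn hx, hK]
  anti _ _ h := image_mono (ε.anti _ _ (image_mono h))

/-- The bijection between the ends of two homeomorphic spaces. -/
def TopEnd.congr (f : L ≃ₜ L') : TopEnd L ≃ TopEnd L' where
  toFun := TopEnd.map f
  invFun := TopEnd.map f.symm
  left_inv ε := TopEnd.ext_comp fun K => by
    have hK : (K.map f f.continuous).map f.symm f.symm.continuous = K :=
      Compacts.ext (by simp [image_image])
    change f.symm '' (f '' ε.comp ((K.map f f.continuous).map f.symm f.symm.continuous)) = _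
    rw [hK, image_image]
    simp
  right_inv ε := TopEnd.ext_comp fun K => by
    have hK : (K.map f.symm f.symm.continuous).map f f.continuous = K :=
      Compacts.ext (by simp [image_image])
    change f '' (f.symm '' ε.comp ((K.map f.symm f.symm.continuous).map f f.continuous)) = _
    rw [hK, image_image]
    simp

lemma MatchesEnds.of_homeomorph {X X' Y : Type*} [TopologicalSpace X] [TopologicalSpace X']
    [TopologicalSpace Y] {π : X → Y} {π' : X' → Y} {x : X} {x' : X'} (h : MatchesEnds π' x')
    (f : connectedComponent x ≃ₜ connectedComponent x') (hx : π x = π' x')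
    (hf : ∀ z : connectedComponent x, π z = π' (f z)) : MatchesEnds π x := by
  rw [MatchesEnds, hx]
  obtain ⟨e, he⟩ := h
  refine ⟨(TopEnd.congr f).trans e, fun ε K' => ?_⟩
  obtain ⟨K, hK⟩ := he (TopEnd.congr f ε) K'
  refine ⟨K.map f.symm f.symm.continuous, ?_⟩
  rintro _ ⟨_, ⟨z, hz, rfl⟩, rfl⟩
  rw [hf]
  exact hK ⟨f z, ⟨f z, ⟨z, hz, rfl⟩, rfl⟩, rfl⟩

end EndsCongr

section Iso

variable {n : ℕ} {X : Type*} [TopologicalSpace X] [MeasurableSpace X]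
  {X' : Type*} [TopologicalSpace X'] [MeasurableSpace X']
  {Y : Type*} [TopologicalSpace Y] [MeasurableSpace Y]
  {μ : InvTransverseMeasure X} {μ' : InvTransverseMeasure X'} {ν : InvTransverseMeasure Y}
  {E : Set X} {E' : Set X'} {e : E ≃ₜ E'}

omit [MeasurableSpace X] [MeasurableSpace X'] in
lemma mem_leaf_of_homeomorph (e : E ≃ₜ E') (hE : IsSaturated E) (hE' : IsSaturated E') {x z : E}
    (hz : (z : X) ∈ connectedComponent (x : X)) :
    (e z : X') ∈ connectedComponent (e x : X') :=
  hE'.mem_connectedComponent_iff.1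
    (e.continuous.mapsTo_connectedComponent x (hE.mem_connectedComponent_iff.2 hz))

/-- The homeomorphism between corresponding leaves of two isomorphic foliations. -/
def leafCongr (e : E ≃ₜ E') (hE : IsSaturated E) (hE' : IsSaturated E') (x : E) :
    connectedComponent (x : X) ≃ₜ connectedComponent (e x : X') where
  toFun z := ⟨e ⟨z, hE x x.2 z.2⟩, mem_leaf_of_homeomorph e hE hE' z.2⟩
  invFun z := ⟨e.symm ⟨z, hE' _ (e x).2 z.2⟩, by
    have := mem_leaf_of_homeomorph e.symm hE' hE (x := e x) (z := ⟨z, hE' _ (e x).2 z.2⟩) z.2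
    rwa [e.symm_apply_apply] at this⟩
  left_inv z := by simp
  right_inv z := by simp
  continuous_toFun := by fun_prop
  continuous_invFun := by fun_prop

lemma IsTransversal.transport (hX' : BorelFoliation n X') (e : E ≃ₜ E') (he : Measurable e.symm)
    (hE' : IsSaturated E') (hE'm : MeasurableSet E') {S : Set E}
    (hS : IsTransversal ((↑) '' S : Set X)) : IsTransversal ((↑) '' (e '' S) : Set X') := by
  have h := IsTransversal.preimage_val (A := E) hS
  rw [preimage_image_eq _ Subtype.val_injective] at h
  exact (h.image_homeomorph e he).image_val hX' hE' hE'm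

lemma IsMeasuredIso.symm (hX : BorelFoliation n X) (he : IsMeasuredIso μ μ' e) : IsMeasuredIso μ' μ e.symm where
  isTotal_source := he.isTotal_target
  isTotal_target := he.isTotal_source
  measurable := he.measurable_symm
  measurable_symm := he.measurable
  measure_eq S hS := by
    have h := he.measure_eq _ (hS.transport hX e.symm he.measurable he.isTotal_source.isSaturated
      he.isTotal_source.measurableSet)
    rw [← h, ← image_comp e e.symm, e.self_comp_symm, image_id]

lemma IsTotal.transport (hX' : BorelFoliation n X')
    (he : IsMeasuredIso μ μ' e) {G : Set X'} (hG : IsTotal μ' G) :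
    IsTotal μ ((↑) '' (e ⁻¹' ((↑) ⁻¹' G)) : Set X) where
  measurableSet := he.isTotal_source.measurableSet.subtype_image
    (he.measurable (measurable_subtype_coe hG.measurableSet))
  isSaturated := by
    rintro _ ⟨x, hx, rfl⟩ z hz
    have hE := he.isTotal_source.isSaturated
    exact ⟨⟨z, hE x x.2 hz⟩, hG.isSaturated _ hx
      (mem_leaf_of_homeomorph e hE he.isTotal_target.isSaturated hz), rfl⟩
  negligible_compl T hT hTG := by
    have hE := he.isTotal_source
    have hTE := hT.mono (hT.measurableSet.inter hE.measurableSet) inter_subset_left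
    rw [μ.inter_add_diff hT hE.measurableSet, hE.negligible_compl _
      (hT.mono (hT.measurableSet.diff hE.measurableSet) sdiff_subset) (fun y hy => hy.2), add_zero]
    have heq : T ∩ E = (↑) '' ((↑) ⁻¹' T : Set E) := by
      rw [Subtype.image_preimage_coe, inter_comm]
    rw [heq] at hTE ⊢
    rw [← he.measure_eq _ hTE]
    refine hG.negligible_compl _ (hTE.transport hX' e he.measurable_symm
      he.isTotal_target.isSaturated he.isTotal_target.measurableSet) ?_
    rintro _ ⟨_, ⟨x, hx, rfl⟩, rfl⟩ hxG
    exact hTG hx ⟨x, hxG, rfl⟩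

/-- Inside `E` the map is `π' ∘ e`. As `e` carries leaves homeomorphically to leaves, ends and
compact fibres are transported; as it preserves transverse measures, so is the comparison of
measures. -/
theorem IsCollapseOn.pullback {A' : Set X'} {B : Set Y} {π' : X' → Y}
    (h : IsCollapseOn μ' ν π' A' B) (hX' : BorelFoliation n X')
    (he : IsMeasuredIso μ μ' e) (hA' : A' ⊆ E') {π : X → Y}
    (hπ : ∀ x : E, π x = π' (e x)) :
    IsCollapseOn μ ν π ((↑) '' (e ⁻¹' ((↑) ⁻¹' A'))) B := by
  have hE := he.isTotal_source.isSaturated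
  have hE' := he.isTotal_target.isSaturated
  set A : Set X := (↑) '' (e ⁻¹' ((↑) ⁻¹' A')) with hAdef
  have hAE : ∀ x ∈ A, ∃ h : x ∈ E, (e ⟨x, h⟩ : X') ∈ A' := by
    rintro _ ⟨x, hx, rfl⟩
    exact ⟨x.2, hx⟩
  let q : A → A' := fun x => ⟨e ⟨x, (hAE x x.2).1⟩, (hAE x x.2).2⟩
  have hq : (fun x : A => π x) = fun x : A => π' (q x) :=
    funext fun x => hπ ⟨x, (hAE x x.2).1⟩
  refine ⟨h.isTotal_source.transport hX' he, h.isTotal_target, ?_, ?_, ?_, ?_, ?_, ?_, ?_, ?_⟩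
  · rintro _ ⟨x, hx, rfl⟩
    rw [hπ]
    exact h.mapsTo hx
  · intro y hy
    obtain ⟨x', hx', rfl⟩ := h.surjOn hy
    refine ⟨e.symm ⟨x', hA' hx'⟩, ⟨_, ?_, rfl⟩, ?_⟩
    · simpa using hx'
    · rw [hπ, e.apply_symm_apply]
  · rw [hq]
    have hqm : Measurable q :=
      (measurable_subtype_coe.comp (he.measurable.comp measurable_subtype_coe.subtype_mk)).subtype_mk
    exact h.measurable.comp hqm
  · rw [continuousOn_iff_continuous_domRestrict]
    have hqc : Continuous q := by fun_prop
    have := (continuousOn_iff_continuous_domRestrict.1 h.continuousOn).comp hqc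
    rwa [show A.domRestrict π = A'.domRestrict π' ∘ q from hq]
  · intro y hy
    have hc : IsCompact ((↑) ⁻¹' (A' ∩ π' ⁻¹' {y}) : Set E') := by
      rw [Subtype.isCompact_iff, Subtype.image_preimage_coe,
        inter_eq_right.2 (inter_subset_left.trans hA')]
      exact h.isCompact_fibre y hy
    convert (hc.image e.symm.continuous).image continuous_subtype_val using 1
    ext x
    constructor
    · rintro ⟨⟨x, hx, rfl⟩, hxy⟩
      refine ⟨x, ⟨e x, ⟨hx, ?_⟩, e.symm_apply_apply x⟩, rfl⟩
      rw [mem_preimage, ← hπ]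
      exact hxy
    · rintro ⟨_, ⟨x', ⟨hx', hy'⟩, rfl⟩, rfl⟩
      refine ⟨⟨_, ?_, rfl⟩, ?_⟩
      · simpa using hx'
      · rw [mem_preimage, hπ, e.apply_symm_apply]
        exact hy'
  · rintro _ ⟨x, hx, rfl⟩ _ ⟨z, hz, rfl⟩ hxz
    rw [hπ, hπ] at hxz
    have h1 := h.fibre_in_leaf _ hx _ hz hxz
    have h2 := mem_leaf_of_homeomorph e.symm hE' hE (x := e x) (z := e z)
      (h1 ▸ mem_connectedComponent)
    rw [e.symm_apply_apply, e.symm_apply_apply] at h2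
    exact connectedComponent_eq h2
  · rintro _ ⟨x, hx, rfl⟩
    exact (h.matchesEnds _ hx).of_homeomorph (leafCongr e hE hE' x) (hπ x)
      fun (z : connectedComponent (x : X)) => hπ ⟨z, hE x x.2 z.2⟩
  · intro T S hT hS hTA hSB hTS
    have heq : T = (↑) '' ((↑) ⁻¹' T : Set E) := by
      rw [Subtype.image_preimage_coe, inter_eq_right.2 fun x hx => (hAE x (hTA hx)).1]
    rw [heq] at hT
    rw [heq, ← he.measure_eq _ hT]
    refine h.measure_eq _ S (hT.transport hX' e he.measurable_symm hE'
      he.isTotal_target.measurableSet) hS ?_ hSB ⟨?_, ?_, ?_⟩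
    · rintro _ ⟨_, ⟨x, hx, rfl⟩, rfl⟩
      exact (hAE x (hTA hx)).2
    · rintro _ ⟨_, ⟨x, hx, rfl⟩, rfl⟩
      rw [← hπ]
      exact hTS.mapsTo hx
    · rintro _ ⟨_, ⟨x, hx, rfl⟩, rfl⟩ _ ⟨_, ⟨z, hz, rfl⟩, rfl⟩ hxz
      rw [← hπ, ← hπ] at hxz
      rw [Subtype.ext (hTS.injOn hx hz hxz)]
    · intro y hy
      obtain ⟨t, ht, rfl⟩ := hTS.surjOn hy
      obtain ⟨htE, -⟩ := hAE t (hTA ht)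
      exact ⟨e ⟨t, htE⟩, ⟨_, ⟨⟨t, htE⟩, ht, rfl⟩, rfl⟩, (hπ ⟨t, htE⟩).symm⟩

lemma Isomorphic.symm (hX : BorelFoliation n X) (h : Isomorphic μ μ') : Isomorphic μ' μ := by
  obtain ⟨E, E', e, he⟩ := h
  exact ⟨E', E, e.symm, he.symm hX⟩

lemma GenericLeafTwoEnded.of_isomorphic (h : GenericLeafTwoEnded μ')
    (hX' : BorelFoliation n X') (hiso : Isomorphic μ μ') : GenericLeafTwoEnded μ := by
  obtain ⟨G, hG, hcard⟩ := h
  obtain ⟨E, E', e, he⟩ := hiso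
  refine ⟨_, hG.transport hX' he, ?_⟩
  rintro _ ⟨x, hx, rfl⟩
  rw [← hcard _ hx]
  exact Nat.card_congr (TopEnd.congr
    (leafCongr e he.isTotal_source.isSaturated he.isTotal_target.isSaturated x))

/-- The collapse is first shrunk to the range of the isomorphism. The map `f` only supplies values
outside the total part `E`, where they play no role. -/
lemma IsCollapse.exists_pullback {π' : X' → Y} (h : IsCollapse μ' ν π')
    (hends : GenericLeafTwoEnded μ') (hX' : BorelFoliation n X')
    (hY : BorelFoliation 1 Y) (hiso : Isomorphic μ μ') (f : X → Y) :
    ∃ π : X → Y, IsCollapse μ ν π := by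
  classical
  obtain ⟨A, B, h⟩ := h
  obtain ⟨G, hG, hcard⟩ := hends
  obtain ⟨E, E', e, he⟩ := hiso
  exact ⟨fun x => if hx : x ∈ E then π' (e ⟨x, hx⟩) else f x, _, _,
    (h.restrict hX' hY (hG.inter he.isTotal_target) fun x hx => hcard x hx.1).pullback hX' he
      (fun x hx => hx.2.2) fun x => dif_pos x.2⟩

end Iso

/-- Two collapses of a foliation by two-ended leaves have isomorphic targets. -/
theorem IsCollapse.isomorphic {n : ℕ} {X : Type*} [TopologicalSpace X] [MeasurableSpace X]
    {Y₀ : Type*} [TopologicalSpace Y₀] [MeasurableSpace Y₀]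
    {Y₁ : Type*} [TopologicalSpace Y₁] [MeasurableSpace Y₁]
    {μ : InvTransverseMeasure X} {ν₀ : InvTransverseMeasure Y₀} {ν₁ : InvTransverseMeasure Y₁}
    {π₀ : X → Y₀} {π₁ : X → Y₁} (h₀ : IsCollapse μ ν₀ π₀) (h₁ : IsCollapse μ ν₁ π₁)
    (hends : GenericLeafTwoEnded μ) (hX : BorelFoliation n X) (hY₀ : BorelFoliation 1 Y₀)
    (hY₁ : BorelFoliation 1 Y₁) : Isomorphic ν₀ ν₁ ∧
      ∀ (𝒜₀ : LeafwiseSmoothStructure 1 Y₀) (𝒜₁ : LeafwiseSmoothStructure 1 Y₁),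
        DiffIsomorphic ν₀ 𝒜₀ ν₁ 𝒜₁ := by
  obtain ⟨A₀, B₀, h₀⟩ := h₀
  obtain ⟨A₁, B₁, h₁⟩ := h₁
  obtain ⟨G, hG, hcard⟩ := hends
  have hr₀ := h₀.restrict hX hY₀ (h₁.isTotal_source.inter hG) fun x hx => hcard x hx.2
  have hr₁ := h₁.restrict hX hY₁ (h₀.isTotal_source.inter hG) fun x hx => hcard x hx.2
  -- Both collapses are now defined on the same total part `A₀ ∩ (A₁ ∩ G)`, as the comparison
  -- requires.
  rw [inter_left_comm] at hr₁
  have hcard' : ∀ x ∈ A₀ ∩ (A₁ ∩ G), Nat.card (TopEnd (connectedComponent x)) = 2 :=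
    fun x hx => hcard x hx.2.2
  exact ⟨hr₀.isomorphic hr₁ hX hY₀ hY₁ hcard', hr₀.diffIsomorphic hr₁ hX hY₀ hY₁ hcard'⟩

end MeasuredFoliation

theorem mainTheorem3 {n : ℕ} {X : Type*} [TopologicalSpace X] [MeasurableSpace X]
    [MeasuredFoliation.BorelFoliation n X] (μ : MeasuredFoliation.InvTransverseMeasure X)
    (hμ : MeasuredFoliation.IsErgodic μ) (hends : MeasuredFoliation.GenericLeafTwoEnded μ)
    {Y₀ : Type*} [TopologicalSpace Y₀] [MeasurableSpace Y₀]
    [MeasuredFoliation.BorelFoliation 1 Y₀] (ν₀ : MeasuredFoliation.InvTransverseMeasure Y₀)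
    (π₀ : X → Y₀) (hπ₀ : MeasuredFoliation.IsCollapse μ ν₀ π₀)
    {Y₁ : Type*} [TopologicalSpace Y₁] [MeasurableSpace Y₁]
    [MeasuredFoliation.BorelFoliation 1 Y₁] (ν₁ : MeasuredFoliation.InvTransverseMeasure Y₁) :
    -- two collapses of `X` have isomorphic targets
    (∀ π₁ : X → Y₁, MeasuredFoliation.IsCollapse μ ν₁ π₁ →
      MeasuredFoliation.Isomorphic ν₀ ν₁ ∧
      ∀ (𝒜₀ : MeasuredFoliation.LeafwiseSmoothStructure 1 Y₀)
        (𝒜₁ : MeasuredFoliation.LeafwiseSmoothStructure 1 Y₁),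
        MeasuredFoliation.DiffIsomorphic ν₀ 𝒜₀ ν₁ 𝒜₁) ∧
    -- the isomorphism type of the target only depends on the isomorphism type of `X`
    (∀ {X' : Type*} [TopologicalSpace X'] [MeasurableSpace X']
      [MeasuredFoliation.BorelFoliation n X'] (μ' : MeasuredFoliation.InvTransverseMeasure X'),
      MeasuredFoliation.Isomorphic μ μ' →
      ∀ π₁ : X' → Y₁, MeasuredFoliation.IsCollapse μ' ν₁ π₁ →
        MeasuredFoliation.Isomorphic ν₀ ν₁ ∧
        ∀ (𝒜₀ : MeasuredFoliation.LeafwiseSmoothStructure 1 Y₀)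
          (𝒜₁ : MeasuredFoliation.LeafwiseSmoothStructure 1 Y₁),
          MeasuredFoliation.DiffIsomorphic ν₀ 𝒜₀ ν₁ 𝒜₁) := by
  have hX : MeasuredFoliation.BorelFoliation n X := inferInstance
  have hY₀ : MeasuredFoliation.BorelFoliation 1 Y₀ := inferInstance
  have hY₁ : MeasuredFoliation.BorelFoliation 1 Y₁ := inferInstance
  refine ⟨fun π₁ hπ₁ => hπ₀.isomorphic hπ₁ hends hX hY₀ hY₁, ?_⟩
  intro X' _ _ hX' μ' hiso π₁ hπ₁
  have hiso' := hiso.symm hX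
  have hends' := hends.of_isomorphic hX hiso'
  -- Pulling `π₁` back to all of `X` needs a default value in `Y₁`. If `Y₁` is empty then so is
  -- `X'`, and `π₀` is pulled back to `X'` instead.
  rcases isEmpty_or_nonempty Y₁ with hempty | ⟨⟨y₁⟩⟩
  · obtain ⟨π, hπ⟩ := hπ₀.exists_pullback hends hX hY₀ hiso' fun x' => isEmptyElim (π₁ x')
    exact hπ.isomorphic hπ₁ hends' hX' hY₀ hY₁
  · obtain ⟨π, hπ⟩ := hπ₁.exists_pullback hends' hX' hY₁ hiso fun _ => y₁
    exact hπ₀.isomorphic hπ hends hX hY₀ hY₁
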